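/- Let $k$ be a field of characteristic $0$ and $K=k[[\hbar]]$. All modules are $\mathbb Z$-graded; $\pm$ denotes the Koszul sign of the permutation of the homogeneous symbols involved (arguments and operations, relative to the order $P,Q,b_1,\dots,b_k$). For a ring $R$ and $\hbar\in R$ (we use $(R,\hbar)=(K,\hbar)$, and $(R,\hbar)=(k,0)$ for the classical limit) define the following. * A *$\mathbb{BD}_1$-algebra* is a dg Lie algebra $A$ over $R$ (bracket of degree $0$) with an associative product, for which $\mathrm d$ is a derivation, such that $\hbar\{x,y\}=xy-(-1)^{|x||y|}yx$ and $\{x,yz\}=\{x,y\}z+(-1)^{|x||y|}y\{x,z\}$. $A^{\mathrm{op}}$ has $a\cdot^{\mathrm{op}}b=(-1)^{|a||b|}ba$, $\{a,b\}^{\mathrm{op}}=-\{a,b\}$. * A *$\mathbb{BD}_0$-algebra* is a complex $B$ with a Lie bracket of degree $1$ and a unital graded commutative product such that $\mathrm d(ab)=\mathrm d(a)b+(-1)^{|a|}a\,\mathrm d(b)+\hbar\{a,b\}$ and $\{x,yz\}=\{x,y\}z+(-1)^{|y||z|}\{x,z\}y$. * For a unital graded commutative algebra $B$, the completed algebra $\widehat{\mathrm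 D}_\hbar(B)$ of $\hbar$-differential operators consists of the families $P=(P_k)_{k\ge 0}$ of graded symmetric multilinear maps $P_k\colon B^{\otimes k}\to B$ of degree $|P|$, vanishing if an argument is $1$ ($k\ge1$), with $$P_k(\dots,xy)=P_k(\dots,x)y+(-1)^{|x||y|}P_k(\dots,y)x+\hbar P_{k+1}(\dots,x,y).$$ ($P_k(b_1,\dots,b_k)$ stands for $\hbar^{-k}[\cdots[P,b_1],\dots,b_k](1)$ when derivations $v$ act as $\hbar v$.) Product and bracket are $$(PQ)_k(b)=\sum_{S\sqcup T=[k]}\pm\big(P_{|S|}(b_S)\,Q_{|T|}(b_T)+\hbar P_{|S|+1}(b_S,Q_{|T|}(b_T))\big),$$ $$\{P,Q\}_k(b)=\sum_{S\sqcup T=[k]}\pm\big(P_{|T|+1}(Q_{|S|}(b_S),b_T)-(-1)^{|P||Q|}Q_{|T|+1}(P_{|S|}(b_S),b_T)\big),$$ (in the second term of the bracket, $\pm$ is the sign of the unshuffle $(b_S,b_T)$ of $b$, as in the first one), and $P$ acts on $B$ by $P\cdot x=P_0x+\hbar P_1(x)$. * A *$\widehat{\mathbb{BD}}_0$-structure*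 on $B$ is a Maurer–Cartan element of $\widehat{\mathrm D}_\hbar(B)$: an element $l=(l_k)$ of degree $1$ with $\{l,l\}=0$ and $l_0=0$; its differential is $l_1$. For $\hbar=0$ this is a $\widehat{\mathbb P}_0$-structure. A $\mathbb{BD}_0$-algebra gives the one with $l_1=\mathrm d$, $l_2=\{\,,\}$, $l_k=0$ for $k\geq 3$, and $\mathrm Z(B)$ denotes $\widehat{\mathrm D}_\hbar(B)$ with the differential $\{l,-\}$. * A *left $\mathbb{BD}_1$-module* over $A$ is a $\mathbb{BD}_0$-algebra $M$ with a morphism $f\colon A\to\mathrm Z(M)$ compatible with degrees, differentials, products and brackets; we write $f_k(a;m_1,\dots,m_k)=f(a)_k(m_1,\dots,m_k)$. A *right $\mathbb{BD}_1$-module* over $A$ is a left module over $A^{\mathrm{op}}$. For $\hbar=0$ left modules are coisotropic morphisms from $\mathbb P_1$-algebras to $\mathbb P_0$-algebras. **Theorem.** Let $A$ be a $\mathbb{BD}_1$-algebra over $K$, $M$ a left $\mathbb{BD}_1$-module over $A$ with structure map $f$ and $N$ a right one with structure map $g$. On $N\otimes_K\mathrm T_\bullet(A[1])\otimes_K M$,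 $\mathrm T_\bullet(A[1])=\bigoplus_pA^{\otimes p}[p]$, take the unital graded commutative product given by the products of $N$ and $M$ and the shuffle product. Put $am=f(a)\cdot m$ and $na=(-1)^{|n||a|}g(a)\cdot n$. There is a $\widehat{\mathbb{BD}}_0$-structure $l$ on this graded commutative algebra such that $l_1$ is the two-sided bar differential: with $\epsilon_s=|n|+\sum_{q\le s}(|a_q|-1)$, $$l_1[n|a_1|\dots|a_p|m]=[\mathrm dn|\dots|m]+\sum_{s=1}^{p}(-1)^{\epsilon_{s-1}}[n|\dots|\mathrm da_s|\dots|m]+(-1)^{\epsilon_p}[n|\dots|\mathrm dm]$$ $$+(-1)^{|n|+|a_1|}[na_1|a_2|\dots|m]+\sum_{s=1}^{p-1}(-1)^{\epsilon_s}[n|\dots|a_sa_{s+1}|\dots|m]+(-1)^{\epsilon_p}[n|\dots|a_{p-1}|a_pm]$$ (for $p=0$ only the terms with $\mathrm dn$ and $\mathrm dm$), and whose operations $l_k$, $k\ge2$, have the following values when each argument lies in $N$, $\mathrm T_\bullet(A[1])$ or $M$: 1. $l_2$ is the given bracket on $N$ and on $M$; 2. $l_2([a_1|\dots|a_p],[b_1|\dots|b_q])$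 is the sum, over all terms of the shuffle product and over all places where some $a_i$ is immediately followed by some $b_j$, of the terms with $a_i|b_j$ replaced by $\{a_i,b_j\}$, multiplied by $(-1)^{\delta}$, $\delta$ being the total degree in $\mathrm T_\bullet(A[1])$ of the letters up to and including $a_i$; 3. for $p,k\ge1$, with $|a|=\sum_q(|a_q|-1)$ and $|n|=\sum_i|n_i|$, $$l_{k+1}([a_1|\dots|a_p],m_1,\dots,m_k)=(-1)^{|a|}[a_1|\dots|a_{p-1}|f_k(a_p;m_1,\dots,m_k)],$$ $$l_{k+1}([a_1|\dots|a_p],n_1,\dots,n_k)=(-1)^{|a_1|+|n|\sum_{q\ge2}(|a_q|-1)}[g_k(a_1;n_1,\dots,n_k)|a_2|\dots|a_p];$$ 4. all other values (up to symmetry) are zero. At $\hbar=0$ this recovers the coisotropic intersection structure: if a $\mathbb P_1$-algebra $A_0$ and coisotropic morphisms $f_0\colon A_0\to\mathrm Z(M_0)$, $g_0\colon A_0^{\mathrm{op}}\to\mathrm Z(N_0)$ over $k$ are the reductions modulo $\hbar$ of $A,f,g$, then the same formulas with $\hbar=0$ (which determine the multiderivations $l_k$) define the $\widehat{\mathbb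 P}_0$-structure of the coisotropic intersection on $N_0\otimes_k\mathrm T_\bullet(A_0[1])\otimes_kM_0$, and the map $[n|a_1|\dots|a_p|m]\mapsto[\bar n|\bar a_1|\dots|\bar a_p|\bar m]$ identifies the latter space with the reduction modulo $\hbar$ of $N\otimes_K\mathrm T_\bullet(A[1])\otimes_KM$, compatibly with products and with all operations $l_k$. -/

import Mathlib

open scoped TensorProduct DirectSum

noncomputable section

namespace BD

universe u v w

/-- The Koszul sign `(-1)^n`. -/
abbrev sgn (n : ℤ) : ℤˣ := n.negOnePow

/-! ## Graded commutative algebras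

Throughout, `R` is the ground ring with a distinguished element `ħ`.  It is used for
`R = k⟦ħ⟧` and for `R = k`, `ħ = 0` (the classical limit).  A graded module is a module `V` with
a family `𝒱 : ℤ → Submodule R V` of which it is the internal direct sum. -/

/-- A unital graded commutative algebra. -/
structure GCAlgebra {R : Type u} [CommRing R] {V : Type v} [AddCommGroup V] [Module R V]
    (𝒱 : ℤ → Submodule R V) where
  one : V
  mul : V →ₗ[R] V →ₗ[R] V
  isInternal : DirectSum.IsInternal 𝒱
  one_mem : one ∈ 𝒱 0
  mul_mem : ∀ {i j : ℤ} {a b : V}, a ∈ 𝒱 i → b ∈ 𝒱 j → mul a b ∈ 𝒱 (i + j)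
  one_mul : ∀ a, mul one a = a
  mul_assoc : ∀ a b c, mul (mul a b) c = mul a (mul b c)
  mul_comm : ∀ {i j : ℤ} {a b : V}, a ∈ 𝒱 i → b ∈ 𝒱 j → mul a b = sgn (i * j) • mul b a

/-! ## `BD₁`-algebras -/

/-- A `BD₁`-algebra: a dg Lie algebra (differential of degree `1`, bracket of degree `0`) which is
also a dg associative algebra, with `ħ {x, y} = x y - (-1)^{|x||y|} y x` and the Leibniz rule.
For `ħ = 0` this is a `P₁`-algebra.  A unit for the product is allowed but not required. -/
structure BD1Algebra {R : Type u} [CommRing R] (ħ : R) {A : Type v} [AddCommGroup A] [Module R A]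
    (𝒜 : ℤ → Submodule R A) where
  d : A →ₗ[R] A
  mul : A →ₗ[R] A →ₗ[R] A
  bracket : A →ₗ[R] A →ₗ[R] A
  isInternal : DirectSum.IsInternal 𝒜
  d_mem : ∀ {i : ℤ} {a : A}, a ∈ 𝒜 i → d a ∈ 𝒜 (i + 1)
  mul_mem : ∀ {i j : ℤ} {a b : A}, a ∈ 𝒜 i → b ∈ 𝒜 j → mul a b ∈ 𝒜 (i + j)
  bracket_mem : ∀ {i j : ℤ} {a b : A}, a ∈ 𝒜 i → b ∈ 𝒜 j → bracket a b ∈ 𝒜 (i + j)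
  d_d : ∀ a, d (d a) = 0
  d_mul : ∀ {i j : ℤ} {a b : A}, a ∈ 𝒜 i → b ∈ 𝒜 j →
    d (mul a b) = mul (d a) b + sgn i • mul a (d b)
  mul_assoc : ∀ {i j l : ℤ} {a b c : A}, a ∈ 𝒜 i → b ∈ 𝒜 j → c ∈ 𝒜 l →
    mul (mul a b) c = mul a (mul b c)
  bracket_antisymm : ∀ {i j : ℤ} {a b : A}, a ∈ 𝒜 i → b ∈ 𝒜 j →
    bracket a b = - (sgn (i * j) • bracket b a)
  jacobi : ∀ {i j l : ℤ} {a b c : A}, a ∈ 𝒜 i → b ∈ 𝒜 j → c ∈ 𝒜 l →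
    bracket a (bracket b c) = bracket (bracket a b) c + sgn (i * j) • bracket b (bracket a c)
  d_bracket : ∀ {i j : ℤ} {a b : A}, a ∈ 𝒜 i → b ∈ 𝒜 j →
    d (bracket a b) = bracket (d a) b + sgn i • bracket a (d b)
  hbar_bracket : ∀ {i j : ℤ} {a b : A}, a ∈ 𝒜 i → b ∈ 𝒜 j →
    ħ • bracket a b = mul a b - sgn (i * j) • mul b a
  bracket_mul : ∀ {i j l : ℤ} {a b c : A}, a ∈ 𝒜 i → b ∈ 𝒜 j → c ∈ 𝒜 l →
    bracket a (mul b c) = mul (bracket a b) c + sgn (i * j) • mul b (bracket a c)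

section Opposite

variable {R : Type u} [CommRing R] {A : Type v} [AddCommGroup A] [Module R A]
  {𝒜 : ℤ → Submodule R A}

/-- The decomposition of a graded module into its homogeneous components. -/
def components (h : DirectSum.IsInternal 𝒜) : A ≃ₗ[R] ⨁ i, 𝒜 i :=
  (LinearEquiv.ofBijective (DirectSum.coeLinearMap 𝒜) h).symm

theorem components_of_mem (h : DirectSum.IsInternal 𝒜) {j : ℤ} {b : A} (hb : b ∈ 𝒜 j) :
    components h b = DirectSum.lof R ℤ (fun j => 𝒜 j) j ⟨b, hb⟩ := by
  unfold components
  refine (LinearEquiv.symm_apply_eq _).2 ?_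
  exact (DirectSum.coeLinearMap_lof 𝒜 j ⟨b, hb⟩).symm

/-- The linear map which is `(-1)^{ij}` on degree `j`. -/
def signMap (h : DirectSum.IsInternal 𝒜) (i : ℤ) : A →ₗ[R] A :=
  (DirectSum.toModule R ℤ A (fun j => sgn (i * j) • (𝒜 j).subtype)) ∘ₗ
    (components h).toLinearMap

theorem signMap_apply (h : DirectSum.IsInternal 𝒜) (i : ℤ) {j : ℤ} {b : A} (hb : b ∈ 𝒜 j) :
    signMap h i b = sgn (i * j) • b := by
  rw [signMap, LinearMap.comp_apply, LinearEquiv.coe_coe, components_of_mem h hb,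
    DirectSum.toModule_lof]
  rfl

/-- The opposite `a, b ↦ (-1)^{|a||b|} μ(b, a)` of a bilinear operation `μ`. -/
def opMul (h : DirectSum.IsInternal 𝒜) (μ : A →ₗ[R] A →ₗ[R] A) : A →ₗ[R] A →ₗ[R] A :=
  (DirectSum.toModule R ℤ (A →ₗ[R] A)
    (fun i => (LinearMap.lcomp R A (signMap h i)) ∘ₗ μ.flip ∘ₗ (𝒜 i).subtype)) ∘ₗ
    (components h).toLinearMap

theorem opMul_apply (h : DirectSum.IsInternal 𝒜) (μ : A →ₗ[R] A →ₗ[R] A) {i j : ℤ} {a b : A}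
    (ha : a ∈ 𝒜 i) (hb : b ∈ 𝒜 j) : opMul h μ a b = sgn (i * j) • μ b a := by
  rw [opMul, LinearMap.comp_apply, LinearEquiv.coe_coe, components_of_mem h ha,
    DirectSum.toModule_lof]
  simp only [LinearMap.comp_apply, LinearMap.lcomp_apply, LinearMap.flip_apply,
    Submodule.subtype_apply, signMap_apply h i hb, Units.smul_def, map_zsmul]

/-- The opposite `BD₁`-algebra: `a ·ᵒᵖ b = (-1)^{|a||b|} b · a` and `{a, b}ᵒᵖ = -{a, b}`. -/
def BD1Algebra.op {ħ : R} (alg : BD1Algebra ħ 𝒜) : BD1Algebra ħ 𝒜 where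
  d := alg.d
  mul := opMul alg.isInternal alg.mul
  bracket := -alg.bracket
  isInternal := alg.isInternal
  d_mem := alg.d_mem
  mul_mem := by
    intro i j a b ha hb
    rw [opMul_apply _ _ ha hb, Units.smul_def, add_comm]
    exact zsmul_mem (alg.mul_mem hb ha) _
  bracket_mem := fun ha hb => neg_mem (alg.bracket_mem ha hb)
  d_d := alg.d_d
  d_mul := by
    intro i j a b ha hb
    rw [opMul_apply _ _ ha hb, opMul_apply _ _ (alg.d_mem ha) hb,
      opMul_apply _ _ ha (alg.d_mem hb), Units.smul_def, map_zsmul, ← Units.smul_def,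
      alg.d_mul hb ha, add_comm]
    simp only [smul_add, smul_smul, ← Int.negOnePow_add]
    congr 2
    · rw [Int.negOnePow_eq_iff]; ring_nf; simp
    · rw [Int.negOnePow_eq_iff]; ring_nf; grind
  mul_assoc := by
    intro i j l a b c ha hb hc
    have hab : opMul alg.isInternal alg.mul a b ∈ 𝒜 (i + j) := by
      rw [opMul_apply _ _ ha hb, Units.smul_def, add_comm]
      exact zsmul_mem (alg.mul_mem hb ha) _
    have hbc : opMul alg.isInternal alg.mul b c ∈ 𝒜 (j + l) := by
      rw [opMul_apply _ _ hb hc, Units.smul_def, add_comm]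
      exact zsmul_mem (alg.mul_mem hc hb) _
    rw [opMul_apply _ _ hab hc, opMul_apply _ _ ha hbc, opMul_apply _ _ ha hb,
      opMul_apply _ _ hb hc]
    simp only [Units.smul_def, map_zsmul, LinearMap.smul_apply]
    rw [alg.mul_assoc hc hb ha]
    simp only [← Units.smul_def, smul_smul, ← Int.negOnePow_add]
    congr 2
    ring
  bracket_antisymm := by
    intro i j a b ha hb
    simp only [LinearMap.neg_apply, smul_neg]
    rw [alg.bracket_antisymm ha hb]
  jacobi := by
    intro i j l a b c ha hb hc
    simp only [LinearMap.neg_apply, map_neg, neg_neg]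
    exact alg.jacobi ha hb hc
  d_bracket := by
    intro i j a b ha hb
    simp only [LinearMap.neg_apply, map_neg, smul_neg]
    rw [alg.d_bracket ha hb, neg_add]
  hbar_bracket := by
    intro i j a b ha hb
    rw [opMul_apply _ _ ha hb, opMul_apply _ _ hb ha, LinearMap.neg_apply, LinearMap.neg_apply,
      smul_neg, alg.hbar_bracket ha hb, smul_smul, ← Int.negOnePow_add, neg_sub]
    congr 1
    rw [show i * j + j * i = 2 * (i * j) by ring, Int.negOnePow_two_mul, one_smul]
  bracket_mul := by
    intro i j l a b c ha hb hc
    rw [opMul_apply _ _ hb hc]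
    simp only [LinearMap.neg_apply, map_neg, smul_neg]
    rw [opMul_apply _ _ (alg.bracket_mem ha hb) hc, opMul_apply _ _ hb (alg.bracket_mem ha hc),
      Units.smul_def, map_zsmul, ← Units.smul_def, alg.bracket_mul ha hc hb, add_comm,
      ← neg_add]
    simp only [smul_add, smul_smul, ← Int.negOnePow_add, neg_add]
    congr 3
    · ring_nf
    · rw [Int.negOnePow_eq_iff]; ring_nf; grind

end Opposite

/-! ## `BD₀`-algebras -/

/-- A `BD₀`-algebra: a complex with a Lie bracket of degree `1` and a unital graded commutative
product with `d(ab) = d(a) b + (-1)^{|a|} a d(b) + ħ {a, b}` and the Leibniz rule.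
For `ħ = 0` this is a `P₀`-algebra. -/
structure BD0Algebra {R : Type u} [CommRing R] (ħ : R) {V : Type v} [AddCommGroup V] [Module R V]
    (𝒱 : ℤ → Submodule R V) extends GCAlgebra 𝒱 where
  d : V →ₗ[R] V
  bracket : V →ₗ[R] V →ₗ[R] V
  d_mem : ∀ {i : ℤ} {a : V}, a ∈ 𝒱 i → d a ∈ 𝒱 (i + 1)
  bracket_mem : ∀ {i j : ℤ} {a b : V}, a ∈ 𝒱 i → b ∈ 𝒱 j → bracket a b ∈ 𝒱 (i + j + 1)
  d_d : ∀ a, d (d a) = 0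
  bracket_symm : ∀ {i j : ℤ} {a b : V}, a ∈ 𝒱 i → b ∈ 𝒱 j →
    bracket a b = sgn (i * j) • bracket b a
  jacobi : ∀ {i j l : ℤ} {a b c : V}, a ∈ 𝒱 i → b ∈ 𝒱 j → c ∈ 𝒱 l →
    bracket (bracket a b) c + sgn (j * l) • bracket (bracket a c) b
      + sgn (i * (j + l)) • bracket (bracket b c) a = 0
  d_bracket : ∀ {i j : ℤ} {a b : V}, a ∈ 𝒱 i → b ∈ 𝒱 j →
    d (bracket a b) = - bracket (d a) b - sgn i • bracket a (d b)
  d_mul : ∀ {i j : ℤ} {a b : V}, a ∈ 𝒱 i → b ∈ 𝒱 j →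
    d (mul a b) = mul (d a) b + sgn i • mul a (d b) + ħ • bracket a b
  bracket_mul : ∀ {i j l : ℤ} {a b c : V}, a ∈ 𝒱 i → b ∈ 𝒱 j → c ∈ 𝒱 l →
    bracket a (mul b c) = mul (bracket a b) c + sgn (j * l) • mul (bracket a c) b

/-! ## The completed algebra `D̂_ħ(V)` of `ħ`-differential operators

An element of `D̂_ħ(V)` is recorded by its values `P_k(b₁, …, b_k)`, `k ≥ 0`, which play the
role of `ħ^{-k} [… [[P, b₁], b₂], …, b_k](1)`: here `v ∈ Der(V)` acts on `V` as `ħ v`.  There is no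
bound on `k`: this is the completion with respect to the order.  For `ħ = 0` one gets the
sequences of symmetric multiderivations, i.e. the completed polyvector fields
`∏_k Hom_V(Sym^k Ω_V, V)`.  The element `b ∈ V` is the family with `P_0 = b` and
`P_k = 0` for `k > 0`; a derivation `v` is the family with `P_1 = v` and `P_k = 0` for `k ≠ 1`. -/

/-- Families `(P_k)_{k ≥ 0}` of multilinear operations. -/
abbrev Ops (R : Type u) [CommRing R] (V : Type v) [AddCommGroup V] [Module R V] : Type v :=
  (k : ℕ) → MultilinearMap R (fun _ : Fin k => V) V

section HDiffOp

variable {R : Type u} [CommRing R] {V : Type v} [AddCommGroup V] [Module R V]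
  {𝒱 : ℤ → Submodule R V}

/-- `P` is an element of degree `p` of `D̂_ħ(V)`. -/
structure IsHDiffOp (ħ : R) (G : GCAlgebra 𝒱) (p : ℤ) (P : Ops R V) : Prop where
  mem : ∀ {k : ℕ} {e : Fin k → ℤ} {b : Fin k → V}, (∀ i, b i ∈ 𝒱 (e i)) →
    P k b ∈ 𝒱 (p + ∑ i, e i)
  symm : ∀ {k : ℕ} {e : Fin k → ℤ} {b : Fin k → V}, (∀ i, b i ∈ 𝒱 (e i)) →
    ∀ s t : Fin k, (t : ℕ) = s + 1 → P k (b ∘ Equiv.swap s t) = sgn (e s * e t) • P k b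
  leibniz : ∀ {k : ℕ} (b : Fin k → V) {i j : ℤ} {x y : V}, x ∈ 𝒱 i → y ∈ 𝒱 j →
    P (k + 1) (Fin.snoc b (G.mul x y) : Fin (k + 1) → V)
      = G.mul (P (k + 1) (Fin.snoc b x : Fin (k + 1) → V)) y
        + sgn (i * j) • G.mul (P (k + 1) (Fin.snoc b y : Fin (k + 1) → V)) x
        + ħ • P (k + 2) (Fin.snoc (Fin.snoc b x : Fin (k + 1) → V) y : Fin (k + 2) → V)
  map_one : ∀ {k : ℕ} (b : Fin k → V), P (k + 1) (Fin.snoc b G.one : Fin (k + 1) → V) = 0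

/-- The arguments `b_i`, `i ∈ T`, in increasing order. -/
def sel {k : ℕ} {W : Type w} (T : Finset (Fin k)) (b : Fin k → W) : Fin T.card → W :=
  fun i => b (T.orderEmbOfFin rfl i)

/-- The Koszul sign of moving the arguments in `T`, of degrees `e_i`, in front of the others. -/
def unshuffleSign {k : ℕ} (e : Fin k → ℤ) (T : Finset (Fin k)) : ℤˣ :=
  ∏ x ∈ (Tᶜ ×ˢ T).filter (fun x => x.1 < x.2), sgn (e x.1 * e x.2)

/-- `∑_T ± P(Q(b_T), b_{Tᶜ})` for arguments `b_i` of degree `e_i`. -/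
def insertion (P Q : Ops R V) {k : ℕ} (e : Fin k → ℤ) (b : Fin k → V) : V :=
  ∑ T : Finset (Fin k), unshuffleSign e T •
    P (Tᶜ.card + 1) (Matrix.vecCons (Q T.card (sel T b)) (sel Tᶜ b))

/-- The value `{P, Q}_k(b₁, …, b_k)` of the Lie bracket of `D̂_ħ(V)`, for `P`, `Q`, `b_i` of degrees
`p`, `q`, `e_i`.  One has `ħ {P, Q} = P Q - (-1)^{pq} Q P`. -/
def hBracket (p q : ℤ) (P Q : Ops R V) {k : ℕ} (e : Fin k → ℤ) (b : Fin k → V) : V :=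
  insertion P Q e b - sgn (p * q) • insertion Q P e b

/-- The value `(P Q)_k(b₁, …, b_k)` of the product of `D̂_ħ(V)`, for `Q`, `b_i` of degrees
`q`, `e_i`. -/
def hMul (ħ : R) (G : GCAlgebra 𝒱) (q : ℤ) (P Q : Ops R V) {k : ℕ} (e : Fin k → ℤ)
    (b : Fin k → V) : V :=
  ∑ T : Finset (Fin k), (unshuffleSign e T * sgn (q * ∑ i ∈ T, e i)) •
    (G.mul (P T.card (sel T b)) (Q Tᶜ.card (sel Tᶜ b))
      + ħ • P (T.card + 1) (Fin.snoc (sel T b) (Q Tᶜ.card (sel Tᶜ b)) : Fin (T.card + 1) → V))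

/-- The operator on `V` given by `P ∈ D̂_ħ(V)`: `x ↦ P_0 x + ħ P_1(x)`. -/
def hAct (ħ : R) (G : GCAlgebra 𝒱) (P : Ops R V) (x : V) : V :=
  G.mul (P 0 ![]) x + ħ • P 1 ![x]

end HDiffOp

/-- A `\widehat{BD}_0`-structure on the graded commutative algebra `G`: a Maurer--Cartan element
of `D̂_ħ(V)`, that is an element `l = (l_k)` of degree `1` with `{l, l} = 0`, without constant term.
The differential is `l_1`.  For `ħ = 0` this is a `\widehat{P}_0`-algebra. -/
structure BDHat0Structure {R : Type u} [CommRing R] (ħ : R) {V : Type v} [AddCommGroup V]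
    [Module R V] {𝒱 : ℤ → Submodule R V} (G : GCAlgebra 𝒱) where
  l : Ops R V
  isHDiffOp : IsHDiffOp ħ G 1 l
  l_zero : l 0 = 0
  maurerCartan : ∀ {k : ℕ} {e : Fin k → ℤ} {b : Fin k → V}, (∀ i, b i ∈ 𝒱 (e i)) →
    hBracket 1 1 l l e b = 0

/-- A bilinear map as a multilinear map of two arguments. -/
def ofBilinear {R : Type u} [CommRing R] {V : Type v} [AddCommGroup V] [Module R V]
    (f : V →ₗ[R] V →ₗ[R] V) : MultilinearMap R (fun _ : Fin 2 => V) V where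
  toFun b := f (b 0) (b 1)
  map_update_add' := by
    intro inst b i x y
    rw [Subsingleton.elim inst (instDecidableEqFin 2)]
    fin_cases i <;> simp
  map_update_smul' := by
    intro inst b i c x
    rw [Subsingleton.elim inst (instDecidableEqFin 2)]
    fin_cases i <;> simp

/-- The Maurer--Cartan element of `D̂_ħ(V)` of a `BD₀`-algebra: `l_1 = d`, `l_2 = { , }`. -/
def BD0Algebra.ops {R : Type u} [CommRing R] {ħ : R} {V : Type v} [AddCommGroup V] [Module R V]
    {𝒱 : ℤ → Submodule R V} (B : BD0Algebra ħ 𝒱) : Ops R V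
  | 1 => MultilinearMap.ofSubsingleton R V V (0 : Fin 1) B.d
  | 2 => ofBilinear B.bracket
  | _ => 0

/-! ## Modules -/

/-- A left `BD₁`-module structure over `alg` on the `BD₀`-algebra `B`: a morphism of `BD₁`-algebras
`f : A → Z(B)`, where `Z(B)` is `D̂_ħ(B)` with the differential `{l_B, -}` given by the
Maurer--Cartan element `l_B = B.ops`.  Here `map k a b = f_k(a; b_1, …, b_k)`.
For `ħ = 0` this is a coisotropic morphism from the `P₁`-algebra `A` to the `P₀`-algebra `B`. -/
structure LeftBD1Module {R : Type u} [CommRing R] {ħ : R} {A : Type v} [AddCommGroup A] [Module R A]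
    {𝒜 : ℤ → Submodule R A} (alg : BD1Algebra ħ 𝒜) {V : Type w} [AddCommGroup V] [Module R V]
    {𝒱 : ℤ → Submodule R V} (B : BD0Algebra ħ 𝒱) where
  map : (k : ℕ) → A →ₗ[R] MultilinearMap R (fun _ : Fin k => V) V
  isHDiffOp : ∀ {i : ℤ} {a : A}, a ∈ 𝒜 i → IsHDiffOp ħ B.toGCAlgebra i (fun k => map k a)
  map_d : ∀ {i : ℤ} {a : A}, a ∈ 𝒜 i →
    ∀ {k : ℕ} {e : Fin k → ℤ} {b : Fin k → V}, (∀ s, b s ∈ 𝒱 (e s)) →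
      map k (alg.d a) b = hBracket 1 i B.ops (fun r => map r a) e b
  map_mul : ∀ {i j : ℤ} {a a' : A}, a ∈ 𝒜 i → a' ∈ 𝒜 j →
    ∀ {k : ℕ} {e : Fin k → ℤ} {b : Fin k → V}, (∀ s, b s ∈ 𝒱 (e s)) →
      map k (alg.mul a a') b
        = hMul ħ B.toGCAlgebra j (fun r => map r a) (fun r => map r a') e b
  map_bracket : ∀ {i j : ℤ} {a a' : A}, a ∈ 𝒜 i → a' ∈ 𝒜 j →
    ∀ {k : ℕ} {e : Fin k → ℤ} {b : Fin k → V}, (∀ s, b s ∈ 𝒱 (e s)) →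
      map k (alg.bracket a a') b = hBracket i j (fun r => map r a) (fun r => map r a') e b

/-- A right `BD₁`-module over `A` is a left `BD₁`-module over `Aᵒᵖ`. -/
abbrev RightBD1Module {R : Type u} [CommRing R] {ħ : R} {A : Type v} [AddCommGroup A] [Module R A]
    {𝒜 : ℤ → Submodule R A} (alg : BD1Algebra ħ 𝒜) {V : Type w} [AddCommGroup V] [Module R V]
    {𝒱 : ℤ → Submodule R V} (B : BD0Algebra ħ 𝒱) :=
  LeftBD1Module alg.op B

/-! ## The two-sided bar complex -/

section Bar

variable (R : Type u) [CommRing R] (N A M : Type*) [AddCommGroup N] [Module R N]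
  [AddCommGroup A] [Module R A] [AddCommGroup M] [Module R M]

/-- The underlying module `⨁_p A^{⊗ p}` of the tensor coalgebra `T_•(A[1])`; the shift is taken
into account in the grading below. -/
abbrev TensorCoalg : Type _ := ⨁ p : ℕ, ⨂[R]^p A

/-- The underlying module of `N ⊗ T_•(A[1]) ⊗ M`. -/
abbrev Bar : Type _ := N ⊗[R] (TensorCoalg R A ⊗[R] M)

variable {N A M}

/-- The element `[n | a_1 | … | a_p | m]`. -/
def bar {p : ℕ} (n : N) (a : Fin p → A) (m : M) : Bar R N A M :=
  n ⊗ₜ[R] ((DirectSum.lof R ℕ (fun p => ⨂[R]^p A) p (PiTensorProduct.tprod R a)) ⊗ₜ[R] m)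

variable {R}

/-- The grading, where `[n | a_1 | … | a_p | m]` has degree `|n| + ∑_q (|a_q| - 1) + |m|`. -/
def barGrading (𝒩 : ℤ → Submodule R N) (𝒜 : ℤ → Submodule R A) (ℳ : ℤ → Submodule R M) (t : ℤ) :
    Submodule R (Bar R N A M) :=
  Submodule.span R {x | ∃ (p : ℕ) (i j : ℤ) (e : Fin p → ℤ) (n : N) (a : Fin p → A) (m : M),
    n ∈ 𝒩 i ∧ (∀ q, a q ∈ 𝒜 (e q)) ∧ m ∈ ℳ j ∧ i + ∑ q, (e q - 1) + j = t ∧ x = bar R n a m}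

end Bar

/-- The degree of `[a_1 | … | a_p]` in `T_•(A[1])`. -/
abbrev wordDeg {p : ℕ} (e : Fin p → ℤ) : ℤ := ∑ q, (e q - 1)

/-- The degree of `[a_1 | … | a_s]` in `T_•(A[1])`: the letters strictly before position `s`. -/
abbrev prefixDeg {p : ℕ} (e : Fin p → ℤ) (s : Fin p) : ℤ := ∑ q ∈ Finset.univ.filter (· < s), (e q - 1)

/-- `(p, q)`-shuffles: permutations increasing on the first `p` and on the last `q` elements. -/
def shuffles (p q : ℕ) : Finset (Equiv.Perm (Fin (p + q))) :=
  Finset.univ.filter fun σ =>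
    (∀ i j : Fin p, i < j → σ (Fin.castAdd q i) < σ (Fin.castAdd q j)) ∧
    (∀ i j : Fin q, i < j → σ (Fin.natAdd p i) < σ (Fin.natAdd p j))

/-- The word obtained from `a_1 … a_p b_1 … b_q` by moving the letter in position `i` to position
`σ i`. -/
def shuffleWord {W : Type*} {p q : ℕ} (σ : Equiv.Perm (Fin (p + q))) (a : Fin p → W)
    (b : Fin q → W) : Fin (p + q) → W :=
  fun s => Fin.append a b (σ.symm s)

/-- The Koszul sign of a shuffle, for letters of degrees `|a_i| - 1` and `|b_j| - 1`. -/
def shuffleSign {p q : ℕ} (σ : Equiv.Perm (Fin (p + q))) (e : Fin p → ℤ) (e' : Fin q → ℤ) : ℤˣ :=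
  ∏ x ∈ (Finset.univ : Finset (Fin p × Fin q)).filter
    (fun x => σ (Fin.natAdd p x.2) < σ (Fin.castAdd q x.1)), sgn ((e x.1 - 1) * (e' x.2 - 1))

/-- The word `[c_1 | … | μ(c_s, c_{s+1}) | … ]`. -/
def mergeAt {W : Type u} {r : ℕ} (μ : W → W → W) (c : Fin (r + 1) → W) (s : Fin r) : Fin r → W :=
  fun t => if t < s then c t.castSucc else if t = s then μ (c s.castSucc) (c s.succ) else c t.succ

section Structure

variable {R : Type u} [CommRing R] {ħ : R} {N A M : Type*} [AddCommGroup N] [Module R N]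
  [AddCommGroup A] [Module R A] [AddCommGroup M] [Module R M]
  {𝒩 : ℤ → Submodule R N} {𝒜 : ℤ → Submodule R A} {ℳ : ℤ → Submodule R M}
  {alg : BD1Algebra ħ 𝒜} {BN : BD0Algebra ħ 𝒩} {BM : BD0Algebra ħ ℳ}

/-- The operation `D` on `N ⊗ T_•(A[1]) ⊗ M` is the two-sided bar differential, where `A` acts on
`M` and `N` through `A → Z(M)` and `Aᵒᵖ → Z(N)`; the right action of `A` on `N` is
`n a = (-1)^{|n||a|} g(a)(n)`. -/
structure IsBarDifferential (f : LeftBD1Module alg BM) (g : RightBD1Module alg BN)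
    (D : Bar R N A M → Bar R N A M) : Prop where
  /-- `d[n | m] = [dn | m] + (-1)^{|n|} [n | dm]` -/
  nil : ∀ {i j : ℤ} {n : N} {m : M}, n ∈ 𝒩 i → m ∈ ℳ j →
    D (bar R n (![] : Fin 0 → A) m)
      = bar R (BN.d n) (![] : Fin 0 → A) m + sgn i • bar R n (![] : Fin 0 → A) (BM.d m)
  cons : ∀ {r : ℕ} {i j : ℤ} {e : Fin (r + 1) → ℤ} {n : N} {a : Fin (r + 1) → A} {m : M},
    n ∈ 𝒩 i → (∀ s, a s ∈ 𝒜 (e s)) → m ∈ ℳ j →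
    D (bar R n a m)
      = bar R (BN.d n) a m
        + ∑ s : Fin (r + 1),
            sgn (i + prefixDeg e s) • bar R n (Function.update a s (alg.d (a s))) m
        + sgn (i + wordDeg e) • bar R n a (BM.d m)
        + sgn (i + e 0) • bar R
            (sgn (i * e 0) • hAct ħ BN.toGCAlgebra (fun k => g.map k (a 0)) n)
            (a ∘ Fin.succ) m
        + ∑ s : Fin r, sgn (i + prefixDeg e s.castSucc + (e s.castSucc - 1)) •
            bar R n (mergeAt (fun x y => alg.mul x y) a s) m
        + sgn (i + wordDeg e) • bar R n (a ∘ Fin.castSucc)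
            (hAct ħ BM.toGCAlgebra (fun k => f.map k (a (Fin.last r))) m)

/-- The unital graded commutative algebra `G` on `N ⊗ T_•(A[1]) ⊗ M` is the tensor product of
`N`, of `T_•(A[1])` with the shuffle product, and of `M`. -/
structure IsShuffleAlgebra (BN : BD0Algebra ħ 𝒩) (BM : BD0Algebra ħ ℳ)
    (G : GCAlgebra (barGrading 𝒩 𝒜 ℳ)) : Prop where
  one_eq : G.one = bar R BN.one (![] : Fin 0 → A) BM.one
  mul_eq : ∀ {p q : ℕ} {i j i' j' : ℤ} {e : Fin p → ℤ} {e' : Fin q → ℤ} {n n' : N}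
    {a : Fin p → A} {a' : Fin q → A} {m m' : M},
    n ∈ 𝒩 i → (∀ s, a s ∈ 𝒜 (e s)) → m ∈ ℳ j →
    n' ∈ 𝒩 i' → (∀ s, a' s ∈ 𝒜 (e' s)) → m' ∈ ℳ j' →
    G.mul (bar R n a m) (bar R n' a' m')
      = ∑ σ ∈ shuffles p q,
          (sgn (j * i' + j * wordDeg e' + wordDeg e * i') * shuffleSign σ e e') •
            bar R (BN.mul n n') (shuffleWord σ a a') (BM.mul m m')

variable (A) in
/-- The element `[n | 1]`. -/
def inN (BM : BD0Algebra ħ ℳ) (n : N) : Bar R N A M := bar R n (![] : Fin 0 → A) BM.one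

/-- The element `[1 | a_1 | … | a_p | 1]`. -/
def inT (BN : BD0Algebra ħ 𝒩) (BM : BD0Algebra ħ ℳ) {p : ℕ} (a : Fin p → A) : Bar R N A M :=
  bar R BN.one a BM.one

variable (A) in
/-- The element `[1 | m]`. -/
def inM (BN : BD0Algebra ħ 𝒩) (m : M) : Bar R N A M := bar R BN.one (![] : Fin 0 → A) m

/-- The `\widehat{BD}_0`-structure `S` on `N ⊗ T_•(A[1]) ⊗ M` is the one of the two-sided bar
complex: the product is the shuffle product, the differential `l_1` is the bar differential, and the
operations `l_k`, `k ≥ 2`, take on `N`, `T_•(A[1])` and `M` (which generate the algebra) the values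
listed.  For `ħ = 0`, when the `l_k` are multiderivations, it is the `\widehat{P}_0`-structure
of the coisotropic intersection. -/
structure IsBarStructure (f : LeftBD1Module alg BM) (g : RightBD1Module alg BN)
    (G : GCAlgebra (barGrading 𝒩 𝒜 ℳ)) (S : BDHat0Structure ħ G) : Prop where
  shuffle : IsShuffleAlgebra BN BM G
  l_one : IsBarDifferential f g (fun x => S.l 1 ![x])
  /-- The bracket on `T_•(A[1])`: in the shuffles of `a` and `b`, a letter of `a` followed by a
  letter of `b` is replaced by their bracket. -/
  bracket_T : ∀ {p q : ℕ} {e : Fin p → ℤ} {e' : Fin (q + 1) → ℤ} {a : Fin p → A}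
    {b : Fin (q + 1) → A}, (∀ s, a s ∈ 𝒜 (e s)) → (∀ s, b s ∈ 𝒜 (e' s)) →
    S.l 2 ![inT BN BM a, inT BN BM b]
      = ∑ σ ∈ shuffles p (q + 1), ∑ s : Fin (p + q),
          let w : Fin (p + q + 1) → A := shuffleWord (p := p) (q := q + 1) σ a b
          let ew : Fin (p + q + 1) → ℤ := shuffleWord (p := p) (q := q + 1) σ e e'
          if (σ.symm s.castSucc : ℕ) < p ∧ p ≤ (σ.symm s.succ : ℕ) then
            (shuffleSign σ e e' * sgn (prefixDeg ew s.castSucc + (ew s.castSucc - 1))) •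
              inT BN BM (mergeAt (fun x y => alg.bracket x y) w s)
          else 0
  bracket_M : ∀ m m' : M, S.l 2 ![inM A BN m, inM A BN m'] = inM A BN (BM.bracket m m')
  bracket_N : ∀ n n' : N, S.l 2 ![inN A BM n, inN A BM n'] = inN A BM (BN.bracket n n')
  /-- `l([a_1 | … | a_p], m_1, …, m_k) = ± [a_1 | … | a_{p-1} | f_k(a_p; m_1, …, m_k)]` -/
  l_TM : ∀ {r k : ℕ} {e : Fin (r + 1) → ℤ} {a : Fin (r + 1) → A} (m : Fin (k + 1) → M),
    (∀ s, a s ∈ 𝒜 (e s)) →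
    S.l (k + 2) (Matrix.vecCons (inT BN BM a) (fun t => inM A BN (m t)))
      = sgn (wordDeg e) • bar R BN.one (a ∘ Fin.castSucc) (f.map (k + 1) (a (Fin.last r)) m)
  /-- `l([a_1 | … | a_p], n_1, …, n_k) = ± [g_k(a_1; n_1, …, n_k) | a_2 | … | a_p]` -/
  l_TN : ∀ {r k : ℕ} {e : Fin (r + 1) → ℤ} {a : Fin (r + 1) → A} {i : Fin (k + 1) → ℤ}
    {n : Fin (k + 1) → N}, (∀ s, a s ∈ 𝒜 (e s)) → (∀ t, n t ∈ 𝒩 (i t)) →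
    S.l (k + 2) (Matrix.vecCons (inT BN BM a) (fun t => inN A BM (n t)))
      = sgn (e 0 + (∑ t, i t) * wordDeg (e ∘ Fin.succ)) •
          bar R (g.map (k + 1) (a 0) n) (a ∘ Fin.succ) BM.one
  /-- All other operations on generators vanish: those involving both `N` and `M`, … -/
  vanish_NM : ∀ {k : ℕ} (x : Fin k → Bar R N A M),
    (∀ t, (∃ n, x t = inN A BM n) ∨ (∃ (p : ℕ) (a : Fin p → A), x t = inT BN BM a) ∨
      (∃ m, x t = inM A BN m)) →
    ∀ s t, s ≠ t → (∃ n, x s = inN A BM n) → (∃ m, x t = inM A BN m) → S.l k x = 0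
  /-- … the `l_k` with `k ≥ 3` and at least two arguments in `T_•(A[1])`, … -/
  vanish_TT : ∀ {k : ℕ} (x : Fin (k + 3) → Bar R N A M),
    (∀ t, (∃ n, x t = inN A BM n) ∨ (∃ (p : ℕ) (a : Fin p → A), x t = inT BN BM a) ∨
      (∃ m, x t = inM A BN m)) →
    ∀ s t, s ≠ t → (∃ (p : ℕ) (a : Fin p → A), x s = inT BN BM a) →
      (∃ (p : ℕ) (a : Fin p → A), x t = inT BN BM a) → S.l (k + 3) x = 0
  /-- … and the `l_k` with `k ≥ 3` and all arguments in `N`, or all in `M`. -/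
  vanish_N : ∀ {k : ℕ} (n : Fin (k + 3) → N), S.l (k + 3) (fun t => inN A BM (n t)) = 0
  vanish_M : ∀ {k : ℕ} (m : Fin (k + 3) → M), S.l (k + 3) (fun t => inM A BN (m t)) = 0

end Structure

/-! ## The classical limit -/

section Limit

variable {k : Type u} [Field k]

/-- The semilinear map `r : V → V₀` exhibits the graded `k`-vector space `V₀` as `V / ħ V`. -/
structure IsReduction {V V₀ : Type*} [AddCommGroup V] [Module (PowerSeries k) V]
    [AddCommGroup V₀] [Module k V₀] (𝒱 : ℤ → Submodule (PowerSeries k) V)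
    (𝒱₀ : ℤ → Submodule k V₀) (r : V →ₛₗ[PowerSeries.constantCoeff (R := k)] V₀) : Prop where
  surjective : Function.Surjective r
  eq_zero_iff : ∀ x, r x = 0 ↔ ∃ y, x = (PowerSeries.X : PowerSeries k) • y
  mem : ∀ {i : ℤ} {x : V}, x ∈ 𝒱 i → r x ∈ 𝒱₀ i

/-- The `P₁`-algebra `A₀` is the reduction at `ħ = 0` of the `BD₁`-algebra `A`. -/
structure IsBD1Reduction {A A₀ : Type*} [AddCommGroup A] [Module (PowerSeries k) A]
    [AddCommGroup A₀] [Module k A₀] {𝒜 : ℤ → Submodule (PowerSeries k) A}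
    {𝒜₀ : ℤ → Submodule k A₀} (alg : BD1Algebra (PowerSeries.X : PowerSeries k) 𝒜)
    (alg₀ : BD1Algebra (0 : k) 𝒜₀) (r : A →ₛₗ[PowerSeries.constantCoeff (R := k)] A₀) : Prop
    extends IsReduction 𝒜 𝒜₀ r where
  map_d : ∀ a, r (alg.d a) = alg₀.d (r a)
  map_mul : ∀ a b, r (alg.mul a b) = alg₀.mul (r a) (r b)
  map_bracket : ∀ a b, r (alg.bracket a b) = alg₀.bracket (r a) (r b)

/-- The `P₀`-algebra `B₀` is the reduction at `ħ = 0` of the `BD₀`-algebra `B`. -/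
structure IsBD0Reduction {V V₀ : Type*} [AddCommGroup V] [Module (PowerSeries k) V]
    [AddCommGroup V₀] [Module k V₀] {𝒱 : ℤ → Submodule (PowerSeries k) V}
    {𝒱₀ : ℤ → Submodule k V₀} (B : BD0Algebra (PowerSeries.X : PowerSeries k) 𝒱)
    (B₀ : BD0Algebra (0 : k) 𝒱₀) (r : V →ₛₗ[PowerSeries.constantCoeff (R := k)] V₀) : Prop
    extends IsReduction 𝒱 𝒱₀ r where
  map_one : r B.one = B₀.one
  map_d : ∀ a, r (B.d a) = B₀.d (r a)
  map_mul : ∀ a b, r (B.mul a b) = B₀.mul (r a) (r b)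
  map_bracket : ∀ a b, r (B.bracket a b) = B₀.bracket (r a) (r b)

end Limit

end BD

end

open scoped TensorProduct DirectSum
open LinearMap (flip_apply lTensor_tmul lcomp llcomp comp_apply compRight eqOn_span rTensor_tmul)
open LinearMap renaming add_apply → lin_add, zero_apply → lin_zero, smul_apply → lin_smul,
  neg_apply → lin_neg, sub_apply → lin_sub
open TensorProduct (tmul_add map_tmul tmul_smul tmul_zero smul_tmul' add_tmul
  zero_tmul mk_apply tmul_neg neg_tmul)
open Submodule (subset_span smul_mem span_induction span_le)

noncomputable section

namespace BD

section

variable {R : Type*} [CommRing R] {ħ : R} {A V W L : Type*} [AddCommGroup A] [Module R A]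
  [AddCommGroup V] [Module R V] [AddCommGroup W] [Module R W] [AddCommGroup L] [Module R L]
  {𝒜 : ℤ → Submodule R A} {𝒱 : ℤ → Submodule R V} {𝒲 : ℤ → Submodule R W} {ℒ : ℤ → Submodule R L}
  {G : GCAlgebra 𝒱} {alg : BD1Algebra ħ 𝒜}

section Grading

variable {X : Type*} [AddCommMonoid X] [Module R X]

/-- The linear map defined by its restrictions to the homogeneous components. -/
def hrec (h : DirectSum.IsInternal 𝒱) (F : ∀ i, 𝒱 i →ₗ[R] X) : V →ₗ[R] X :=
  (DirectSum.toModule R ℤ X F) ∘ₗ (components h).toLinearMap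

theorem hrec_of_mem (h : DirectSum.IsInternal 𝒱) (F : ∀ i, 𝒱 i →ₗ[R] X) {i : ℤ} {v : V}
    (hv : v ∈ 𝒱 i) : hrec h F v = F i ⟨v, hv⟩ := by
  rw [hrec, comp_apply, LinearEquiv.coe_coe, components_of_mem h hv, DirectSum.toModule_lof]

/-- The bilinear map `v, w ↦ (-1)^{|v||w|} φ(v, w)`. -/
def tw (h : DirectSum.IsInternal 𝒱) (h' : DirectSum.IsInternal 𝒲) (φ : V →ₗ[R] W →ₗ[R] X) :
    V →ₗ[R] W →ₗ[R] X :=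
  hrec h fun i => (lcomp R X (signMap h' i)) ∘ₗ φ ∘ₗ (𝒱 i).subtype

theorem tw_left (h : DirectSum.IsInternal 𝒱) (h' : DirectSum.IsInternal 𝒲)
    (φ : V →ₗ[R] W →ₗ[R] X) {i : ℤ} {v : V} (hv : v ∈ 𝒱 i) (w : W) :
    tw h h' φ v w = φ v (signMap h' i w) := by
  rw [tw, hrec_of_mem h _ hv]; rfl

theorem mem_span_iUnion (h : DirectSum.IsInternal 𝒱) (v : V) :
    v ∈ Submodule.span R {v | ∃ i, v ∈ 𝒱 i} := by
  have : v ∈ ⨆ i, 𝒱 i := by rw [h.submodule_iSup_eq_top]; trivial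
  induction this using Submodule.iSup_induction' with
  | mem i x hx => exact subset_span ⟨i, hx⟩
  | zero => exact zero_mem _
  | add x y _ _ hx hy => exact add_mem hx hy

theorem hom_ext (h : DirectSum.IsInternal 𝒱) {F G : V →ₗ[R] X}
    (H : ∀ i, ∀ v ∈ 𝒱 i, F v = G v) : F = G := by
  ext v
  induction mem_span_iUnion h v using span_induction with
  | mem x hx => obtain ⟨i, hx⟩ := hx; exact H i x hx
  | zero => simp
  | add x y _ _ hx hy => simp [hx, hy]
  | smul r x _ hx => simp [hx]

theorem sgn_smul_mem (𝒮 : Submodule R V) (n : ℤ) {v : V} (hv : v ∈ 𝒮) : sgn n • v ∈ 𝒮 := by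
  rw [Units.smul_def]; exact zsmul_mem hv _

theorem multilinear_hom_ext (h : DirectSum.IsInternal 𝒱) {k : ℕ}
    {F G : MultilinearMap R (fun _ : Fin k => V) X}
    (H : ∀ (e : Fin k → ℤ) (b : Fin k → V), (∀ i, b i ∈ 𝒱 (e i)) → F b = G b) : F = G := by
  induction k with
  | zero => ext b; exact H (fun i => i.elim0) b (fun i => i.elim0)
  | succ k ih =>
    have : F.curryLeft = G.curryLeft := by
      refine hom_ext h fun i v hv => ih fun e b hb => ?_
      simp only [MultilinearMap.curryLeft_apply]
      refine H (Fin.cons i e) _ fun s => ?_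
      cases s using Fin.cases with
      | zero => simpa
      | succ s => simpa using hb s
    rw [← MultilinearMap.uncurry_curryLeft F, this, MultilinearMap.uncurry_curryLeft]

end Grading

section Sign

variable {X : Type*} [AddCommGroup X] [Module R X]

@[simp] theorem map_sgn_smul (F : V →ₗ[R] X) (n : ℤˣ) (v : V) : F (n • v) = n • F v := by
  rw [Units.smul_def, map_zsmul, ← Units.smul_def]

@[simp] theorem sgn_smul_apply (F : V →ₗ[R] X) (n : ℤˣ) (v : V) : (n • F) v = n • F v := by
  rw [Units.smul_def, lin_smul, ← Units.smul_def]

@[simp] theorem map_sgn_smul₂ (F : V →ₗ[R] W →ₗ[R] X) (n : ℤˣ) (v : V) (w : W) :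
    F (n • v) w = n • F v w := map_sgn_smul (F.flip w) n v

theorem tw_apply (h : DirectSum.IsInternal 𝒱) (h' : DirectSum.IsInternal 𝒲)
    (φ : V →ₗ[R] W →ₗ[R] X) {i j : ℤ} {v : V} {w : W} (hv : v ∈ 𝒱 i) (hw : w ∈ 𝒲 j) :
    tw h h' φ v w = sgn (i * j) • φ v w := by
  rw [tw_left h h' φ hv, signMap_apply h' i hw, Units.smul_def, map_zsmul, ← Units.smul_def]

theorem sgn_mul_self (i : ℤ) : sgn i * sgn i = 1 := Int.units_mul_self _

theorem sgn_mul_cancel (i : ℤ) (u : ℤˣ) : sgn i * (sgn i * u) = u := by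
  rw [← mul_assoc, sgn_mul_self, one_mul]

theorem sgn_mul_comm (i j : ℤ) : sgn (i * j) = sgn (j * i) := by rw [mul_comm]

theorem sgn_add (i j : ℤ) : sgn (i + j) = sgn i * sgn j := Int.negOnePow_add i j

theorem sgn_sub (i j : ℤ) : sgn (i - j) = sgn i * sgn j := Int.negOnePow_sub i j

theorem sgn_zero : sgn 0 = 1 := Int.negOnePow_zero

theorem sgn_one : sgn 1 = -1 := Int.negOnePow_one

theorem sgn_mul_sgn_comm (i j : ℤ) : sgn i * sgn j = sgn j * sgn i := mul_comm _ _

theorem sgn_mul_sgn_left_comm (i j : ℤ) (u : ℤˣ) :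
    sgn i * (sgn j * u) = sgn j * (sgn i * u) := mul_left_comm _ _ _

theorem sgn_mul_sgn_assoc (u v w : ℤˣ) : u * v * w = u * (v * w) := mul_assoc _ _ _

/-- Signs of sums. -/
theorem sgn_expand : (∀ i j : ℤ, sgn (i + j) = sgn i * sgn j) ∧
    (∀ i j l : ℤ, i * (j + l) = i * j + i * l) ∧ ∀ i j l : ℤ, (i + j) * l = i * l + j * l :=
  ⟨sgn_add, mul_add, add_mul⟩

/-- Cancellation of signs. -/
theorem sgn_cancel : (∀ i : ℤ, sgn i * sgn i = 1) ∧ (∀ (i : ℤ) (u : ℤˣ), sgn i * (sgn i * u) = u) ∧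
    (∀ u : ℤˣ, u * 1 = u) ∧ (∀ u : ℤˣ, 1 * u = u) ∧ (∀ i : ℤ, i * 1 = i) ∧ ∀ i : ℤ, 1 * i = i :=
  ⟨sgn_mul_self, sgn_mul_cancel, mul_one, one_mul, mul_one, one_mul⟩

/-- Ordering of products of signs. -/
theorem sgn_sort : (∀ i j : ℤ, sgn (i * j) = sgn (j * i)) ∧
    (∀ i j : ℤ, sgn i * sgn j = sgn j * sgn i) ∧
    (∀ (i j : ℤ) (u : ℤˣ), sgn i * (sgn j * u) = sgn j * (sgn i * u)) ∧
    ∀ u v w : ℤˣ, u * v * w = u * (v * w) :=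
  ⟨sgn_mul_comm, sgn_mul_sgn_comm, sgn_mul_sgn_left_comm, sgn_mul_sgn_assoc⟩

end Sign

/-! ## Families of multilinear operations -/

section Operations

/-- Insertion of an element as first argument: `(cur P b)_k(c) = P_{k+1}(b, c)`. -/
def cur : Ops R V →ₗ[R] V →ₗ[R] Ops R V :=
  LinearMap.mk₂ R (fun P b k => (P (k + 1)).curryLeft b)
    (fun _ _ _ => by ext; simp) (fun _ _ _ => by ext; simp)
    (fun _ _ _ => by ext; simp) (fun _ _ _ => by ext; simp)

theorem cur_apply (P : Ops R V) (b : V) (k : ℕ) (c : Fin k → V) :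
    cur P b k c = P (k + 1) (Fin.cons b c) := rfl

/-- The value of an operation on a list of arguments. -/
def evl : Ops R V → List V → V
  | P, [] => P 0 ![]
  | P, b :: β => evl (cur P b) β

@[simp] theorem evl_cons (P : Ops R V) (b : V) (β : List V) :
    evl P (b :: β) = evl (cur P b) β := rfl

theorem evl_ofFn {k : ℕ} (P : Ops R V) (b : Fin k → V) : evl P (List.ofFn b) = P k b := by
  induction k generalizing P with
  | zero => simp only [List.ofFn_zero, evl]; congr 1; exact Subsingleton.elim _ _
  | succ k ih =>
    rw [List.ofFn_succ, evl_cons, ih, cur_apply]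
    congr 1
    exact Fin.cons_self_tail b

theorem evl_nil (P : Ops R V) : evl P [] = P 0 ![] := rfl

@[simp] theorem evl_add (P Q : Ops R V) (β : List V) : evl (P + Q) β = evl P β + evl Q β := by
  induction β generalizing P Q with
  | nil => rfl
  | cons b β ih => simp [ih]

@[simp] theorem evl_zero (β : List V) : evl (0 : Ops R V) β = 0 := by
  induction β with
  | nil => rfl
  | cons b β ih => simp [ih]

@[simp] theorem evl_smul (r : R) (P : Ops R V) (β : List V) : evl (r • P) β = r • evl P β := by
  induction β generalizing P with
  | nil => rfl
  | cons b β ih => simp [ih]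

/-- The value on a list of arguments as a linear map of the operation. -/
def evlₗ (β : List V) : Ops R V →ₗ[R] V where
  toFun P := evl P β
  map_add' P Q := evl_add P Q β
  map_smul' r P := evl_smul r P β

@[simp] theorem evlₗ_apply (β : List V) (P : Ops R V) : evlₗ β P = evl P β := rfl

@[simp] theorem evl_neg (P : Ops R V) (β : List V) : evl (-P) β = -evl P β :=
  map_neg (evlₗ β) P

@[simp] theorem evl_sgn (n : ℤˣ) (P : Ops R V) (β : List V) : evl (n • P) β = n • evl P β :=
  map_sgn_smul (evlₗ β) n P

theorem ops_ext {P Q : Ops R V} (h : ∀ β, evl P β = evl Q β) : P = Q := by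
  funext k; ext b; rw [← evl_ofFn, ← evl_ofFn, h]

variable {D : Type*} [AddCommGroup D] [Module R D]

/-- The multilinear operations computed by a linear state machine. -/
def run (act : V →ₗ[R] D →ₗ[R] D) (ev : D →ₗ[R] V) : D →ₗ[R] Ops R V :=
  LinearMap.pi fun k => Nat.rec (motive := fun k => D →ₗ[R] MultilinearMap R (fun _ : Fin k => V) V)
    ((MultilinearMap.constLinearEquivOfIsEmpty (R := R) (S := R) (ι := Fin 0)
      (M₁ := fun _ : Fin 0 => V) (M₂ := V)).toLinearMap ∘ₗ ev)
    (fun k F => (multilinearCurryLeftEquiv R (fun _ : Fin (k + 1) => V) V).symm.toLinearMap ∘ₗ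
      (llcomp R V D _ F) ∘ₗ act.flip) k

@[simp] theorem cur_run (act : V →ₗ[R] D →ₗ[R] D) (ev : D →ₗ[R] V) (S : D) (b : V) :
    cur (run act ev S) b = run act ev (act b S) := by
  funext k; ext c; rfl

end Operations

section HD

theorem IsHDiffOp.nil_mem {p : ℤ} {P : Ops R V} (h : IsHDiffOp ħ G p P) : evl P [] ∈ 𝒱 p := by
  have := h.mem (k := 0) (e := Fin.elim0) (b := ![]) (fun i => i.elim0)
  simpa [evl_nil] using this

theorem IsHDiffOp.cur {p i : ℤ} {P : Ops R V} (h : IsHDiffOp ħ G p P) {b : V} (hb : b ∈ 𝒱 i) :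
    IsHDiffOp ħ G (p + i) (cur P b) where
  mem := by
    intro k e c hc
    have := h.mem (e := Fin.cons i e) (b := Fin.cons b c) (by
      intro s; cases s using Fin.cases with
      | zero => simpa
      | succ s => simpa using hc s)
    rw [Fin.sum_univ_succ] at this
    simpa [cur_apply, add_assoc] using this
  symm := by
    intro k e c hc s t hst
    have := h.symm (e := Fin.cons i e) (b := Fin.cons b c) (by
      intro s; cases s using Fin.cases with
      | zero => simpa
      | succ s => simpa using hc s) s.succ t.succ (by simp [hst])
    simp only [Fin.cons_succ] at this
    rw [cur_apply, cur_apply, ← this]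
    congr 1
    funext r
    cases r using Fin.cases with
    | zero =>
      simp [Equiv.swap_apply_of_ne_of_ne (Fin.succ_ne_zero s).symm (Fin.succ_ne_zero t).symm]
    | succ r =>
      simp only [Function.comp_apply, Fin.cons_succ]
      rw [(Fin.succ_injective k).swap_apply, Fin.cons_succ]
  leibniz := by
    intro k c i j x y hx hy
    simp only [cur_apply, Fin.cons_snoc_eq_snoc_cons]
    exact h.leibniz _ hx hy
  map_one := by
    intro k c
    simp only [cur_apply, Fin.cons_snoc_eq_snoc_cons]
    exact h.map_one _

theorem IsHDiffOp.cur_cur {p i j : ℤ} {P : Ops R V} (h : IsHDiffOp ħ G p P) {x y : V}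
    (hx : x ∈ 𝒱 i) (hy : y ∈ 𝒱 j) :
    BD.cur (BD.cur P x) y = sgn (i * j) • BD.cur (BD.cur P y) x := by
  funext k
  refine multilinear_hom_ext G.isInternal fun e b hb => ?_
  have := h.symm (e := Fin.cons j (Fin.cons i e)) (b := Fin.cons y (Fin.cons x b)) (by
      intro s; cases s using Fin.cases with
      | zero => simpa
      | succ s => cases s using Fin.cases with
        | zero => simpa
        | succ s => simpa using hb s) 0 1 (by simp)
  rw [sgn_mul_comm]
  refine Eq.trans ?_ (this.trans ?_)
  · rw [cur_apply, cur_apply]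
    congr 1
    funext r
    cases r using Fin.cases with
    | zero => simp
    | succ r => cases r using Fin.cases with
      | zero => simp
      | succ r =>
        simp only [Function.comp_apply]
        rw [show (1 : Fin (k + 2)) = Fin.succ 0 from rfl,
          Equiv.swap_apply_of_ne_of_ne (Fin.succ_ne_zero _) (fun h => Fin.succ_ne_zero r
            (Fin.succ_injective _ h))]
        simp
  · rfl

theorem IsHDiffOp.leib {p i j : ℤ} {P : Ops R V} (h : IsHDiffOp ħ G p P) {x y : V}
    (hx : x ∈ 𝒱 i) (hy : y ∈ 𝒱 j) :
    evl P [G.mul x y] = G.mul (evl P [x]) y + sgn (i * j) • G.mul (evl P [y]) x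
      + ħ • evl P [x, y] := by
  have := h.leibniz (k := 0) ![] hx hy
  have e1 : ∀ z : V, (Fin.snoc (![] : Fin 0 → V) z : Fin 1 → V) = Fin.cons z ![] := by
    intro z; funext s; fin_cases s; rfl
  have e2 : (Fin.snoc (Fin.cons x ![] : Fin 1 → V) y : Fin 2 → V) = Fin.cons x
    (Fin.cons y ![]) := by
    funext s; fin_cases s <;> rfl
  rw [e1, e1, e1, e2] at this
  exact this

theorem IsHDiffOp.one {p : ℤ} {P : Ops R V} (h : IsHDiffOp ħ G p P) : evl P [G.one] = 0 := by
  have := h.map_one (k := 0) ![]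
  rw [← this]
  change P 1 _ = P 1 _
  congr 1
  funext s; fin_cases s; rfl

/-- A criterion for membership in `D̂_ħ(V)`: a set `𝒪` of operations stable under insertion of
elements of a spanning set. -/
theorem IsHDiffOp.intro {𝒢 : ℤ → Set V} (hs : ∀ i, 𝒱 i = Submodule.span R (𝒢 i))
    {𝒪 : ℤ → Set (Ops R V)}
    (h0 : ∀ {p P}, P ∈ 𝒪 p → evl P [] ∈ 𝒱 p)
    (h1 : ∀ {p P i b}, P ∈ 𝒪 p → b ∈ 𝒢 i → BD.cur P b ∈ Submodule.span R (𝒪 (p + i)))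
    (h2 : ∀ {p P i j x y}, P ∈ 𝒪 p → x ∈ 𝒢 i → y ∈ 𝒢 j →
      BD.cur (BD.cur P x) y = sgn (i * j) • BD.cur (BD.cur P y) x)
    (h3 : ∀ {p P i j x y}, P ∈ 𝒪 p → x ∈ 𝒢 i → y ∈ 𝒢 j →
      evl P [G.mul x y] = G.mul (evl P [x]) y + sgn (i * j) • G.mul (evl P [y]) x
        + ħ • evl P [x, y])
    (h4 : ∀ {p P}, P ∈ 𝒪 p → evl P [G.one] = 0) {p : ℤ} {P : Ops R V}
    (hP : P ∈ Submodule.span R (𝒪 p)) : IsHDiffOp ħ G p P := by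
  have k1 : ∀ {p P i b}, P ∈ Submodule.span R (𝒪 p) → b ∈ 𝒱 i →
      BD.cur P b ∈ Submodule.span R (𝒪 (p + i)) := by
    intro p P i b hP hb
    rw [hs] at hb
    induction hP, hb using Submodule.span_induction₂ with
    | mem_mem x y hx hy => exact h1 hx hy
    | zero_left y hy => simp
    | zero_right y hy => simp
    | add_left x y z _ _ _ hx hy => simpa using add_mem hx hy
    | add_right x y z _ _ _ hx hy => simpa using add_mem hx hy
    | smul_left r x y _ _ h => simpa using smul_mem _ r h
    | smul_right r x y _ _ h => simpa using smul_mem _ r h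
  have k0 : ∀ {p P}, P ∈ Submodule.span R (𝒪 p) → evl P [] ∈ 𝒱 p := by
    intro p P hP
    induction hP using span_induction with
    | mem x hx => exact h0 hx
    | zero => simp
    | add x y _ _ hx hy => simpa using add_mem hx hy
    | smul r x _ h => simpa using smul_mem _ r h
  have k4 : ∀ {p P}, P ∈ Submodule.span R (𝒪 p) → evl P [G.one] = 0 := by
    intro p P hP
    induction hP using span_induction with
    | mem x hx => exact h4 hx
    | zero => simp
    | add x y _ _ hx hy => rw [evl_add, hx, hy, add_zero]
    | smul r x _ h => rw [evl_smul, h, smul_zero]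
  have k2 : ∀ {p P i j x y}, P ∈ Submodule.span R (𝒪 p) → x ∈ 𝒱 i → y ∈ 𝒱 j →
      BD.cur (BD.cur P x) y = sgn (i * j) • BD.cur (BD.cur P y) x := by
    intro p P i j x y hP hx hy
    rw [hs] at hx hy
    induction hP using span_induction with
    | zero => simp
    | add P Q _ _ hP hQ => simp [hP, hQ, smul_add]
    | smul r P _ hP => simp only [map_smul, lin_smul, hP, smul_comm r]
    | mem P hP =>
    induction hx, hy using Submodule.span_induction₂ with
    | mem_mem x y hx hy => exact h2 hP hx hy
    | zero_left y hy => simp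
    | zero_right y hy => simp
    | add_left x y z _ _ _ hx hy => simp [hx, hy, smul_add]
    | add_right x y z _ _ _ hx hy => simp [hx, hy, smul_add]
    | smul_left r x y _ _ h => simp only [map_smul, lin_smul, h, smul_comm r]
    | smul_right r x y _ _ h => simp only [map_smul, lin_smul, h, smul_comm r]
  have k3 : ∀ {p P i j x y}, P ∈ Submodule.span R (𝒪 p) → x ∈ 𝒱 i → y ∈ 𝒱 j →
      evl P [G.mul x y] = G.mul (evl P [x]) y + sgn (i * j) • G.mul (evl P [y]) x
        + ħ • evl P [x, y] := by
    intro p P i j x y hP hx hy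
    rw [hs] at hx hy
    induction hP using span_induction with
    | zero => simp
    | add P Q _ _ hP hQ => simp only [evl_add, hP, hQ, smul_add, map_add, lin_add]; abel
    | smul r P _ hP =>
      simp only [evl_smul, hP, smul_add, map_smul, lin_smul, smul_comm r]
    | mem P hP =>
    induction hx, hy using Submodule.span_induction₂ with
    | mem_mem x y hx hy => exact h3 hP hx hy
    | zero_left y hy => simp
    | zero_right y hy => simp
    | add_left x y z _ _ _ hx hy =>
      simp only [map_add, lin_add, evl_cons, evl_add, smul_add] at hx hy ⊢
      rw [hx, hy]; abel
    | add_right x y z _ _ _ hx hy =>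
      simp only [map_add, lin_add, evl_cons, evl_add, smul_add] at hx hy ⊢
      rw [hx, hy]; abel
    | smul_left r x y _ _ h =>
      simp only [map_smul, lin_smul, evl_cons, evl_smul] at h ⊢
      rw [h]; simp only [smul_add, smul_comm r]
    | smul_right r x y _ _ h =>
      simp only [map_smul, lin_smul, evl_cons, evl_smul] at h ⊢
      rw [h]; simp only [smul_add, smul_comm r]
  have cons_eq : ∀ {k} (P : Ops R V) (b : Fin (k + 1) → V), P (k + 1) b
      = BD.cur P (b 0) k (Fin.tail b) := by
    intro k P b; rw [cur_apply, Fin.cons_self_tail]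
  refine ⟨?_, ?_, ?_, ?_⟩
  · intro k e b hb
    induction k generalizing p P with
    | zero => have := k0 hP; simp only [evl] at this; simpa [Subsingleton.elim b ![]] using this
    | succ k ih =>
      rw [cons_eq, Fin.sum_univ_succ, ← add_assoc]
      exact ih (k1 hP (hb 0)) (e := fun i => e i.succ) (fun i => hb i.succ)
  · intro k e b hb s t hst
    induction k generalizing p P with
    | zero => exact s.elim0
    | succ k ih =>
      obtain ⟨t', rfl⟩ : ∃ t' : Fin k, t = t'.succ := 
        ⟨t.pred (by rintro rfl; simp at hst), by simp⟩
      cases s using Fin.cases with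
      | zero =>
        obtain ⟨k, rfl⟩ : ∃ m, k = m + 1 := ⟨k - 1, by have := t'.2; omega⟩
        obtain rfl : t' = 0 := Fin.ext (by simpa using hst)
        rw [cons_eq, cons_eq, cons_eq P, cons_eq (BD.cur P (b 0))]
        have := congrFun (k2 hP (hb 1) (hb 0)) k
        have := congrArg (fun F => F (Fin.tail (Fin.tail b))) this
        have e1 : Fin.tail (Fin.tail (b ∘ Equiv.swap 0 (0 : Fin (k + 1)).succ))
            = Fin.tail (Fin.tail b) := by
          funext r
          simp only [Fin.tail, Function.comp_apply]
          rw [Equiv.swap_apply_of_ne_of_ne (Fin.succ_ne_zero _) (fun h => Fin.succ_ne_zero r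
            (Fin.succ_injective _ h))]
        rw [e1]
        simp only [Function.comp_apply, Equiv.swap_apply_left, Fin.tail, Equiv.swap_apply_right]
        rw [sgn_mul_comm]
        exact this
      | succ s =>
        rw [cons_eq, cons_eq P]
        have e1 : (b ∘ Equiv.swap s.succ t'.succ) 0 = b 0 := by
          simp only [Function.comp_apply]
          rw [Equiv.swap_apply_of_ne_of_ne (Fin.succ_ne_zero _).symm (Fin.succ_ne_zero _).symm]
        have e2 : Fin.tail (b ∘ Equiv.swap s.succ t'.succ) = Fin.tail b ∘ Equiv.swap s t' := by
          funext r
          simp only [Fin.tail, Function.comp_apply]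
          congr 1
          exact (Fin.succ_injective k).swap_apply s t' r
        rw [e1, e2]
        exact ih (k1 hP (hb 0)) (e := fun i => e i.succ) (fun i => hb i.succ) s t'
          (by simpa using hst)
  · intro k b i j x y hx hy
    induction k generalizing p P with
    | zero =>
      have e1 : ∀ z : V, (Fin.snoc b z : Fin 1 → V) = Fin.cons z ![] := by
        intro z; funext s; fin_cases s; rfl
      have e2 : (Fin.snoc (Fin.cons x ![] : Fin 1 → V) y : Fin 2 → V)
          = Fin.cons x (Fin.cons y ![]) := by
        funext s; fin_cases s <;> rfl
      rw [e1, e1, e1, e2]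
      exact k3 hP hx hy
    | succ k ih =>
      rw [← Fin.cons_self_tail b]
      simp only [← Fin.cons_snoc_eq_snoc_cons]
      simp only [← cur_apply]
      generalize b 0 = b0
      induction mem_span_iUnion G.isInternal b0 using span_induction with
      | mem z hz => obtain ⟨l, hz⟩ := hz; exact ih (k1 hP hz) _
      | zero => simp
      | add u v _ _ hu hv =>
        simp only [map_add, Pi.add_apply, add_apply, hu, hv, lin_add, smul_add]
        abel
      | smul r u _ hu =>
        simp only [map_smul, Pi.smul_apply, smul_apply, hu, lin_smul, smul_add, smul_comm r]
  · intro k b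
    induction k generalizing p P with
    | zero =>
      have e1 : ∀ z : V, (Fin.snoc b z : Fin 1 → V) = Fin.cons z ![] := by
        intro z; funext s; fin_cases s; rfl
      rw [e1]
      exact k4 hP
    | succ k ih =>
      rw [← Fin.cons_self_tail b]
      simp only [← Fin.cons_snoc_eq_snoc_cons]
      simp only [← cur_apply]
      generalize b 0 = b0
      induction mem_span_iUnion G.isInternal b0 using span_induction with
      | mem z hz => obtain ⟨l, hz⟩ := hz; exact ih (k1 hP hz) _
      | zero => simp
      | add u v _ _ hu hv =>
        simp only [map_add, Pi.add_apply, add_apply, hu, hv, add_zero]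
      | smul r u _ hu =>
        simp only [map_smul, Pi.smul_apply, smul_apply, hu, smul_zero]

end HD

section Brackets

/-- Lists of homogeneous arguments together with their degrees. -/
def HomList (𝒱 : ℤ → Submodule R V) (β : List (ℤ × V)) : Prop := ∀ x ∈ β, x.2 ∈ 𝒱 x.1

theorem HomList.cons_iff {x : ℤ × V} {β : List (ℤ × V)} :
    HomList 𝒱 (x :: β) ↔ x.2 ∈ 𝒱 x.1 ∧ HomList 𝒱 β := by
  simp [HomList]

theorem IsHDiffOp.evl_mem {p : ℤ} {P : Ops R V} (h : IsHDiffOp ħ G p P) {β : List (ℤ × V)}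
    (hβ : HomList 𝒱 β) : evl P (β.map Prod.snd) ∈ 𝒱 (p + (β.map Prod.fst).sum) := by
  induction β generalizing p P with
  | nil => simpa using h.nil_mem
  | cons x β ih =>
    rw [HomList.cons_iff] at hβ
    simpa [add_assoc] using ih (h.cur hβ.1) hβ.2

/-- `∑ ± P(Q(b_T), b_{Tᶜ})` for a list of arguments. -/
def insL : ℤ → Ops R V → Ops R V → List (ℤ × V) → V
  | _, P, Q, [] => evl P [evl Q []]
  | q, P, Q, x :: β => insL (q + x.1) P (cur Q x.2) β + sgn (x.1 * q) • insL q (cur P x.2) Q β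

/-- The bracket of `P` and `Q`, of degrees `p` and `q`, on a list of arguments. -/
def brL : ℤ → ℤ → Ops R V → Ops R V → List (ℤ × V) → V
  | p, q, P, Q, [] => evl P [evl Q []] - sgn (p * q) • evl Q [evl P []]
  | p, q, P, Q, x :: β =>
    brL p (q + x.1) P (cur Q x.2) β + sgn (x.1 * q) • brL (p + x.1) q (cur P x.2) Q β

/-- The product of `P` and `Q`, where `Q` has degree `q`, on a list of arguments. -/
def prdL (ħ : R) (G : GCAlgebra 𝒱) : ℤ → Ops R V → Ops R V → List (ℤ × V) → V
  | _, P, Q, [] => G.mul (evl P []) (evl Q []) + ħ • evl P [evl Q []]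
  | q, P, Q, x :: β =>
    sgn (q * x.1) • prdL ħ G q (cur P x.2) Q β + prdL ħ G (q + x.1) P (cur Q x.2) β

theorem brL_eq_insL (p q : ℤ) (P Q : Ops R V) (β : List (ℤ × V)) :
    brL p q P Q β = insL q P Q β - sgn (p * q) • insL p Q P β := by
  induction β generalizing p q P Q with
  | nil => rfl
  | cons x β ih =>
    simp only [brL, insL, ih, smul_add, smul_sub, smul_smul, mul_comm, mul_left_comm, sgn_expand,
      sgn_cancel]
    abel

section Lists

variable {α : Type*} {k : ℕ}

/-- The arguments with indices in `T`, in increasing order. -/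
def srt (T : Finset (Fin k)) (b : Fin k → α) : List α := (T.sort (· ≤ ·)).map b

theorem ofFn_sel (T : Finset (Fin k)) (b : Fin k → α) : List.ofFn (sel T b) = srt T b := by
  rw [srt, ← Finset.listMap_orderEmbOfFin_finRange T rfl, List.map_map, List.ofFn_eq_map]; rfl

theorem sort_image_succ (T : Finset (Fin k)) :
    (T.image Fin.succ).sort (· ≤ ·) = (T.sort (· ≤ ·)).map Fin.succ := by
  have hn : ((T.sort (· ≤ ·)).map Fin.succ).Nodup :=
    (T.sort_nodup _).map (Fin.succ_injective k)
  have e : ((T.sort (· ≤ ·)).map Fin.succ).toFinset = T.image Fin.succ := by ext; simp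
  rw [← e]
  refine (List.toFinset_sort _ hn).2 ?_
  rw [List.pairwise_map]
  exact (T.pairwise_sort (· ≤ ·)).imp fun h => Fin.succ_le_succ_iff.2 h

theorem srt_image (T : Finset (Fin k)) (b : Fin (k + 1) → α) :
    srt (T.image Fin.succ) b = srt T (Fin.tail b) := by
  rw [srt, sort_image_succ, List.map_map]; rfl

theorem srt_insert (T : Finset (Fin k)) (b : Fin (k + 1) → α) :
    srt (insert 0 (T.image Fin.succ)) b = b 0 :: srt T (Fin.tail b) := by
  rw [srt, Finset.sort_insert _ (fun b _ => Fin.zero_le b) (by simp), List.map_cons]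
  congr 1
  exact srt_image T b

theorem compl_image (T : Finset (Fin k)) :
    (T.image Fin.succ)ᶜ = insert 0 (Tᶜ.image Fin.succ) := by
  ext s; cases s using Fin.cases <;> simp

theorem compl_insert (T : Finset (Fin k)) :
    (insert 0 (T.image Fin.succ))ᶜ = Tᶜ.image Fin.succ := by
  ext s; cases s using Fin.cases <;> simp

theorem sum_finset_fin_succ {M : Type*} [AddCommMonoid M] (F : Finset (Fin (k + 1)) → M) :
    ∑ T, F T = ∑ T : Finset (Fin k), F (insert 0 (T.image Fin.succ))
      + ∑ T : Finset (Fin k), F (T.image Fin.succ) := by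
  have h : (Finset.univ : Finset (Finset (Fin (k + 1))))
      = (insert 0 (Finset.univ.image Fin.succ) : Finset (Fin (k + 1))).powerset := by
    ext T; simp only [Finset.mem_univ, Finset.mem_powerset, true_iff]
    intro s _; cases s using Fin.cases <;> simp
  have hi := Finset.image_injective (Fin.succ_injective k)
  rw [h, Finset.sum_powerset_insert (by simp), Finset.powerset_image, Finset.powerset_univ,
    Finset.sum_image (fun _ _ _ _ h => hi h), Finset.sum_image (fun _ _ _ _ h => hi h), add_comm]

theorem unshuffleSign_eq (e : Fin k → ℤ) (T : Finset (Fin k)) :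
    unshuffleSign e T = ∏ x ∈ Tᶜ, ∏ y ∈ T, if x < y then sgn (e x * e y) else 1 := by
  rw [unshuffleSign, Finset.prod_filter, Finset.prod_product]

theorem sgn_sum {ι : Type*} (s : Finset ι) (c : ℤ) (e : ι → ℤ) :
    ∏ y ∈ s, sgn (c * e y) = sgn (c * ∑ y ∈ s, e y) := by
  classical
  induction s using Finset.induction_on with
  | empty => simp
  | insert a s ha ih => rw [Finset.prod_insert ha, Finset.sum_insert ha, ih, mul_add, sgn_add]

theorem unshuffleSign_image (e : Fin (k + 1) → ℤ) (T : Finset (Fin k)) :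
    unshuffleSign e (T.image Fin.succ)
      = sgn (e 0 * ∑ y ∈ T, Fin.tail e y) * unshuffleSign (Fin.tail e) T := by
  have hi : ∀ s : Set (Fin k), Set.InjOn Fin.succ s := fun s => (Fin.succ_injective k).injOn
  rw [unshuffleSign_eq, unshuffleSign_eq, compl_image, Finset.prod_insert (by simp)]
  congr 1
  · rw [Finset.prod_image (hi _), ← sgn_sum]
    simp [Fin.tail]
  · rw [Finset.prod_image (hi _)]
    refine Finset.prod_congr rfl fun x _ => ?_
    rw [Finset.prod_image (hi _)]
    simp [Fin.tail]

theorem unshuffleSign_insert (e : Fin (k + 1) → ℤ) (T : Finset (Fin k)) :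
    unshuffleSign e (insert 0 (T.image Fin.succ)) = unshuffleSign (Fin.tail e) T := by
  rw [unshuffleSign_eq, unshuffleSign_eq, compl_insert,
    Finset.prod_image (fun _ _ _ _ h => Fin.succ_injective k h)]
  refine Finset.prod_congr rfl fun x _ => ?_
  rw [Finset.prod_insert (by simp), Finset.prod_image (fun _ _ _ _ h => Fin.succ_injective k h)]
  simp [Fin.tail]

theorem sum_sort (e : Fin k → ℤ) (T : Finset (Fin k)) : (srt T e).sum = ∑ y ∈ T, e y := by
  rw [srt, ← Multiset.sum_coe, ← Multiset.map_coe, Finset.sort_eq]; rfl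

theorem IsHDiffOp.srt_mem {p : ℤ} {P : Ops R V} (h : IsHDiffOp ħ G p P) {e : Fin k → ℤ}
    {b : Fin k → V} (hb : ∀ s, b s ∈ 𝒱 (e s)) (T : Finset (Fin k)) :
    evl P (srt T b) ∈ 𝒱 (p + ∑ y ∈ T, e y) := by
  have := h.evl_mem (β := (T.sort (· ≤ ·)).map fun s => (e s, b s)) (by
    intro x hx
    obtain ⟨s, _, rfl⟩ := List.mem_map.1 hx
    exact hb s)
  rw [List.map_map, List.map_map] at this
  rw [← sum_sort]
  exact this

end Lists

theorem insertion_eq_insL {k : ℕ} {p q : ℤ} {P Q : Ops R V} (hP : IsHDiffOp ħ G p P)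
    (hQ : IsHDiffOp ħ G q Q) {e : Fin k → ℤ} {b : Fin k → V} (hb : ∀ s, b s ∈ 𝒱 (e s)) :
    insertion P Q e b = insL q P Q (List.ofFn fun s => (e s, b s)) := by
  have key : ∀ {k : ℕ} (P Q : Ops R V) (e : Fin k → ℤ) (b : Fin k → V), insertion P Q e b
      = ∑ T, unshuffleSign e T • evl P (evl Q (srt T b) :: srt Tᶜ b) := by
    intro k P Q e b
    refine Finset.sum_congr rfl fun T _ => ?_
    rw [← ofFn_sel, ← ofFn_sel, evl_ofFn, ← List.ofFn_cons, evl_ofFn]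
    rfl
  induction k generalizing p q P Q with
  | zero =>
    rw [key, Fintype.sum_eq_single ∅ (fun T h => (h (Finset.eq_empty_of_isEmpty T)).elim)]
    simp [unshuffleSign, srt, insL]
  | succ k ih =>
    rw [List.ofFn_succ, insL, ← ih hP (hQ.cur (hb 0)) (fun s => hb s.succ),
      ← ih (hP.cur (hb 0)) hQ (fun s => hb s.succ), key, key, key, sum_finset_fin_succ,
      Finset.smul_sum]
    congr 1
    · refine Finset.sum_congr rfl fun T _ => ?_
      rw [unshuffleSign_insert, srt_insert, compl_insert, srt_image]; rfl
    · refine Finset.sum_congr rfl fun T _ => ?_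
      have h := hP.cur_cur (hQ.srt_mem (fun s => hb s.succ) T) (hb 0)
      change _ = sgn (e 0 * q) • unshuffleSign (Fin.tail e) T •
        evl (cur (cur P (b 0)) (evl Q (srt T (Fin.tail b)))) (srt Tᶜ (Fin.tail b))
      change cur (cur P (evl Q (srt T (Fin.tail b)))) (b 0) = _ at h
      rw [unshuffleSign_image, srt_image, compl_image, srt_insert, evl_cons, evl_cons, h, evl_sgn,
        smul_smul, smul_smul]
      congr 1
      change _ * sgn ((q + ∑ y ∈ T, Fin.tail e y) * e 0) = _
      rw [mul_comm _ (e 0), mul_add, sgn_add]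
      simp only [mul_left_comm, mul_comm, sgn_mul_self, one_mul]

theorem hBracket_eq_brL {k : ℕ} {p q : ℤ} {P Q : Ops R V} (hP : IsHDiffOp ħ G p P)
    (hQ : IsHDiffOp ħ G q Q) {e : Fin k → ℤ} {b : Fin k → V} (hb : ∀ s, b s ∈ 𝒱 (e s)) :
    hBracket p q P Q e b = brL p q P Q (List.ofFn fun s => (e s, b s)) := by
  rw [brL_eq_insL, hBracket, insertion_eq_insL hP hQ hb, insertion_eq_insL hQ hP hb]

theorem hMul_eq_prdL {k : ℕ} (q : ℤ) (P Q : Ops R V) (e : Fin k → ℤ) (b : Fin k → V) :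
    hMul ħ G q P Q e b = prdL ħ G q P Q (List.ofFn fun s => (e s, b s)) := by
  have key : ∀ {k : ℕ} (q : ℤ) (P Q : Ops R V) (e : Fin k → ℤ) (b : Fin k → V),
      hMul ħ G q P Q e b = ∑ T : Finset (Fin k), (unshuffleSign e T * sgn (q * ∑ i ∈ T, e i)) •
      (G.mul (evl P (srt T b)) (evl Q (srt Tᶜ b))
        + ħ • evl P (srt T b ++ [evl Q (srt Tᶜ b)])) := by
    intro k q P Q e b
    refine Finset.sum_congr rfl fun T _ => ?_
    rw [← ofFn_sel, ← ofFn_sel, evl_ofFn, evl_ofFn, ← evl_ofFn P (Fin.snoc _ _), List.ofFn_succ']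
    simp
  induction k generalizing q P Q with
  | zero =>
    rw [key, Fintype.sum_eq_single ∅ (fun T h => (h (Finset.eq_empty_of_isEmpty T)).elim)]
    simp [unshuffleSign, srt, prdL]
  | succ k ih =>
    rw [List.ofFn_succ, prdL, ← ih, ← ih, key, key, key, sum_finset_fin_succ, Finset.smul_sum]
    congr 1
    · refine Finset.sum_congr rfl fun T _ => ?_
      rw [unshuffleSign_insert, srt_insert, compl_insert, srt_image, Finset.sum_insert (by simp),
        Finset.sum_image (fun _ _ _ _ h => Fin.succ_injective k h), mul_add, sgn_add, smul_smul,
        mul_left_comm]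
      rfl
    · refine Finset.sum_congr rfl fun T _ => ?_
      rw [unshuffleSign_image, srt_image, compl_image, srt_insert,
        Finset.sum_image (fun _ _ _ _ h => Fin.succ_injective k h), add_mul, sgn_add,
        mul_comm (sgn (e 0 * _)), mul_assoc, mul_comm (sgn (q * _))]
      rfl

end Brackets

section Bilinearity

theorem brL_add_left (p q : ℤ) (P P' Q : Ops R V) (β : List (ℤ × V)) :
    brL p q (P + P') Q β = brL p q P Q β + brL p q P' Q β := by
  induction β generalizing p q P P' Q with
  | nil =>
    simp only [brL, evl_cons, evl_add, map_add, smul_add, lin_add]; abel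
  | cons x β ih => simp only [brL, map_add, lin_add, ih, smul_add]; abel

theorem brL_symm (p q : ℤ) (P Q : Ops R V) (β : List (ℤ × V)) :
    brL p q P Q β = -(sgn (p * q) • brL q p Q P β) := by
  rw [brL_eq_insL, brL_eq_insL, mul_comm q p, smul_sub, smul_smul, sgn_mul_self, one_smul, neg_sub]

theorem brL_add_right (p q : ℤ) (P Q Q' : Ops R V) (β : List (ℤ × V)) :
    brL p q P (Q + Q') β = brL p q P Q β + brL p q P Q' β := by
  rw [brL_symm, brL_add_left, brL_symm p q P Q, brL_symm p q P Q', smul_add, neg_add]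

theorem brL_smul_left (p q : ℤ) (r : R) (P Q : Ops R V) (β : List (ℤ × V)) :
    brL p q (r • P) Q β = r • brL p q P Q β := by
  induction β generalizing p q P Q with
  | nil =>
    simp only [brL, evl_cons, evl_nil, map_smul, lin_smul, Pi.smul_apply, smul_apply, smul_sub,
      smul_comm r]
  | cons x β ih =>
    simp only [brL, map_smul, lin_smul, ih, smul_add, smul_comm r]

theorem brL_smul_right (p q : ℤ) (r : R) (P Q : Ops R V) (β : List (ℤ × V)) :
    brL p q P (r • Q) β = r • brL p q P Q β := by
  rw [brL_symm, brL_smul_left, brL_symm p q P Q, smul_neg, smul_comm r]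

/-- The bracket on a list of arguments as a bilinear map. -/
def brLₗ (p q : ℤ) (β : List (ℤ × V)) : Ops R V →ₗ[R] Ops R V →ₗ[R] V :=
  LinearMap.mk₂ R (fun P Q => brL p q P Q β) (fun _ _ _ => brL_add_left ..)
    (fun _ _ _ => brL_smul_left ..) (fun _ _ _ => brL_add_right ..)
    (fun _ _ _ => brL_smul_right ..)

theorem brLₗ_apply (p q : ℤ) (β : List (ℤ × V)) (P Q : Ops R V) :
    brLₗ p q β P Q = brL p q P Q β := rfl

theorem brL_zero_left (p q : ℤ) (Q : Ops R V) (β : List (ℤ × V)) : brL p q 0 Q β = 0 := by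
  rw [← brLₗ_apply, map_zero, lin_zero]

theorem brL_zero_right (p q : ℤ) (P : Ops R V) (β : List (ℤ × V)) : brL p q P 0 β = 0 := by
  rw [← brLₗ_apply, map_zero]

theorem brL_sgn_left (p q : ℤ) (u : ℤˣ) (P Q : Ops R V) (β : List (ℤ × V)) :
    brL p q (u • P) Q β = u • brL p q P Q β := by
  rw [← brLₗ_apply, map_sgn_smul, sgn_smul_apply, brLₗ_apply]

theorem brL_sgn_right (p q : ℤ) (u : ℤˣ) (P Q : Ops R V) (β : List (ℤ × V)) :
    brL p q P (u • Q) β = u • brL p q P Q β := by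
  rw [← brLₗ_apply, map_sgn_smul, brLₗ_apply]

end Bilinearity

section Generators

theorem brL_swap {p q : ℤ} {P Q : Ops R V} (hP : IsHDiffOp ħ G p P) (hQ : IsHDiffOp ħ G q Q)
    {x y : ℤ × V} (hx : x.2 ∈ 𝒱 x.1) (hy : y.2 ∈ 𝒱 y.1) (β : List (ℤ × V)) :
    brL p q P Q (x :: y :: β) = sgn (x.1 * y.1) • brL p q P Q (y :: x :: β) := by
  simp only [brL]
  rw [hP.cur_cur hx hy, hQ.cur_cur hx hy, brL_sgn_left, brL_sgn_right, add_right_comm q,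
    add_right_comm p]
  simp only [smul_add, smul_smul, mul_comm, mul_left_comm, mul_assoc, sgn_expand, sgn_cancel]
  abel

theorem HomList.perm {β γ : List (ℤ × V)} (h : HomList 𝒱 β) (hp : β.Perm γ) : HomList 𝒱 γ :=
  fun x hx => h x (hp.mem_iff.2 hx)

theorem brL_perm {β γ : List (ℤ × V)} (hp : β.Perm γ) (hβ : HomList 𝒱 β) :
    ∃ s : ℤˣ, ∀ {p q : ℤ} {P Q : Ops R V}, IsHDiffOp ħ G p P → IsHDiffOp ħ G q Q →
      brL p q P Q β = s • brL p q P Q γ := by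
  induction hp with
  | nil => exact ⟨1, fun _ _ => by rw [one_smul]⟩
  | cons x _ ih =>
    rw [HomList.cons_iff] at hβ
    obtain ⟨s, hs⟩ := ih hβ.2
    refine ⟨s, fun hP hQ => ?_⟩
    rw [brL, hs hP (hQ.cur hβ.1), hs (hP.cur hβ.1) hQ, brL, smul_add, smul_comm]
  | swap x y l =>
    rw [HomList.cons_iff, HomList.cons_iff] at hβ
    exact ⟨_, fun hP hQ => brL_swap hP hQ hβ.1 hβ.2.1 l⟩
  | trans h₁ h₂ ih₁ ih₂ =>
    obtain ⟨s, hs⟩ := ih₁ hβ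
    obtain ⟨t, ht⟩ := ih₂ (hβ.perm h₁)
    exact ⟨s * t, fun hP hQ => by rw [hs hP hQ, ht hP hQ, smul_smul]⟩

theorem brL_eq_zero_of_perm {β γ : List (ℤ × V)} (hp : β.Perm γ) (hβ : HomList 𝒱 β) {p q : ℤ}
    {P Q : Ops R V} (hP : IsHDiffOp ħ G p P) (hQ : IsHDiffOp ħ G q Q)
    (h : brL p q P Q γ = 0) : brL p q P Q β = 0 := by
  obtain ⟨s, hs⟩ := brL_perm (ħ := ħ) (G := G) hp hβ
  rw [hs hP hQ, h, smul_zero]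

/-- The bracket as a function of its last argument. -/
theorem exists_brL_last (p q : ℤ) (P Q : Ops R V) (β : List (ℤ × V)) (i : ℤ) :
    ∃ F : V →ₗ[R] V, ∀ x, brL p q P Q (β ++ [(i, x)]) = F x := by
  induction β generalizing p q P Q with
  | nil =>
    refine ⟨(brLₗ p (q + i) [] P) ∘ₗ (cur Q) + sgn (i * q) • (brLₗ (p + i) q []).flip Q ∘ₗ cur P,
      fun x => ?_⟩
    rw [lin_add, sgn_smul_apply]
    rfl
  | cons y β ih =>
    obtain ⟨F, hF⟩ := ih p (q + y.1) P (cur Q y.2)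
    obtain ⟨F', hF'⟩ := ih (p + y.1) q (cur P y.2) Q
    refine ⟨F + sgn (y.1 * q) • F', fun x => ?_⟩
    rw [List.cons_append, brL, hF, hF', lin_add, sgn_smul_apply]

theorem IsHDiffOp.evl_one_mem {p i : ℤ} {P : Ops R V} (h : IsHDiffOp ħ G p P) {x : V}
    (hx : x ∈ 𝒱 i) : evl P [x] ∈ 𝒱 (p + i) := (h.cur hx).nil_mem

theorem IsHDiffOp.leib_cur {p i j : ℤ} {P : Ops R V} (h : IsHDiffOp ħ G p P) {x y : V}
    (hx : x ∈ 𝒱 i) (hy : y ∈ 𝒱 j) {a : ℤ} {z : V} (hz : z ∈ 𝒱 a) :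
    evl P [G.mul x y, z] = sgn (a * j) • G.mul (evl P [x, z]) y
      + sgn (i * j + a * i) • G.mul (evl P [y, z]) x + ħ • evl P [x, y, z] := by
  have e := (h.cur hz).leib hx hy
  have s : ∀ {u : V} {b : ℤ}, u ∈ 𝒱 b → evl P [z, u] = sgn (a * b) • evl P [u, z] := by
    intro u b hu
    rw [evl_cons, evl_cons, h.cur_cur hz hu, evl_sgn]; rfl
  have s2 : evl P [z, x, y] = sgn (a * (i + j)) • evl P [x, y, z] := by
    rw [evl_cons, evl_cons, h.cur_cur hz hx, evl_sgn, evl_cons, (h.cur hx).cur_cur hz hy, evl_sgn,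
      smul_smul, mul_add, sgn_add]; rfl
  change evl P [z, _] = G.mul (evl P [z, x]) y + _ • G.mul (evl P [z, y]) x + ħ • evl P [z, x, y]
    at e
  rw [s (G.mul_mem hx hy), s hx, s hy, s2] at e
  have := congrArg (sgn (a * (i + j)) • ·) e
  simp only [smul_smul, sgn_mul_self, one_smul] at this
  rw [this]
  simp only [map_sgn_smul, sgn_smul_apply, smul_add, smul_smul, smul_comm ħ]
  simp only [mul_comm, mul_left_comm, one_smul, sgn_expand, sgn_cancel]

theorem brL_leibniz {p q i j : ℤ} {P Q : Ops R V} (hP : IsHDiffOp ħ G p P)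
    (hQ : IsHDiffOp ħ G q Q) {x y : V} (hx : x ∈ 𝒱 i) (hy : y ∈ 𝒱 j) {β : List (ℤ × V)}
    (hβ : HomList 𝒱 β) :
    brL p q P Q (β ++ [(i + j, G.mul x y)]) = G.mul (brL p q P Q (β ++ [(i, x)])) y
      + sgn (i * j) • G.mul (brL p q P Q (β ++ [(j, y)])) x
      + ħ • brL p q P Q (β ++ [(i, x), (j, y)]) := by
  induction β generalizing p q P Q with
  | cons z β ih =>
    rw [HomList.cons_iff] at hβ
    simp only [List.cons_append, brL, ih hP (hQ.cur hβ.1) hβ.2, ih (hP.cur hβ.1) hQ hβ.2, map_add,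
      lin_add, map_sgn_smul, sgn_smul_apply, smul_add, smul_comm ħ, smul_comm (sgn (i * j))]
    abel
  | nil =>
    simp only [List.nil_append, brL, ← evl_cons]
    rw [hQ.leib hx hy, hP.leib hx hy, hQ.leib_cur hx hy hP.nil_mem, hP.leib_cur hx hy hQ.nil_mem]
    have e : ∀ (P : Ops R V) (u v w : V), evl P [u + v + ħ • w]
        = evl P [u] + evl P [v] + ħ • evl P [w] := by
      intro P u v w
      simp only [evl_cons, map_add, map_smul, evl_add, evl_smul]
    have e' : ∀ (P : Ops R V) (n : ℤˣ) (u : V), evl P [n • u] = n • evl P [u] := by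
      intro P n u; simp only [evl_cons, map_sgn_smul, evl_sgn]
    rw [e, e, e', e', hP.leib (hQ.evl_one_mem hx) hy, hP.leib (hQ.evl_one_mem hy) hx,
      hQ.leib (hP.evl_one_mem hx) hy, hQ.leib (hP.evl_one_mem hy) hx,
      G.mul_comm (hQ.evl_one_mem hx) (hP.evl_one_mem hy),
      G.mul_comm (hQ.evl_one_mem hy) (hP.evl_one_mem hx)]
    have e2 : ∀ {p} {P : Ops R V} (hP : IsHDiffOp ħ G p P) {a b : ℤ} {u v : V}, u ∈ 𝒱 a → v ∈ 𝒱 b →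
        evl P [u, v] = sgn (a * b) • evl P [v, u] := by
      intro p P hP a b u v hu hv
      rw [evl_cons, evl_cons, hP.cur_cur hu hv, evl_sgn]; rfl
    have e3 : ∀ {p} {P : Ops R V} (hP : IsHDiffOp ħ G p P) {a : ℤ} {u : V}, u ∈ 𝒱 a → 
      evl P [u, x, y] = sgn (a * (i + j)) • evl P [x, y, u] := by
      intro p P hP a u hu
      rw [evl_cons, evl_cons, hP.cur_cur hu hx, evl_sgn, evl_cons, (hP.cur hx).cur_cur hu hy,
        evl_sgn, smul_smul, mul_add, sgn_add]; rfl
    rw [e2 hP hy (hQ.evl_one_mem hx), e2 hQ hy (hP.evl_one_mem hx), e2 hP (hQ.evl_one_mem hy) hx,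
      e2 hQ (hP.evl_one_mem hy) hx]
    simp only [map_add, map_sub, lin_add, lin_sub, map_sgn_smul, sgn_smul_apply, smul_add, smul_sub,
      smul_smul, smul_comm ħ, mul_comm, mul_left_comm, mul_assoc, one_smul, sgn_expand, sgn_cancel]
    abel

theorem brL_one {p q : ℤ} {P Q : Ops R V} (hP : IsHDiffOp ħ G p P)
    (hQ : IsHDiffOp ħ G q Q) {β : List (ℤ × V)} (hβ : HomList 𝒱 β) :
    brL p q P Q (β ++ [(0, G.one)]) = 0 := by
  induction β generalizing p q P Q with
  | cons z β ih =>
    rw [HomList.cons_iff] at hβ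
    rw [List.cons_append, brL, ih hP (hQ.cur hβ.1) hβ.2, ih (hP.cur hβ.1) hQ hβ.2, smul_zero,
      add_zero]
  | nil =>
    have e : ∀ {p i} {P : Ops R V} {u}, IsHDiffOp ħ G p P → u ∈ 𝒱 i →
        evl P [G.one, u] = 0 := by
      intro p i P u hP hu
      rw [evl_cons, evl_cons, hP.cur_cur G.one_mem hu, evl_sgn]
      exact (smul_eq_zero_iff_eq _).2 (hP.cur hu).one
    simp only [List.nil_append, brL, ← evl_cons]
    rw [hQ.one, hP.one, e hP hQ.nil_mem, e hQ hP.nil_mem]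
    simp [evl_cons]

/-- Products of generators. -/
inductive Prods (G : GCAlgebra 𝒱) (𝒢 : ℤ → Set V) : ℤ → V → Prop
  | one : Prods G 𝒢 0 G.one
  | mul {i j : ℤ} {x g : V} : Prods G 𝒢 i x → g ∈ 𝒢 j → Prods G 𝒢 (i + j) (G.mul x g)

theorem Prods.mem {𝒢 : ℤ → Set V} (hG : ∀ i, 𝒢 i ⊆ 𝒱 i) {i : ℤ} {x : V}
    (h : Prods G 𝒢 i x) : x ∈ 𝒱 i := by
  induction h with
  | one => exact G.one_mem
  | mul _ hg ih => exact G.mul_mem ih (hG _ hg)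

theorem brL_eq_zero_of_generators {𝒢 : ℤ → Set V} (hG : ∀ i, 𝒢 i ⊆ 𝒱 i)
    (hs : ∀ i, 𝒱 i ≤ Submodule.span R {x | Prods G 𝒢 i x}) {p q : ℤ} {P Q : Ops R V}
    (hP : IsHDiffOp ħ G p P) (hQ : IsHDiffOp ħ G q Q)
    (h : ∀ γ : List (ℤ × V), (∀ x ∈ γ, x.2 ∈ 𝒢 x.1) → brL p q P Q γ = 0)
    {β : List (ℤ × V)} (hβ : HomList 𝒱 β) : brL p q P Q β = 0 := by
  have hom : ∀ {γ : List (ℤ × V)}, (∀ x ∈ γ, x.2 ∈ 𝒢 x.1) → HomList 𝒱 γ :=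
    fun hγ x hx => hG _ (hγ x hx)
  have app : ∀ {β γ : List (ℤ × V)}, HomList 𝒱 β → HomList 𝒱 γ → HomList 𝒱 (β ++ γ) := by
    intro β γ h h' x hx
    rcases List.mem_append.1 hx with hx | hx
    exacts [h x hx, h' x hx]
  suffices H : ∀ γ : List (ℤ × V), (∀ x ∈ γ, x.2 ∈ 𝒢 x.1) → brL p q P Q (β ++ γ) = 0 by
    simpa using H [] (by simp)
  induction β with
  | nil => simpa using h
  | cons x β ih =>
    rw [HomList.cons_iff] at hβ
    have key : ∀ {i : ℤ} {x : V}, Prods G 𝒢 i x → ∀ γ : List (ℤ × V),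
        (∀ x ∈ γ, x.2 ∈ 𝒢 x.1) → brL p q P Q ((β ++ γ) ++ [(i, x)]) = 0 := by
      intro i x hx
      induction hx with
      | one => exact fun γ hγ => brL_one hP hQ (app hβ.2 (hom hγ))
      | @mul i j x g hx hg ihx =>
        intro γ hγ
        have hg' : ∀ y ∈ γ ++ [(j, g)], y.2 ∈ 𝒢 y.1 := by
          intro y hy
          rcases List.mem_append.1 hy with hy | hy
          · exact hγ y hy
          · rw [List.mem_singleton.1 hy]; exact hg
        have e1 := ih hβ.2 _ hg'
        have e2 := ihx _ hg'
        have e3 : brL p q P Q (β ++ γ ++ [(i, x), (j, g)]) = 0 := by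
          refine brL_eq_zero_of_perm ?_ ?_ hP hQ e2
          · simp only [List.append_assoc, List.cons_append, List.nil_append]
            exact ((List.Perm.swap _ _ _).append_left γ).append_left β
          · refine app (app hβ.2 (hom hγ)) ?_
            have hg0 : g ∈ 𝒱 j := hG j hg
            simp [HomList, hx.mem hG, hg0]
        rw [← List.append_assoc] at e1
        rw [brL_leibniz hP hQ (hx.mem hG) (hG _ hg) (app hβ.2 (hom hγ)), ihx γ hγ, e1, e3]
        simp
    intro γ hγ
    obtain ⟨i, x⟩ := x
    refine brL_eq_zero_of_perm (γ := (β ++ γ) ++ [(i, x)]) ?_ ?_ hP hQ ?_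
    · rw [List.cons_append]
      exact (List.perm_append_singleton _ _).symm
    · refine app ?_ (hom hγ)
      rw [HomList.cons_iff]; exact hβ
    · obtain ⟨F, hF⟩ := exists_brL_last p q P Q (β ++ γ) i
      rw [hF]
      have hle : Submodule.span R {x | Prods G 𝒢 i x} ≤ LinearMap.ker F :=
        Submodule.span_le.2 fun y hy => (hF y).symm.trans (key hy γ hγ)
      exact hle (hs i hβ.1)

end Generators

section Internal

variable {X : Type*} [AddCommGroup X] [Module R X]

/-- A grading is internal if it spans and there is a compatible coaction of `ℤ`. -/
theorem isInternal_of_coaction (δ : V →ₗ[R] ℤ →₀ V)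
    (hδ : ∀ i, ∀ v ∈ 𝒱 i, δ v = Finsupp.single i v)
    (hs : ∀ v, v ∈ Submodule.span R {v | ∃ i, v ∈ 𝒱 i}) : DirectSum.IsInternal 𝒱 := by
  have key : ∀ x : ⨁ i, 𝒱 i, ∀ i, δ (DirectSum.coeLinearMap 𝒱 x) i = x i := by
    intro x i
    induction x using DirectSum.induction_on with
    | zero => simp
    | of j y =>
      rw [← DirectSum.lof_eq_of R, DirectSum.coeLinearMap_lof, hδ j _ y.2, DirectSum.lof_eq_of]
      rcases eq_or_ne i j with rfl | h
      · rw [DirectSum.of_eq_same, Finsupp.single_eq_same]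
      · rw [DirectSum.of_eq_of_ne _ _ _ h, Finsupp.single_eq_of_ne h]; rfl
    | add x y hx hy => rw [map_add, map_add, Finsupp.add_apply, hx, hy]; rfl
  constructor
  · intro x y h
    have h : DirectSum.coeLinearMap 𝒱 x = DirectSum.coeLinearMap 𝒱 y := h
    refine DFinsupp.ext fun i => Subtype.ext ?_
    rw [← key x i, h, key y i]
  · intro v
    change v ∈ Set.range (DirectSum.coeLinearMap 𝒱)
    rw [← LinearMap.coe_range]
    refine Submodule.span_le.2 ?_ (hs v)
    rintro v ⟨i, hv⟩
    exact ⟨DirectSum.lof R ℤ (fun i => 𝒱 i) i ⟨v, hv⟩, DirectSum.coeLinearMap_lof 𝒱 i _⟩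

/-- The coaction of `ℤ` on a graded module. -/
def coaction (h : DirectSum.IsInternal 𝒱) : V →ₗ[R] ℤ →₀ V :=
  hrec h fun i => Finsupp.lsingle i ∘ₗ (𝒱 i).subtype

theorem coaction_of_mem (h : DirectSum.IsInternal 𝒱) {i : ℤ} {v : V} (hv : v ∈ 𝒱 i) :
    coaction h v = Finsupp.single i v := hrec_of_mem h _ hv

theorem hom_ext_gens {𝒢 : ℤ → Set V} (h : DirectSum.IsInternal 𝒱)
    (hs : ∀ i, 𝒱 i = Submodule.span R (𝒢 i)) {F G : V →ₗ[R] X}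
    (H : ∀ i, ∀ v ∈ 𝒢 i, F v = G v) : F = G := by
  refine hom_ext h fun i v hv => ?_
  rw [hs] at hv
  exact eqOn_span (fun v hv => H i v hv) hv

/-- Homogeneous pure tensors. -/
def pureT (𝒱 : ℤ → Submodule R V) (𝒲 : ℤ → Submodule R W) (t : ℤ) : Set (V ⊗[R] W) :=
  {x | ∃ (i j : ℤ) (v : V) (w : W), v ∈ 𝒱 i ∧ w ∈ 𝒲 j ∧ i + j = t ∧ x = v ⊗ₜ w}

/-- The grading of the tensor product. -/
def tgr (𝒱 : ℤ → Submodule R V) (𝒲 : ℤ → Submodule R W) (t : ℤ) : Submodule R (V ⊗[R] W) :=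
  Submodule.span R (pureT 𝒱 𝒲 t)

theorem tmul_mem {i j k : ℤ} {v : V} {w : W} (hv : v ∈ 𝒱 i) (hw : w ∈ 𝒲 j) (h : i + j = k) :
    v ⊗ₜ[R] w ∈ tgr 𝒱 𝒲 k :=
  subset_span ⟨i, j, v, w, hv, hw, h, rfl⟩

theorem tgr_isInternal (h : DirectSum.IsInternal 𝒱) (h' : DirectSum.IsInternal 𝒲) :
    DirectSum.IsInternal (tgr 𝒱 𝒲) := by
  refine isInternal_of_coaction ((Finsupp.lmapDomain (V ⊗[R] W) R fun x : ℤ × ℤ => x.1 + x.2) ∘ₗ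
    (finsuppTensorFinsupp R R V W ℤ ℤ).toLinearMap ∘ₗ
    TensorProduct.map (coaction h) (coaction h')) ?_ ?_
  · intro t x hx
    refine eqOn_span (g := Finsupp.lsingle t) ?_ hx
    rintro _ ⟨i, j, v, w, hv, hw, rfl, rfl⟩
    simp only [comp_apply, map_tmul, coaction_of_mem h hv, coaction_of_mem h' hw,
      LinearEquiv.coe_coe, finsuppTensorFinsupp_single, Finsupp.lmapDomain_apply,
      Finsupp.mapDomain_single, Finsupp.lsingle_apply]
  · intro x
    induction x using TensorProduct.induction_on with
    | zero => exact zero_mem _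
    | add x y hx hy => exact add_mem hx hy
    | tmul v w =>
      induction mem_span_iUnion h v, mem_span_iUnion h' w using Submodule.span_induction₂ with
      | mem_mem v w hv hw =>
        obtain ⟨i, hv⟩ := hv
        obtain ⟨j, hw⟩ := hw
        exact subset_span ⟨_, tmul_mem hv hw rfl⟩
      | zero_left y hy => simp
      | zero_right y hy => simp
      | add_left x y z _ _ _ hx hy => rw [add_tmul]; exact add_mem hx hy
      | add_right x y z _ _ _ hx hy => rw [tmul_add]; exact add_mem hx hy
      | smul_left r x y _ _ hx =>
        rw [← smul_tmul']; exact smul_mem _ r hx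
      | smul_right r x y _ _ hx => rw [tmul_smul]; exact smul_mem _ r hx

/-- A bilinear product with the axioms of a graded commutative algebra on spanning sets. -/
def GCAlgebra.ofGens {𝒢 : ℤ → Set V} (h : DirectSum.IsInternal 𝒱)
    (hs : ∀ i, 𝒱 i = Submodule.span R (𝒢 i)) (one : V) (mul : V →ₗ[R] V →ₗ[R] V)
    (one_mem : one ∈ 𝒱 0)
    (mul_mem : ∀ {i j a b}, a ∈ 𝒢 i → b ∈ 𝒢 j → mul a b ∈ 𝒱 (i + j))
    (one_mul : ∀ {i a}, a ∈ 𝒢 i → mul one a = a)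
    (assoc : ∀ {i j l a b c}, a ∈ 𝒢 i → b ∈ 𝒢 j → c ∈ 𝒢 l → mul (mul a b) c = mul a (mul b c))
    (comm : ∀ {i j a b}, a ∈ 𝒢 i → b ∈ 𝒢 j → mul a b = sgn (i * j) • mul b a) :
    GCAlgebra 𝒱 where
  one := one
  mul := mul
  isInternal := h
  one_mem := one_mem
  mul_mem := by
    intro i j a b ha hb
    rw [hs] at ha hb
    induction ha, hb using Submodule.span_induction₂ with
    | mem_mem x y hx hy => exact mul_mem hx hy
    | zero_left y hy => simp
    | zero_right y hy => simp
    | add_left x y z _ _ _ hx hy => simpa using add_mem hx hy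
    | add_right x y z _ _ _ hx hy => simpa using add_mem hx hy
    | smul_left r x y _ _ h => simpa using smul_mem _ r h
    | smul_right r x y _ _ h => simpa using smul_mem _ r h
  one_mul := by
    have : mul one = LinearMap.id := hom_ext_gens h hs fun i a ha => one_mul ha
    exact fun a => LinearMap.congr_fun this a
  mul_assoc := by
    have : (llcomp R V V V ∘ₗ mul).flip ∘ₗ mul
        = (llcomp R V V (V →ₗ[R] V) mul ∘ₗ mul).flip.flip.flip := by
      refine hom_ext_gens h hs fun j b hb => hom_ext_gens h hs fun i a ha =>
        hom_ext_gens h hs fun l c hc => ?_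
      exact (assoc ha hb hc).symm
    exact fun a b c => (LinearMap.congr_fun (LinearMap.congr_fun
      (LinearMap.congr_fun this b) a) c).symm
  mul_comm := by
    intro i j a b ha hb
    rw [hs] at ha hb
    induction ha, hb using Submodule.span_induction₂ with
    | mem_mem x y hx hy => exact comm hx hy
    | zero_left y hy => simp
    | zero_right y hy => simp
    | add_left x y z _ _ _ hx hy => simp [hx, hy, smul_add]
    | add_right x y z _ _ _ hx hy => simp [hx, hy, smul_add]
    | smul_left r x y _ _ h => simp only [map_smul, lin_smul, h, smul_comm r]
    | smul_right r x y _ _ h => simp only [map_smul, lin_smul, h, smul_comm r]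

theorem signMap_zero (h : DirectSum.IsInternal 𝒱) : signMap h 0 = LinearMap.id := by
  refine hom_ext h fun i v hv => ?_
  rw [signMap_apply h 0 hv, zero_mul, sgn_zero, one_smul]; rfl

end Internal

section TensorAlgebra

variable {X : Type*} (G) (H : GCAlgebra 𝒲)

/-- The product `(v ⊗ w)(v' ⊗ w') = (-1)^{|w||v'|} v v' ⊗ w w'`. -/
def tensorMul : V ⊗[R] W →ₗ[R] V ⊗[R] W →ₗ[R] V ⊗[R] W :=
  TensorProduct.lift (hrec (X := V →ₗ[R] V ⊗[R] W →ₗ[R] V ⊗[R] W) H.isInternal fun j =>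
    (lcomp R _ ((lcomp R V (signMap G.isInternal j)) ∘ₗ G.mul)) ∘ₗ
      (TensorProduct.mapBilinear (RingHom.id R) V W V W).flip ∘ₗ H.mul ∘ₗ (𝒲 j).subtype).flip

theorem tensorMul_left {j : ℤ} {w : W} (hw : w ∈ 𝒲 j) (v v' : V) (w' : W) :
    tensorMul G H (v ⊗ₜ w) (v' ⊗ₜ w') = G.mul v (signMap G.isInternal j v') ⊗ₜ H.mul w w' := by
  rw [tensorMul, TensorProduct.lift.tmul, flip_apply, hrec_of_mem _ _ hw]
  rfl

theorem tensorMul_apply {i j : ℤ} {v' : V} {w : W} (hw : w ∈ 𝒲 j) (hv : v' ∈ 𝒱 i) (v : V)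
    (w' : W) : tensorMul G H (v ⊗ₜ w) (v' ⊗ₜ w') = sgn (j * i) • (G.mul v v' ⊗ₜ H.mul w w') := by
  rw [tensorMul_left G H hw, signMap_apply _ _ hv, map_sgn_smul, Units.smul_def, ← smul_tmul',
    ← Units.smul_def]

/-- The tensor product of two graded commutative algebras. -/
def tensorGC : GCAlgebra (tgr 𝒱 𝒲) :=
  GCAlgebra.ofGens (tgr_isInternal G.isInternal H.isInternal) (fun _ => rfl) (G.one ⊗ₜ H.one)
    (tensorMul G H) (tmul_mem G.one_mem H.one_mem (add_zero 0))
    (by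
      rintro _ _ _ _ ⟨i, j, v, w, hv, hw, rfl, rfl⟩ ⟨i', j', v', w', hv', hw', rfl, rfl⟩
      rw [tensorMul_apply G H hw hv']
      exact sgn_smul_mem _ _ (tmul_mem (G.mul_mem hv hv') (H.mul_mem hw hw') (by ring)))
    (by
      rintro _ _ ⟨i, j, v, w, hv, hw, rfl, rfl⟩
      rw [tensorMul_left G H H.one_mem, signMap_zero, G.one_mul, H.one_mul]; rfl)
    (by
      rintro _ _ _ _ _ _ ⟨i, j, v, w, hv, hw, rfl, rfl⟩ ⟨i', j', v', w', hv', hw', rfl, rfl⟩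
        ⟨i'', j'', v'', w'', hv'', hw'', rfl, rfl⟩
      rw [tensorMul_apply G H hw hv', tensorMul_apply G H hw' hv'']
      simp only [map_sgn_smul, sgn_smul_apply]
      rw [tensorMul_apply G H (H.mul_mem hw hw') hv'', tensorMul_apply G H hw (G.mul_mem hv' hv''),
        G.mul_assoc, H.mul_assoc]
      simp only [smul_smul, mul_comm, mul_assoc, sgn_expand])
    (by
      rintro _ _ _ _ ⟨i, j, v, w, hv, hw, rfl, rfl⟩ ⟨i', j', v', w', hv', hw', rfl, rfl⟩
      rw [tensorMul_apply G H hw hv', tensorMul_apply G H hw' hv, G.mul_comm hv hv',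
        H.mul_comm hw hw']
      simp only [Units.smul_def, tmul_smul, ← smul_tmul']
      simp only [← Units.smul_def, smul_smul, mul_comm, mul_left_comm, mul_assoc, sgn_expand,
        sgn_cancel])

theorem tensorGC_mul_apply {i j : ℤ} {v' : V} {w : W} (hw : w ∈ 𝒲 j) (hv : v' ∈ 𝒱 i) (v : V)
    (w' : W) :
    (tensorGC G H).mul (v ⊗ₜ w) (v' ⊗ₜ w') = sgn (j * i) • (G.mul v v' ⊗ₜ H.mul w w') :=
  tensorMul_apply G H hw hv v w'

theorem tensorGC_one : (tensorGC G H).one = G.one ⊗ₜ H.one := rfl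

end TensorAlgebra

theorem IsHDiffOp.cur_one {p : ℤ} {P : Ops R V} (h : IsHDiffOp ħ G p P) :
    BD.cur P G.one = 0 := by
  refine funext fun k => multilinear_hom_ext G.isInternal fun e b hb => ?_
  rw [← evl_ofFn]
  change _ = 0
  clear hb e
  generalize hl : List.ofFn b = l
  clear hl b
  have key : ∀ {p : ℤ} {P : Ops R V}, IsHDiffOp ħ G p P → ∀ l : List V,
      evl (BD.cur P G.one) l = 0 := by
    intro p P hP l
    induction l generalizing p P with
    | nil => exact hP.one
    | cons x l ih =>
      rw [evl_cons]
      have : evlₗ l ∘ₗ BD.cur (BD.cur P G.one) = 0 := by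
        refine hom_ext G.isInternal fun i v hv => ?_
        rw [comp_apply, hP.cur_cur G.one_mem hv, map_sgn_smul, evlₗ_apply, ih (hP.cur hv),
          smul_zero, lin_zero]
      exact LinearMap.congr_fun this x
  exact key h l

/-- An embedding of graded commutative algebras together with a compatible extension of
`ħ`-differential operators. -/
structure OpEmb (ħ : R) {B : Type*} [AddCommGroup B] [Module R B] {ℬ : ℤ → Submodule R B}
    (G : GCAlgebra 𝒱) (H : GCAlgebra ℬ) where
  j : V →ₗ[R] B
  ι : Ops R V →ₗ[R] Ops R B
  j_mem : ∀ {i v}, v ∈ 𝒱 i → j v ∈ ℬ i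
  j_one : j G.one = H.one
  j_mul : ∀ u v, j (G.mul u v) = H.mul (j u) (j v)
  ι_nil : ∀ P, evl (ι P) [] = j (evl P [])
  ι_cur : ∀ P v, cur (ι P) (j v) = ι (cur P v)
  ι_hd : ∀ {p P}, IsHDiffOp ħ G p P → IsHDiffOp ħ H p (ι P)

namespace OpEmb

variable {B C : Type*} [AddCommGroup B] [Module R B] [AddCommGroup C] [Module R C]
  {ℬ : ℤ → Submodule R B} {𝒞 : ℤ → Submodule R C} {H : GCAlgebra ℬ} {K : GCAlgebra 𝒞}

/-- Operations from the subalgebra vanish if one of the arguments is `u`. -/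
def Kills (E : OpEmb ħ G H) (u : B) : Prop :=
  ∀ {p P}, IsHDiffOp ħ G p P → cur (E.ι P) u = 0

def comp (F : OpEmb ħ H K) (E : OpEmb ħ G H) : OpEmb ħ G K where
  j := F.j ∘ₗ E.j
  ι := F.ι ∘ₗ E.ι
  j_mem h := F.j_mem (E.j_mem h)
  j_one := by rw [comp_apply, E.j_one, F.j_one]
  j_mul u v := by simp only [comp_apply, E.j_mul, F.j_mul]
  ι_nil P := by simp only [comp_apply, F.ι_nil, E.ι_nil]
  ι_cur P v := by simp only [comp_apply, F.ι_cur, E.ι_cur]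
  ι_hd h := F.ι_hd (E.ι_hd h)

theorem Kills.comp_left {E : OpEmb ħ G H} {F : OpEmb ħ H K} {u : C} (h : F.Kills u) :
    (F.comp E).Kills u := fun hP => h (E.ι_hd hP)

theorem Kills.comp_right {E : OpEmb ħ G H} {F : OpEmb ħ H K} {u : B} (h : E.Kills u) :
    (F.comp E).Kills (F.j u) := by
  intro p P hP
  change cur (F.ι (E.ι P)) (F.j u) = 0
  rw [F.ι_cur, h hP, map_zero]

theorem evl_ι (E : OpEmb ħ G H) (P : Ops R V) (l : List V) :
    evl (E.ι P) (l.map E.j) = E.j (evl P l) := by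
  induction l generalizing P with
  | nil => exact E.ι_nil P
  | cons x l ih => rw [List.map_cons, evl_cons, E.ι_cur, ih, evl_cons]

theorem brL_ι (E : OpEmb ħ G H) (p q : ℤ) (P Q : Ops R V) (l : List (ℤ × V)) :
    brL p q (E.ι P) (E.ι Q) (l.map fun x => (x.1, E.j x.2)) = E.j (brL p q P Q l) := by
  induction l generalizing p q P Q with
  | nil =>
    simp only [List.map_nil, brL, evl_cons, E.ι_nil, E.ι_cur, map_sub, map_sgn_smul]
  | cons x l ih =>
    simp only [List.map_cons, brL, E.ι_cur, ih, map_add, map_sgn_smul]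

end OpEmb

section Tensor

variable (G) (H : GCAlgebra 𝒲)

/-- The action of `V ⊗ W` on `O ⊗ W` given by an operation of `V` on `O`. -/
def actFst {O : Type*} [AddCommGroup O] [Module R O] (c : O →ₗ[R] V →ₗ[R] O) :
    V ⊗[R] W →ₗ[R] O ⊗[R] W →ₗ[R] O ⊗[R] W :=
  TensorProduct.lift (hrec (X := W →ₗ[R] O ⊗[R] W →ₗ[R] O ⊗[R] W) G.isInternal fun i =>
      (lcomp R _ ((lcomp R W (signMap H.isInternal i)) ∘ₗ H.mul.flip)) ∘ₗ
      (TensorProduct.mapBilinear (RingHom.id R) O W O W) ∘ₗ c.flip ∘ₗ (𝒱 i).subtype)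

theorem actFst_apply {O : Type*} [AddCommGroup O] [Module R O] (c : O →ₗ[R] V →ₗ[R] O) {i j : ℤ}
    {v : V} {x : W} (hv : v ∈ 𝒱 i) (hx : x ∈ 𝒲 j) (w : W)
    (Q : O) : actFst G H c (v ⊗ₜ w) (Q ⊗ₜ x) = sgn (i * j) • (c Q v ⊗ₜ H.mul x w) := by
  rw [actFst, TensorProduct.lift.tmul, hrec_of_mem _ _ hv]
  change c Q v ⊗ₜ H.mul (signMap H.isInternal i x) w = _
  rw [signMap_apply _ _ hx, map_sgn_smul, sgn_smul_apply]
  simp only [Units.smul_def, tmul_smul]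

/-- The operation `v₁ ⊗ w₁, … ↦ ± P(v₁, …) ⊗ x w₁ ⋯`. -/
def opFst : Ops R V →ₗ[R] W →ₗ[R] Ops R (V ⊗[R] W) :=
  TensorProduct.curry (run (actFst G H cur) (TensorProduct.map (evlₗ []) LinearMap.id))

variable {G H}

theorem opFst_nil (P : Ops R V) (x : W) : evl (opFst G H P x) [] = evl P [] ⊗ₜ x := rfl

theorem cur_opFst {i j : ℤ} {v : V} {x : W} (hv : v ∈ 𝒱 i) (hx : x ∈ 𝒲 j) (w : W)
    (P : Ops R V) :
    cur (opFst G H P x) (v ⊗ₜ w) = sgn (i * j) • opFst G H (cur P v) (H.mul x w) := by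
  rw [opFst, TensorProduct.curry_apply, cur_run, actFst_apply G H cur hv hx, map_sgn_smul]; rfl

theorem opFst_hd {p j : ℤ} {P : Ops R V} (hP : IsHDiffOp ħ G p P) {x : W} (hx : x ∈ 𝒲 j) :
    IsHDiffOp ħ (tensorGC G H) (p + j) (opFst G H P x) := by
  refine IsHDiffOp.intro (fun _ => rfl) (𝒪 := fun t => {Q | ∃ (p j : ℤ) (P : Ops R V) (x : W),
    IsHDiffOp ħ G p P ∧ x ∈ 𝒲 j ∧ p + j = t ∧ Q = opFst G H P x}) ?_ ?_ ?_ ?_ ?_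
    (subset_span ⟨p, j, P, x, hP, hx, rfl, rfl⟩)
  · rintro _ _ ⟨p, j, P, x, hP, hx, rfl, rfl⟩
    exact tmul_mem hP.nil_mem hx rfl
  · rintro _ _ _ _ ⟨p, j, P, x, hP, hx, rfl, rfl⟩ ⟨i, l, v, w, hv, hw, rfl, rfl⟩
    rw [cur_opFst hv hx]
    exact sgn_smul_mem _ _ (subset_span
      ⟨_, _, _, _, hP.cur hv, H.mul_mem hx hw, by ring, rfl⟩)
  · rintro _ _ _ _ _ _ ⟨p, j, P, x, hP, hx, rfl, rfl⟩ ⟨i, l, v, w, hv, hw, rfl, rfl⟩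
      ⟨i', l', v', w', hv', hw', rfl, rfl⟩
    rw [cur_opFst hv hx, cur_opFst hv' hx]
    simp only [map_sgn_smul, sgn_smul_apply]
    rw [cur_opFst hv' (H.mul_mem hx hw), cur_opFst hv (H.mul_mem hx hw'), hP.cur_cur hv hv',
      H.mul_assoc, H.mul_assoc, H.mul_comm hw hw']
    simp only [map_sgn_smul, sgn_smul_apply, smul_smul, mul_comm, mul_left_comm, mul_assoc,
      sgn_expand, sgn_cancel]
  · rintro _ _ _ _ _ _ ⟨p, j, P, x, hP, hx, rfl, rfl⟩ ⟨i, l, v, w, hv, hw, rfl, rfl⟩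
      ⟨i', l', v', w', hv', hw', rfl, rfl⟩
    rw [tensorGC_mul_apply G H hw hv']
    simp only [evl_cons, map_sgn_smul, evl_sgn]
    rw [cur_opFst hv hx, cur_opFst hv' hx, cur_opFst (G.mul_mem hv hv') hx]
    simp only [map_sgn_smul, sgn_smul_apply, evl_sgn]
    rw [cur_opFst hv' (H.mul_mem hx hw)]
    have e := hP.leib hv hv'
    simp only [evl_cons] at e
    simp only [evl_sgn, opFst_nil]
    rw [e, tensorGC_mul_apply G H (H.mul_mem hx hw) hv',
      tensorGC_mul_apply G H (H.mul_mem hx hw') hv, H.mul_assoc, H.mul_assoc, H.mul_comm hw' hw]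
    simp only [map_sgn_smul]
    simp only [add_tmul, Units.smul_def, tmul_smul, ← smul_tmul']
    simp only [← Units.smul_def, smul_add, smul_comm ħ, smul_smul, mul_comm, mul_left_comm,
      mul_assoc, sgn_expand, sgn_cancel]
  · rintro _ _ ⟨p, j, P, x, hP, hx, rfl, rfl⟩
    rw [tensorGC_one, evl_cons, cur_opFst G.one_mem hx, hP.cur_one]
    simp

/-- `V` as a subalgebra of `V ⊗ W`. -/
def embFst : OpEmb ħ G (tensorGC G H) where
  j := (TensorProduct.mk R V W).flip H.one
  ι := (opFst G H).flip H.one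
  j_mem h := tmul_mem h H.one_mem (add_zero _)
  j_one := rfl
  j_mul := by
    intro u v
    change _ = (tensorGC G H).mul (u ⊗ₜ H.one) (v ⊗ₜ H.one)
    change _ = tensorMul G H (u ⊗ₜ H.one) (v ⊗ₜ H.one)
    rw [tensorMul_left G H H.one_mem, signMap_zero, H.one_mul]; rfl
  ι_nil P := rfl
  ι_cur P v := by
    have : cur (opFst G H P H.one) ∘ₗ (TensorProduct.mk R V W).flip H.one
        = ((opFst G H).flip H.one) ∘ₗ cur P := by
      refine hom_ext G.isInternal fun i v hv => ?_
      change cur _ (v ⊗ₜ H.one) = opFst G H (cur P v) H.one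
      rw [cur_opFst hv H.one_mem, mul_zero, sgn_zero, one_smul, H.one_mul]
    exact LinearMap.congr_fun this v
  ι_hd h := by simpa using opFst_hd h H.one_mem

theorem embFst_kills (w : W) : (embFst (ħ := ħ) (G := G) (H := H)).Kills (G.one ⊗ₜ w) := by
  intro p P hP
  change cur (opFst G H P H.one) _ = 0
  rw [cur_opFst G.one_mem H.one_mem, hP.cur_one, map_zero, lin_zero, smul_zero]

variable (G H)

/-- The action of `V ⊗ W` on `O ⊗ V` given by an operation of `W` on `O`. -/
def actSnd {O : Type*} [AddCommGroup O] [Module R O] (c : O →ₗ[R] W →ₗ[R] O) :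
    V ⊗[R] W →ₗ[R] O ⊗[R] V →ₗ[R] O ⊗[R] V :=
  TensorProduct.lift (hrec (X := V →ₗ[R] O ⊗[R] V →ₗ[R] O ⊗[R] V) H.isInternal fun j =>
      (lcomp R _ ((compRight R (signMap G.isInternal j)) ∘ₗ G.mul.flip)) ∘ₗ
      (TensorProduct.mapBilinear (RingHom.id R) O V O V) ∘ₗ c.flip ∘ₗ (𝒲 j).subtype).flip

theorem actSnd_apply {O : Type*} [AddCommGroup O] [Module R O] (c : O →ₗ[R] W →ₗ[R] O) {i j l : ℤ}
    {v x : V} {w : W} (hv : v ∈ 𝒱 i) (hx : x ∈ 𝒱 l) (hw : w ∈ 𝒲 j)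
    (Q : O) :
    actSnd G H c (v ⊗ₜ w) (Q ⊗ₜ x) = sgn (j * (l + i)) • (c Q w ⊗ₜ G.mul x v) := by
  rw [actSnd, TensorProduct.lift.tmul, flip_apply, hrec_of_mem _ _ hw]
  change c Q w ⊗ₜ signMap G.isInternal j (G.mul x v) = _
  rw [signMap_apply _ _ (G.mul_mem hx hv)]
  simp only [Units.smul_def, tmul_smul]

/-- The operation `v₁ ⊗ w₁, … ↦ ± x v₁ ⋯ ⊗ P(w₁, …)`. -/
def opSnd : Ops R W →ₗ[R] V →ₗ[R] Ops R (V ⊗[R] W) :=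
  TensorProduct.curry (run (actSnd G H cur) (TensorProduct.lift
    ((tw G.isInternal H.isInternal (TensorProduct.mk R V W)).flip ∘ₗ evlₗ [])))

variable {G H}

theorem opSnd_nil {p j : ℤ} {P : Ops R W} {x : V} (hP : IsHDiffOp ħ H p P) (hx : x ∈ 𝒱 j) :
    evl (opSnd G H P x) [] = sgn (j * p) • (x ⊗ₜ evl P []) :=
  tw_apply G.isInternal H.isInternal (TensorProduct.mk R V W) hx hP.nil_mem

theorem cur_opSnd {i j l : ℤ} {v x : V} {w : W} (hv : v ∈ 𝒱 i) (hx : x ∈ 𝒱 l) (hw : w ∈ 𝒲 j)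
    (P : Ops R W) :
    cur (opSnd G H P x) (v ⊗ₜ w) = sgn (j * (l + i)) • opSnd G H (cur P w) (G.mul x v) := by
  rw [opSnd, TensorProduct.curry_apply, cur_run, actSnd_apply G H cur hv hx hw, map_sgn_smul]; rfl

set_option maxHeartbeats 1000000 in
theorem opSnd_hd {p j : ℤ} {P : Ops R W} (hP : IsHDiffOp ħ H p P) {x : V} (hx : x ∈ 𝒱 j) :
    IsHDiffOp ħ (tensorGC G H) (p + j) (opSnd G H P x) := by
  refine IsHDiffOp.intro (fun _ => rfl) (𝒪 := fun t => {Q | ∃ (p j : ℤ) (P : Ops R W) (x : V),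
    IsHDiffOp ħ H p P ∧ x ∈ 𝒱 j ∧ p + j = t ∧ Q = opSnd G H P x}) ?_ ?_ ?_ ?_ ?_
    (subset_span ⟨p, j, P, x, hP, hx, rfl, rfl⟩)
  · rintro _ _ ⟨p, j, P, x, hP, hx, rfl, rfl⟩
    rw [opSnd_nil hP hx]
    exact sgn_smul_mem _ _ (tmul_mem hx hP.nil_mem (add_comm _ _))
  · rintro _ _ _ _ ⟨p, j, P, x, hP, hx, rfl, rfl⟩ ⟨i, l, v, w, hv, hw, rfl, rfl⟩
    rw [cur_opSnd hv hx hw]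
    exact sgn_smul_mem _ _ (subset_span
      ⟨_, _, _, _, hP.cur hw, G.mul_mem hx hv, by ring, rfl⟩)
  · rintro _ _ _ _ _ _ ⟨p, j, P, x, hP, hx, rfl, rfl⟩ ⟨i, l, v, w, hv, hw, rfl, rfl⟩
      ⟨i', l', v', w', hv', hw', rfl, rfl⟩
    rw [cur_opSnd hv hx hw, cur_opSnd hv' hx hw']
    simp only [map_sgn_smul, sgn_smul_apply]
    rw [cur_opSnd hv' (G.mul_mem hx hv) hw', cur_opSnd hv (G.mul_mem hx hv') hw, hP.cur_cur hw hw',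
      G.mul_assoc, G.mul_assoc, G.mul_comm hv hv']
    simp only [map_sgn_smul, sgn_smul_apply, smul_smul, mul_comm, mul_left_comm, mul_assoc,
      sgn_expand, sgn_cancel]
  · rintro _ _ _ _ _ _ ⟨p, j, P, x, hP, hx, rfl, rfl⟩ ⟨i, l, v, w, hv, hw, rfl, rfl⟩
      ⟨i', l', v', w', hv', hw', rfl, rfl⟩
    rw [tensorGC_mul_apply G H hw hv']
    simp only [evl_cons, map_sgn_smul, evl_sgn]
    rw [cur_opSnd hv hx hw, cur_opSnd hv' hx hw',
      cur_opSnd (G.mul_mem hv hv') hx (H.mul_mem hw hw')]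
    simp only [map_sgn_smul, sgn_smul_apply, evl_sgn]
    rw [cur_opSnd hv' (G.mul_mem hx hv) hw']
    have e := hP.leib hw hw'
    simp only [evl_cons] at e
    simp only [evl_sgn]
    rw [opSnd_nil (hP.cur (H.mul_mem hw hw')) (G.mul_mem hx (G.mul_mem hv hv')),
      opSnd_nil (hP.cur hw) (G.mul_mem hx hv), opSnd_nil (hP.cur hw') (G.mul_mem hx hv'),
      opSnd_nil ((hP.cur hw).cur hw') (G.mul_mem (G.mul_mem hx hv) hv')]
    simp only [map_sgn_smul, sgn_smul_apply]
    rw [e, tensorGC_mul_apply G H (hP.cur hw).nil_mem hv',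
      tensorGC_mul_apply G H (hP.cur hw').nil_mem hv, G.mul_assoc, G.mul_assoc, G.mul_comm hv' hv]
    simp only [map_sgn_smul]
    simp only [tmul_add, Units.smul_def, tmul_smul, ← smul_tmul']
    simp only [← Units.smul_def, smul_add, smul_comm ħ, smul_smul, mul_comm, mul_left_comm,
      mul_assoc, sgn_expand, sgn_cancel]
  · rintro _ _ ⟨p, j, P, x, hP, hx, rfl, rfl⟩
    rw [tensorGC_one, evl_cons, cur_opSnd G.one_mem hx H.one_mem, hP.cur_one]
    simp

theorem GCAlgebra.mul_one (a : V) : G.mul a G.one = a := by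
  have : G.mul.flip G.one = LinearMap.id := by
    refine hom_ext G.isInternal fun i a ha => ?_
    rw [flip_apply, G.mul_comm ha G.one_mem, G.one_mul, mul_zero, sgn_zero, one_smul]; rfl
  exact LinearMap.congr_fun this a

/-- `W` as a subalgebra of `V ⊗ W`. -/
def embSnd : OpEmb ħ H (tensorGC G H) where
  j := TensorProduct.mk R V W G.one
  ι := (opSnd G H).flip G.one
  j_mem h := tmul_mem G.one_mem h (zero_add _)
  j_one := rfl
  j_mul := by
    intro u v
    have : TensorProduct.mk R V W G.one ∘ₗ H.mul.flip v
        = ((tensorGC G H).mul.flip (G.one ⊗ₜ v)) ∘ₗ TensorProduct.mk R V W G.one := by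
      refine hom_ext H.isInternal fun i u hu => ?_
      change _ = (tensorGC G H).mul (G.one ⊗ₜ u) (G.one ⊗ₜ v)
      rw [tensorGC_mul_apply G H hu G.one_mem, G.one_mul, mul_zero, sgn_zero, one_smul]; rfl
    exact LinearMap.congr_fun this u
  ι_nil P := by
    change tw G.isInternal H.isInternal (TensorProduct.mk R V W) G.one (evl P []) = _
    rw [tw_left _ _ _ G.one_mem, signMap_zero]; rfl
  ι_cur P w := by
    have : cur (opSnd G H P G.one) ∘ₗ (TensorProduct.mk R V W) G.one
        = ((opSnd G H).flip G.one) ∘ₗ cur P := by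
      refine hom_ext H.isInternal fun i v hv => ?_
      change cur _ (G.one ⊗ₜ v) = opSnd G H (cur P v) G.one
      rw [cur_opSnd G.one_mem G.one_mem hv, add_zero, mul_zero, sgn_zero, one_smul, G.one_mul]
    exact LinearMap.congr_fun this w
  ι_hd h := by simpa using opSnd_hd h G.one_mem

theorem embSnd_kills (v : V) : (embSnd (ħ := ħ) (G := G) (H := H)).Kills (v ⊗ₜ H.one) := by
  intro p P hP
  change cur (opSnd G H P G.one) _ = 0
  have : cur (opSnd G H P G.one) ∘ₗ (TensorProduct.mk R V W).flip H.one = 0 := by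
    refine hom_ext G.isInternal fun i v hv => ?_
    change cur (opSnd G H P G.one) (v ⊗ₜ H.one) = 0
    rw [cur_opSnd hv G.one_mem H.one_mem, hP.cur_one, map_zero, lin_zero, smul_zero]
  exact LinearMap.congr_fun this v

end Tensor

section Star

/-- The action of `V` on `O ⊗ V` given by an operation of `V` on `O`. -/
def actTwist (h : DirectSum.IsInternal 𝒱) {O : Type*} [AddCommGroup O] [Module R O]
    (c : O →ₗ[R] V →ₗ[R] O) : V →ₗ[R] O ⊗[R] V →ₗ[R] O ⊗[R] V :=
  hrec (X := O ⊗[R] V →ₗ[R] O ⊗[R] V) h fun i =>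
    (TensorProduct.mapBilinear (RingHom.id R) O V O V).flip (signMap h i) ∘ₗ c.flip ∘ₗ
      (𝒱 i).subtype

theorem actTwist_apply (h : DirectSum.IsInternal 𝒱) {O : Type*} [AddCommGroup O] [Module R O]
    (c : O →ₗ[R] V →ₗ[R] O) {i j : ℤ} {b x : V} (hb : b ∈ 𝒱 i) (hx : x ∈ 𝒱 j) (Q : O) :
    actTwist h c b (Q ⊗ₜ x) = sgn (i * j) • (c Q b ⊗ₜ x) := by
  rw [actTwist, hrec_of_mem _ _ hb]
  change c Q b ⊗ₜ signMap h i x = _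
  rw [signMap_apply _ _ hx]
  simp only [Units.smul_def, tmul_smul]

variable (ħ) (G)

/-- The product of `P ∈ D̂_ħ(V)` with the element `x ∈ V`. -/
def star : Ops R V →ₗ[R] V →ₗ[R] Ops R V :=
  TensorProduct.curry (run (actTwist G.isInternal cur) (TensorProduct.lift
    (G.mul ∘ₗ evlₗ [] + ħ • (compRight R (evlₗ []) ∘ₗ cur))))

theorem star_nil (P : Ops R V) (x : V) :
    evl (star ħ G P x) [] = G.mul (evl P []) x + ħ • evl P [x] := rfl

theorem cur_star {i j : ℤ} {b x : V} (hb : b ∈ 𝒱 i) (hx : x ∈ 𝒱 j) (P : Ops R V) :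
    cur (star ħ G P x) b = sgn (i * j) • star ħ G (cur P b) x := by
  rw [star, TensorProduct.curry_apply, cur_run, actTwist_apply _ _ hb hx, map_sgn_smul]; rfl

variable {ħ G}

theorem IsHDiffOp.star {p j : ℤ} {P : Ops R V} (hP : IsHDiffOp ħ G p P) {x : V} (hx : x ∈ 𝒱 j) :
    IsHDiffOp ħ G (p + j) (star ħ G P x) := by
  refine IsHDiffOp.intro (𝒢 := fun i => 𝒱 i) (fun i => (Submodule.span_eq _).symm)
    (𝒪 := fun t => {Q | ∃ (p j : ℤ) (P : Ops R V) (x : V),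
    IsHDiffOp ħ G p P ∧ x ∈ 𝒱 j ∧ p + j = t ∧ Q = BD.star ħ G P x}) ?_ ?_ ?_ ?_ ?_
    (subset_span ⟨p, j, P, x, hP, hx, rfl, rfl⟩)
  · rintro _ _ ⟨p, j, P, x, hP, hx, rfl, rfl⟩
    exact add_mem (G.mul_mem hP.nil_mem hx) (smul_mem _ _ (hP.evl_one_mem hx))
  · rintro _ _ i b ⟨p, j, P, x, hP, hx, rfl, rfl⟩ hb
    rw [cur_star ħ G hb hx]
    exact sgn_smul_mem _ _ (subset_span
      ⟨_, _, _, _, hP.cur hb, hx, by ring, rfl⟩)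
  · rintro _ _ i i' b b' ⟨p, j, P, x, hP, hx, rfl, rfl⟩ hb hb'
    rw [cur_star ħ G hb hx, cur_star ħ G hb' hx]
    simp only [map_sgn_smul, sgn_smul_apply]
    rw [cur_star ħ G hb' hx, cur_star ħ G hb hx, hP.cur_cur hb hb']
    simp only [map_sgn_smul, sgn_smul_apply, smul_smul, mul_comm, mul_left_comm]
  · rintro _ _ i i' b b' ⟨p, j, P, x, hP, hx, rfl, rfl⟩ hb hb'
    simp only [evl_cons]
    rw [cur_star ħ G hb hx, cur_star ħ G hb' hx, cur_star ħ G (G.mul_mem hb hb') hx]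
    simp only [map_sgn_smul, sgn_smul_apply, evl_sgn]
    rw [cur_star ħ G hb' hx]
    have e := hP.leib hb hb'
    have e' := hP.leib_cur hb hb' hx
    simp only [evl_cons] at e e'
    simp only [evl_sgn, star_nil, evl_cons]
    rw [e, e']
    simp only [map_add, map_smul, map_sgn_smul, lin_add, lin_smul]
    rw [G.mul_assoc _ b' x, G.mul_comm hb' hx, G.mul_assoc _ b x, G.mul_comm hb hx]
    simp only [map_sgn_smul]
    rw [← G.mul_assoc, ← G.mul_assoc]
    simp only [smul_add, smul_comm ħ, smul_smul, mul_comm, mul_left_comm, mul_assoc, sgn_expand,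
      sgn_cancel]
    abel
  · rintro _ _ ⟨p, j, P, x, hP, hx, rfl, rfl⟩
    rw [evl_cons, cur_star ħ G G.one_mem hx, hP.cur_one]
    simp

theorem star_mul_nil {p i j : ℤ} {P : Ops R V} (hP : IsHDiffOp ħ G p P) {x y : V} (hx : x ∈ 𝒱 i)
    (hy : y ∈ 𝒱 j) : evl (BD.star ħ G P (G.mul x y)) []
      = G.mul (evl (BD.star ħ G P x) []) y + ħ • evl (BD.star ħ G P x) [y] := by
  rw [evl_cons, cur_star ħ G hy hx, evl_sgn, star_nil, star_nil, star_nil, hP.leib hx hy,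
    ← G.mul_assoc]
  simp only [evl_cons]
  rw [hP.cur_cur hy hx, evl_sgn]
  simp only [map_add, map_smul, lin_add, lin_smul, smul_add, smul_comm ħ, smul_smul, mul_comm j i,
    one_smul, sgn_cancel]
  abel

end Star

section Phi

/-- A derivation `∂ : V → L ⊗ V`. -/
structure IsDeriv (ℒ : ℤ → Submodule R L) (G : GCAlgebra 𝒱) (D : V →ₗ[R] L ⊗[R] V) : Prop where
  mem : ∀ {i x}, x ∈ 𝒱 i → D x ∈ tgr ℒ 𝒱 i
  leib : ∀ {i j x y}, x ∈ 𝒱 i → y ∈ 𝒱 j → D (G.mul x y)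
    = (G.mul.flip y).lTensor L (D x) + sgn (i * j) • (G.mul.flip x).lTensor L (D y)

theorem IsDeriv.one {G : GCAlgebra 𝒱} {D : V →ₗ[R] L ⊗[R] V} (h : IsDeriv ℒ G D) :
    D G.one = 0 := by
  have e : G.mul.flip G.one = LinearMap.id := LinearMap.ext fun x => GCAlgebra.mul_one x
  have := h.leib G.one_mem G.one_mem
  rw [G.one_mul, e, LinearMap.lTensor_id, LinearMap.id_apply, mul_zero, sgn_zero, one_smul] at this
  exact left_eq_add.1 this

/-- The operation `φ ↦ φ^b`, `φ^b(a) = (-1)^{|a||b|} φ(a)(b, …)`. -/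
def curFam (hL : DirectSum.IsInternal ℒ) (h : DirectSum.IsInternal 𝒱) {O : Type*} [AddCommGroup O]
    [Module R O] (c : O →ₗ[R] V →ₗ[R] O) : V →ₗ[R] (L →ₗ[R] O) →ₗ[R] (L →ₗ[R] O) :=
  hrec (X := (L →ₗ[R] O) →ₗ[R] (L →ₗ[R] O)) h fun i =>
    (llcomp R (L →ₗ[R] O) (L →ₗ[R] O) (L →ₗ[R] O)).flip
      (lcomp R O (signMap hL i)) ∘ₗ (llcomp R L O O) ∘ₗ c.flip ∘ₗ
        (𝒱 i).subtype

theorem curFam_apply (hL : DirectSum.IsInternal ℒ) (h : DirectSum.IsInternal 𝒱) {O : Type*}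
    [AddCommGroup O] [Module R O] (c : O →ₗ[R] V →ₗ[R] O) {i j : ℤ} {b : V} {a : L} (hb : b ∈ 𝒱 i)
    (ha : a ∈ ℒ j) (φ : L →ₗ[R] O) :
    curFam hL h c b φ a = sgn (i * j) • c (φ a) b := by
  rw [curFam, hrec_of_mem _ _ hb]
  change c (φ (signMap hL i a)) b = _
  rw [signMap_apply _ _ ha, map_sgn_smul, map_sgn_smul, sgn_smul_apply]

variable (hL : DirectSum.IsInternal ℒ) (ħ) (G : GCAlgebra 𝒱) (D : V →ₗ[R] L ⊗[R] V)

/-- The operation `∑ φ(a) ⋆ x` for `∑ a ⊗ x ∈ L ⊗ V`. -/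
def starSum : (L →ₗ[R] Ops R V) →ₗ[R] L ⊗[R] V →ₗ[R] Ops R V :=
  (TensorProduct.uncurry (RingHom.id R) L V (Ops R V)) ∘ₗ llcomp R L _ _ (star ħ G)

theorem starSum_tmul (φ : L →ₗ[R] Ops R V) (a : L) (x : V) :
    starSum ħ G φ (a ⊗ₜ x) = star ħ G (φ a) x := rfl

/-- The state machine for `phi`. -/
def phiAct : V →ₗ[R] ((L →ₗ[R] Ops R V) × Ops R V) →ₗ[R] ((L →ₗ[R] Ops R V) × Ops R V) :=
  (compRight R (LinearMap.inl R (L →ₗ[R] Ops R V) (Ops R V))).comp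
      ((lcomp R _ (LinearMap.fst R (L →ₗ[R] Ops R V) (Ops R V))).comp
        (curFam hL G.isInternal cur))
    + (compRight R (LinearMap.inr R (L →ₗ[R] Ops R V) (Ops R V))).comp
      ((lcomp R _ (LinearMap.snd R (L →ₗ[R] Ops R V) (Ops R V))).comp cur.flip
      + (lcomp R _ (LinearMap.fst R (L →ₗ[R] Ops R V) (Ops R V))).comp
        ((starSum ħ G).flip.comp D))

theorem phiAct_apply (b : V) (φ : L →ₗ[R] Ops R V) (Q : Ops R V) : phiAct ħ hL G D b (φ, Q)
    = (curFam hL G.isInternal cur b φ, cur Q b + starSum ħ G φ (D b)) := by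
  change (curFam hL G.isInternal cur b φ, (0 : Ops R V)) + ((0 : L →ₗ[R] Ops R V), _) = _
  rw [Prod.mk_add_mk, zero_add, add_zero]
  rfl

/-- The operation `Φ(φ) = ∑ φ(a) ∂_a` associated with a derivation `∂` and a family `φ`. -/
def phi : (L →ₗ[R] Ops R V) →ₗ[R] Ops R V :=
  run (phiAct ħ hL G D) (evlₗ [] ∘ₗ LinearMap.snd R _ _) ∘ₗ LinearMap.inl R _ _

theorem phi_nil (φ : L →ₗ[R] Ops R V) : evl (phi ħ hL G D φ) [] = 0 := rfl

theorem cur_phi (φ : L →ₗ[R] Ops R V) (b : V) : cur (phi ħ hL G D φ) b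
    = phi ħ hL G D (curFam hL G.isInternal cur b φ) + starSum ħ G φ (D b) := by
  have key : ∀ (β : List V) (Q : Ops R V), evl (run (phiAct ħ hL G D)
      (evlₗ [] ∘ₗ LinearMap.snd R _ _) (0, Q)) β = evl Q β := by
    intro β
    induction β with
    | nil => intro Q; rfl
    | cons x β ih =>
      intro Q
      rw [evl_cons, cur_run, phiAct_apply, map_zero, map_zero, lin_zero, add_zero, ih, evl_cons]
  have key' : ∀ Q, run (phiAct ħ hL G D) (evlₗ [] ∘ₗ LinearMap.snd R _ _) (0, Q) = Q :=
    fun Q => ops_ext fun β => key β Q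
  change cur (run _ _ (φ, 0)) b = run _ _ (_, 0) + _
  rw [cur_run, phiAct_apply, map_zero, lin_zero, zero_add, ← key' (starSum ħ G φ (D b)), ← map_add,
    Prod.mk_add_mk, add_zero, zero_add, key']
  rfl

/-- `φ` is a family of `ħ`-differential operators of degree `δ`. -/
def IsFam (ℒ : ℤ → Submodule R L) (ħ : R) (G : GCAlgebra 𝒱) (δ : ℤ) (φ : L →ₗ[R] Ops R V) : Prop :=
  ∀ {i a}, a ∈ ℒ i → IsHDiffOp ħ G (δ + i) (φ a)

variable {ħ hL G D}

theorem IsHDiffOp.smul {p : ℤ} {P : Ops R V} (r : R) (hP : IsHDiffOp ħ G p P) :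
    IsHDiffOp ħ G p (r • P) where
  mem hb := smul_mem _ _ (hP.mem hb)
  symm hb s t hst := by
    rw [Pi.smul_apply, smul_apply, hP.symm hb s t hst, smul_apply, smul_comm]
  leibniz b _ _ _ _ hx hy := by
    simp only [Pi.smul_apply, smul_apply, hP.leibniz b hx hy, smul_add, map_smul, lin_smul,
      smul_comm r]
  map_one b := by rw [Pi.smul_apply, smul_apply, hP.map_one, smul_zero]

theorem IsHDiffOp.add {p : ℤ} {P Q : Ops R V} (hP : IsHDiffOp ħ G p P) (hQ : IsHDiffOp ħ G p Q) :
    IsHDiffOp ħ G p (P + Q) where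
  mem hb := add_mem (hP.mem hb) (hQ.mem hb)
  symm hb s t hst := by
    rw [Pi.add_apply, add_apply, hP.symm hb s t hst, hQ.symm hb s t hst, add_apply, smul_add]
  leibniz b _ _ _ _ hx hy := by
    simp only [Pi.add_apply, add_apply, hP.leibniz b hx hy, hQ.leibniz b hx hy, smul_add, map_add,
      lin_add]
    abel
  map_one b := by rw [Pi.add_apply, add_apply, hP.map_one, hQ.map_one, add_zero]

theorem IsHDiffOp.zero {p : ℤ} : IsHDiffOp ħ G p 0 where
  mem hb := zero_mem _
  symm hb s t hst := by simp
  leibniz b _ _ _ _ hx hy := by simp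
  map_one b := rfl

theorem IsHDiffOp.sgn_smul {p : ℤ} {P : Ops R V} (n : ℤˣ) (hP : IsHDiffOp ħ G p P) :
    IsHDiffOp ħ G p (n • P) := by
  have : n • P = ((n : ℤ) : R) • P := by rw [Units.smul_def, Int.cast_smul_eq_zsmul]
  rw [this]; exact hP.smul _

/-- A linear map on a tensor product is determined by homogeneous pure tensors. -/
theorem tgr_induction {t : ℤ} {p : (x : L ⊗[R] W) → x ∈ tgr ℒ 𝒲 t → Prop}
    (tmul : ∀ {i j a w} (ha : a ∈ ℒ i) (hw : w ∈ 𝒲 j) (h : i + j = t), p (a ⊗ₜ w)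
      (tmul_mem ha hw h))
    (zero : p 0 (zero_mem _)) (add : ∀ x y hx hy, p x hx → p y hy → p (x + y) (add_mem hx hy))
    (smul : ∀ (r : R) x hx, p x hx → p (r • x) (smul_mem _ r hx)) {x : L ⊗[R] W}
    (hx : x ∈ tgr ℒ 𝒲 t) : p x hx := by
  induction hx using span_induction with
  | mem x hx => obtain ⟨i, j, v, w, hv, hw, h, rfl⟩ := hx; exact tmul hv hw h
  | zero => exact zero
  | add x y _ _ hx hy => exact add x y _ _ hx hy
  | smul r x _ hx => exact smul r x _ hx

theorem IsFam.starSum {δ t : ℤ} {φ : L →ₗ[R] Ops R V} (hφ : IsFam ℒ ħ G δ φ) {x : L ⊗[R] V}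
    (hx : x ∈ tgr ℒ 𝒱 t) : IsHDiffOp ħ G (δ + t) (starSum ħ G φ x) := by
  induction hx using tgr_induction with
  | tmul ha hw h => rw [starSum_tmul, ← h, ← add_assoc]; exact (hφ ha).star hw
  | zero => rw [map_zero]; exact IsHDiffOp.zero
  | add x y _ _ hx hy => rw [map_add]; exact hx.add hy
  | smul r x _ hx => rw [map_smul]; exact hx.smul r

theorem IsFam.curFam {δ i : ℤ} {φ : L →ₗ[R] Ops R V} (hφ : IsFam ℒ ħ G δ φ) {b : V}
    (hb : b ∈ 𝒱 i) : IsFam ℒ ħ G (δ + i) (curFam hL G.isInternal cur b φ) := by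
  intro j a ha
  rw [curFam_apply hL _ _ hb ha, add_right_comm]
  exact ((hφ ha).cur hb).sgn_smul _

theorem starSum_curFam {i t : ℤ} (φ : L →ₗ[R] Ops R V) {b : V}
    (hb : b ∈ 𝒱 i) {x : L ⊗[R] V} (hx : x ∈ tgr ℒ 𝒱 t) :
    BD.starSum ħ G (BD.curFam hL G.isInternal cur b φ) x
      = sgn (i * t) • cur (BD.starSum ħ G φ x) b := by
  induction hx using tgr_induction with
  | tmul ha hw h =>
    rw [starSum_tmul, starSum_tmul, curFam_apply hL _ _ hb ha, cur_star ħ G hb hw, ← h]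
    simp only [map_sgn_smul, sgn_smul_apply, smul_smul, mul_assoc, sgn_expand, sgn_cancel]
  | zero => simp
  | add x y _ _ hx hy => simp only [map_add, hx, hy, lin_add, smul_add]
  | smul r x _ hx => simp only [map_smul, hx, lin_smul, smul_comm r]

theorem starSum_mul {δ t j : ℤ} {φ : L →ₗ[R] Ops R V} (hφ : IsFam ℒ ħ G δ φ) {x : L ⊗[R] V}
    (hx : x ∈ tgr ℒ 𝒱 t) {y : V} (hy : y ∈ 𝒱 j) :
    evl (starSum ħ G φ ((G.mul.flip y).lTensor L x)) []
      = G.mul (evl (starSum ħ G φ x) []) y + ħ • evl (starSum ħ G φ x) [y] := by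
  induction hx using tgr_induction with
  | tmul ha hw h => exact star_mul_nil (hφ ha) hw hy
  | zero => simp
  | add u v _ _ hx hy =>
    simp only [map_add, evl_add, hx, hy, lin_add, smul_add, evl_cons]; abel
  | smul r u _ hx =>
    simp only [map_smul, evl_smul, hx, lin_smul, smul_add, evl_cons, smul_comm r]

theorem curFam_curFam {δ i j : ℤ} {φ : L →ₗ[R] Ops R V} (hφ : IsFam ℒ ħ G δ φ) {b c : V}
    (hb : b ∈ 𝒱 i) (hc : c ∈ 𝒱 j) :
    curFam hL G.isInternal cur c (curFam hL G.isInternal cur b φ)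
      = sgn (i * j) • curFam hL G.isInternal cur b (curFam hL G.isInternal cur c φ) := by
  refine hom_ext hL fun l a ha => ?_
  rw [sgn_smul_apply, curFam_apply hL _ _ hc ha, curFam_apply hL _ _ hb ha,
    curFam_apply hL _ _ hb ha, curFam_apply hL _ _ hc ha]
  simp only [map_sgn_smul, sgn_smul_apply]
  rw [(hφ ha).cur_cur hb hc]
  simp only [smul_smul, mul_comm, mul_assoc]

theorem IsFam.phi {δ : ℤ} {φ : L →ₗ[R] Ops R V} (hφ : IsFam ℒ ħ G δ φ) (hD : IsDeriv ℒ G D) :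
    IsHDiffOp ħ G δ (phi ħ hL G D φ) := by
  refine IsHDiffOp.intro (𝒢 := fun i => 𝒱 i) (fun i => (Submodule.span_eq _).symm)
    (𝒪 := fun t => {Q | (∃ φ : L →ₗ[R] Ops R V, IsFam ℒ ħ G t φ ∧ Q = BD.phi ħ hL G D φ) ∨
      IsHDiffOp ħ G t Q}) ?_ ?_ ?_ ?_ ?_
    (subset_span (Or.inl ⟨φ, hφ, rfl⟩))
  · rintro p P (⟨φ, hφ, rfl⟩ | hP)
    · rw [phi_nil]; exact zero_mem _
    · exact hP.nil_mem
  · rintro p P i b (⟨φ, hφ, rfl⟩ | hP) hb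
    · rw [cur_phi]
      exact add_mem (subset_span (Or.inl ⟨_, hφ.curFam hb, rfl⟩))
        (subset_span (Or.inr (hφ.starSum (hD.mem hb))))
    · exact subset_span (Or.inr (hP.cur hb))
  · rintro p P i j b c (⟨φ, hφ, rfl⟩ | hP) hb hc
    · rw [cur_phi, cur_phi, map_add, map_add, lin_add, lin_add, cur_phi, cur_phi,
        starSum_curFam φ hb (hD.mem hc), starSum_curFam φ hc (hD.mem hb), curFam_curFam hφ hb hc,
        map_sgn_smul]
      simp only [smul_add, smul_smul, mul_comm j i, sgn_mul_self, one_smul]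
      abel
    · exact hP.cur_cur hb hc
  · rintro p P i j b c (⟨φ, hφ, rfl⟩ | hP) hb hc
    · simp only [evl_cons, cur_phi, map_add, lin_add, evl_add, phi_nil, zero_add]
      rw [hD.leib hb hc, map_add, map_sgn_smul, evl_add, evl_sgn, starSum_mul hφ (hD.mem hb) hc,
        starSum_mul hφ (hD.mem hc) hb, starSum_curFam φ hb (hD.mem hc)]
      simp only [evl_cons, evl_sgn, smul_add, smul_comm ħ]
      abel
    · exact hP.leib hb hc
  · rintro p P (⟨φ, hφ, rfl⟩ | hP)
    · rw [evl_cons, cur_phi, hD.one, evl_add, phi_nil, map_zero, evl_zero, add_zero]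
    · exact hP.one

end Phi

section Words

variable {S : Type*} [AddCommMonoid S] [Module R S]

variable (R) in
/-- The word with one letter. -/
def lett : A →ₗ[R] TensorCoalg R A :=
  (TensorAlgebra.toDirectSum (R := R) (M := A)).toLinearMap ∘ₗ TensorAlgebra.ι R

variable (R) in
/-- The word with given letters. -/
def wd (l : List A) : TensorCoalg R A := (l.map (lett R)).prod

/-- The word `w` followed by the letter `a`. -/
def sn : TensorCoalg R A →ₗ[R] A →ₗ[R] TensorCoalg R A :=
  (lcomp R _ (lett R)) ∘ₗ LinearMap.mul R (TensorCoalg R A)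

theorem sn_apply (w : TensorCoalg R A) (a : A) : sn w a = w * lett R a := rfl

theorem wd_append_singleton (l : List A) (a : A) : wd R (l ++ [a]) = sn (wd R l) a := by
  simp [wd, sn_apply]

theorem lof_tprod {p : ℕ} (a : Fin p → A) :
    DirectSum.lof R ℕ (fun p => ⨂[R]^p A) p (PiTensorProduct.tprod R a) = wd R (List.ofFn a) := by
  have := congrArg (TensorAlgebra.toDirectSum (R := R) (M := A))
    (TensorAlgebra.ofDirectSum_of_tprod (R := R) (M := A) a)
  rw [TensorAlgebra.toDirectSum_ofDirectSum] at this
  rw [DirectSum.lof_eq_of, this, TensorAlgebra.tprod_apply, map_list_prod, wd, List.map_ofFn,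
    List.map_ofFn]
  rfl

theorem mem_span_wd (x : TensorCoalg R A) : x ∈ Submodule.span R (Set.range (wd R (A := A))) := by
  have key : ∀ y : TensorAlgebra R A, ∀ w ∈ Submodule.span R (Set.range (wd R (A := A))),
      w * TensorAlgebra.toDirectSum y ∈ Submodule.span R (Set.range (wd R (A := A))) := by
    intro y
    induction y using TensorAlgebra.induction with
    | algebraMap r =>
      intro w hw
      rw [AlgHom.commutes, ← Algebra.commutes, ← Algebra.smul_def]
      exact smul_mem _ _ hw
    | ι a =>
      intro w hw
      induction hw using span_induction with
      | mem w hw =>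
        obtain ⟨l, rfl⟩ := hw
        exact subset_span ⟨l ++ [a], wd_append_singleton l a⟩
      | zero => simp
      | add x y _ _ hx hy => rw [add_mul]; exact add_mem hx hy
      | smul r x _ hx => rw [smul_mul_assoc]; exact smul_mem _ _ hx
    | mul y z hy hz => intro w hw; rw [map_mul, ← mul_assoc]; exact hz _ (hy w hw)
    | add y z hy hz => intro w hw; rw [map_add, mul_add]; exact add_mem (hy w hw) (hz w hw)
  have := key (TensorAlgebra.ofDirectSum x) 1 (subset_span ⟨[], by simp [wd]⟩)
  rwa [one_mul, TensorAlgebra.toDirectSum_ofDirectSum] at this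

theorem tensor_hom_ext_snoc {F G : TensorCoalg R A →ₗ[R] S} (h1 : F 1 = G 1)
    (h2 : ∀ w, F w = G w → ∀ a, F (sn w a) = G (sn w a)) : F = G := by
  refine LinearMap.ext fun x => ?_
  refine eqOn_span (s := Set.range (wd R (A := A))) ?_ (mem_span_wd x)
  rintro _ ⟨l, rfl⟩
  induction l using List.reverseRecOn with
  | nil => simpa [wd] using h1
  | append_singleton l a ih => rw [wd_append_singleton]; exact h2 _ ih a

/-- Right fold over the letters of a word, as a homomorphism. -/
def foldHom (step : A →ₗ[R] Module.End R S) : TensorCoalg R A →ₐ[R] (Module.End R S)ᵐᵒᵖ :=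
  (TensorAlgebra.lift R ((MulOpposite.opLinearEquiv R).toLinearMap ∘ₗ step)).comp
    (TensorAlgebra.ofDirectSum (R := R) (M := A))

/-- Right fold over the letters of a word. -/
def foldState (s : S) (step : A →ₗ[R] Module.End R S) : TensorCoalg R A →ₗ[R] S :=
  LinearMap.applyₗ s ∘ₗ (MulOpposite.opLinearEquiv R).symm.toLinearMap ∘ₗ
    (foldHom step).toLinearMap

theorem foldState_one (s : S) (step : A →ₗ[R] Module.End R S) : foldState s step 1 = s := by
  change MulOpposite.unop (foldHom step 1) s = s
  rw [map_one]; rfl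

theorem foldState_sn (s : S) (step : A →ₗ[R] Module.End R S) (w : TensorCoalg R A) (a : A) :
    foldState s step (sn w a) = step a (foldState s step w) := by
  change MulOpposite.unop (foldHom step (w * lett R a)) s = _
  have : foldHom step (lett R a) = MulOpposite.op (step a) := by
    change TensorAlgebra.lift R _ (TensorAlgebra.ofDirectSum
      (TensorAlgebra.toDirectSum (TensorAlgebra.ι R a))) = _
    rw [TensorAlgebra.ofDirectSum_toDirectSum, TensorAlgebra.lift_ι_apply]; rfl
  rw [map_mul, this]
  rfl

/-- The linear map with `F(1) = s` and `F(w a) = g(F(w), a) + f(w, a)`. -/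
def rrec (s : S) (f : TensorCoalg R A →ₗ[R] A →ₗ[R] S) (g : S →ₗ[R] A →ₗ[R] S) :
    TensorCoalg R A →ₗ[R] S :=
  LinearMap.fst R S (TensorCoalg R A) ∘ₗ foldState (S := S × TensorCoalg R A) (s, 1)
    ((LinearMap.prodMapLinear R S (TensorCoalg R A) S (TensorCoalg R A) R).comp
        ((LinearMap.inl R _ _).comp g.flip + (LinearMap.inr R _ _).comp sn.flip)
      + (compRight R (LinearMap.inl R S (TensorCoalg R A))).comp
        ((lcomp R S (LinearMap.snd R S (TensorCoalg R A))).comp f.flip))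

theorem rrec_one (s : S) (f : TensorCoalg R A →ₗ[R] A →ₗ[R] S) (g : S →ₗ[R] A →ₗ[R] S) :
    rrec s f g 1 = s := by
  rw [rrec, comp_apply, foldState_one]; rfl

theorem rrec_sn (s : S) (f : TensorCoalg R A →ₗ[R] A →ₗ[R] S) (g : S →ₗ[R] A →ₗ[R] S)
    (w : TensorCoalg R A) (a : A) : rrec s f g (sn w a) = g (rrec s f g w) a + f w a := by
  have key : LinearMap.snd R S (TensorCoalg R A) ∘ₗ foldState (S := S × TensorCoalg R A) (s, 1)
    ((LinearMap.prodMapLinear R S (TensorCoalg R A) S (TensorCoalg R A) R).comp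
        ((LinearMap.inl R _ _).comp g.flip + (LinearMap.inr R _ _).comp sn.flip)
      + (compRight R (LinearMap.inl R S (TensorCoalg R A))).comp
        ((lcomp R S (LinearMap.snd R S (TensorCoalg R A))).comp f.flip))
      = LinearMap.id := by
    refine tensor_hom_ext_snoc ?_ fun w hw a => ?_
    · rw [comp_apply, foldState_one]; rfl
    · have hw' := hw
      rw [comp_apply] at hw'
      rw [comp_apply, foldState_sn]
      change (0 + sn (LinearMap.snd R S (TensorCoalg R A) _) a) + 0 = sn w a
      rw [add_zero, zero_add, hw']; rfl
  have key' := LinearMap.congr_fun key w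
  rw [comp_apply] at key'
  rw [rrec, comp_apply, foldState_sn]
  change (g (LinearMap.fst R S (TensorCoalg R A) _) a + 0)
    + f (LinearMap.snd R S (TensorCoalg R A) _) a = _
  rw [key', add_zero]; rfl

end Words

section TGrading

/-- Words with homogeneous letters, with their degrees. -/
inductive IsWord (ℒ : ℤ → Submodule R A) : ℤ → TensorCoalg R A → Prop
  | one : IsWord ℒ 0 1
  | sn {i j : ℤ} {w : TensorCoalg R A} {a : A} : IsWord ℒ i w → a ∈ ℒ j → IsWord ℒ (i + j) (sn w a)

/-- The grading of `T(A)` for letters graded by `ℒ`. -/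
def Tgr (ℒ : ℤ → Submodule R A) (t : ℤ) : Submodule R (TensorCoalg R A) :=
  Submodule.span R {x | IsWord ℒ t x}

variable {ℒ : ℤ → Submodule R A}

theorem IsWord.mem {t : ℤ} {x : TensorCoalg R A} (h : IsWord ℒ t x) : x ∈ Tgr ℒ t :=
  subset_span h

theorem one_mem_Tgr : (1 : TensorCoalg R A) ∈ Tgr ℒ 0 := IsWord.one.mem

theorem sn_mem {i j : ℤ} {w : TensorCoalg R A} {a : A} (hw : w ∈ Tgr ℒ i) (ha : a ∈ ℒ j) :
    sn w a ∈ Tgr ℒ (i + j) := by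
  induction hw using span_induction with
  | mem w hw => exact (IsWord.sn hw ha).mem
  | zero => simp
  | add x y _ _ hx hy => simpa using add_mem hx hy
  | smul r x _ hx => simpa using smul_mem _ r hx

theorem sn_mem' {i j t : ℤ} {w : TensorCoalg R A} {a : A} (hw : w ∈ Tgr ℒ i) (ha : a ∈ ℒ j)
    (h : i + j = t) : sn w a ∈ Tgr ℒ t := h ▸ sn_mem hw ha

theorem Tgr_isInternal (h : DirectSum.IsInternal ℒ) : DirectSum.IsInternal (Tgr ℒ) := by
  let g : (ℤ →₀ TensorCoalg R A) →ₗ[R] A →ₗ[R] (ℤ →₀ TensorCoalg R A) :=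
    Finsupp.lsum R fun i => (hrec (X := TensorCoalg R A →ₗ[R] ℤ →₀ TensorCoalg R A) h fun j =>
      compRight R (Finsupp.lsingle (i + j)) ∘ₗ sn.flip ∘ₗ (ℒ j).subtype).flip
  have hg : ∀ {i j w a}, a ∈ ℒ j → g (Finsupp.single i w) a = Finsupp.single (i + j) (sn w a) := by
    intro i j w a ha
    simp only [g, Finsupp.lsum_single]
    rw [flip_apply, hrec_of_mem _ _ ha]
    rfl
  refine isInternal_of_coaction (rrec (Finsupp.single 0 1) 0 g) ?_ ?_
  · intro t x hx
    refine eqOn_span (g := Finsupp.lsingle t) ?_ hx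
    clear hx x
    intro x hx
    simp only [Finsupp.lsingle_apply]
    induction hx with
    | one => rw [rrec_one]
    | sn _ ha ih => rw [rrec_sn, ih, hg ha]; simp
  · intro x
    refine Submodule.span_le.2 ?_ (mem_span_wd x)
    rintro _ ⟨l, rfl⟩
    induction l using List.reverseRecOn with
    | nil => exact subset_span ⟨0, by simpa [wd] using one_mem_Tgr⟩
    | append_singleton l a ih =>
      rw [wd_append_singleton]
      have ih : wd R l ∈ Submodule.span R {v | ∃ i, v ∈ Tgr ℒ i} := ih
      have : sn (wd R l) a ∈ Submodule.span R {v | ∃ i, v ∈ Tgr ℒ i} := by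
        generalize wd R l = w at ih
        induction ih, mem_span_iUnion h a using Submodule.span_induction₂ with
        | mem_mem v w hv hw =>
          obtain ⟨i, hv⟩ := hv
          obtain ⟨j, hw⟩ := hw
          exact subset_span ⟨_, sn_mem hv hw⟩
        | zero_left y hy => simp
        | zero_right y hy => simp
        | add_left x y z _ _ _ hx hy => simpa using add_mem hx hy
        | add_right x y z _ _ _ hx hy => simpa using add_mem hx hy
        | smul_left r x y _ _ hx => simpa using smul_mem _ r hx
        | smul_right r x y _ _ hx => simpa using smul_mem _ r hx
      exact this

end TGrading

section Recursion

variable {S : Type*} [AddCommMonoid S] [Module R S]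

theorem rrec_add (s s' : S) (f f' : TensorCoalg R A →ₗ[R] A →ₗ[R] S) (g : S →ₗ[R] A →ₗ[R] S) :
    rrec (s + s') (f + f') g = rrec s f g + rrec s' f' g := by
  refine tensor_hom_ext_snoc ?_ fun w hw a => ?_
  · simp only [rrec_one, lin_add]
  · simp only [rrec_sn, hw, lin_add, map_add, add_add_add_comm]

theorem rrec_smul (r : R) (s : S) (f : TensorCoalg R A →ₗ[R] A →ₗ[R] S) (g : S →ₗ[R] A →ₗ[R] S) :
    rrec (r • s) (r • f) g = r • rrec s f g := by
  refine tensor_hom_ext_snoc ?_ fun w hw a => ?_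
  · simp only [rrec_one, lin_smul]
  · simp only [rrec_sn, hw, lin_smul, map_smul, smul_add]

variable {X : Type*} [AddCommMonoid X] [Module R X]

theorem tw_add (h : DirectSum.IsInternal 𝒱) (h' : DirectSum.IsInternal 𝒲)
    (φ ψ : V →ₗ[R] W →ₗ[R] X) : tw h h' (φ + ψ) = tw h h' φ + tw h h' ψ :=
  hom_ext h fun i v hv => LinearMap.ext fun w => by
    simp only [lin_add, tw_left h h' _ hv]

theorem tw_smul (h : DirectSum.IsInternal 𝒱) (h' : DirectSum.IsInternal 𝒲) (r : R)
    (φ : V →ₗ[R] W →ₗ[R] X) : tw h h' (r • φ) = r • tw h h' φ :=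
  hom_ext h fun i v hv => LinearMap.ext fun w => by
    simp only [lin_smul, tw_left h h' _ hv]

end Recursion

section Aux

/-- The trilinear map `a, v, b ↦ ψ(a, c(v, b))`. -/
def inner₂ (c : V →ₗ[R] A →ₗ[R] V) (ψ : A →ₗ[R] V →ₗ[R] V) : A →ₗ[R] V →ₗ[R] A →ₗ[R] V :=
  (lcomp R _ c) ∘ₗ (llcomp R A V V) ∘ₗ ψ

theorem inner₂_apply (c : V →ₗ[R] A →ₗ[R] V) (ψ : A →ₗ[R] V →ₗ[R] V) (a v b) :
    inner₂ c ψ a v b = ψ a (c v b) := rfl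

theorem inner₂_add (c : V →ₗ[R] A →ₗ[R] V) (ψ ψ' : A →ₗ[R] V →ₗ[R] V) (a : A) :
    inner₂ c (ψ + ψ') a = inner₂ c ψ a + inner₂ c ψ' a := rfl

theorem inner₂_smul (c : V →ₗ[R] A →ₗ[R] V) (r : R) (ψ : A →ₗ[R] V →ₗ[R] V) (a : A) :
    inner₂ c (r • ψ) a = r • inner₂ c ψ a := rfl

variable {ℒ : ℤ → Submodule R A}

theorem tw_flip_add (h : DirectSum.IsInternal ℒ) (h' : DirectSum.IsInternal 𝒱)
    (c : V →ₗ[R] A →ₗ[R] V) (F F' : V →ₗ[R] V) :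
    tw h h' (c ∘ₗ (F + F')).flip = tw h h' (c ∘ₗ F).flip + tw h h' (c ∘ₗ F').flip := by
  rw [LinearMap.comp_add, ← tw_add]; rfl

theorem tw_flip_smul (h : DirectSum.IsInternal ℒ) (h' : DirectSum.IsInternal 𝒱)
    (c : V →ₗ[R] A →ₗ[R] V) (r : R) (F : V →ₗ[R] V) :
    tw h h' (c ∘ₗ (r • F)).flip = r • tw h h' (c ∘ₗ F).flip := by
  rw [LinearMap.comp_smul, ← tw_smul]; rfl

end Aux

section Product

variable {ℒ : ℤ → Submodule R A} (h : DirectSum.IsInternal ℒ)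

/-- Auxiliary function for the shuffle product. -/
def shufAux (F : TensorCoalg R A →ₗ[R] TensorCoalg R A) :
    A →ₗ[R] TensorCoalg R A →ₗ[R] A →ₗ[R] TensorCoalg R A :=
  inner₂ sn (tw h (Tgr_isInternal h) (sn ∘ₗ F).flip)

theorem shufAux_apply (F : TensorCoalg R A →ₗ[R] TensorCoalg R A) {i j : ℤ} {a : A}
    (ha : a ∈ ℒ j) {y : TensorCoalg R A} (hy : y ∈ Tgr ℒ i) (v : TensorCoalg R A) (b : A)
    (e : y = sn v b) : shufAux h F a v b = sgn (j * i) • sn (F (sn v b)) a := by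
  subst e
  rw [shufAux, inner₂_apply, tw_apply h _ _ ha hy]
  rfl

/-- The operator `x a · -` in terms of the operator `F = x · -`. -/
def shufStep : (TensorCoalg R A →ₗ[R] TensorCoalg R A) →ₗ[R] A →ₗ[R]
    (TensorCoalg R A →ₗ[R] TensorCoalg R A) :=
  LinearMap.mk₂ R (fun F a => rrec (sn (F 1) a) (shufAux h F a) sn)
    (fun F F' a => by
      rw [← rrec_add, shufAux, tw_flip_add, inner₂_add, lin_add, map_add, lin_add]; rfl)
    (fun r F a => by
      rw [← rrec_smul, shufAux, tw_flip_smul, inner₂_smul, lin_smul, map_smul, lin_smul]; rfl)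
    (fun F a b => by rw [← rrec_add]; simp only [map_add])
    (fun r F a => by rw [← rrec_smul]; simp only [map_smul])

/-- The shuffle product. -/
def mulT : TensorCoalg R A →ₗ[R] TensorCoalg R A →ₗ[R] TensorCoalg R A :=
  rrec LinearMap.id 0 (shufStep h)

theorem mulT_one_left (y : TensorCoalg R A) : mulT h 1 y = y := by
  rw [mulT, rrec_one]; rfl

theorem mulT_sn (w : TensorCoalg R A) (a : A) :
    mulT h (sn w a) = rrec (sn (mulT h w 1) a) (shufAux h (mulT h w) a) sn := by
  rw [mulT, rrec_sn, lin_zero, lin_zero, add_zero]; rfl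

theorem mulT_one_right (x : TensorCoalg R A) : mulT h x 1 = x := by
  have : (mulT h).flip 1 = LinearMap.id := by
    refine tensor_hom_ext_snoc ?_ fun w hw a => ?_
    · rw [flip_apply, mulT_one_left]; rfl
    · rw [flip_apply] at hw ⊢
      rw [mulT_sn, rrec_one, hw]; rfl
  exact LinearMap.congr_fun this x

theorem mulT_sn_sn {i j l : ℤ} {a b : A} {v : TensorCoalg R A} (w : TensorCoalg R A)
    (ha : a ∈ ℒ j) (hv : v ∈ Tgr ℒ i) (hb : b ∈ ℒ l) :
    mulT h (sn w a) (sn v b)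
      = sn (mulT h (sn w a) v) b + sgn (j * (i + l)) • sn (mulT h w (sn v b)) a := by
  rw [mulT_sn, rrec_sn, ← mulT_sn, shufAux_apply h _ ha (sn_mem hv hb) v b rfl]

theorem mulT_mem_word {i j : ℤ} {x y : TensorCoalg R A} (hx : IsWord ℒ i x) (hy : IsWord ℒ j y) :
    mulT h x y ∈ Tgr ℒ (i + j) := by
  induction hx generalizing j y with
  | one => rw [mulT_one_left, zero_add]; exact hy.mem
  | @sn i l w a hw ha ih =>
    induction hy with
    | one => rw [mulT_one_right, add_zero]; exact (hw.sn ha).mem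
    | @sn j m v b hv hb ih' =>
      rw [mulT_sn_sn h w ha hv.mem hb]
      exact add_mem (sn_mem' ih' hb (by ring))
        (sgn_smul_mem _ _ (sn_mem' (ih (hv.sn hb)) ha (by ring)))

theorem mulT_comm_word {i j : ℤ} {x y : TensorCoalg R A} (hx : IsWord ℒ i x) (hy : IsWord ℒ j y) :
    mulT h x y = sgn (i * j) • mulT h y x := by
  induction hx generalizing j y with
  | one => rw [mulT_one_left, mulT_one_right, zero_mul, sgn_zero, one_smul]
  | @sn i l w a hw ha ih =>
    induction hy with
    | one => rw [mulT_one_left, mulT_one_right, mul_zero, sgn_zero, one_smul]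
    | @sn j m v b hv hb ih' =>
      rw [mulT_sn_sn h w ha hv.mem hb, mulT_sn_sn h v hb hw.mem ha, ih', ih (hv.sn hb)]
      simp only [map_sgn_smul₂, smul_add, smul_smul, mul_comm, mul_left_comm, mul_assoc, sgn_expand,
        sgn_cancel]
      rw [add_comm]

theorem mulT_assoc_word {i j t : ℤ} {x y z : TensorCoalg R A} (hx : IsWord ℒ i x)
    (hy : IsWord ℒ j y) (hz : IsWord ℒ t z) :
    mulT h (mulT h x y) z = mulT h x (mulT h y z) := by
  induction hx generalizing j t y z with
  | one => rw [mulT_one_left, mulT_one_left]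
  | @sn i l w a hw ha ih =>
    induction hy generalizing t z with
    | one => rw [mulT_one_left, mulT_one_right]
    | @sn j m v b hv hb ih' =>
      induction hz with
      | one => rw [mulT_one_right, mulT_one_right]
      | @sn t n u c hu hc ih'' =>
        have hx := hw.sn ha
        have hy := hv.sn hb
        have hz := hu.sn hc
        have h1 := ih'' 
        have h2 := ih' hz
        have h3 := ih hy hz
        rw [mulT_sn_sn h v hb hu.mem hc, map_add, map_sgn_smul] at h3
        rw [mulT_sn_sn h w ha hv.mem hb] at h1 ⊢
        simp only [map_add, map_sgn_smul₂, lin_add] at h1 ⊢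
        rw [mulT_sn_sn h v hb hu.mem hc, mulT_sn_sn h _ hb hu.mem hc, mulT_sn_sn h _ ha hu.mem hc,
          h2, h3]
        rw [← eq_sub_iff_add_eq] at h1
        rw [h1]
        simp only [map_add, map_sub, lin_sub, map_sgn_smul]
        rw [mulT_sn_sn h w ha (mulT_mem_word h hy hu) hc,
          mulT_sn_sn h w ha (mulT_mem_word h hv hz) hb]
        simp only [lin_add, map_sgn_smul₂, smul_add, smul_smul, mul_comm, mul_left_comm, mul_assoc,
          sgn_expand]
        abel

/-- `T(A)` with the shuffle product. -/
def shuffleGC : GCAlgebra (Tgr ℒ) :=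
  GCAlgebra.ofGens (Tgr_isInternal h) (fun _ => rfl) 1 (mulT h) one_mem_Tgr
    (fun ha hb => mulT_mem_word h ha hb) (fun _ => mulT_one_left h _)
    (fun ha hb hc => mulT_assoc_word h ha hb hc) (fun ha hb => mulT_comm_word h ha hb)

end Product

/-- The operations of a `BD₁`-algebra in terms of the shifted degrees: all three have degree `1`. -/
structure ShiftedBD (ħ : R) (ℒ : ℤ → Submodule R A) where
  isInternal : DirectSum.IsInternal ℒ
  d : A →ₗ[R] A
  μ : A →ₗ[R] A →ₗ[R] A
  β : A →ₗ[R] A →ₗ[R] A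
  d_mem : ∀ {i a}, a ∈ ℒ i → d a ∈ ℒ (i + 1)
  μ_mem : ∀ {i j a b}, a ∈ ℒ i → b ∈ ℒ j → μ a b ∈ ℒ (i + j + 1)
  β_mem : ∀ {i j a b}, a ∈ ℒ i → b ∈ ℒ j → β a b ∈ ℒ (i + j + 1)
  d_d : ∀ a, d (d a) = 0
  d_μ : ∀ {i j a b}, a ∈ ℒ i → b ∈ ℒ j → d (μ a b) = - μ (d a) b - sgn i • μ a (d b)
  μ_μ : ∀ {i j l a b c}, a ∈ ℒ i → b ∈ ℒ j → c ∈ ℒ l → μ (μ a b) c = - (sgn i • μ a (μ b c))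
  β_symm : ∀ {i j a b}, a ∈ ℒ i → b ∈ ℒ j → β a b = sgn (i * j) • β b a
  jacobi : ∀ {i j l a b c}, a ∈ ℒ i → b ∈ ℒ j → c ∈ ℒ l →
    β (β a b) c + sgn (j * l) • β (β a c) b + sgn (i * (j + l)) • β (β b c) a = 0
  d_β : ∀ {i j a b}, a ∈ ℒ i → b ∈ ℒ j → d (β a b) = - β (d a) b - sgn i • β a (d b)
  hbar_β : ∀ {i j a b}, a ∈ ℒ i → b ∈ ℒ j → ħ • β a b = μ a b + sgn (i * j) • μ b a
  β_μ : ∀ {i j l a b c}, a ∈ ℒ i → b ∈ ℒ j → c ∈ ℒ l →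
    β a (μ b c) = - (sgn i • μ (β a b) c) - sgn (i * j + i + j) • μ b (β a c)

section Inner

/-- The trilinear map `a, v, b ↦ c(m(v), β(a, b))`. -/
def inner₃ (c : V →ₗ[R] A →ₗ[R] V) (β : A →ₗ[R] A →ₗ[R] A) (m : V →ₗ[R] V) :
    A →ₗ[R] V →ₗ[R] A →ₗ[R] V :=
  ((llcomp R A A V) ∘ₗ c ∘ₗ m).flip ∘ₗ β

theorem inner₃_apply (c : V →ₗ[R] A →ₗ[R] V) (β : A →ₗ[R] A →ₗ[R] A) (m : V →ₗ[R] V) (a v b) :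
    inner₃ c β m a v b = c (m v) (β a b) := rfl

theorem inner₃_add (c : V →ₗ[R] A →ₗ[R] V) (β : A →ₗ[R] A →ₗ[R] A) (m m' : V →ₗ[R] V) :
    inner₃ c β (m + m') = inner₃ c β m + inner₃ c β m' :=
  LinearMap.ext fun a => LinearMap.ext fun v => LinearMap.ext fun b => by
    simp only [inner₃_apply, lin_add, map_add]

theorem inner₃_smul (c : V →ₗ[R] A →ₗ[R] V) (β : A →ₗ[R] A →ₗ[R] A) (r : R) (m : V →ₗ[R] V) :
    inner₃ c β (r • m) = r • inner₃ c β m :=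
  LinearMap.ext fun a => LinearMap.ext fun v => LinearMap.ext fun b => by
    simp only [inner₃_apply, lin_smul, map_smul]

end Inner

namespace ShiftedBD

variable {ℒ : ℤ → Submodule R A} (D : ShiftedBD ħ ℒ)

/-- The sign `(-1)^{|x|}` on words. -/
abbrev σ : TensorCoalg R A →ₗ[R] TensorCoalg R A := signMap (Tgr_isInternal D.isInternal) 1

theorem σ_apply {i : ℤ} {x : TensorCoalg R A} (hx : x ∈ Tgr ℒ i) : D.σ x = sgn i • x := by
  rw [signMap_apply _ _ hx, one_mul]

/-- The shuffle product. -/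
abbrev mul : TensorCoalg R A →ₗ[R] TensorCoalg R A →ₗ[R] TensorCoalg R A := mulT D.isInternal

/-- The multiplication of the last letter of a word with a letter. -/
def last : TensorCoalg R A →ₗ[R] A →ₗ[R] TensorCoalg R A :=
  rrec 0 (inner₃ sn D.μ D.σ).flip 0

/-- The multiplication of the last letter of the second factor of a shuffle product with a
letter. -/
def last₂ (w : TensorCoalg R A) : TensorCoalg R A →ₗ[R] A →ₗ[R] TensorCoalg R A :=
  rrec 0 (inner₃ sn D.μ (D.mul (D.σ w) ∘ₗ D.σ)).flip 0

/-- The differential of the bar complex. -/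
def dT : TensorCoalg R A →ₗ[R] TensorCoalg R A :=
  rrec 0 ((sn ∘ₗ D.σ).compl₂ D.d + D.last) sn

/-- Auxiliary function for the bracket. -/
def brAux (w : TensorCoalg R A) : A →ₗ[R] TensorCoalg R A →ₗ[R] A →ₗ[R] TensorCoalg R A :=
  tw D.isInternal (Tgr_isInternal D.isInternal) (inner₃ sn D.β (D.mul (D.σ w) ∘ₗ D.σ))

/-- The bracket of words. -/
def brT : TensorCoalg R A →ₗ[R] TensorCoalg R A →ₗ[R] TensorCoalg R A :=
  rrec 0
    (LinearMap.mk₂ R (fun w a => rrec 0 (D.brAux w a) sn)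
      (fun w w' a => by
        rw [← rrec_add, brAux, map_add, map_add, LinearMap.add_comp, inner₃_add, tw_add, lin_add,
          add_zero]; rfl)
      (fun r w a => by
        rw [← rrec_smul, brAux, map_smul, map_smul, LinearMap.smul_comp, inner₃_smul, tw_smul,
          lin_smul, smul_zero]; rfl)
      (fun w a b => by rw [← rrec_add, map_add, add_zero])
      (fun r w a => by rw [← rrec_smul, map_smul, smul_zero]))
    (LinearMap.mk₂ R (fun F a => rrec 0 (shufAux D.isInternal F a) sn)
      (fun F F' a => by
        rw [← rrec_add, shufAux, tw_flip_add, inner₂_add, add_zero]; rfl)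
      (fun r F a => by
        rw [← rrec_smul, shufAux, tw_flip_smul, inner₂_smul, smul_zero]; rfl)
      (fun F a b => by rw [← rrec_add, map_add, add_zero])
      (fun r F a => by rw [← rrec_smul, map_smul, smul_zero]))

theorem last_one (a : A) : D.last 1 a = 0 := by
  rw [last, rrec_one]; rfl

theorem last_sn {i : ℤ} {w : TensorCoalg R A} (hw : w ∈ Tgr ℒ i) (c a : A) :
    D.last (sn w c) a = sgn i • sn w (D.μ c a) := by
  rw [last, rrec_sn, lin_zero, lin_zero, zero_add, flip_apply, inner₃_apply, D.σ_apply hw,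
    map_sgn_smul₂]

theorem last₂_one (w : TensorCoalg R A) (a : A) : D.last₂ w 1 a = 0 := by
  rw [last₂, rrec_one]; rfl

theorem last₂_sn {i j : ℤ} {w v : TensorCoalg R A} (hw : w ∈ Tgr ℒ i) (hv : v ∈ Tgr ℒ j)
    (c a : A) : D.last₂ w (sn v c) a = sgn (i + j) • sn (D.mul w v) (D.μ c a) := by
  rw [last₂, rrec_sn, lin_zero, lin_zero, zero_add, flip_apply, inner₃_apply, comp_apply,
    D.σ_apply hw, D.σ_apply hv]
  simp only [map_sgn_smul, map_sgn_smul₂, smul_smul, sgn_add, mul_comm]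

theorem dT_one : D.dT 1 = 0 := by rw [dT, rrec_one]

theorem dT_sn {i : ℤ} {w : TensorCoalg R A} (hw : w ∈ Tgr ℒ i) (a : A) :
    D.dT (sn w a) = sn (D.dT w) a + sgn i • sn w (D.d a) + D.last w a := by
  rw [dT, rrec_sn, lin_add, lin_add, LinearMap.compl₂_apply, comp_apply, D.σ_apply hw,
    map_sgn_smul₂, add_assoc]

theorem brT_one_left (y : TensorCoalg R A) : D.brT 1 y = 0 := by
  rw [brT, rrec_one]; rfl

theorem brT_sn (w : TensorCoalg R A) (a : A) :
    D.brT (sn w a) = rrec 0 (shufAux D.isInternal (D.brT w) a) sn + rrec 0 (D.brAux w a) sn := by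
  rw [brT, rrec_sn]; rfl

theorem brT_one_right (x : TensorCoalg R A) : D.brT x 1 = 0 := by
  have : D.brT.flip 1 = 0 := by
    refine tensor_hom_ext_snoc ?_ fun w _ a => ?_
    · rw [flip_apply, brT_one_left]; rfl
    · rw [flip_apply, brT_sn, lin_add, rrec_one, rrec_one, add_zero]; rfl
  exact LinearMap.congr_fun this x

theorem brT_sn_sn {i j l n : ℤ} {a b : A} {w v : TensorCoalg R A} (hw : w ∈ Tgr ℒ n)
    (ha : a ∈ ℒ j) (hv : v ∈ Tgr ℒ i) (hb : b ∈ ℒ l) :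
    D.brT (sn w a) (sn v b) = sn (D.brT (sn w a) v) b
      + sgn (j * (i + l)) • sn (D.brT w (sn v b)) a
      + sgn (n + i + j * i) • sn (D.mul w v) (D.β a b) := by
  rw [brT_sn, lin_add, rrec_sn, rrec_sn, lin_add, shufAux_apply _ _ ha (sn_mem hv hb) v b rfl,
    brAux, tw_left _ _ _ ha, signMap_apply _ _ hv, inner₃_apply, comp_apply, D.σ_apply hw,
    map_sgn_smul, map_sgn_smul, D.σ_apply hv]
  simp only [map_add, lin_add, map_sgn_smul, map_sgn_smul₂, smul_smul, mul_comm, mul_assoc,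
    sgn_expand]
  abel

theorem last_mem {i j : ℤ} {w : TensorCoalg R A} {a : A} (hw : IsWord ℒ i w) (ha : a ∈ ℒ j) :
    D.last w a ∈ Tgr ℒ (i + j + 1) := by
  induction hw with
  | one => rw [last_one]; exact zero_mem _
  | sn hw hc _ =>
    rw [D.last_sn hw.mem]
    exact sgn_smul_mem _ _ (sn_mem' hw.mem (D.μ_mem hc ha) (by ring))

theorem dT_mem {i : ℤ} {x : TensorCoalg R A} (hx : IsWord ℒ i x) : D.dT x ∈ Tgr ℒ (i + 1) := by
  induction hx with
  | one => rw [dT_one]; exact zero_mem _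
  | sn hw ha ih =>
    rw [D.dT_sn hw.mem]
    exact add_mem (add_mem (sn_mem' ih ha (by ring))
      (sgn_smul_mem _ _ (sn_mem' hw.mem (D.d_mem ha) (by ring)))) (D.last_mem hw ha)

theorem mul_mem {i j : ℤ} {x y : TensorCoalg R A} (hx : x ∈ Tgr ℒ i) (hy : y ∈ Tgr ℒ j) :
    D.mul x y ∈ Tgr ℒ (i + j) := (shuffleGC D.isInternal).mul_mem hx hy

theorem mul_comm' {i j : ℤ} {x y : TensorCoalg R A} (hx : x ∈ Tgr ℒ i) (hy : y ∈ Tgr ℒ j) :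
    D.mul x y = sgn (i * j) • D.mul y x := (shuffleGC D.isInternal).mul_comm hx hy

theorem mul_assoc' (x y z : TensorCoalg R A) : D.mul (D.mul x y) z = D.mul x (D.mul y z) :=
  (shuffleGC D.isInternal).mul_assoc x y z

theorem brT_mem {i j : ℤ} {x y : TensorCoalg R A} (hx : IsWord ℒ i x) (hy : IsWord ℒ j y) :
    D.brT x y ∈ Tgr ℒ (i + j + 1) := by
  induction hx generalizing j y with
  | one => rw [brT_one_left]; exact zero_mem _
  | @sn i l w a hw ha ih =>
    induction hy with
    | one => rw [brT_one_right]; exact zero_mem _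
    | @sn j m v b hv hb ih' =>
      rw [D.brT_sn_sn hw.mem ha hv.mem hb]
      exact add_mem (add_mem (sn_mem' ih' hb (by ring))
        (sgn_smul_mem _ _ (sn_mem' (ih (hv.sn hb)) ha (by ring))))
        (sgn_smul_mem _ _ (sn_mem' (D.mul_mem hw.mem hv.mem) (D.β_mem ha hb) (by ring)))

theorem brT_symm {i j : ℤ} {x y : TensorCoalg R A} (hx : IsWord ℒ i x) (hy : IsWord ℒ j y) :
    D.brT x y = sgn (i * j) • D.brT y x := by
  induction hx generalizing j y with
  | one => rw [brT_one_left, brT_one_right, smul_zero]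
  | @sn i l w a hw ha ih =>
    induction hy with
    | one => rw [brT_one_left, brT_one_right, smul_zero]
    | @sn j m v b hv hb ih' =>
      rw [D.brT_sn_sn hw.mem ha hv.mem hb, D.brT_sn_sn hv.mem hb hw.mem ha, ih', ih (hv.sn hb),
        D.β_symm ha hb, D.mul_comm' hw.mem hv.mem]
      simp only [map_sgn_smul, map_sgn_smul₂, smul_add, smul_smul, mul_comm, mul_left_comm,
        mul_assoc, sgn_expand, sgn_cancel]
      abel

theorem last_mul {i j : ℤ} {w v : TensorCoalg R A} {c : A} (hw : IsWord ℒ i w)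
    (hv : IsWord ℒ j v) :
    D.last (D.mul w v) c = D.last₂ w v c + sgn (i * j) • D.last₂ v w c := by
  cases hw with
  | one =>
    rw [mulT_one_left, last₂_one, smul_zero, add_zero]
    cases hv with
    | one => rw [last_one, last₂_one]
    | sn hv hb =>
      rw [D.last_sn hv.mem, D.last₂_sn one_mem_Tgr hv.mem, mulT_one_left, zero_add]
  | sn hw ha =>
    cases hv with
    | one =>
      rw [mulT_one_right, last₂_one, zero_add, D.last_sn hw.mem, D.last₂_sn one_mem_Tgr hw.mem,
        mulT_one_left, zero_add, mul_zero, sgn_zero, one_smul]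
    | sn hv hb =>
      rw [mulT_sn_sn _ _ ha hv.mem hb, map_add, lin_add, map_sgn_smul₂,
        D.last_sn (D.mul_mem (hw.sn ha).mem hv.mem), D.last_sn (D.mul_mem hw.mem (hv.sn hb).mem),
        D.last₂_sn (hw.sn ha).mem hv.mem, D.last₂_sn (hv.sn hb).mem hw.mem,
        D.mul_comm' hw.mem (hv.sn hb).mem]
      simp only [map_sgn_smul₂, smul_smul, mul_comm, mul_left_comm, mul_assoc, sgn_expand]

theorem last₂_left {i j l n : ℤ} {w v : TensorCoalg R A} {a b : A} (hw : IsWord ℒ i w)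
    (ha : a ∈ ℒ j) (hv : IsWord ℒ l v) (hb : b ∈ ℒ n) :
    D.last₂ (sn w a) v b = sgn (i + j) • D.mul (sn w a) (D.last v b)
      - sgn (i + j + j * (l + n + 1)) • sn (D.mul w (D.last v b)) a := by
  cases hv with
  | one => simp [last₂_one, last_one]
  | sn hv hc =>
    rw [D.last₂_sn (hw.sn ha).mem hv.mem, D.last_sn hv.mem, map_sgn_smul,
      mulT_sn_sn _ _ ha hv.mem (D.μ_mem hc hb)]
    simp only [map_sgn_smul, map_sgn_smul₂, smul_add, smul_smul, mul_comm, mul_left_comm,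
      mul_assoc, sgn_expand, sgn_cancel]
    abel

set_option maxHeartbeats 4000000 in
theorem dT_mul {i j : ℤ} {x y : TensorCoalg R A} (hx : IsWord ℒ i x) (hy : IsWord ℒ j y) :
    D.dT (D.mul x y) = D.mul (D.dT x) y + sgn i • D.mul x (D.dT y) + ħ • D.brT x y := by
  induction hx generalizing j y with
  | one => simp [mulT_one_left, brT_one_left, dT_one]
  | @sn i l w a hw ha ih =>
    induction hy with
    | one => simp [mulT_one_right, brT_one_right, dT_one]
    | @sn j m v b hv hb ih' =>
      have hx := hw.sn ha
      have hy := hv.sn hb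
      have ih := ih hy
      have hl := D.last_mem hw ha
      have hl' := D.last_mem hv hb
      rw [D.brT_sn_sn hw.mem ha hv.mem hb, mulT_sn_sn _ w ha hv.mem hb, map_add, map_sgn_smul,
        D.dT_sn (D.mul_mem hx.mem hv.mem), D.dT_sn (D.mul_mem hw.mem hy.mem), ih, ih',
        D.last_mul hx hv, D.last_mul hw hy, D.last₂_left hw ha hv hb, D.last₂_left hv hb hw ha,
        D.last₂_sn hv.mem hw.mem, D.last₂_sn hw.mem hv.mem, D.dT_sn hw.mem, D.dT_sn hv.mem,
        D.mul_comm' hv.mem hw.mem, D.mul_comm' hy.mem hl, D.mul_comm' hv.mem hl]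
      simp only [map_add, lin_add, map_sgn_smul, map_sgn_smul₂]
      rw [mulT_sn_sn _ _ ha hv.mem hb, mulT_sn_sn _ _ (D.d_mem ha) hv.mem hb,
        mulT_sn_sn _ _ ha (D.dT_mem hv) hb, mulT_sn_sn _ _ ha hv.mem (D.d_mem hb)]
      have e : ∀ z : TensorCoalg R A, ħ • sn z (D.β a b)
          = sn z (D.μ a b) + sgn (l * m) • sn z (D.μ b a) := by
        intro z; rw [← map_smul, D.hbar_β ha hb, map_add, map_sgn_smul]
      simp only [smul_add, smul_sub, smul_comm ħ, e, map_smul, lin_smul, smul_smul, mul_comm,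
        mul_left_comm, mul_assoc, sgn_expand, sgn_cancel]
      simp only [one_smul]
      abel

end ShiftedBD

namespace ShiftedBD

variable {ℒ : ℤ → Submodule R A} (D : ShiftedBD ħ ℒ)

theorem Tgr_induction₂ {i j : ℤ} {S : Type*} [AddCommGroup S] [Module R S]
    {F F' : TensorCoalg R A →ₗ[R] TensorCoalg R A →ₗ[R] S}
    (h : ∀ {x y}, IsWord ℒ i x → IsWord ℒ j y → F x y = F' x y) {x y : TensorCoalg R A}
    (hx : x ∈ Tgr ℒ i) (hy : y ∈ Tgr ℒ j) : F x y = F' x y := by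
  have h1 : ∀ y', IsWord ℒ j y' → F x y' = F' x y' := fun y' hy' =>
    eqOn_span (f := F.flip y') (g := F'.flip y') (fun x hx => h hx hy') hx
  exact eqOn_span (f := F x) (g := F' x) (fun y hy => h1 y hy) hy

theorem brT_symm' {i j : ℤ} {x y : TensorCoalg R A} (hx : x ∈ Tgr ℒ i) (hy : y ∈ Tgr ℒ j) :
    D.brT x y = sgn (i * j) • D.brT y x :=
  Tgr_induction₂ (F' := sgn (i * j) • D.brT.flip) (fun hx hy => D.brT_symm hx hy) hx hy

theorem brT_mem' {i j : ℤ} {x y : TensorCoalg R A} (hx : x ∈ Tgr ℒ i) (hy : y ∈ Tgr ℒ j) :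
    D.brT x y ∈ Tgr ℒ (i + j + 1) := by
  have h1 : ∀ y', IsWord ℒ j y' → D.brT x y' ∈ Tgr ℒ (i + j + 1) := fun y' hy' =>
    (span_le (p := (Tgr ℒ (i + j + 1)).comap (D.brT.flip y'))).2
      (fun x hx => D.brT_mem hx hy') hx
  exact (span_le (p := (Tgr ℒ (i + j + 1)).comap (D.brT x))).2 (fun y hy => h1 y hy) hy

theorem dT_mem' {i : ℤ} {x : TensorCoalg R A} (hx : x ∈ Tgr ℒ i) : D.dT x ∈ Tgr ℒ (i + 1) :=
  (span_le (p := (Tgr ℒ (i + 1)).comap D.dT)).2 (fun _ hx => D.dT_mem hx) hx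

set_option maxHeartbeats 4000000 in
theorem brT_mul {i j t : ℤ} {x y z : TensorCoalg R A} (hx : IsWord ℒ i x) (hy : IsWord ℒ j y)
    (hz : IsWord ℒ t z) :
    D.brT x (D.mul y z) = D.mul (D.brT x y) z + sgn (j * t) • D.mul (D.brT x z) y := by
  induction hx generalizing j t y z with
  | one => simp [brT_one_left]
  | @sn i l w a hw ha ih =>
    induction hy generalizing t z with
    | one => simp [mulT_one_left, brT_one_right, mulT_one_right]
    | @sn j m v b hv hb ihy =>
      induction hz with
      | one => simp [brT_one_right, mulT_one_right]
      | @sn t n u c hu hc ihz =>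
        have hx := hw.sn ha
        have hy := hv.sn hb
        have hz := hu.sn hc
        rw [mulT_sn_sn _ v hb hu.mem hc, map_add, map_sgn_smul,
          D.brT_sn_sn hw.mem ha (D.mul_mem hy.mem hu.mem) hc,
          D.brT_sn_sn hw.mem ha (D.mul_mem hv.mem hz.mem) hb, ihz, ihy hz]
        have e := ih hy hz
        rw [mulT_sn_sn _ v hb hu.mem hc, map_add, map_sgn_smul, ← eq_sub_iff_add_eq] at e
        rw [e, D.brT_sn_sn hw.mem ha hv.mem hb, D.brT_sn_sn hw.mem ha hu.mem hc,
          D.mul_comm' hy.mem hu.mem, ← D.mul_assoc', map_sgn_smul, ← D.mul_assoc']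
        simp only [map_add, lin_add, map_sgn_smul₂]
        rw [mulT_sn_sn _ _ hb hu.mem hc, mulT_sn_sn _ _ ha hu.mem hc,
          mulT_sn_sn _ _ (D.β_mem ha hb) hu.mem hc, mulT_sn_sn _ _ hc hv.mem hb,
          mulT_sn_sn _ _ ha hv.mem hb, mulT_sn_sn _ _ (D.β_mem ha hc) hv.mem hb]
        simp only [map_add, map_sub, lin_sub, lin_add, map_sgn_smul₂, smul_add, smul_sub, smul_smul,
          mul_comm, mul_left_comm, mul_assoc, sgn_expand, sgn_cancel]
        abel

end ShiftedBD

namespace ShiftedBD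

variable {ℒ : ℤ → Submodule R A} (D : ShiftedBD ħ ℒ)

theorem last_last {i j l : ℤ} {w : TensorCoalg R A} {c a : A} (hw : IsWord ℒ i w)
    (hc : c ∈ ℒ j) (ha : a ∈ ℒ l) :
    D.last (D.last w c) a = sgn (i + 1) • D.last w (D.μ c a) := by
  cases hw with
  | one => simp [last_one]
  | sn hw he =>
    rw [D.last_sn hw.mem, D.last_sn hw.mem, map_sgn_smul₂, D.last_sn hw.mem, D.μ_μ he hc ha]
    simp only [map_neg, map_sgn_smul, smul_smul, smul_neg, sgn_add, sgn_one, Units.neg_smul,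
      mul_neg, mul_comm, sgn_cancel]

theorem dT_dT_word {i : ℤ} {x : TensorCoalg R A} (hx : IsWord ℒ i x) : D.dT (D.dT x) = 0 := by
  induction hx with
  | one => rw [dT_one, map_zero]
  | @sn i l w a hw ha ih =>
    have e : D.dT (D.last w a) + D.last (D.dT w) a + sgn i • D.last w (D.d a) = 0 := by
      cases hw with
      | one => simp [last_one, dT_one]
      | @sn i m w c hw hc =>
        rw [D.last_sn hw.mem, D.last_sn hw.mem, map_sgn_smul, D.dT_sn hw.mem, D.dT_sn hw.mem]
        simp only [map_add, lin_add, map_sgn_smul₂]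
        rw [D.last_sn (D.dT_mem hw), D.last_sn hw.mem, D.last_last hw hc ha, D.d_μ hc ha]
        simp only [map_sub, map_neg, map_sgn_smul, smul_add, smul_sub, smul_smul, sgn_add, sgn_one,
          Units.neg_smul, mul_neg, smul_neg, mul_comm, one_smul, sgn_cancel]
        abel
    rw [D.dT_sn hw.mem, map_add, map_add, D.dT_sn (D.dT_mem hw), map_sgn_smul, D.dT_sn hw.mem, ih,
      D.d_d]
    rw [add_assoc, ← eq_neg_iff_add_eq_zero] at e
    rw [e]
    simp only [map_zero, lin_zero, smul_add, sgn_add, sgn_one, Units.neg_smul, mul_neg, smul_zero,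
      sgn_cancel]
    abel

theorem dT_dT (x : TensorCoalg R A) : D.dT (D.dT x) = 0 := by
  have h := hom_ext_gens (𝒢 := fun i => {x | IsWord ℒ i x}) (F := D.dT ∘ₗ D.dT) (G := 0)
    (Tgr_isInternal D.isInternal) (fun i => rfl) fun i x hx => D.dT_dT_word hx
  exact LinearMap.congr_fun h x

theorem last_brT {i j l m : ℤ} {w v : TensorCoalg R A} {a b : A} (hw : IsWord ℒ i w)
    (ha : a ∈ ℒ j) (hv : IsWord ℒ l v) (hb : b ∈ ℒ m) :
    D.last (D.brT (sn w a) v) b = sgn (i + j + 1) • D.brT (sn w a) (D.last v b)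
      + sgn (i + j + j * (l + m + 1)) • sn (D.brT w (D.last v b)) a
      + sgn (j * l + i + l + 1) • sn (D.brT w v) (D.μ a b)
      - sgn (j * l + l + i) • D.last₂ w v (D.β a b) := by
  cases hv with
  | one => simp [last_one, brT_one_right, last₂_one]
  | @sn l n v c hv hc =>
    rw [D.brT_sn_sn hw.mem ha hv.mem hc, D.last_sn hv.mem, D.last₂_sn hw.mem hv.mem, map_sgn_smul,
      D.brT_sn_sn hw.mem ha hv.mem (D.μ_mem hc hb), D.β_μ ha hc hb]
    simp only [map_add, lin_add, map_sgn_smul₂]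
    rw [D.last_sn (D.brT_mem (hw.sn ha) hv), D.last_sn (D.brT_mem hw (hv.sn hc)),
      D.last_sn (D.mul_mem hw.mem hv.mem)]
    simp only [map_sub, map_neg, map_sgn_smul, map_sgn_smul₂, smul_add, smul_sub, smul_smul,
      sgn_one, Units.neg_smul, mul_neg, neg_neg, smul_neg, mul_comm, mul_left_comm, mul_assoc,
      sgn_expand, sgn_cancel]
    abel

set_option maxHeartbeats 4000000 in
theorem dT_brT {i j : ℤ} {x y : TensorCoalg R A} (hx : IsWord ℒ i x) (hy : IsWord ℒ j y) :
    D.dT (D.brT x y) = - D.brT (D.dT x) y - sgn i • D.brT x (D.dT y) := by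
  induction hx generalizing j y with
  | one => simp [brT_one_left, dT_one]
  | @sn i l w a hw ha ih =>
    induction hy with
    | one => simp [brT_one_right, dT_one]
    | @sn j m v b hv hb ih' =>
      have hx := hw.sn ha
      have hy := hv.sn hb
      have hl := D.last_mem hw ha
      have e₂ : D.last (D.brT w (sn v b)) a
          = sgn (i * (j + m)) • D.last (D.brT (sn v b) w) a := by
        rw [D.brT_symm hw hy, map_sgn_smul₂]
      rw [D.brT_sn_sn hw.mem ha hv.mem hb, map_add, map_add, map_sgn_smul, map_sgn_smul,
        D.dT_sn (D.brT_mem hx hv), D.dT_sn (D.brT_mem hw hy), D.dT_sn (D.mul_mem hw.mem hv.mem),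
        ih hy, ih', D.dT_mul hw hv, D.last_mul hw hv, D.last_brT hw ha hv hb, e₂,
        D.last_brT hv hb hw ha, D.dT_sn hw.mem, D.dT_sn hv.mem, D.brT_symm' hy.mem hl,
        D.brT_symm' hv.mem hl, D.brT_symm hv hw, D.β_symm hb ha, D.d_β ha hb]
      simp only [map_add, lin_add, map_sgn_smul, map_sgn_smul₂]
      rw [D.brT_sn_sn (D.dT_mem hw) ha hv.mem hb, D.brT_sn_sn hw.mem (D.d_mem ha) hv.mem hb,
        D.brT_sn_sn hw.mem ha (D.dT_mem hv) hb, D.brT_sn_sn hw.mem ha hv.mem (D.d_mem hb)]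
      have e : ∀ z : TensorCoalg R A, sn (ħ • z) (D.β a b)
          = sn z (D.μ a b) + sgn (l * m) • sn z (D.μ b a) := by
        intro z; rw [map_smul, lin_smul, ← map_smul, D.hbar_β ha hb, map_add, map_sgn_smul]
      simp only [map_add, map_sub, map_neg, lin_sub, lin_neg, lin_add, map_sgn_smul, map_sgn_smul₂,
        smul_add, smul_sub, e, smul_smul, sgn_one, Units.neg_smul, mul_neg, neg_neg, smul_neg,
        mul_comm, mul_left_comm, mul_assoc, neg_add, sgn_expand, sgn_cancel]
      simp only [one_smul]
      abel

end ShiftedBD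

namespace ShiftedBD

variable {ℒ : ℤ → Submodule R A} (D : ShiftedBD ħ ℒ)

theorem brT_mul_left {i j t : ℤ} {x y z : TensorCoalg R A} (hx : IsWord ℒ i x)
    (hy : IsWord ℒ j y) (hz : IsWord ℒ t z) :
    D.brT (D.mul y z) x = sgn (i * t) • D.mul (D.brT y x) z
      + sgn (i * j + j * t) • D.mul (D.brT z x) y := by
  rw [D.brT_symm' (D.mul_mem hy.mem hz.mem) hx.mem, D.brT_mul hx hy hz, D.brT_symm hx hy,
    D.brT_symm hx hz]
  simp only [map_sgn_smul₂, smul_add, smul_smul, mul_comm, mul_left_comm, mul_assoc, sgn_expand,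
    sgn_cancel]

set_option maxHeartbeats 8000000 in
theorem brT_jacobi {i j t : ℤ} {x y z : TensorCoalg R A} (hx : IsWord ℒ i x) (hy : IsWord ℒ j y)
    (hz : IsWord ℒ t z) :
    D.brT (D.brT x y) z + sgn (j * t) • D.brT (D.brT x z) y
      + sgn (i * (j + t)) • D.brT (D.brT y z) x = 0 := by
  induction hx generalizing j t y z with
  | one => simp [brT_one_left, brT_one_right]
  | @sn i l w a hw ha ih =>
    induction hy generalizing t z with
    | one => simp [brT_one_left, brT_one_right]
    | @sn j m v b hv hb ihy =>
      induction hz with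
      | one => simp [brT_one_right]
      | @sn t n u c hu hc ihz =>
        have hx := hw.sn ha
        have hy := hv.sn hb
        have hz := hu.sn hc
        have h1 := congrArg (fun r => sn r c) ihz
        have h2 := congrArg (fun r => sgn (m * (t + n)) • sn r b) (ihy hz)
        have h3 := congrArg (fun r => sgn (l * (j + m + t + n)) • sn r a) (ih hy hz)
        have h4 := congrArg (fun r => sgn (i + j + l * j + i + j + t + (l + m + 1) * t) •
          sn (D.mul (D.mul w v) u) r) (D.jacobi ha hb hc)
        have e1 : D.mul (D.mul w u) v = sgn (j * t) • D.mul (D.mul w v) u := by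
          rw [mul_assoc', D.mul_comm' hu.mem hv.mem, map_sgn_smul, ← mul_assoc', mul_comm t j]
        have e2 : D.mul (D.mul v u) w = sgn (i * (j + t)) • D.mul (D.mul w v) u := by
          rw [D.mul_comm' (D.mul_mem hv.mem hu.mem) hw.mem, ← mul_assoc', mul_comm i]
        have f1 := D.brT_symm hu hy
        have f2 := D.brT_symm hv hx
        have f3 := D.brT_symm hu hx
        rw [D.brT_sn_sn hw.mem ha hv.mem hb, D.brT_sn_sn hw.mem ha hu.mem hc,
          D.brT_sn_sn hv.mem hb hu.mem hc] at *
        refine Eq.trans ?_ (congrArg₂ (· + ·) (congrArg₂ (· + ·) (congrArg₂ (· + ·) h1 h2) h3) h4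
          |>.trans (by simp))
        simp only [map_add, lin_add, map_sgn_smul, map_sgn_smul₂]
        have bxv := D.brT_mem hx hv
        have bwy := D.brT_mem hw hy
        have bxu := D.brT_mem hx hu
        have bwz := D.brT_mem hw hz
        have byu := D.brT_mem hy hu
        have bvz := D.brT_mem hv hz
        rw [D.brT_sn_sn bxv hb hu.mem hc, D.brT_sn_sn bwy ha hu.mem hc,
          D.brT_sn_sn (D.mul_mem hw.mem hv.mem) (D.β_mem ha hb) hu.mem hc,
          D.brT_sn_sn bxu hc hv.mem hb, D.brT_sn_sn bwz ha hv.mem hb,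
          D.brT_sn_sn (D.mul_mem hw.mem hu.mem) (D.β_mem ha hc) hv.mem hb,
          D.brT_sn_sn byu hc hw.mem ha, D.brT_sn_sn bvz hb hw.mem ha,
          D.brT_sn_sn (D.mul_mem hv.mem hu.mem) (D.β_mem hb hc) hw.mem ha, D.brT_mul_left hz hw hv,
          D.brT_mul_left hy hw hu, D.brT_mul_left hx hv hu, f1, f2, f3, e1, e2, D.β_symm hb ha,
          D.β_symm hc ha, D.β_symm hc hb]
        simp only [map_add, lin_add, map_sgn_smul, map_sgn_smul₂]
        simp only [smul_add, smul_smul]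
        simp only [sgn_one, mul_neg, neg_mul, mul_one, one_mul, Units.neg_smul, sgn_expand]
        simp only [sgn_mul_sgn_assoc]
        simp only [sgn_cancel, sgn_sort]
        abel

end ShiftedBD

section Shift

theorem isInternal_shift (h : DirectSum.IsInternal 𝒜) :
    DirectSum.IsInternal (fun i => 𝒜 (i + 1)) := by
  rw [DirectSum.isInternal_submodule_iff_iSupIndep_and_iSup_eq_top] at h ⊢
  exact ⟨h.1.comp (add_left_injective 1),
    ((Equiv.addRight (1 : ℤ)).iSup_comp (g := 𝒜)).trans h.2⟩

/-- The operation `(-1)^{|a| - 1} m(a, b)`. -/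
def shiftOp (h : DirectSum.IsInternal 𝒜) (m : A →ₗ[R] A →ₗ[R] A) : A →ₗ[R] A →ₗ[R] A :=
  -(m ∘ₗ signMap h 1)

theorem shiftOp_apply (h : DirectSum.IsInternal 𝒜) (m : A →ₗ[R] A →ₗ[R] A) {i : ℤ} {a : A}
    (ha : a ∈ 𝒜 (i + 1)) (b : A) : shiftOp h m a b = sgn i • m a b := by
  rw [shiftOp, lin_neg, lin_neg, comp_apply, signMap_apply _ _ ha, map_sgn_smul₂, one_mul, sgn_add,
    sgn_one, mul_neg, mul_one, Units.neg_smul, neg_neg]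

/-- The shifted operations of a `BD₁`-algebra. -/
def BD1Algebra.shifted (alg : BD1Algebra ħ 𝒜) : ShiftedBD ħ (fun i => 𝒜 (i + 1)) where
  isInternal := isInternal_shift alg.isInternal
  d := alg.d
  μ := shiftOp alg.isInternal alg.mul
  β := shiftOp alg.isInternal alg.bracket
  d_mem := fun h => alg.d_mem h
  μ_mem := by
    intro i j a b ha hb
    rw [shiftOp_apply _ _ ha]
    convert sgn_smul_mem _ _ (alg.mul_mem ha hb) using 2
    ring
  β_mem := by
    intro i j a b ha hb
    rw [shiftOp_apply _ _ ha]
    convert sgn_smul_mem _ _ (alg.bracket_mem ha hb) using 2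
    ring
  d_d := alg.d_d
  d_μ := by
    intro i j a b ha hb
    rw [shiftOp_apply _ _ ha, shiftOp_apply _ _ ha, shiftOp_apply _ _ (alg.d_mem ha), map_sgn_smul,
      alg.d_mul ha hb]
    simp only [smul_add, smul_smul, sgn_add, sgn_one, mul_neg, Units.neg_smul, smul_neg, neg_neg,
      one_smul, sgn_cancel]
    abel
  μ_μ := by
    intro i j l a b c ha hb hc
    rw [shiftOp_apply _ _ ha, shiftOp_apply _ _ ha, shiftOp_apply _ _ hb,
      shiftOp_apply (i := i + j + 1) _ _ (sgn_smul_mem _ _ (by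
        convert alg.mul_mem ha hb using 2; ring)), map_sgn_smul₂, map_sgn_smul,
      alg.mul_assoc ha hb hc]
    simp only [smul_smul, sgn_add, sgn_one, mul_neg, Units.neg_smul, mul_comm, _root_.mul_assoc,
      sgn_cancel]
  β_symm := by
    intro i j a b ha hb
    rw [shiftOp_apply _ _ ha, shiftOp_apply _ _ hb, alg.bracket_antisymm ha hb]
    simp only [smul_smul, sgn_one, mul_neg, Units.neg_smul, neg_neg, mul_comm, sgn_expand,
      sgn_cancel]
  jacobi := by
    intro i j l a b c ha hb hc
    have m : ∀ {i j : ℤ} {a b : A} (s : ℤ), a ∈ 𝒜 (i + 1) → b ∈ 𝒜 (j + 1) →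
        sgn s • alg.bracket a b ∈ 𝒜 (i + j + 1 + 1) := fun s ha hb => sgn_smul_mem _ _ (by
        convert alg.bracket_mem ha hb using 2; ring)
    rw [shiftOp_apply _ _ ha, shiftOp_apply _ _ ha, shiftOp_apply _ _ hb,
      shiftOp_apply _ _ (m _ ha hb), shiftOp_apply _ _ (m _ ha hc), shiftOp_apply _ _ (m _ hb hc)]
    have e := alg.jacobi ha hb hc
    rw [alg.bracket_antisymm ha (alg.bracket_mem hb hc),
      alg.bracket_antisymm hb (alg.bracket_mem ha hc)] at e
    rw [← eq_sub_iff_add_eq'] at *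
    rw [← sub_eq_iff_eq_add] at e
    simp only [map_sgn_smul₂]
    rw [← e]
    simp only [smul_smul, smul_neg, smul_sub, sgn_one, mul_neg, Units.neg_smul, neg_neg, mul_comm,
      mul_left_comm, _root_.mul_assoc, sgn_expand, sgn_cancel]
    abel
  d_β := by
    intro i j a b ha hb
    rw [shiftOp_apply _ _ ha, shiftOp_apply _ _ ha, shiftOp_apply _ _ (alg.d_mem ha), map_sgn_smul,
      alg.d_bracket ha hb]
    simp only [smul_add, smul_smul, sgn_add, sgn_one, mul_neg, Units.neg_smul, smul_neg, neg_neg,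
      one_smul, sgn_cancel]
    abel
  hbar_β := by
    intro i j a b ha hb
    rw [shiftOp_apply _ _ ha, shiftOp_apply _ _ ha, shiftOp_apply _ _ hb, smul_comm,
      alg.hbar_bracket ha hb]
    simp only [smul_smul, smul_add, sgn_one, mul_neg, sub_eq_add_neg, Units.neg_smul, neg_neg,
      mul_comm, sgn_expand, sgn_cancel]
  β_μ := by
    intro i j l a b c ha hb hc
    rw [shiftOp_apply _ _ ha, shiftOp_apply _ _ ha, shiftOp_apply _ _ ha, shiftOp_apply _ _ hb,
      shiftOp_apply _ _ hb, shiftOp_apply (i := i + j + 1) _ _ (sgn_smul_mem _ _ (by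
        convert alg.bracket_mem ha hb using 2; ring)), map_sgn_smul₂, map_sgn_smul, map_sgn_smul,
      alg.bracket_mul ha hb hc]
    simp only [smul_smul, smul_neg, smul_add, sgn_one, mul_neg, sub_eq_add_neg, Units.neg_smul,
      neg_neg, mul_comm, mul_left_comm, _root_.mul_assoc, sgn_expand, sgn_cancel]

end Shift

theorem jacobi_span (br : V →ₗ[R] V →ₗ[R] V) (s s' : ℤˣ) {X Y Z : Set V}
    (h : ∀ x ∈ X, ∀ y ∈ Y, ∀ z ∈ Z, br (br x y) z + s • br (br x z) y + s' • br (br y z) x = 0)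
    {x y z : V} (hx : x ∈ Submodule.span R X) (hy : y ∈ Submodule.span R Y)
    (hz : z ∈ Submodule.span R Z) :
    br (br x y) z + s • br (br x z) y + s' • br (br y z) x = 0 := by
  have h1 : ∀ x ∈ X, ∀ y ∈ Y, br (br x y) z + s • br (br x z) y + s' • br (br y z) x = 0 := by
    intro x hx y hy
    exact eqOn_span (f := br (br x y) + s • br.flip y ∘ₗ br x + s' • br.flip x ∘ₗ br y)
      (g := 0) (fun z hz => h x hx y hy z hz) hz
  have h2 : ∀ x ∈ X, br (br x y) z + s • br (br x z) y + s' • br (br y z) x = 0 := by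
    intro x hx
    exact eqOn_span (f := br.flip z ∘ₗ br x + s • br (br x z)
      + s' • br.flip x ∘ₗ br.flip z) (g := 0) (fun y hy => h1 x hx y hy) hy
  exact eqOn_span (f := br.flip z ∘ₗ br.flip y + s • br.flip y ∘ₗ br.flip z
    + s' • br (br y z)) (g := 0) (fun x hx => h2 x hx) hx

namespace ShiftedBD

variable {ℒ : ℤ → Submodule R A} (D : ShiftedBD ħ ℒ)

theorem eqOn_Tgr {i : ℤ} {S : Type*} [AddCommMonoid S] [Module R S]
    {F F' : TensorCoalg R A →ₗ[R] S} (h : ∀ {x}, IsWord ℒ i x → F x = F' x) {x : TensorCoalg R A}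
    (hx : x ∈ Tgr ℒ i) : F x = F' x :=
  eqOn_span (s := {x | IsWord ℒ i x}) (fun _ hx => h hx) hx

theorem brT_jacobi' {i j t : ℤ} {x y z : TensorCoalg R A} (hx : x ∈ Tgr ℒ i) (hy : y ∈ Tgr ℒ j)
    (hz : z ∈ Tgr ℒ t) :
    D.brT (D.brT x y) z + sgn (j * t) • D.brT (D.brT x z) y
      + sgn (i * (j + t)) • D.brT (D.brT y z) x = 0 :=
  jacobi_span D.brT _ _ (fun _ hx _ hy _ hz => D.brT_jacobi hx hy hz) hx hy hz

theorem brT_mul' {i j t : ℤ} {x y z : TensorCoalg R A} (hx : x ∈ Tgr ℒ i) (hy : y ∈ Tgr ℒ j)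
    (hz : z ∈ Tgr ℒ t) :
    D.brT x (D.mul y z) = D.mul (D.brT x y) z + sgn (j * t) • D.mul (D.brT x z) y :=
  eqOn_Tgr (F := D.brT.flip (D.mul y z)) (F' := D.mul.flip z ∘ₗ D.brT.flip y
    + sgn (j * t) • D.mul.flip y ∘ₗ D.brT.flip z) (fun {x} hx =>
    eqOn_Tgr (F := D.brT x ∘ₗ D.mul.flip z) (F' := D.mul.flip z ∘ₗ D.brT x
      + sgn (j * t) • D.mul (D.brT x z)) (fun {y} hy =>
      eqOn_Tgr (F := D.brT x ∘ₗ D.mul y) (F' := D.mul (D.brT x y)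
        + sgn (j * t) • D.mul.flip y ∘ₗ D.brT x) (fun hz => D.brT_mul hx hy hz) hz) hy) hx

theorem dT_mul' {i j : ℤ} {x y : TensorCoalg R A} (hx : x ∈ Tgr ℒ i) (hy : y ∈ Tgr ℒ j) :
    D.dT (D.mul x y) = D.mul (D.dT x) y + sgn i • D.mul x (D.dT y) + ħ • D.brT x y :=
  eqOn_Tgr (F := D.dT ∘ₗ D.mul.flip y) (F' := D.mul.flip y ∘ₗ D.dT + sgn i • D.mul.flip (D.dT y)
    + ħ • D.brT.flip y) (fun {x} hx =>
    eqOn_Tgr (F := D.dT ∘ₗ D.mul x) (F' := D.mul (D.dT x) + sgn i • D.mul x ∘ₗ D.dT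
      + ħ • D.brT x) (fun hy => D.dT_mul hx hy) hy) hx

theorem dT_brT' {i j : ℤ} {x y : TensorCoalg R A} (hx : x ∈ Tgr ℒ i) (hy : y ∈ Tgr ℒ j) :
    D.dT (D.brT x y) = - D.brT (D.dT x) y - sgn i • D.brT x (D.dT y) :=
  eqOn_Tgr (F := D.dT ∘ₗ D.brT.flip y) (F' := - D.brT.flip y ∘ₗ D.dT
    - sgn i • D.brT.flip (D.dT y)) (fun {x} hx =>
    eqOn_Tgr (F := D.dT ∘ₗ D.brT x) (F' := - D.brT (D.dT x) - sgn i • D.brT x ∘ₗ D.dT)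
      (fun hy => D.dT_brT hx hy) hy) hx

/-- The bar complex of a `BD₁`-algebra is a `BD₀`-algebra. -/
def barT : BD0Algebra ħ (Tgr ℒ) where
  toGCAlgebra := shuffleGC D.isInternal
  d := D.dT
  bracket := D.brT
  d_mem := D.dT_mem'
  bracket_mem := D.brT_mem'
  d_d := D.dT_dT
  bracket_symm := D.brT_symm'
  jacobi := D.brT_jacobi'
  d_bracket := D.dT_brT'
  d_mul := D.dT_mul'
  bracket_mul := D.brT_mul'

end ShiftedBD

section BD0

variable (B : BD0Algebra ħ 𝒱)

theorem BD0Algebra.bracket_one (x : V) : B.bracket x B.one = 0 := by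
  have h : B.bracket.flip B.one = 0 := hom_ext B.isInternal fun i x hx => by
    have e := B.bracket_mul hx B.one_mem B.one_mem
    rw [B.one_mul, B.toGCAlgebra.mul_one, mul_zero, sgn_zero, one_smul] at e
    simpa using e
  exact LinearMap.congr_fun h x

theorem BD0Algebra.d_one : B.d B.one = 0 := by
  have e := B.d_mul B.one_mem B.one_mem
  rw [B.one_mul, B.toGCAlgebra.mul_one, B.one_mul, sgn_zero, one_smul, B.bracket_one, smul_zero,
    add_zero] at e
  simpa using e

theorem BD0Algebra.bracket_mul_left (x : V) {j l : ℤ} {y z : V} (hy : y ∈ 𝒱 j) (hz : z ∈ 𝒱 l) :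
    B.bracket x (B.mul y z)
      = B.mul (B.bracket x y) z + sgn (j * l) • B.mul (B.bracket x z) y := by
  have h : B.bracket.flip (B.mul y z) = B.mul.flip z ∘ₗ B.bracket.flip y
      + sgn (j * l) • B.mul.flip y ∘ₗ B.bracket.flip z :=
    hom_ext B.isInternal fun i x hx => B.bracket_mul hx hy hz
  exact LinearMap.congr_fun h x

theorem BD0Algebra.ops_isHDiffOp : IsHDiffOp ħ B.toGCAlgebra 1 B.ops where
  mem := by
    rintro (_ | _ | _ | k) e b hb
    · exact zero_mem _
    · have h : B.d (b 0) ∈ 𝒱 (1 + ∑ i, e i) := by simpa [add_comm] using B.d_mem (hb 0)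
      exact h
    · have h : B.bracket (b 0) (b 1) ∈ 𝒱 (1 + ∑ i, e i) := by
        simpa [Fin.sum_univ_two, add_comm] using B.bracket_mem (hb 0) (hb 1)
      exact h
    · exact zero_mem _
  symm := by
    rintro (_ | _ | _ | k) e b hb s t hst
    · exact s.elim0
    · omega
    · obtain rfl : s = 0 := Fin.ext (by have := t.2; simp only [Fin.val_zero]; omega)
      obtain rfl : t = 1 := Fin.ext (by simpa using hst)
      exact (B.bracket_symm (hb 1) (hb 0)).trans (by rw [mul_comm]; rfl)
    · exact (smul_zero _).symm
  leibniz := by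
    rintro (_ | _ | k) b i j x y hx hy
    · have := B.d_mul hx hy
      have e := B.toGCAlgebra.mul_comm hx (B.d_mem hy)
      rw [e, smul_smul, mul_add, sgn_add, mul_one, mul_comm (sgn (i * j)), sgn_mul_cancel] at this
      exact this
    · refine (B.bracket_mul_left (b 0) hx hy).trans ?_
      change _ = _ + ħ • (0 : V)
      rw [smul_zero, add_zero]
      rfl
    · change (0 : V) = B.mul 0 y + sgn (i * j) • B.mul 0 x + ħ • 0
      simp
  map_one := by
    rintro (_ | _ | k) b
    · exact B.d_one
    · exact B.bracket_one _
    · rfl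

theorem insL_eq_zero {P : Ops R V} (h : ∀ b, cur P b = 0) (q : ℤ) (Q : Ops R V)
    (β : List (ℤ × V)) : insL q P Q β = 0 := by
  induction β generalizing P q Q with
  | nil => rw [insL, evl_cons, h, evl_zero]
  | cons x β ih =>
    rw [insL, ih h, h, ih (fun b => by rw [map_zero]; rfl), smul_zero, add_zero]

theorem insL_zero_right (P : Ops R V) (q : ℤ) (β : List (ℤ × V)) : insL q P 0 β = 0 := by
  induction β generalizing P q with
  | nil => rw [insL, evl_zero, evl_cons, map_zero, evl_zero]
  | cons x β ih => rw [insL, map_zero, lin_zero, ih, ih, smul_zero, add_zero]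

theorem BD0Algebra.cur_ops (x y z : V) : cur (cur (cur B.ops x) y) z = 0 := rfl

theorem BD0Algebra.brL_ops {β : List (ℤ × V)} (hβ : HomList 𝒱 β) : brL 1 1 B.ops B.ops β = 0 := by
  have h0 : evl B.ops [] = 0 := rfl
  have h1 : ∀ x, evl B.ops [x] = B.d x := fun _ => rfl
  have h2 : ∀ x y, evl B.ops [x, y] = B.bracket x y := fun _ _ => rfl
  have h3 : ∀ q x y Q β, insL q (cur (cur B.ops x) y) Q β = 0 := fun q x y Q β =>
    insL_eq_zero (B.cur_ops x y) q Q β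
  simp only [evl_cons] at h1 h2
  suffices insL 1 B.ops B.ops β = 0 by rw [brL_eq_insL, this, smul_zero, sub_zero]
  rcases β with _ | ⟨x, _ | ⟨y, _ | ⟨z, _ | ⟨t, β⟩⟩⟩⟩
  · simp [insL, h0]
  · simp [insL, h0, h1, B.d_d]
  · simp only [HomList.cons_iff] at hβ
    obtain ⟨hx, hy, -⟩ := hβ
    simp only [insL, evl_cons, h0, h1, h2, smul_zero, add_zero, B.cur_ops, evl_zero]
    rw [B.d_bracket hx hy, B.bracket_symm hy (B.d_mem hx)]
    simp only [smul_smul, one_smul, sgn_expand, sgn_cancel, sgn_sort]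
    abel
  · simp only [HomList.cons_iff] at hβ
    obtain ⟨hx, hy, hz, -⟩ := hβ
    simp only [insL, evl_cons, h0, h1, h2, smul_zero, add_zero, map_zero, B.cur_ops, evl_zero,
      zero_add]
    have e := B.jacobi hx hy hz
    rw [B.bracket_symm hx (B.bracket_mem hy hz), B.bracket_symm hy (B.bracket_mem hx hz),
      B.bracket_symm hz (B.bracket_mem hx hy)]
    simp only [smul_smul, one_smul, sgn_expand, sgn_cancel, sgn_sort] at e ⊢
    rw [← e]
  · have h4 : ∀ (q : ℤ) (Q : Ops R V) (β : List (ℤ × V)), insL q 0 Q β = 0 := fun q Q β =>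
      insL_eq_zero (fun b => by rw [map_zero]; rfl) q Q β
    simp only [insL, h3, h4, B.cur_ops, insL_zero_right, smul_zero, add_zero, map_zero, lin_zero]

end BD0

end

section

variable {R : Type*} [CommRing R] {ħ : R} {T Y Y' V L : Type*} [AddCommGroup T] [Module R T]
  [AddCommGroup Y] [Module R Y] [AddCommGroup Y'] [Module R Y'] [AddCommGroup V] [Module R V]
  [AddCommGroup L] [Module R L] {𝒯 : ℤ → Submodule R T} {𝒴 : ℤ → Submodule R Y}
  {𝒴' : ℤ → Submodule R Y'} {𝒱 : ℤ → Submodule R V} {ℒ : ℤ → Submodule R L} {G : GCAlgebra 𝒱}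
  {GT : GCAlgebra 𝒯} {GY : GCAlgebra 𝒴} {GY' : GCAlgebra 𝒴'}

section Prd

variable (G)

variable (ħ) in
/-- The product on a list of arguments as a linear map of the first factor. -/
def prdLₗ (q : ℤ) (Q : Ops R V) (β : List (ℤ × V)) : Ops R V →ₗ[R] V where
  toFun P := prdL ħ G q P Q β
  map_add' P P' := by
    induction β generalizing q P P' Q with
    | nil =>
      simp only [prdL, evl_cons, evl_add, map_add, smul_add, lin_add]; abel
    | cons x β ih =>
      simp only [prdL, map_add, lin_add, ih, smul_add]; abel
  map_smul' r P := by
    simp only [RingHom.id_apply]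
    induction β generalizing q P Q with
    | nil =>
      simp only [prdL, evl_cons, evl_smul, map_smul, smul_add, lin_smul, smul_comm ħ]
    | cons x β ih =>
      simp only [prdL, map_smul, lin_smul, ih, smul_add, smul_comm r]

theorem prdLₗ_apply (q : ℤ) (P Q : Ops R V) (β : List (ℤ × V)) :
    prdLₗ ħ G q Q β P = prdL ħ G q P Q β := rfl

end Prd

section Wing

/-- Subalgebras `T` and `Y` of a graded commutative algebra `V`, and a derivation `V → L ⊗ V` which
vanishes on `Y` and restricts to a derivation `T → L ⊗ T`. -/
structure Wing (ħ : R) (GT : GCAlgebra 𝒯) (GY : GCAlgebra 𝒴) (G : GCAlgebra 𝒱)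
    (ℒ : ℤ → Submodule R L) where
  eT : OpEmb ħ GT G
  eY : OpEmb ħ GY G
  kills_T : ∀ t, eY.Kills (eT.j t)
  kills_Y : ∀ y, eT.Kills (eY.j y)
  hL : DirectSum.IsInternal ℒ
  δ : T →ₗ[R] L ⊗[R] T
  δ_mem : ∀ {i t}, t ∈ 𝒯 i → δ t ∈ tgr ℒ 𝒯 i
  D : V →ₗ[R] L ⊗[R] V
  isDeriv : IsDeriv ℒ G D
  D_Y : ∀ y, D (eY.j y) = 0
  D_T : ∀ t, D (eT.j t) = eT.j.lTensor L (δ t)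

theorem OpEmb.curFam_ι (E : OpEmb ħ GY G) (hL : DirectSum.IsInternal ℒ) {i : ℤ} {y : Y}
    (hy : y ∈ 𝒴 i) (φ : L →ₗ[R] Ops R Y) :
    curFam hL G.isInternal cur (E.j y) (E.ι ∘ₗ φ)
      = E.ι ∘ₗ curFam hL GY.isInternal cur y φ := by
  refine hom_ext hL fun l a ha => ?_
  rw [curFam_apply hL _ _ (E.j_mem hy) ha, comp_apply, comp_apply, curFam_apply hL _ _ hy ha,
    E.ι_cur, map_sgn_smul]

theorem IsFam.ι (E : OpEmb ħ GY G) {d : ℤ} {φ : L →ₗ[R] Ops R Y} (h : IsFam ℒ ħ GY d φ) :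
    IsFam ℒ ħ G d (E.ι ∘ₗ φ) := fun ha => E.ι_hd (h ha)

namespace Wing

variable (W : Wing ħ GT GY G ℒ)

/-- The operation `P ⋆ t`. -/
def S (P : Ops R Y) (t : T) : Ops R V := star ħ G (W.eY.ι P) (W.eT.j t)

/-- The operation `∑ φ(a) ⋆ t` for `∑ a ⊗ t ∈ L ⊗ T`. -/
def F (φ : L →ₗ[R] Ops R Y) (x : L ⊗[R] T) : Ops R V :=
  starSum ħ G (W.eY.ι ∘ₗ φ) (W.eT.j.lTensor L x)

/-- The operation `∑ φ(a) ∂_a`. -/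
def Φ (φ : L →ₗ[R] Ops R Y) : Ops R V := phi ħ W.hL G W.D (W.eY.ι ∘ₗ φ)

/-- A list of arguments from `Y`. -/
abbrev yl (β : List (ℤ × Y)) : List (ℤ × V) := β.map fun x => (x.1, W.eY.j x.2)

theorem F_tmul (φ : L →ₗ[R] Ops R Y) (a : L) (t : T) : W.F φ (a ⊗ₜ t) = W.S (φ a) t := rfl

theorem F_add (φ : L →ₗ[R] Ops R Y) (x y : L ⊗[R] T) : W.F φ (x + y) = W.F φ x + W.F φ y := by
  simp only [F, map_add]

theorem F_smul (φ : L →ₗ[R] Ops R Y) (r : R) (x : L ⊗[R] T) : W.F φ (r • x) = r • W.F φ x := by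
  simp only [F, map_smul]

theorem F_zero (φ : L →ₗ[R] Ops R Y) : W.F φ 0 = 0 := by
  simp only [F, map_zero]

variable {W}

theorem S_hd {p j : ℤ} {P : Ops R Y} (hP : IsHDiffOp ħ GY p P) {t : T} (ht : t ∈ 𝒯 j) :
    IsHDiffOp ħ G (p + j) (W.S P t) := (W.eY.ι_hd hP).star (W.eT.j_mem ht)

theorem cur_S_Y {i j : ℤ} {y : Y} (hy : y ∈ 𝒴 i) {t : T} (ht : t ∈ 𝒯 j) (P : Ops R Y) :
    cur (W.S P t) (W.eY.j y) = sgn (i * j) • W.S (cur P y) t := by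
  rw [S, cur_star ħ G (W.eY.j_mem hy) (W.eT.j_mem ht), W.eY.ι_cur, S]

theorem cur_S_of_kills {i j p : ℤ} {P : Ops R Y} (hP : IsHDiffOp ħ GY p P) {t : T} (ht : t ∈ 𝒯 j)
    {z : V} (hz : z ∈ 𝒱 i) (h : W.eY.Kills z) : cur (W.S P t) z = 0 := by
  rw [S, cur_star ħ G hz (W.eT.j_mem ht), h hP, map_zero, lin_zero, smul_zero]

theorem cur_S_T {i j p : ℤ} {P : Ops R Y} (hP : IsHDiffOp ħ GY p P) {t t' : T} (ht : t ∈ 𝒯 j)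
    (ht' : t' ∈ 𝒯 i) : cur (W.S P t) (W.eT.j t') = 0 :=
  cur_S_of_kills hP ht (W.eT.j_mem ht') (W.kills_T t')

theorem S_nil {p : ℤ} {P : Ops R Y} (hP : IsHDiffOp ħ GY p P) (t : T) :
    evl (W.S P t) [] = G.mul (W.eY.j (evl P [])) (W.eT.j t) := by
  rw [S, star_nil, W.eY.ι_nil, evl_cons, W.kills_T t hP, evl_zero, smul_zero, add_zero]

theorem S_one_mul {p i j j' : ℤ} {P : Ops R Y} (hP : IsHDiffOp ħ GY p P) {y : Y} (hy : y ∈ 𝒴 i)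
    {t t' : T} (ht : t ∈ 𝒯 j) (ht' : t' ∈ 𝒯 j') :
    evl (W.S P t) [G.mul (W.eY.j y) (W.eT.j t')]
      = sgn (i * j) • G.mul (W.eY.j (evl P [y])) (W.eT.j (GT.mul t t')) := by
  rw [(S_hd hP ht).leib (W.eY.j_mem hy) (W.eT.j_mem ht')]
  simp only [evl_cons]
  rw [cur_S_Y hy ht, cur_S_T hP ht ht', map_sgn_smul₂, cur_S_T (hP.cur hy) ht ht', smul_zero,
    evl_zero, evl_sgn, S_nil (hP.cur hy), map_zero, lin_zero, smul_zero, smul_zero, add_zero,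
    add_zero, map_sgn_smul₂, G.mul_assoc, W.eT.j_mul]

theorem cur_Φ_Y {i : ℤ} {y : Y} (hy : y ∈ 𝒴 i) (φ : L →ₗ[R] Ops R Y) :
    cur (W.Φ φ) (W.eY.j y) = W.Φ (curFam W.hL GY.isInternal cur y φ) := by
  rw [Φ, cur_phi, W.D_Y, map_zero, add_zero, W.eY.curFam_ι W.hL hy, Φ]

theorem curFam_of_kills {d i : ℤ} {φ : L →ₗ[R] Ops R Y} (hφ : IsFam ℒ ħ GY d φ) {z : V}
    (hz : z ∈ 𝒱 i) (h : W.eY.Kills z) :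
    curFam W.hL G.isInternal cur z (W.eY.ι ∘ₗ φ) = 0 := by
  refine hom_ext W.hL fun l a ha => ?_
  rw [curFam_apply W.hL _ _ hz ha, comp_apply, h (hφ ha), smul_zero, lin_zero]

theorem cur_Φ_of_kills {d i : ℤ} {φ : L →ₗ[R] Ops R Y} (hφ : IsFam ℒ ħ GY d φ) {z : V}
    (hz : z ∈ 𝒱 i) (h : W.eY.Kills z) :
    cur (W.Φ φ) z = starSum ħ G (W.eY.ι ∘ₗ φ) (W.D z) := by
  rw [Φ, cur_phi, curFam_of_kills hφ hz h, map_zero, zero_add]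

theorem cur_Φ_T {d i : ℤ} {φ : L →ₗ[R] Ops R Y} (hφ : IsFam ℒ ħ GY d φ) {t : T} (ht : t ∈ 𝒯 i) :
    cur (W.Φ φ) (W.eT.j t) = W.F φ (W.δ t) := by
  rw [cur_Φ_of_kills hφ (W.eT.j_mem ht) (W.kills_T t), W.D_T, F]

theorem Φ_hd {d : ℤ} {φ : L →ₗ[R] Ops R Y} (hφ : IsFam ℒ ħ GY d φ) :
    IsHDiffOp ħ G d (W.Φ φ) := IsFam.phi (hφ.ι W.eY) W.isDeriv

theorem cur_F_of_kills {d i j : ℤ} {φ : L →ₗ[R] Ops R Y} (hφ : IsFam ℒ ħ GY d φ) {x : L ⊗[R] T}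
    (hx : x ∈ tgr ℒ 𝒯 j) {z : V} (hz : z ∈ 𝒱 i) (h : W.eY.Kills z) : cur (W.F φ x) z = 0 := by
  induction hx using tgr_induction with
  | tmul ha ht _ => exact cur_S_of_kills (hφ ha) ht hz h
  | zero => simp [F_zero]
  | add x y _ _ hx hy => rw [F_add, map_add, lin_add, hx, hy, add_zero]
  | smul r x _ hx => rw [F_smul, map_smul, lin_smul, hx, smul_zero]

theorem cur_F_T {d i j : ℤ} {φ : L →ₗ[R] Ops R Y} (hφ : IsFam ℒ ħ GY d φ) {x : L ⊗[R] T}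
    (hx : x ∈ tgr ℒ 𝒯 j) {t : T} (ht : t ∈ 𝒯 i) : cur (W.F φ x) (W.eT.j t) = 0 :=
  cur_F_of_kills hφ hx (W.eT.j_mem ht) (W.kills_T t)

theorem brL_T_S {p q j : ℤ} {P : Ops R Y} {Q : Ops R T} (hQ : IsHDiffOp ħ GT q Q)
    (hP : IsHDiffOp ħ GY p P) {t : T} (ht : t ∈ 𝒯 j) {β : List (ℤ × Y)} (hβ : HomList 𝒴 β) :
    brL q (p + j) (W.eT.ι Q) (W.S P t) (W.yl β)
      = sgn (q * p) • evl (W.S P (evl Q [t])) ((W.yl β).map Prod.snd) := by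
  have ht' := (hQ.cur ht).nil_mem
  induction β generalizing p P with
  | nil =>
    have hT := W.eT.ι_hd hQ
    have hP0 := W.eY.j_mem hP.nil_mem
    simp only [yl, List.map_nil, brL]
    rw [S_nil hP, S_nil hP, hT.leib hP0 (W.eT.j_mem ht), W.eT.ι_nil]
    simp only [evl_cons]
    rw [W.kills_Y _ hQ, cur_S_T hP ht hQ.nil_mem, map_zero, lin_zero, evl_zero, map_zero,
      W.eT.ι_cur, W.eT.ι_nil, lin_zero, smul_zero, smul_zero, zero_add, add_zero, sub_zero,
      G.mul_comm (W.eT.j_mem ht') hP0, smul_smul]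
    simp only [sgn_expand, sgn_cancel, sgn_sort]
  | cons y β ih =>
    rw [HomList.cons_iff] at hβ
    simp only [yl, List.map_cons, brL, evl_cons] at ih ⊢
    rw [W.kills_Y _ hQ, brL_zero_left, smul_zero, add_zero, cur_S_Y hβ.1 ht, brL_sgn_right,
      add_right_comm, ih (hP.cur hβ.1) hβ.2, cur_S_Y hβ.1 ht', evl_sgn]
    simp only [smul_smul, sgn_expand, sgn_sort]

theorem brL_T_Φ {d q : ℤ} {φ : L →ₗ[R] Ops R Y} {Q : Ops R T} (hQ : IsHDiffOp ħ GT q Q)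
    (hφ : IsFam ℒ ħ GY d φ) {β : List (ℤ × Y)} (hβ : HomList 𝒴 β) :
    brL q d (W.eT.ι Q) (W.Φ φ) (W.yl β)
      = - (sgn (q * d) • evl (W.F φ (W.δ (evl Q []))) ((W.yl β).map Prod.snd)) := by
  induction β generalizing d φ with
  | nil =>
    simp only [yl, List.map_nil, brL]
    rw [show evl (W.Φ φ) [] = 0 from phi_nil .., W.eT.ι_nil]
    simp only [evl_cons]
    rw [cur_Φ_T hφ hQ.nil_mem, map_zero, evl_zero, zero_sub]
  | cons y β ih =>
    rw [HomList.cons_iff] at hβ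
    simp only [yl, List.map_cons, brL, evl_cons] at ih ⊢
    rw [W.kills_Y _ hQ, brL_zero_left, smul_zero, add_zero, cur_Φ_Y hβ.1, ih (hφ.curFam hβ.1) hβ.2,
      F, ← W.eY.curFam_ι W.hL hβ.1, ← W.D_T,
      starSum_curFam _ (W.eY.j_mem hβ.1) (W.isDeriv.mem (W.eT.j_mem hQ.nil_mem)), evl_sgn, F,
      ← W.D_T]
    simp only [smul_smul, sgn_expand, sgn_cancel, sgn_sort]

theorem brL_S_S {p q j j' : ℤ} {P Q : Ops R Y} (hP : IsHDiffOp ħ GY p P)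
    (hQ : IsHDiffOp ħ GY q Q) {t t' : T} (ht : t ∈ 𝒯 j) (ht' : t' ∈ 𝒯 j') {β : List (ℤ × Y)}
    (hβ : HomList 𝒴 β) :
    brL (p + j) (q + j') (W.S P t) (W.S Q t') (W.yl β)
      = sgn (q * j + (j + j') * (β.map Prod.fst).sum) •
        G.mul (W.eY.j (brL p q P Q β)) (W.eT.j (GT.mul t t')) := by
  induction β generalizing p q P Q with
  | nil =>
    simp only [yl, List.map_nil, brL]
    rw [S_nil hP, S_nil hQ, S_one_mul hP hQ.nil_mem ht ht', S_one_mul hQ hP.nil_mem ht' ht,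
      GT.mul_comm ht' ht]
    simp only [map_sub, lin_sub, map_sgn_smul, sgn_smul_apply, smul_sub, smul_smul, List.sum_nil,
      mul_zero, sgn_zero, sgn_expand, sgn_cancel, sgn_sort]
  | cons y β ih =>
    rw [HomList.cons_iff] at hβ
    simp only [yl, List.map_cons, brL, List.sum_cons] at ih ⊢
    rw [cur_S_Y hβ.1 ht, cur_S_Y hβ.1 ht', brL_sgn_right, brL_sgn_left, add_right_comm q,
      ih hP (hQ.cur hβ.1) hβ.2, add_right_comm p, ih (hP.cur hβ.1) hQ hβ.2]
    simp only [map_add, lin_add, map_sgn_smul, sgn_smul_apply, smul_add, smul_smul, sgn_expand,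
      sgn_sort]

/-- The bilinear map `b, t ↦ ± (φ(b) P)(β) t`. -/
def prdT (W : Wing ħ GT GY G ℒ) (φ : L →ₗ[R] Ops R Y) (p : ℤ) (P : Ops R Y) (β : List (ℤ × Y)) :
    L ⊗[R] T →ₗ[R] V :=
  TensorProduct.lift ((G.mul.compl₂ (W.eT.j ∘ₗ signMap GT.isInternal (β.map Prod.fst).sum)) ∘ₗ
    W.eY.j ∘ₗ prdLₗ ħ GY p P β ∘ₗ φ ∘ₗ signMap W.hL p)

theorem prdT_tmul (φ : L →ₗ[R] Ops R Y) (p : ℤ) (P : Ops R Y) (β : List (ℤ × Y)) {i j : ℤ} {b : L}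
    {t : T} (hb : b ∈ ℒ i) (ht : t ∈ 𝒯 j) :
    W.prdT φ p P β (b ⊗ₜ t) = sgn (p * i + (β.map Prod.fst).sum * j) •
      G.mul (W.eY.j (prdL ħ GY p (φ b) P β)) (W.eT.j t) := by
  change G.mul (W.eY.j (prdLₗ ħ GY p P β (φ (signMap W.hL p b))))
    (W.eT.j (signMap GT.isInternal _ t)) = _
  rw [signMap_apply _ _ hb, signMap_apply _ _ ht]
  simp only [map_sgn_smul, sgn_smul_apply, smul_smul, sgn_add, prdLₗ_apply, sgn_mul_sgn_comm]

theorem brL_Φ_S {d p j : ℤ} {P : Ops R Y} {φ : L →ₗ[R] Ops R Y} (hφ : IsFam ℒ ħ GY d φ)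
    (hP : IsHDiffOp ħ GY p P) {t : T} (ht : t ∈ 𝒯 j) {β : List (ℤ × Y)} (hβ : HomList 𝒴 β) :
    brL d (p + j) (W.Φ φ) (W.S P t) (W.yl β) = W.prdT φ p P β (W.δ t) := by
  induction β generalizing d p P φ with
  | nil =>
    simp only [yl, List.map_nil, brL]
    rw [show evl (W.Φ φ) [] = 0 from phi_nil .., S_nil hP]
    simp only [evl_cons]
    rw [map_zero, evl_zero, smul_zero, sub_zero, Φ, cur_phi, evl_add, phi_nil, zero_add,
      W.isDeriv.leib (W.eY.j_mem hP.nil_mem) (W.eT.j_mem ht), W.D_Y, map_zero, zero_add, W.D_T,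
      map_sgn_smul, evl_sgn]
    have hx := W.δ_mem ht
    generalize W.δ t = x at hx ⊢
    induction hx using tgr_induction with
    | @tmul i l b u hb hu h =>
      rw [prdT_tmul φ p P [] hb hu, lTensor_tmul, lTensor_tmul, starSum_tmul, flip_apply,
        G.mul_comm (W.eT.j_mem hu) (W.eY.j_mem hP.nil_mem), map_sgn_smul, evl_sgn, comp_apply,
        star_mul_nil (W.eY.ι_hd (hφ hb)) (W.eY.j_mem hP.nil_mem) (W.eT.j_mem hu)]
      simp only [evl_cons]
      rw [cur_star ħ G (W.eT.j_mem hu) (W.eY.j_mem hP.nil_mem), W.kills_T u (hφ hb), map_zero,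
        lin_zero, smul_zero, evl_zero, smul_zero, add_zero, star_nil, evl_cons, W.eY.ι_cur,
        W.eY.ι_nil, W.eY.ι_nil, ← W.eY.j_mul, prdL, evl_cons, map_add W.eY.j, map_smul W.eY.j, ← h]
      simp only [smul_smul, List.map_nil, List.sum_nil, zero_mul, sgn_zero, sgn_expand, sgn_cancel,
        sgn_sort]
    | zero => simp
    | add x y _ _ hx hy => simp only [map_add, evl_add, smul_add, hx, hy]
    | smul r x _ hx => simp only [map_smul, evl_smul, smul_comm _ r, hx]
  | cons y β ih =>
    rw [HomList.cons_iff] at hβ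
    simp only [yl, List.map_cons, brL] at ih ⊢
    rw [cur_S_Y hβ.1 ht, cur_Φ_Y hβ.1, brL_sgn_right, add_right_comm, ih hφ (hP.cur hβ.1) hβ.2,
      ih (hφ.curFam hβ.1) hP hβ.2]
    have hx := W.δ_mem ht
    generalize W.δ t = x at hx ⊢
    induction hx using tgr_induction with
    | @tmul i l b u hb hu h =>
      rw [prdT_tmul _ _ _ _ hb hu, prdT_tmul _ _ _ _ hb hu, prdT_tmul _ _ _ _ hb hu, prdL,
        curFam_apply W.hL _ _ hβ.1 hb, ← h, List.map_cons, List.sum_cons]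
      simp only [← prdLₗ_apply]
      simp only [map_add, lin_add, map_sgn_smul, sgn_smul_apply, smul_add, smul_smul]
      simp only [sgn_expand, sgn_cancel, sgn_sort]
      exact add_comm _ _
    | zero => simp
    | add x y _ _ hx hy => simp only [map_add, smul_add, ← hx, ← hy]; abel
    | smul r x _ hx => simp only [map_smul, smul_comm _ r, ← hx, smul_add]

end Wing
end Wing

section Wing

variable {BT : BD0Algebra ħ 𝒯} {BY : BD0Algebra ħ 𝒴}

namespace Wing

/-- The value on one argument. -/
abbrev one₁ (Q : Ops R T) : T →ₗ[R] T := evlₗ [] ∘ₗ cur Q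

/-- A family `φ` of operations which is compatible with operations `d`, `β`, `ν` on `L`, and the
compatibility of these with the differential and the bracket of `T`. -/
structure Compat (W : Wing ħ BT.toGCAlgebra BY.toGCAlgebra G ℒ) (φ : L →ₗ[R] Ops R Y) where
  d : L →ₗ[R] L
  β : L →ₗ[R] L →ₗ[R] L
  ν : L →ₗ[R] L →ₗ[R] L
  B : L ⊗[R] T →ₗ[R] L ⊗[R] T →ₗ[R] L ⊗[R] T
  fam : IsFam ℒ ħ BY.toGCAlgebra 1 φ
  φ_d : ∀ {i a γ}, a ∈ ℒ i → HomList 𝒴 γ →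
    evl (φ (d a)) (γ.map Prod.snd) = - brL 1 (1 + i) BY.ops (φ a) γ
  φ_β : ∀ {i j a b γ}, a ∈ ℒ i → b ∈ ℒ j → HomList 𝒴 γ →
    evl (φ (β a b)) (γ.map Prod.snd) = - (sgn i • brL (1 + i) (1 + j) (φ a) (φ b) γ)
  φ_ν : ∀ {i j a b γ}, a ∈ ℒ i → b ∈ ℒ j → HomList 𝒴 γ →
    evl (φ (ν a b)) (γ.map Prod.snd)
      = - (sgn (i * j + j) • prdL ħ BY.toGCAlgebra (1 + i) (φ b) (φ a) γ)
  d_mem : ∀ {i a}, a ∈ ℒ i → d a ∈ ℒ (i + 1)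
  β_mem : ∀ {i j a b}, a ∈ ℒ i → b ∈ ℒ j → β a b ∈ ℒ (i + j + 1)
  ν_mem : ∀ {i j a b}, a ∈ ℒ i → b ∈ ℒ j → ν a b ∈ ℒ (i + j + 1)
  B_apply : ∀ {i j k l a t b u}, a ∈ ℒ i → t ∈ 𝒯 j → b ∈ ℒ k → u ∈ 𝒯 l →
    B (a ⊗ₜ t) (b ⊗ₜ u) = sgn (k * j) • (β a b ⊗ₜ BT.mul t u)
  δ_d : ∀ {j t}, t ∈ 𝒯 j → W.δ (BT.d t)
    = TensorProduct.map (signMap W.hL 1) BT.d (W.δ t) + d.rTensor T (W.δ t)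
      + TensorProduct.lift (LinearMap.rTensorHom T ∘ₗ ν) (W.δ.lTensor L (W.δ t))
  δ_bracket : ∀ {i j s t}, s ∈ 𝒯 i → t ∈ 𝒯 j → W.δ (BT.bracket s t)
    = TensorProduct.map (signMap W.hL (1 + i)) (BT.bracket s) (W.δ t)
      + sgn (i * j) • TensorProduct.map (signMap W.hL (1 + j)) (BT.bracket t) (W.δ s)
      + B (W.δ s) (W.δ t)

variable {W : Wing ħ BT.toGCAlgebra BY.toGCAlgebra G ℒ}

theorem F_sgn (φ : L →ₗ[R] Ops R Y) (u : ℤˣ) (x : L ⊗[R] T) : W.F φ (u • x) = u • W.F φ x := by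
  simp only [F, map_sgn_smul]

theorem evl_S {p j : ℤ} {P : Ops R Y} (hP : IsHDiffOp ħ BY.toGCAlgebra p P) {t : T} (ht : t ∈ 𝒯 j)
    {γ : List (ℤ × Y)} (hγ : HomList 𝒴 γ) :
    evl (W.S P t) ((W.yl γ).map Prod.snd) = sgn (j * (γ.map Prod.fst).sum) •
      G.mul (W.eY.j (evl P (γ.map Prod.snd))) (W.eT.j t) := by
  induction γ generalizing p P with
  | nil =>
    simp only [yl, List.map_nil, List.sum_nil, mul_zero, sgn_zero, one_smul]
    exact S_nil hP t
  | cons y γ ih =>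
    rw [HomList.cons_iff] at hγ
    simp only [yl, List.map_cons, evl_cons, List.sum_cons] at ih ⊢
    rw [cur_S_Y hγ.1 ht, evl_sgn, ih (hP.cur hγ.1) hγ.2, smul_smul, mul_add, sgn_add, sgn_mul_comm]

theorem brL_Y_S {p q j : ℤ} {P Q : Ops R Y} (hQ : IsHDiffOp ħ BY.toGCAlgebra q Q)
    (hP : IsHDiffOp ħ BY.toGCAlgebra p P) {t : T} (ht : t ∈ 𝒯 j) {γ : List (ℤ × Y)}
    (hγ : HomList 𝒴 γ) :
    brL q (p + j) (W.eY.ι Q) (W.S P t) (W.yl γ) = sgn (j * (γ.map Prod.fst).sum) •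
      G.mul (W.eY.j (brL q p Q P γ)) (W.eT.j t) := by
  induction γ generalizing p q P Q with
  | nil =>
    simp only [yl, List.map_nil, brL]
    rw [S_nil hP, (W.eY.ι_hd hQ).leib (W.eY.j_mem hP.nil_mem) (W.eT.j_mem ht), W.eY.ι_nil]
    simp only [evl_cons]
    rw [W.kills_T t hQ, W.eY.ι_cur, W.kills_T t (hQ.cur hP.nil_mem), cur_S_Y hQ.nil_mem ht, evl_sgn,
      S_nil (hP.cur hQ.nil_mem), W.eY.ι_nil]
    simp only [evl_zero, map_zero, lin_zero, smul_zero, add_zero, map_sub, lin_sub, map_sgn_smul,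
      sgn_smul_apply, smul_smul, List.sum_nil, mul_zero, sgn_zero, one_smul, mul_assoc, sgn_expand,
      sgn_cancel]
  | cons y γ ih =>
    rw [HomList.cons_iff] at hγ
    simp only [yl, List.map_cons, brL, List.sum_cons] at ih ⊢
    rw [cur_S_Y hγ.1 ht, W.eY.ι_cur, brL_sgn_right, add_right_comm p, ih hQ (hP.cur hγ.1) hγ.2,
      ih (hQ.cur hγ.1) hP hγ.2]
    simp only [map_add, lin_add, map_sgn_smul, sgn_smul_apply, smul_add, smul_smul, sgn_expand,
      sgn_sort]

theorem brL_Y_Φ {d q : ℤ} {φ : L →ₗ[R] Ops R Y} (Q : Ops R Y) {γ : List (ℤ × Y)}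
    (hγ : HomList 𝒴 γ) : brL q d (W.eY.ι Q) (W.Φ φ) (W.yl γ) = 0 := by
  have h0 : ∀ φ, evl (W.Φ φ) [] = 0 := fun φ => phi_nil ..
  induction γ generalizing d q φ Q with
  | nil =>
    simp only [yl, List.map_nil, brL]
    have : evl (W.Φ φ) [W.eY.j (evl Q [])] = 0 := by
      rw [evl_cons, Φ, cur_phi, W.D_Y, map_zero, add_zero]; exact phi_nil ..
    rw [h0, W.eY.ι_nil, this, evl_cons, map_zero, evl_zero, smul_zero, sub_zero]
  | cons y γ ih =>
    rw [HomList.cons_iff] at hγ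
    simp only [yl, List.map_cons, brL] at ih ⊢
    rw [cur_Φ_Y hγ.1, W.eY.ι_cur, ih _ hγ.2, ih _ hγ.2, smul_zero, add_zero]

theorem brL_Φ_Φ {d e : ℤ} {φ ψ : L →ₗ[R] Ops R Y} {γ : List (ℤ × Y)}
    (hγ : HomList 𝒴 γ) : brL d e (W.Φ φ) (W.Φ ψ) (W.yl γ) = 0 := by
  have h0 : ∀ φ, evl (W.Φ φ) [] = 0 := fun φ => phi_nil ..
  induction γ generalizing d e φ ψ with
  | nil => simp only [yl, List.map_nil, brL, h0, evl_cons, map_zero, evl_zero, smul_zero, sub_zero]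
  | cons y γ ih =>
    rw [HomList.cons_iff] at hγ
    simp only [yl, List.map_cons, brL] at ih ⊢
    rw [cur_Φ_Y hγ.1, cur_Φ_Y hγ.1, ih hγ.2, ih hγ.2, smul_zero, add_zero]

theorem brL_T_F {d q j : ℤ} {φ : L →ₗ[R] Ops R Y} {Q : Ops R T}
    (hQ : IsHDiffOp ħ BT.toGCAlgebra q Q) (hφ : IsFam ℒ ħ BY.toGCAlgebra d φ) {x : L ⊗[R] T}
    (hx : x ∈ tgr ℒ 𝒯 j) {γ : List (ℤ × Y)} (hγ : HomList 𝒴 γ) :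
    brL q (d + j) (W.eT.ι Q) (W.F φ x) (W.yl γ) = sgn (q * d) •
      evl (W.F φ (TensorProduct.map (signMap W.hL q) (one₁ Q) x)) ((W.yl γ).map Prod.snd) := by
  induction hx using tgr_induction with
  | @tmul i l a t ha ht h =>
    rw [map_tmul, F_tmul, F_tmul, ← h, ← add_assoc, brL_T_S hQ (hφ ha) ht hγ, signMap_apply _ _ ha,
      map_sgn_smul, S, S, map_sgn_smul, map_sgn_smul₂, evl_sgn, smul_smul, mul_add, sgn_add]
    rfl
  | zero => simp only [map_zero, F_zero, brL_zero_right, evl_zero, smul_zero]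
  | add x y _ _ hx hy => simp only [map_add, F_add, brL_add_right, evl_add, smul_add, hx, hy]
  | smul r x _ hx => simp only [map_smul, F_smul, brL_smul_right, evl_smul, hx, smul_comm r]

variable {φ : L →ₗ[R] Ops R Y} (C : W.Compat φ)

theorem brL_Y_F {j : ℤ} {x : L ⊗[R] T} (hx : x ∈ tgr ℒ 𝒯 j) {γ : List (ℤ × Y)}
    (hγ : HomList 𝒴 γ) : brL 1 (1 + j) (W.eY.ι BY.ops) (W.F φ x) (W.yl γ)
      = - evl (W.F φ (C.d.rTensor T x)) ((W.yl γ).map Prod.snd) := by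
  induction hx using tgr_induction with
  | @tmul i l a t ha ht h =>
    rw [rTensor_tmul, F_tmul, F_tmul, ← h, ← add_assoc, brL_Y_S BY.ops_isHDiffOp (C.fam ha) ht hγ,
      evl_S (C.fam (C.d_mem ha)) ht hγ, C.φ_d ha hγ]
    simp only [map_neg, lin_neg, smul_neg, neg_neg]
  | zero => simp only [map_zero, F_zero, brL_zero_right, evl_zero, neg_zero]
  | add x y _ _ hx hy => simp only [map_add, F_add, brL_add_right, evl_add, neg_add, hx, hy]
  | smul r x _ hx => simp only [map_smul, F_smul, brL_smul_right, evl_smul, hx, smul_neg]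

theorem brL_Φ_F {j : ℤ} {x : L ⊗[R] T} (hx : x ∈ tgr ℒ 𝒯 j) {γ : List (ℤ × Y)}
    (hγ : HomList 𝒴 γ) : brL 1 (1 + j) (W.Φ φ) (W.F φ x) (W.yl γ)
      = - evl (W.F φ (TensorProduct.lift (LinearMap.rTensorHom T ∘ₗ C.ν) (W.δ.lTensor L x)))
        ((W.yl γ).map Prod.snd) := by
  induction hx using tgr_induction with
  | @tmul i l a t ha ht h =>
    rw [lTensor_tmul, TensorProduct.lift.tmul, F_tmul, ← h, ← add_assoc,
      brL_Φ_S C.fam (C.fam ha) ht hγ]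
    have hx := W.δ_mem ht
    generalize W.δ t = x at hx ⊢
    clear h ht
    induction hx using tgr_induction with
    | @tmul i' l b u hb hu h =>
      change _ = - evl (W.F φ (C.ν a b ⊗ₜ u)) _
      rw [prdT_tmul _ _ _ _ hb hu, F_tmul, evl_S (C.fam (C.ν_mem ha hb)) hu hγ, C.φ_ν ha hb hγ]
      simp only [map_neg, lin_neg, smul_neg, neg_neg, map_sgn_smul, sgn_smul_apply, smul_smul,
        sgn_expand, sgn_cancel, sgn_sort]
    | zero => simp only [map_zero, F_zero, evl_zero, neg_zero]
    | add x y _ _ hx hy => simp only [map_add, F_add, evl_add, neg_add, hx, hy]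
    | smul r x _ hx => simp only [map_smul, F_smul, evl_smul, hx, smul_neg]
  | zero => simp only [map_zero, F_zero, brL_zero_right, evl_zero, neg_zero]
  | add x y _ _ hx hy => simp only [map_add, F_add, brL_add_right, evl_add, neg_add, hx, hy]
  | smul r x _ hx => simp only [map_smul, F_smul, brL_smul_right, evl_smul, hx, smul_neg]

theorem brL_F_F {i j : ℤ} {x y : L ⊗[R] T} (hx : x ∈ tgr ℒ 𝒯 i) (hy : y ∈ tgr ℒ 𝒯 j)
    {γ : List (ℤ × Y)} (hγ : HomList 𝒴 γ) :
    brL (1 + i) (1 + j) (W.F φ x) (W.F φ y) (W.yl γ)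
      = - (sgn i • evl (W.F φ (C.B x y)) ((W.yl γ).map Prod.snd)) := by
  induction hx using tgr_induction with
  | @tmul i' l a t ha ht h =>
    induction hy using tgr_induction with
    | @tmul j' l' b u hb hu h' =>
      rw [C.B_apply ha ht hb hu, F_sgn, F_tmul, F_tmul, F_tmul, ← h, ← h', ← add_assoc, ← add_assoc,
        brL_S_S (C.fam ha) (C.fam hb) ht hu hγ, evl_sgn,
        evl_S (C.fam (C.β_mem ha hb)) (BT.mul_mem ht hu) hγ, C.φ_β ha hb hγ]
      simp only [map_neg, lin_neg, smul_neg, neg_neg, map_sgn_smul, sgn_smul_apply, smul_smul,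
        sgn_expand, sgn_cancel, sgn_sort]
    | zero => simp only [map_zero, F_zero, brL_zero_right, evl_zero, smul_zero, neg_zero]
    | add x y _ _ hx hy =>
      simp only [map_add, F_add, brL_add_right, evl_add, smul_add, neg_add, hx, hy]
    | smul r x _ hx =>
      simp only [map_smul, F_smul, brL_smul_right, evl_smul, hx, smul_neg, smul_comm r]
  | zero =>
    simp only [map_zero, lin_zero, F_zero, brL_zero_left, evl_zero, smul_zero, neg_zero]
  | add x y _ _ hx hy =>
    simp only [map_add, lin_add, F_add, brL_add_left, evl_add, smul_add, neg_add, hx, hy]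
  | smul r x _ hx =>
    simp only [map_smul, lin_smul, F_smul, brL_smul_left, evl_smul, hx, smul_neg, smul_comm r]

end Wing
end Wing

theorem brL_cons_eq_zero {P Q : Ops R V} {x : ℤ × V} (hP : cur P x.2 = 0) (hQ : cur Q x.2 = 0)
    (p q : ℤ) (β : List (ℤ × V)) : brL p q P Q (x :: β) = 0 := by
  rw [brL, hP, hQ, brL_zero_left, brL_zero_right, smul_zero, add_zero]

section Wing

variable {BT : BD0Algebra ħ 𝒯} {BY : BD0Algebra ħ 𝒴}

namespace Wing

variable {W : Wing ħ BT.toGCAlgebra BY.toGCAlgebra G ℒ}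

variable (W) in
/-- A list of arguments from `T`. -/
abbrev tl (τ : List (ℤ × T)) : List (ℤ × V) := τ.map fun x => (x.1, W.eT.j x.2)

variable {φ : L →ₗ[R] Ops R Y} (C : W.Compat φ)

include C in
theorem wing_mc {τ : List (ℤ × T)} (hτ : HomList 𝒯 τ) {γ : List (ℤ × Y)} (hγ : HomList 𝒴 γ) :
    2 • brL 1 1 (W.eT.ι BT.ops) (W.Φ φ) (W.tl τ ++ W.yl γ)
      + 2 • brL 1 1 (W.eY.ι BY.ops) (W.Φ φ) (W.tl τ ++ W.yl γ)
      + brL 1 1 (W.Φ φ) (W.Φ φ) (W.tl τ ++ W.yl γ) = 0 := by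
  have ops := BT.ops_isHDiffOp
  have one₁_ops : ∀ x, one₁ (cur BT.ops x) = BT.bracket x := fun x => LinearMap.ext fun _ => rfl
  have hY : ∀ t, cur (W.eY.ι BY.ops) (W.eT.j t) = 0 := fun t => W.kills_T t BY.ops_isHDiffOp
  have hFam : IsFam ℒ ħ BY.toGCAlgebra 1 φ := C.fam
  rcases τ with _ | ⟨⟨i, s⟩, _ | ⟨⟨j, t⟩, _ | ⟨⟨l, u⟩, τ⟩⟩⟩
  · simp only [tl, List.map_nil, List.nil_append]
    rw [brL_Y_Φ _ hγ, brL_Φ_Φ hγ, brL_T_Φ ops hFam hγ, show evl BT.ops [] = 0 from rfl, map_zero,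
      F_zero, evl_zero]
    simp
  · rw [HomList.cons_iff] at hτ
    have hδ := W.δ_mem hτ.1
    simp only [tl, List.map_cons, List.map_nil, List.nil_append, List.cons_append, brL] at hδ ⊢
    rw [hY, brL_zero_left, cur_Φ_T hFam hτ.1, W.eT.ι_cur, brL_T_F ops hFam hδ hγ,
      brL_T_Φ (ops.cur hτ.1) hFam hγ, brL_Y_F C hδ hγ, brL_symm (1 + i), brL_Φ_F C hδ hγ,
      show evl (cur BT.ops s) [] = BT.d s from rfl, C.δ_d hτ.1,
      show one₁ BT.ops = BT.d from LinearMap.ext fun _ => rfl]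
    simp only [F_add, evl_add, smul_add, smul_neg, smul_smul, smul_zero, add_zero]
    simp only [sgn_one, mul_neg, neg_mul, neg_neg, Units.neg_smul, one_smul, smul_neg, neg_neg,
      sgn_expand, sgn_cancel]
    abel
  · simp only [HomList.cons_iff] at hτ
    obtain ⟨hs, ht, -⟩ := hτ
    have hδs := W.δ_mem hs
    have hδt := W.δ_mem ht
    simp only [tl, List.map_cons, List.map_nil, List.nil_append, List.cons_append, brL] at hδs hδt ⊢
    rw [hY, hY, cur_Φ_T hFam hs, cur_F_T hFam hδs ht, cur_Φ_T hFam ht, W.eT.ι_cur, W.eT.ι_cur,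
      W.eT.ι_cur, brL_T_F (ops.cur ht) hFam hδs hγ, brL_T_F (ops.cur hs) hFam hδt hγ,
      brL_T_Φ ((ops.cur hs).cur ht) hFam hγ, brL_symm (1 + j) (1 + i) (W.F φ _),
      brL_F_F C hδs hδt hγ, one₁_ops, one₁_ops,
      show evl (cur (cur BT.ops s) t) [] = BT.bracket s t from rfl, C.δ_bracket hs ht]
    simp only [map_zero, lin_zero, brL_zero_left, brL_zero_right, F_add, F_sgn, evl_add, evl_sgn,
      smul_add, smul_neg, smul_smul, smul_zero, add_zero, zero_add]
    simp only [sgn_one, mul_neg, neg_mul, neg_neg, Units.neg_smul, one_smul, smul_neg, neg_neg,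
      two_smul, sgn_expand, sgn_cancel, sgn_sort]
    abel
  · simp only [HomList.cons_iff] at hτ
    obtain ⟨hs, ht, hu, hτ⟩ := hτ
    have key : ∀ {p q m x y} {z : L ⊗[R] T}, x ∈ 𝒯 p → y ∈ 𝒯 q → z ∈ tgr ℒ 𝒯 m →
        brL (1 + p + q) (1 + m) (W.eT.ι (cur (cur BT.ops x) y)) (W.F φ z) (W.tl τ ++ W.yl γ)
          = 0 := by
      intro p q m x y z hx hy hz
      rcases τ with _ | ⟨v, τ⟩
      · rw [tl, List.map_nil, List.nil_append, brL_T_F ((ops.cur hx).cur hy) hFam hz hγ,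
          show one₁ (cur (cur BT.ops x) y) = 0 from LinearMap.ext fun _ => rfl,
          TensorProduct.map_zero_right, lin_zero, F_zero, evl_zero, smul_zero]
      · rw [HomList.cons_iff] at hτ
        refine brL_cons_eq_zero ?_ (cur_F_T hFam hz hτ.1) _ _ _
        exact (W.eT.ι_cur _ _).trans (map_zero _)
    have hδs := W.δ_mem hs
    have hδt := W.δ_mem ht
    have hδu := W.δ_mem hu
    simp only [List.map_cons, List.cons_append, brL] at hδs hδt hδu ⊢
    simp only [hY, cur_Φ_T hFam hs, cur_F_T hFam hδs ht, cur_Φ_T hFam ht, cur_Φ_T hFam hu,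
      W.eT.ι_cur, cur_F_T hFam hδs hu, cur_F_T hFam hδt hu, map_zero, brL_zero_left, brL_zero_right,
      lin_zero, smul_zero, add_zero, BT.cur_ops, key hs ht hδu, key hs hu hδt, key ht hu hδs]

end Wing
end Wing

theorem brL_eq_zero_of_mem {p q : ℤ} {P Q : Ops R V} (hP : IsHDiffOp ħ G p P)
    (hQ : IsHDiffOp ħ G q Q) {γ : List (ℤ × V)} (hγ : HomList 𝒱 γ) {x : ℤ × V} (hx : x ∈ γ)
    (hPx : cur P x.2 = 0) (hQx : cur Q x.2 = 0) :
    brL p q P Q γ = 0 := by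
  classical
  exact brL_eq_zero_of_perm (List.perm_cons_erase hx) hγ hP hQ (brL_cons_eq_zero hPx hQx _ _ _)

theorem brL_ι_ι {X : Type*} [AddCommGroup X] [Module R X] {𝒳 : ℤ → Submodule R X} {GX : GCAlgebra 𝒳}
    {E : OpEmb ħ GX G} {F : OpEmb ħ GY G} (hE : ∀ y, E.Kills (F.j y)) (hF : ∀ x, F.Kills (E.j x))
    {p q : ℤ} {P : Ops R X} {Q : Ops R Y} (hP : IsHDiffOp ħ GX p P) (hQ : IsHDiffOp ħ GY q Q)
    {γ : List (ℤ × V)}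
    (hγ : ∀ z ∈ γ, (∃ x ∈ 𝒳 z.1, z.2 = E.j x) ∨ (∃ y ∈ 𝒴 z.1, z.2 = F.j y) ∨
      (E.Kills z.2 ∧ F.Kills z.2)) :
    brL p q (E.ι P) (F.ι Q) γ = 0 := by
  induction γ generalizing p q P Q with
  | nil =>
    simp only [brL, E.ι_nil, F.ι_nil, evl_cons]
    rw [hE _ hP, hF _ hQ]
    simp
  | cons z γ ih =>
    obtain ⟨hz, hγ⟩ := List.forall_mem_cons.1 hγ
    rcases hz with ⟨x, hx, hz⟩ | ⟨y, hy, hz⟩ | ⟨h, h'⟩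
    · rw [brL, hz, hF x hQ, brL_zero_right, E.ι_cur, ih (hP.cur hx) hQ hγ, smul_zero, zero_add]
    · rw [brL, hz, hE y hP, brL_zero_left, F.ι_cur, ih hP (hQ.cur hy) hγ, smul_zero, zero_add]
    · exact brL_cons_eq_zero (h hP) (h' hQ) _ _ _

section Wing

namespace Wing

/-- Two wings at opposite sides of `T`. -/
structure Opposite (W : Wing ħ GT GY G ℒ) (W' : Wing ħ GT GY' G ℒ) : Prop where
  eq_T : W'.eT.j = W.eT.j
  kills : ∀ y, W.eY.Kills (W'.eY.j y)
  kills' : ∀ y, W'.eY.Kills (W.eY.j y)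
  D_Y' : ∀ y, W.D (W'.eY.j y) = 0
  D'_Y : ∀ y, W'.D (W.eY.j y) = 0

/-- An element of `T`, `Y` or `Y'`. -/
def Gen (W : Wing ħ GT GY G ℒ) (W' : Wing ħ GT GY' G ℒ) (z : ℤ × V) : Prop :=
  (∃ t ∈ 𝒯 z.1, z.2 = W.eT.j t) ∨ (∃ y ∈ 𝒴 z.1, z.2 = W.eY.j y) ∨ ∃ y ∈ 𝒴' z.1, z.2 = W'.eY.j y

variable {W : Wing ħ GT GY G ℒ} {W' : Wing ħ GT GY' G ℒ} (O : W.Opposite W')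

include O

theorem Opposite.symm : W'.Opposite W := ⟨O.eq_T.symm, O.kills', O.kills, O.D'_Y, O.D_Y'⟩

theorem Opposite.gen_symm {z : ℤ × V} (h : W.Gen W' z) : W'.Gen W z := by
  rcases h with h | h | h
  · exact Or.inl (by rw [O.eq_T]; exact h)
  · exact Or.inr (Or.inr h)
  · exact Or.inr (Or.inl h)

theorem Opposite.cur_Φ {d i : ℤ} {φ : L →ₗ[R] Ops R Y} (hφ : IsFam ℒ ħ GY d φ) {y : Y'}
    (hy : y ∈ 𝒴' i) : cur (W.Φ φ) (W'.eY.j y) = 0 := by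
  rw [cur_Φ_of_kills hφ (W'.eY.j_mem hy) (O.kills y), O.D_Y', map_zero]

theorem Opposite.evl_ι_S {p q j : ℤ} {P : Ops R Y'} {Q : Ops R Y} (hP : IsHDiffOp ħ GY' p P)
    (hQ : IsHDiffOp ħ GY q Q) {t : T} (ht : t ∈ 𝒯 j) :
    evl (W'.eY.ι P) [evl (W.S Q t) []] = 0 := by
  rw [S_nil hQ, (W'.eY.ι_hd hP).leib (W.eY.j_mem hQ.nil_mem) (W.eT.j_mem ht)]
  simp only [evl_cons]
  rw [O.kills' _ hP, ← O.eq_T, W'.kills_T t hP]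
  simp

theorem Opposite.brL_ι_S {p q j : ℤ} {P : Ops R Y'} {Q : Ops R Y} (hP : IsHDiffOp ħ GY' p P)
    (hQ : IsHDiffOp ħ GY q Q) {t : T} (ht : t ∈ 𝒯 j) {γ : List (ℤ × V)}
    (hγ : ∀ z ∈ γ, W.Gen W' z) : brL p (q + j) (W'.eY.ι P) (W.S Q t) γ = 0 := by
  induction γ generalizing p q P Q with
  | nil =>
    rw [brL, O.evl_ι_S hP hQ ht, evl_cons, W'.eY.ι_nil,
      cur_S_of_kills hQ ht (W'.eY.j_mem hP.nil_mem) (O.kills _), evl_zero, smul_zero, sub_zero]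
  | cons z γ ih =>
    obtain ⟨⟨x, hx, hz⟩ | ⟨y, hy, hz⟩ | ⟨y, hy, hz⟩, hγ⟩ := List.forall_mem_cons.1 hγ
    · refine brL_cons_eq_zero ?_ ?_ _ _ _
      · rw [hz, ← O.eq_T]; exact W'.kills_T x hP
      · rw [hz, cur_S_T hQ ht hx]
    · rw [brL, hz, O.kills' y hP, brL_zero_left, cur_S_Y hy ht, brL_sgn_right, add_right_comm,
        ih hP (hQ.cur hy) hγ, smul_zero, smul_zero, zero_add]
    · rw [brL, hz, cur_S_of_kills hQ ht (W'.eY.j_mem hy) (O.kills y), brL_zero_right, W'.eY.ι_cur,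
        ih (hP.cur hy) hQ hγ, smul_zero, zero_add]

theorem Opposite.brL_ι_Φ {p d : ℤ} {P : Ops R Y'} (hP : IsHDiffOp ħ GY' p P)
    {φ : L →ₗ[R] Ops R Y} (hφ : IsFam ℒ ħ GY d φ) {γ : List (ℤ × V)}
    (hγ : ∀ z ∈ γ, W.Gen W' z) : brL p d (W'.eY.ι P) (W.Φ φ) γ = 0 := by
  induction γ generalizing p d P φ with
  | nil =>
    rw [brL, show evl (W.Φ φ) [] = 0 from phi_nil .., W'.eY.ι_nil, evl_cons, evl_cons, map_zero,
      O.cur_Φ hφ hP.nil_mem, evl_zero, smul_zero, sub_zero]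
  | cons z γ ih =>
    obtain ⟨⟨x, hx, hz⟩ | ⟨y, hy, hz⟩ | ⟨y, hy, hz⟩, hγ⟩ := List.forall_mem_cons.1 hγ
    · have hk : cur (W'.eY.ι P) (W.eT.j x) = 0 := by rw [← O.eq_T]; exact W'.kills_T x hP
      rw [brL, hz, hk, brL_zero_left, smul_zero, add_zero, cur_Φ_T hφ hx]
      have hδ := W.δ_mem hx
      generalize W.δ x = w at hδ ⊢
      induction hδ using tgr_induction with
      | tmul ha ht h => rw [F_tmul, ← h, ← add_assoc, O.brL_ι_S hP (hφ ha) ht hγ]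
      | zero => rw [F_zero, brL_zero_right]
      | add x y _ _ hx hy => rw [F_add, brL_add_right, hx, hy, add_zero]
      | smul r x _ hx => rw [F_smul, brL_smul_right, hx, smul_zero]
    · rw [brL, hz, O.kills' y hP, brL_zero_left, cur_Φ_Y hy, ih hP (hφ.curFam hy) hγ, smul_zero,
        zero_add]
    · rw [brL, hz, O.cur_Φ hφ hy, brL_zero_right, W'.eY.ι_cur, ih (hP.cur hy) hφ hγ, smul_zero,
        zero_add]

theorem Opposite.brL_S_S {p q i j : ℤ} {P : Ops R Y} {Q : Ops R Y'} (hP : IsHDiffOp ħ GY p P)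
    (hQ : IsHDiffOp ħ GY' q Q) {s t : T} (hs : s ∈ 𝒯 i) (ht : t ∈ 𝒯 j) {γ : List (ℤ × V)}
    (hγ : ∀ z ∈ γ, W.Gen W' z) : brL (p + i) (q + j) (W.S P s) (W'.S Q t) γ = 0 := by
  have nil : ∀ {p q i j : ℤ} {P : Ops R Y} {Q : Ops R Y'}, IsHDiffOp ħ GY p P →
      IsHDiffOp ħ GY' q Q → ∀ {s t : T}, s ∈ 𝒯 i → t ∈ 𝒯 j →
      evl (W.S P s) [evl (W'.S Q t) []] = 0 ∧ evl (W'.S Q t) [evl (W.S P s) []] = 0 := by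
    intro p q i j P Q hP hQ s t hs ht
    constructor
    · rw [S_nil hQ, (S_hd hP hs).leib (W'.eY.j_mem hQ.nil_mem) (W'.eT.j_mem ht)]
      simp only [evl_cons]
      rw [cur_S_of_kills hP hs (W'.eY.j_mem hQ.nil_mem) (O.kills _), O.eq_T, cur_S_T hP hs ht]
      simp
    · rw [S_nil hP, (S_hd hQ ht).leib (W.eY.j_mem hP.nil_mem) (W.eT.j_mem hs)]
      simp only [evl_cons]
      rw [cur_S_of_kills hQ ht (W.eY.j_mem hP.nil_mem) (O.kills' _), ← O.eq_T, cur_S_T hQ ht hs]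
      simp
  induction γ generalizing p q P Q with
  | nil => rw [brL, (nil hP hQ hs ht).1, (nil hP hQ hs ht).2, smul_zero, sub_zero]
  | cons z γ ih =>
    obtain ⟨⟨x, hx, hz⟩ | ⟨y, hy, hz⟩ | ⟨y, hy, hz⟩, hγ⟩ := List.forall_mem_cons.1 hγ
    · refine brL_cons_eq_zero ?_ ?_ _ _ _
      · rw [hz, cur_S_T hP hs hx]
      · rw [hz, ← O.eq_T, cur_S_T hQ ht hx]
    · rw [brL, hz, cur_S_of_kills hQ ht (W.eY.j_mem hy) (O.kills' y), brL_zero_right, cur_S_Y hy hs,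
        brL_sgn_left, add_right_comm, ih (hP.cur hy) hQ hγ]
      simp only [smul_zero, zero_add]
    · rw [brL, hz, cur_S_of_kills hP hs (W'.eY.j_mem hy) (O.kills y), brL_zero_left, cur_S_Y hy ht,
        brL_sgn_right, add_right_comm, ih hP (hQ.cur hy) hγ]
      simp only [smul_zero, zero_add]

theorem Opposite.brL_F_F {d e i j : ℤ} {φ : L →ₗ[R] Ops R Y} {ψ : L →ₗ[R] Ops R Y'}
    (hφ : IsFam ℒ ħ GY d φ) (hψ : IsFam ℒ ħ GY' e ψ) {x y : L ⊗[R] T} (hx : x ∈ tgr ℒ 𝒯 i)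
    (hy : y ∈ tgr ℒ 𝒯 j) {γ : List (ℤ × V)} (hγ : ∀ z ∈ γ, W.Gen W' z) :
    brL (d + i) (e + j) (W.F φ x) (W'.F ψ y) γ = 0 := by
  induction hx using tgr_induction with
  | tmul ha hs h =>
    induction hy using tgr_induction with
    | tmul hb ht h' =>
      rw [F_tmul, F_tmul, ← h, ← h', ← add_assoc, ← add_assoc, O.brL_S_S (hφ ha) (hψ hb) hs ht hγ]
    | zero => rw [F_zero, brL_zero_right]
    | add x y _ _ hx hy => rw [F_add, brL_add_right, hx, hy, add_zero]
    | smul r x _ hx => rw [F_smul, brL_smul_right, hx, smul_zero]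
  | zero => rw [F_zero, brL_zero_left]
  | add x y _ _ hx hy => rw [F_add, brL_add_left, hx, hy, add_zero]
  | smul r x _ hx => rw [F_smul, brL_smul_left, hx, smul_zero]

theorem Opposite.evl_Φ_S {d q j : ℤ} {φ : L →ₗ[R] Ops R Y} {Q : Ops R Y'} (hφ : IsFam ℒ ħ GY d φ)
    (hQ : IsHDiffOp ħ GY' q Q) {t : T} (ht : t ∈ 𝒯 j) :
    evl (W.Φ φ) [evl (W'.S Q t) []] = TensorProduct.lift
      ((G.mul.compl₂ (G.mul (W'.eY.j (evl Q [])) ∘ₗ W.eT.j)) ∘ₗ W.eY.j ∘ₗ evlₗ [] ∘ₗ φ ∘ₗ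
        signMap W.hL q) (W.δ t) := by
  rw [S_nil hQ, evl_cons, Φ, cur_phi, evl_add, phi_nil, zero_add,
    W.isDeriv.leib (W'.eY.j_mem hQ.nil_mem) (W'.eT.j_mem ht), O.D_Y', map_zero, zero_add, O.eq_T,
    W.D_T, map_sgn_smul, evl_sgn]
  have hx := W.δ_mem ht
  generalize W.δ t = x at hx ⊢
  induction hx using tgr_induction with
  | @tmul i l b u hb hu h =>
    rw [lTensor_tmul, lTensor_tmul, starSum_tmul, flip_apply,
      G.mul_comm (W.eT.j_mem hu) (W'.eY.j_mem hQ.nil_mem), map_sgn_smul, evl_sgn, comp_apply,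
      star_nil, W.eY.ι_nil, TensorProduct.lift.tmul]
    simp only [evl_cons]
    have h0 : evl (cur (W.eY.ι (φ b)) (G.mul (W'.eY.j (evl Q [])) (W.eT.j u))) [] = 0 := by
      have := (W.eY.ι_hd (hφ hb)).leib (W'.eY.j_mem hQ.nil_mem) (W.eT.j_mem hu)
      simp only [evl_cons] at this
      rw [this, O.kills _ (hφ hb), W.kills_T u (hφ hb)]
      simp
    rw [h0, smul_zero, add_zero]
    simp only [comp_apply, LinearMap.compl₂_apply, signMap_apply _ _ hb, evlₗ_apply]
    simp only [map_sgn_smul, sgn_smul_apply, smul_smul, evl_sgn, ← h]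
    simp only [sgn_expand, sgn_cancel, sgn_sort]
  | zero => simp
  | add x y _ _ hx hy => simp only [map_add, evl_add, smul_add, hx, hy]
  | smul r x _ hx => simp only [map_smul, evl_smul, smul_comm _ r, hx]

omit O in
/-- The map `a ⊗ b ⊗ t ↦ (-1)^{|a||b|} b ⊗ a ⊗ t`. -/
def swp (hL : DirectSum.IsInternal ℒ) : L ⊗[R] (L ⊗[R] T) →ₗ[R] L ⊗[R] (L ⊗[R] T) :=
  (TensorProduct.assoc R L L T).toLinearMap ∘ₗ
    (TensorProduct.lift (tw hL hL (TensorProduct.mk R L L).flip)).rTensor T ∘ₗ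
    (TensorProduct.assoc R L L T).symm.toLinearMap

omit O in
theorem swp_tmul (hL : DirectSum.IsInternal ℒ) {i j : ℤ} {a b : L} (ha : a ∈ ℒ i) (hb : b ∈ ℒ j)
    (t : T) : swp hL (a ⊗ₜ (b ⊗ₜ t)) = sgn (i * j) • b ⊗ₜ (a ⊗ₜ t) := by
  change (TensorProduct.assoc R L L T).toLinearMap (tw hL hL (TensorProduct.mk R L L).flip a b ⊗ₜ t)
    = _
  rw [tw_apply _ _ _ ha hb]
  rw [show ((sgn (i * j)) • (TensorProduct.mk R L L).flip a b) ⊗ₜ[R] t = _ from map_sgn_smul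
    ((TensorProduct.mk R (L ⊗[R] L) T).flip t) _ _,
    map_sgn_smul]
  rfl

variable (W W') in
omit O in
/-- The map `a ⊗ b ⊗ t ↦ ± φ(a) ψ(b) t`. -/
def prd₂ (φ : L →ₗ[R] Ops R Y) (ψ : L →ₗ[R] Ops R Y') (e : ℤ) : L ⊗[R] (L ⊗[R] T) →ₗ[R] V :=
  TensorProduct.lift ((G.mul.compl₂ (TensorProduct.lift
    ((G.mul.compl₂ W.eT.j) ∘ₗ W'.eY.j ∘ₗ evlₗ [] ∘ₗ ψ))) ∘ₗ W.eY.j ∘ₗ evlₗ [] ∘ₗ φ ∘ₗ signMap W.hL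
      e)

omit O in
theorem prd₂_tmul (φ : L →ₗ[R] Ops R Y) (ψ : L →ₗ[R] Ops R Y') (e : ℤ) {i : ℤ} {a : L}
    (ha : a ∈ ℒ i) (b : L) (t : T) : prd₂ W W' φ ψ e (a ⊗ₜ (b ⊗ₜ t)) = sgn (e * i) •
      G.mul (W.eY.j (evl (φ a) [])) (G.mul (W'.eY.j (evl (ψ b) [])) (W.eT.j t)) := by
  change G.mul (W.eY.j (evlₗ [] (φ (signMap W.hL e a)))) _ = _
  rw [signMap_apply _ _ ha]
  simp only [map_sgn_smul, evlₗ_apply]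
  rfl

theorem Opposite.evl_Φ_F {d e j : ℤ} {φ : L →ₗ[R] Ops R Y} {ψ : L →ₗ[R] Ops R Y'}
    (hφ : IsFam ℒ ħ GY d φ) (hψ : IsFam ℒ ħ GY' e ψ) {x : L ⊗[R] T} (hx : x ∈ tgr ℒ 𝒯 j) :
    evl (W.Φ φ) [evl (W'.F ψ x) []] = prd₂ W W' φ ψ e (swp W.hL (W.δ.lTensor L x)) := by
  simp only [evl_cons]
  induction hx using tgr_induction with
  | @tmul k l b u hb hu h =>
    have := O.evl_Φ_S hφ (hψ hb) hu
    simp only [evl_cons] at this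
    rw [F_tmul, this, lTensor_tmul]
    have hx := W.δ_mem hu
    generalize W.δ u = x at hx ⊢
    clear h hu this
    induction hx using tgr_induction with
    | @tmul i m a w ha hw h =>
      rw [swp_tmul _ hb ha, map_sgn_smul, prd₂_tmul _ _ _ ha, TensorProduct.lift.tmul]
      simp only [comp_apply, LinearMap.compl₂_apply, signMap_apply _ _ ha]
      simp only [map_sgn_smul, sgn_smul_apply, smul_smul, evlₗ_apply, sgn_mul_sgn_comm, sgn_expand]
    | zero => simp
    | add x y _ _ hx hy => simp only [map_add, tmul_add, hx, hy]
    | smul r x _ hx => simp only [map_smul, tmul_smul, hx]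
  | zero => simp [F_zero]
  | add x y _ _ hx hy => simp only [map_add, F_add, evl_add, hx, hy]
  | smul r x _ hx => simp only [map_smul, F_smul, evl_smul, hx]

theorem Opposite.evl_Φ'_F {d e j : ℤ} {φ : L →ₗ[R] Ops R Y} {ψ : L →ₗ[R] Ops R Y'}
    (hφ : IsFam ℒ ħ GY d φ) (hψ : IsFam ℒ ħ GY' e ψ) {x : L ⊗[R] T} (hx : x ∈ tgr ℒ 𝒯 j) :
    sgn (d * e) • evl (W'.Φ ψ) [evl (W.F φ x) []] = prd₂ W W' φ ψ e (W'.δ.lTensor L x) := by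
  simp only [evl_cons]
  induction hx using tgr_induction with
  | @tmul k l a u ha hu h =>
    have := O.symm.evl_Φ_S hψ (hφ ha) hu
    simp only [evl_cons] at this
    rw [F_tmul, this, lTensor_tmul]
    have hx := W'.δ_mem hu
    generalize W'.δ u = x at hx ⊢
    clear h hu this
    induction hx using tgr_induction with
    | @tmul i m b w hb hw h =>
      rw [prd₂_tmul _ _ _ ha, TensorProduct.lift.tmul]
      simp only [comp_apply, LinearMap.compl₂_apply, signMap_apply _ _ hb]
      simp only [map_sgn_smul, sgn_smul_apply, smul_smul, evlₗ_apply]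
      rw [← G.mul_assoc, ← G.mul_assoc, O.eq_T,
        G.mul_comm (W.eY.j_mem (hφ ha).nil_mem) (W'.eY.j_mem (hψ hb).nil_mem)]
      simp only [map_sgn_smul, sgn_smul_apply, smul_smul]
      simp only [sgn_expand, sgn_cancel, sgn_sort]
    | zero => simp
    | add x y _ _ hx hy => simp only [map_add, tmul_add, smul_add, hx, hy]
    | smul r x _ hx => simp only [map_smul, tmul_smul, smul_comm _ r, hx]
  | zero => simp [F_zero]
  | add x y _ _ hx hy => simp only [map_add, F_add, evl_add, smul_add, hx, hy]
  | smul r x _ hx => simp only [map_smul, F_smul, evl_smul, smul_comm _ r, hx]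

theorem Opposite.brL_Φ_F {d e j : ℤ} {φ : L →ₗ[R] Ops R Y} {ψ : L →ₗ[R] Ops R Y'}
    (hφ : IsFam ℒ ħ GY d φ) (hψ : IsFam ℒ ħ GY' e ψ) {t : T} (ht : t ∈ 𝒯 j)
    (hc : swp W.hL (W.δ.lTensor L (W'.δ t)) = W'.δ.lTensor L (W.δ t)) {γ : List (ℤ × V)}
    (hγ : ∀ z ∈ γ, W.Gen W' z) :
    brL d (e + j) (W.Φ φ) (W'.F ψ (W'.δ t)) γ
      + sgn (j * e) • brL (d + j) e (W.F φ (W.δ t)) (W'.Φ ψ) γ = 0 := by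
  have hδ := W.δ_mem ht
  have hδ' := W'.δ_mem ht
  induction γ generalizing d e φ ψ with
  | nil =>
    have h := O.evl_Φ_F hφ hψ hδ'
    rw [hc, ← O.evl_Φ'_F hφ hψ hδ] at h
    rw [brL, brL, show evl (W.Φ φ) [] = 0 from phi_nil .., show evl (W'.Φ ψ) [] = 0 from phi_nil ..,
      h]
    simp only [evl_cons, map_zero, evl_zero, smul_zero, sub_zero, zero_sub, smul_neg, smul_smul,
      sgn_mul_cancel, sgn_expand, sgn_sort]
    rw [add_neg_cancel]
  | cons z γ ih =>
    obtain ⟨⟨x, hx, hz⟩ | ⟨y, hy, hz⟩ | ⟨y, hy, hz⟩, hγ⟩ := List.forall_mem_cons.1 hγ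
    · have hx' : cur (W'.Φ ψ) (W.eT.j x) = W'.F ψ (W'.δ x) := by rw [← O.eq_T, cur_Φ_T hψ hx]
      have hx'' : cur (W'.F ψ (W'.δ t)) (W.eT.j x) = 0 := by rw [← O.eq_T, cur_F_T hψ hδ' hx]
      rw [brL, brL, hz, cur_Φ_T hφ hx, hx', hx'', cur_F_T hφ hδ hx, brL_zero_left, brL_zero_right,
        O.brL_F_F hφ hψ (W.δ_mem hx) hδ' hγ, O.brL_F_F hφ hψ hδ (W'.δ_mem hx) hγ]
      simp only [smul_zero, add_zero]
    · have h1 : cur (W.F φ (W.δ t)) (W.eY.j y)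
          = sgn (j * z.1) • W.F (curFam W.hL GY.isInternal cur y φ) (W.δ t) := by
        rw [← cur_Φ_T hφ ht, (Φ_hd hφ).cur_cur (W.eT.j_mem ht) (W.eY.j_mem hy), cur_Φ_Y hy,
          cur_Φ_T (hφ.curFam hy) ht]
      rw [brL, brL, hz, h1, O.symm.cur_Φ hψ hy, cur_F_of_kills hψ hδ' (W.eY.j_mem hy) (O.kills' y),
        cur_Φ_Y hy, brL_sgn_left, brL_zero_right, brL_zero_right, add_right_comm d,
        eq_neg_of_add_eq_zero_left (ih (hφ.curFam hy) hψ hγ)]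
      simp only [smul_neg, smul_smul, zero_add, neg_add_cancel, sgn_expand, sgn_sort]
    · have h1 : cur (W'.F ψ (W'.δ t)) (W'.eY.j y)
          = sgn (j * z.1) • W'.F (curFam W'.hL GY'.isInternal cur y ψ) (W'.δ t) := by
        rw [← cur_Φ_T hψ ht, (Φ_hd hψ).cur_cur (W'.eT.j_mem ht) (W'.eY.j_mem hy), cur_Φ_Y hy,
          cur_Φ_T (hψ.curFam hy) ht]
      rw [brL, brL, hz, h1, O.cur_Φ hφ hy, cur_F_of_kills hφ hδ (W'.eY.j_mem hy) (O.kills y),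
        cur_Φ_Y hy, brL_sgn_right, brL_zero_left, brL_zero_left, add_right_comm e,
        eq_neg_of_add_eq_zero_left (ih hφ (hψ.curFam hy) hγ)]
      simp only [smul_neg, smul_smul, smul_zero, add_zero, neg_add_cancel, sgn_expand, sgn_cancel,
        sgn_sort]

theorem Opposite.brL_Φ_Φ {d e : ℤ} {φ : L →ₗ[R] Ops R Y} {ψ : L →ₗ[R] Ops R Y'}
    (hφ : IsFam ℒ ħ GY d φ) (hψ : IsFam ℒ ħ GY' e ψ)
    (hc : ∀ {j t}, t ∈ 𝒯 j → swp W.hL (W.δ.lTensor L (W'.δ t)) = W'.δ.lTensor L (W.δ t))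
    {γ : List (ℤ × V)} (hγ : ∀ z ∈ γ, W.Gen W' z) : brL d e (W.Φ φ) (W'.Φ ψ) γ = 0 := by
  induction γ generalizing d e φ ψ with
  | nil =>
    rw [brL, show evl (W.Φ φ) [] = 0 from phi_nil .., show evl (W'.Φ ψ) [] = 0 from phi_nil ..]
    simp only [evl_cons, map_zero, evl_zero, smul_zero, sub_zero]
  | cons z γ ih =>
    obtain ⟨⟨x, hx, hz⟩ | ⟨y, hy, hz⟩ | ⟨y, hy, hz⟩, hγ⟩ := List.forall_mem_cons.1 hγ
    · have hx' : cur (W'.Φ ψ) (W.eT.j x) = W'.F ψ (W'.δ x) := by rw [← O.eq_T, cur_Φ_T hψ hx]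
      rw [brL, hz, cur_Φ_T hφ hx, hx', O.brL_Φ_F hφ hψ hx (hc hx) hγ]
    · rw [brL, hz, O.symm.cur_Φ hψ hy, brL_zero_right, cur_Φ_Y hy, ih (hφ.curFam hy) hψ hγ,
        smul_zero, zero_add]
    · rw [brL, hz, O.cur_Φ hφ hy, brL_zero_left, cur_Φ_Y hy, ih hφ (hψ.curFam hy) hγ, smul_zero,
        add_zero]

end Wing
end Wing

section

variable {L' : Type*} {BT : BD0Algebra ħ 𝒯} {BY : BD0Algebra ħ 𝒴} {BY' : BD0Algebra ħ 𝒴'}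

omit [AddCommGroup V] [Module R V] in
theorem exists_perm {j : T → V} {j' : Y → V} {γ : List (ℤ × V)}
    (hγ : ∀ z ∈ γ, (∃ t ∈ 𝒯 z.1, z.2 = j t) ∨ (∃ y ∈ 𝒴 z.1, z.2 = j' y)) :
    ∃ (τ : List (ℤ × T)) (β : List (ℤ × Y)), HomList 𝒯 τ ∧ HomList 𝒴 β ∧
      γ.Perm (τ.map (fun x => (x.1, j x.2)) ++ β.map (fun x => (x.1, j' x.2))) := by
  induction γ with
  | nil => exact ⟨[], [], by simp [HomList], by simp [HomList], List.Perm.nil⟩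
  | cons z γ ih =>
    obtain ⟨hz, hγ⟩ := List.forall_mem_cons.1 hγ
    obtain ⟨τ, β, hτ, hβ, hp⟩ := ih hγ
    rcases hz with ⟨t, ht, hz⟩ | ⟨y, hy, hz⟩
    · exact ⟨(z.1, t) :: τ, β, HomList.cons_iff.2 ⟨ht, hτ⟩, hβ, by
        rw [List.map_cons, List.cons_append, ← hz]; exact hp.cons z⟩
    · refine ⟨τ, (z.1, y) :: β, hτ, HomList.cons_iff.2 ⟨hy, hβ⟩, ?_⟩
      rw [List.map_cons, ← hz]
      exact (hp.cons z).trans List.perm_middle.symm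

theorem brL_ι_ops (E : OpEmb ħ BT.toGCAlgebra G) {γ : List (ℤ × V)} (hγ : HomList 𝒱 γ)
    (h : ∀ z ∈ γ, (∃ t ∈ 𝒯 z.1, z.2 = E.j t) ∨ E.Kills z.2) :
    brL 1 1 (E.ι BT.ops) (E.ι BT.ops) γ = 0 := by
  have hd := E.ι_hd BT.ops_isHDiffOp
  by_cases hk : ∃ z ∈ γ, E.Kills z.2
  · obtain ⟨z, hz, hk⟩ := hk
    exact brL_eq_zero_of_mem hd hd hγ hz (hk BT.ops_isHDiffOp) (hk BT.ops_isHDiffOp)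
  · push Not at hk
    obtain ⟨τ, β, hτ, hβ, hp⟩ := exists_perm (𝒯 := 𝒯) (𝒴 := 𝒯) (j := E.j) (j' := E.j) (γ := γ)
      fun z hz => Or.inl ((h z hz).resolve_right (hk z hz))
    refine brL_eq_zero_of_perm hp hγ hd hd ?_
    have happ : HomList 𝒯 (τ ++ β) := fun x hx => (List.mem_append.1 hx).elim (hτ x) (hβ x)
    rw [← List.map_append, E.brL_ι, BT.brL_ops happ, map_zero]

namespace Wing

variable {W : Wing ħ BT.toGCAlgebra BY.toGCAlgebra G ℒ}
  {W' : Wing ħ BT.toGCAlgebra BY'.toGCAlgebra G ℒ} (O : W.Opposite W')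
  {φ : L →ₗ[R] Ops R Y} (C : W.Compat φ) {ψ : L →ₗ[R] Ops R Y'} (C' : W'.Compat ψ)

theorem gen_mem {z : ℤ × V} (h : W.Gen W' z) : z.2 ∈ 𝒱 z.1 := by
  rcases h with ⟨x, hx, hz⟩ | ⟨x, hx, hz⟩ | ⟨x, hx, hz⟩
  · rw [hz]; exact W.eT.j_mem hx
  · rw [hz]; exact W.eY.j_mem hx
  · rw [hz]; exact W'.eY.j_mem hx

include O C in
theorem Opposite.wing_mc (hT : ∀ y, W.eT.Kills (W'.eY.j y)) {γ : List (ℤ × V)}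
    (hγ : ∀ z ∈ γ, W.Gen W' z) :
    2 • brL 1 1 (W.eT.ι BT.ops) (W.Φ φ) γ + 2 • brL 1 1 (W.eY.ι BY.ops) (W.Φ φ) γ
      + brL 1 1 (W.Φ φ) (W.Φ φ) γ = 0 := by
  have hm : HomList 𝒱 γ := fun z hz => gen_mem (hγ z hz)
  have hFam : IsFam ℒ ħ BY.toGCAlgebra 1 φ := C.fam
  have h1 := W.eT.ι_hd BT.ops_isHDiffOp
  have h2 := W.eY.ι_hd BY.ops_isHDiffOp
  have h3 := Φ_hd (W := W) hFam
  by_cases hk : ∃ z ∈ γ, ∃ y ∈ 𝒴' z.1, z.2 = W'.eY.j y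
  · obtain ⟨z, hz, y, hy, he⟩ := hk
    have e1 : cur (W.eT.ι BT.ops) z.2 = 0 := by rw [he]; exact hT y BT.ops_isHDiffOp
    have e2 : cur (W.eY.ι BY.ops) z.2 = 0 := by rw [he]; exact O.kills y BY.ops_isHDiffOp
    have e3 : cur (W.Φ φ) z.2 = 0 := by rw [he]; exact O.cur_Φ hFam hy
    rw [brL_eq_zero_of_mem h1 h3 hm hz e1 e3, brL_eq_zero_of_mem h2 h3 hm hz e2 e3,
      brL_eq_zero_of_mem h3 h3 hm hz e3 e3]
    simp
  · push Not at hk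
    obtain ⟨τ, β, hτ, hβ, hp⟩ := exists_perm (𝒯 := 𝒯) (𝒴 := 𝒴) (j := W.eT.j) (j' := W.eY.j)
      (γ := γ) fun z hz => by
        rcases hγ z hz with h | h | ⟨y, hy, he⟩
        exacts [Or.inl h, Or.inr h, absurd he (hk z hz y hy)]
    obtain ⟨s, hs⟩ := brL_perm (ħ := ħ) (G := G) hp hm
    rw [hs h1 h3, hs h2 h3, hs h3 h3, ← smul_comm s 2, ← smul_comm s 2, ← smul_add, ← smul_add,
      Wing.wing_mc C hτ hβ, smul_zero]

include O C C' in
theorem Opposite.mc (hT : W'.eT = W.eT)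
    (hc : ∀ {j t}, t ∈ 𝒯 j → swp W.hL (W.δ.lTensor L (W'.δ t)) = W'.δ.lTensor L (W.δ t))
    {γ : List (ℤ × V)} (hγ : ∀ z ∈ γ, W.Gen W' z) :
    let l := W.eT.ι BT.ops + W.eY.ι BY.ops + W'.eY.ι BY'.ops + W.Φ φ + W'.Φ ψ
    brL 1 1 l l γ = 0 := by
  intro l
  have symm : ∀ P Q : Ops R V, brL 1 1 P Q γ = brL 1 1 Q P γ := fun P Q => by
    rw [brL_symm, mul_one, sgn_one, Units.neg_smul, one_smul, neg_neg]
  have hm : HomList 𝒱 γ := fun z hz => gen_mem (hγ z hz)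
  have hTY' : ∀ y, W.eT.Kills (W'.eY.j y) := by rw [← hT]; exact W'.kills_Y
  have hY'T : ∀ t, W'.eY.Kills (W.eT.j t) := by rw [← hT]; exact W'.kills_T
  have a1 := brL_ι_ops W.eT hm fun z hz => by
    rcases hγ z hz with h | ⟨y, hy, he⟩ | ⟨y, hy, he⟩
    exacts [Or.inl h, Or.inr (he ▸ W.kills_Y y), Or.inr (he ▸ hTY' y)]
  have a2 := brL_ι_ops W.eY hm fun z hz => by
    rcases hγ z hz with ⟨y, hy, he⟩ | h | ⟨y, hy, he⟩
    exacts [Or.inr (he ▸ W.kills_T y), Or.inl h, Or.inr (he ▸ O.kills y)]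
  have a3 := brL_ι_ops W'.eY hm fun z hz => by
    rcases hγ z hz with ⟨y, hy, he⟩ | ⟨y, hy, he⟩ | h
    exacts [Or.inr (he ▸ hY'T y), Or.inr (he ▸ O.kills' y), Or.inl h]
  have b1 := brL_ι_ι W.kills_Y W.kills_T BT.ops_isHDiffOp BY.ops_isHDiffOp (γ := γ) fun z hz => by
    rcases hγ z hz with h | h | ⟨y, hy, he⟩
    exacts [Or.inl h, Or.inr (Or.inl h), Or.inr (Or.inr ⟨he ▸ hTY' y, he ▸ O.kills y⟩)]
  have b2 := brL_ι_ι hTY' hY'T BT.ops_isHDiffOp BY'.ops_isHDiffOp (γ := γ) fun z hz => by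
    rcases hγ z hz with h | ⟨y, hy, he⟩ | h
    exacts [Or.inl h, Or.inr (Or.inr ⟨he ▸ W.kills_Y y, he ▸ O.kills' y⟩), Or.inr (Or.inl h)]
  have b3 := brL_ι_ι O.kills O.kills' BY.ops_isHDiffOp BY'.ops_isHDiffOp (γ := γ) fun z hz => by
    rcases hγ z hz with ⟨y, hy, he⟩ | h | h
    exacts [Or.inr (Or.inr ⟨he ▸ W.kills_T y, he ▸ hY'T y⟩), Or.inl h, Or.inr (Or.inl h)]
  have c1 := O.brL_ι_Φ BY'.ops_isHDiffOp C.fam hγ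
  have c2 := O.symm.brL_ι_Φ BY.ops_isHDiffOp C'.fam fun z hz => O.gen_symm (hγ z hz)
  have c3 := O.brL_Φ_Φ C.fam C'.fam hc hγ
  have w1 := O.wing_mc C hTY' hγ
  have w2 := O.symm.wing_mc C' (by rw [hT]; exact W.kills_Y) fun z hz => O.gen_symm (hγ z hz)
  rw [hT] at w2
  simp only [l, brL_add_left, brL_add_right]
  rw [symm (W.eY.ι _) (W.eT.ι _), symm (W'.eY.ι _) (W.eT.ι _), symm (W'.eY.ι _) (W.eY.ι _),
    symm (W.Φ φ) (W.eT.ι _), symm (W.Φ φ) (W.eY.ι _), symm (W.Φ φ) (W'.eY.ι _),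
    symm (W'.Φ ψ) (W.eT.ι _), symm (W'.Φ ψ) (W.eY.ι _), symm (W'.Φ ψ) (W'.eY.ι _),
    symm (W'.Φ ψ) (W.Φ φ), a1, a2, a3, b1, b2, b3, c1, c2, c3]
  have h := congrArg₂ (· + ·) w1 w2
  simp only [add_zero] at h
  refine Eq.trans ?_ h
  abel

end Wing
end

end

section

variable {R : Type*} [CommRing R] {ħ : R} {A L M N T V W : Type*} [AddCommGroup A] [Module R A]
  [AddCommGroup L] [Module R L] [AddCommGroup M] [Module R M] [AddCommGroup N] [Module R N]
  [AddCommGroup T] [Module R T] [AddCommGroup V] [Module R V] [AddCommGroup W] [Module R W]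
  {𝒜 : ℤ → Submodule R A} {ℒ : ℤ → Submodule R L} {ℳ : ℤ → Submodule R M} {𝒩 : ℤ → Submodule R N}
  {𝒯 : ℤ → Submodule R T} {𝒱 : ℤ → Submodule R V} {𝒲 : ℤ → Submodule R W} {G : GCAlgebra 𝒱}
  {GN : GCAlgebra 𝒩} {GT : GCAlgebra 𝒯} {GM : GCAlgebra ℳ} {alg : BD1Algebra ħ 𝒜}
  {BM : BD0Algebra ħ ℳ} {BN : BD0Algebra ħ 𝒩}

section

/-- The operation `(v ⊗ w, v' ⊗ w') ↦ (-1)^{|w||v'|} m(v, v') ⊗ n(w, w')`. -/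
def koszulMap₂ (hV : DirectSum.IsInternal 𝒱) (hW : DirectSum.IsInternal 𝒲)
    (m : V →ₗ[R] V →ₗ[R] V) (n : W →ₗ[R] W →ₗ[R] W) :
    V ⊗[R] W →ₗ[R] V ⊗[R] W →ₗ[R] V ⊗[R] W :=
  TensorProduct.lift (hrec (X := V →ₗ[R] V ⊗[R] W →ₗ[R] V ⊗[R] W) hW fun j =>
    (lcomp R _ ((lcomp R V (signMap hV j)) ∘ₗ m)) ∘ₗ
      (TensorProduct.mapBilinear (RingHom.id R) V W V W).flip ∘ₗ n ∘ₗ (𝒲 j).subtype).flip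

theorem koszulMap₂_apply (hV : DirectSum.IsInternal 𝒱) (hW : DirectSum.IsInternal 𝒲)
    (m : V →ₗ[R] V →ₗ[R] V) (n : W →ₗ[R] W →ₗ[R] W) {i j : ℤ} {v' : V} {w : W} (hw : w ∈ 𝒲 j)
    (hv : v' ∈ 𝒱 i) (v : V) (w' : W) :
    koszulMap₂ hV hW m n (v ⊗ₜ w) (v' ⊗ₜ w') = sgn (i * j) • (m v v' ⊗ₜ n w w') := by
  rw [koszulMap₂, TensorProduct.lift.tmul, flip_apply, hrec_of_mem _ _ hw]
  change m v (signMap hV j v') ⊗ₜ n w w' = _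
  rw [signMap_apply _ _ hv, map_sgn_smul, Units.smul_def, ← smul_tmul', ← Units.smul_def, mul_comm]

theorem tmul_sgn (u : ℤˣ) (v : V) (w : W) : v ⊗ₜ[R] (u • w) = u • v ⊗ₜ[R] w :=
  map_sgn_smul (TensorProduct.mk R V W v) u w

theorem sgn_tmul (u : ℤˣ) (v : V) (w : W) : (u • v) ⊗ₜ[R] w = u • v ⊗ₜ[R] w :=
  map_sgn_smul ((TensorProduct.mk R V W).flip w) u v

end

namespace ShiftedBD

variable {ℒ : ℤ → Submodule R A} (D : ShiftedBD ħ ℒ)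

/-- The removal of the last letter of a word. -/
def delR : TensorCoalg R A →ₗ[R] A ⊗[R] TensorCoalg R A :=
  rrec 0 (tw (𝒲 := Tgr ℒ) D.isInternal (Tgr_isInternal D.isInternal)
    (TensorProduct.mk R A (TensorCoalg R A))).flip
    (0 : A ⊗[R] TensorCoalg R A →ₗ[R] A →ₗ[R] A ⊗[R] TensorCoalg R A)

/-- The shuffle product with a fixed second factor. -/
def mulR (y : TensorCoalg R A) : TensorCoalg R A →ₗ[R] TensorCoalg R A := D.mul.flip y

theorem mulR_apply (x y : TensorCoalg R A) : D.mulR y x = D.mul x y := rfl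

/-- A letter added at the end of a word. -/
def snR (a : A) : TensorCoalg R A →ₗ[R] TensorCoalg R A := sn.flip a

theorem snR_apply (w : TensorCoalg R A) (a : A) : snR a w = sn w a := rfl

theorem mulR_one : D.mulR 1 = LinearMap.id := by
  refine LinearMap.ext fun x => ?_
  rw [mulR_apply, mulT_one_right, LinearMap.id_apply]

theorem delR_one : D.delR 1 = 0 := rrec_one ..

theorem delR_sn {i j : ℤ} {w : TensorCoalg R A} {a : A} (hw : w ∈ Tgr ℒ i) (ha : a ∈ ℒ j) :
    D.delR (sn w a) = sgn (j * i) • a ⊗ₜ w := by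
  rw [delR, rrec_sn, flip_apply, tw_apply _ _ _ ha hw]
  exact zero_add _

variable (R A) in
/-- The counit. -/
def cou : TensorCoalg R A →ₗ[R] R := rrec 1 0 0

theorem cou_one : cou R A 1 = 1 := rrec_one ..

theorem cou_sn (w : TensorCoalg R A) (a : A) : cou R A (sn w a) = 0 :=
  (rrec_sn ..).trans (zero_add _)

variable (R A) in
/-- The removal of the first letter of a word. -/
def delL : TensorCoalg R A →ₗ[R] A ⊗[R] TensorCoalg R A :=
  rrec 0 ((cou R A).smulRight ((TensorProduct.mk R A (TensorCoalg R A)).flip 1))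
    (LinearMap.lTensorHom A ∘ₗ sn.flip).flip

theorem delL_one : delL R A 1 = 0 := rrec_one ..

theorem delL_sn (w : TensorCoalg R A) (a : A) :
    delL R A (sn w a) = (snR a).lTensor A (delL R A w) + cou R A w • a ⊗ₜ 1 := rrec_sn ..

theorem cou_mul {i j : ℤ} {x y : TensorCoalg R A} (hx : IsWord ℒ i x) (hy : IsWord ℒ j y) :
    cou R A (D.mul x y) = cou R A x * cou R A y := by
  cases hx with
  | one => rw [mulT_one_left, cou_one, one_mul]
  | sn hw ha =>
    cases hy with
    | one => rw [mulT_one_right, cou_one, mul_one]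
    | sn hv hb =>
      rw [mulT_sn_sn _ _ ha hv.mem hb, map_add, cou_sn, map_sgn_smul, cou_sn, cou_sn, zero_mul,
        smul_zero, add_zero]

theorem delR_mem {i : ℤ} {x : TensorCoalg R A} (hx : IsWord ℒ i x) :
    D.delR x ∈ tgr ℒ (Tgr ℒ) i := by
  cases hx with
  | one => rw [delR_one]; exact zero_mem _
  | sn hw ha =>
    rw [D.delR_sn hw.mem ha]
    exact sgn_smul_mem _ _ (tmul_mem ha hw.mem (add_comm _ _))

theorem delL_mem {i : ℤ} {x : TensorCoalg R A} (hx : IsWord ℒ i x) :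
    delL R A x ∈ tgr ℒ (Tgr ℒ) i := by
  induction hx with
  | one => rw [delL_one]; exact zero_mem _
  | @sn i j w a hw ha ih =>
    rw [delL_sn]
    refine add_mem ?_ ?_
    · clear hw
      generalize delL R A w = x at ih ⊢
      induction ih using tgr_induction with
      | tmul hb hu h => exact tmul_mem hb (sn_mem hu ha) (by rw [← h, add_assoc])
      | zero => rw [map_zero]; exact zero_mem _
      | add x y _ _ hx hy => rw [map_add]; exact add_mem hx hy
      | smul r x _ hx => rw [map_smul]; exact smul_mem _ _ hx
    · cases hw with
      | one => exact smul_mem _ _ (tmul_mem ha one_mem_Tgr (add_comm _ _))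
      | sn => rw [cou_sn, zero_smul]; exact zero_mem _

theorem delR_mul {i j : ℤ} {x y : TensorCoalg R A} (hx : IsWord ℒ i x) (hy : IsWord ℒ j y) :
    D.delR (D.mul x y) = (D.mulR y).lTensor A (D.delR x)
      + sgn (i * j) • (D.mulR x).lTensor A (D.delR y) := by
  cases hx with
  | one =>
    rw [mulT_one_left, delR_one, map_zero, zero_add, zero_mul, sgn_zero, one_smul, mulR_one,
      LinearMap.lTensor_id]; rfl
  | @sn i l w a hw ha =>
    cases hy with
    | one =>
        rw [mulT_one_right, delR_one, map_zero, smul_zero, add_zero, mulR_one,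
          LinearMap.lTensor_id]; rfl
    | @sn j m v b hv hb =>
      have hx := hw.sn ha
      have hy := hv.sn hb
      rw [mulT_sn_sn _ _ ha hv.mem hb, map_add, map_sgn_smul,
        D.delR_sn (D.mul_mem hx.mem hv.mem) hb, D.delR_sn (D.mul_mem hw.mem hy.mem) ha,
        D.delR_sn hw.mem ha, D.delR_sn hv.mem hb, map_sgn_smul, map_sgn_smul, lTensor_tmul,
        lTensor_tmul, mulR_apply, mulR_apply, D.mul_comm' hv.mem hx.mem, tmul_sgn]
      simp only [smul_smul, sgn_expand, sgn_cancel, sgn_sort]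
      abel

theorem delL_mul {i j : ℤ} {x y : TensorCoalg R A} (hx : IsWord ℒ i x) (hy : IsWord ℒ j y) :
    delL R A (D.mul x y) = (D.mulR y).lTensor A (delL R A x)
      + sgn (i * j) • (D.mulR x).lTensor A (delL R A y) := by
  induction hx generalizing j y with
  | one =>
    rw [mulT_one_left, delL_one, map_zero, zero_add, zero_mul, sgn_zero, one_smul, mulR_one,
      LinearMap.lTensor_id]; rfl
  | @sn i l w a hw ha ih =>
    induction hy with
    | one =>
      rw [mulT_one_right, delL_one, map_zero, smul_zero, add_zero, mulR_one, LinearMap.lTensor_id];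
        rfl
    | @sn j m v b hv hb ih' =>
      have hx := hw.sn ha
      have hy := hv.sn hb
      have e1 : ∀ z, (D.mulR (sn v b)).lTensor A ((snR a).lTensor A z)
          = (snR b).lTensor A ((D.mulR v).lTensor A ((snR a).lTensor A z))
            + sgn (l * (j + m)) • (snR a).lTensor A ((D.mulR (sn v b)).lTensor A z) := by
        intro z
        induction z using TensorProduct.induction_on with
        | zero => simp
        | tmul c u =>
          simp only [lTensor_tmul, mulR_apply, snR_apply, ← tmul_sgn, ← tmul_add]
          rw [mulT_sn_sn _ _ ha hv.mem hb]
        | add x y hx hy => simp only [map_add, hx, hy, smul_add]; abel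
      have e2 : ∀ z, (D.mulR (sn w a)).lTensor A ((snR b).lTensor A z)
          = (snR a).lTensor A ((D.mulR w).lTensor A ((snR b).lTensor A z))
            + sgn (m * (i + l)) • (snR b).lTensor A ((D.mulR (sn w a)).lTensor A z) := by
        intro z
        induction z using TensorProduct.induction_on with
        | zero => simp
        | tmul c u =>
          simp only [lTensor_tmul, mulR_apply, snR_apply, ← tmul_sgn, ← tmul_add]
          rw [mulT_sn_sn _ _ hb hw.mem ha]
        | add x y hx hy => simp only [map_add, hx, hy, smul_add]; abel
      rw [mulT_sn_sn _ _ ha hv.mem hb, map_add, map_sgn_smul, delL_sn, delL_sn, ih', ih hy,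
        D.cou_mul hx hv, D.cou_mul hw hy, cou_sn, cou_sn, delL_sn, delL_sn]
      simp only [map_add, map_smul, map_sgn_smul, e1, e2, lTensor_tmul, mulR_apply, snR_apply,
        mulT_one_left, zero_mul, mul_zero, zero_smul, add_zero]
      simp only [smul_add, smul_smul, sgn_expand, sgn_cancel, sgn_sort]
      abel

theorem delL_delR {i : ℤ} {x : TensorCoalg R A} (hx : IsWord ℒ i x) :
    Wing.swp D.isInternal (D.delR.lTensor A (delL R A x)) = (delL R A).lTensor A (D.delR x) := by
  cases hx with
  | one => rw [delL_one, delR_one, map_zero, map_zero, map_zero]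
  | @sn i j w a hw ha =>
    have hz := delL_mem hw
    rw [delL_sn, D.delR_sn hw.mem ha, map_sgn_smul, lTensor_tmul, map_add, map_smul, lTensor_tmul,
      delR_one, tmul_zero, smul_zero, add_zero]
    clear hw
    generalize delL R A w = z at hz ⊢
    induction hz using tgr_induction with
    | @tmul k l c u hc hu h =>
      rw [lTensor_tmul, snR_apply, lTensor_tmul, D.delR_sn hu ha, tmul_sgn, map_sgn_smul,
        Wing.swp_tmul _ hc ha, smul_smul, ← h]
      simp only [sgn_expand, sgn_sort]
    | zero => simp only [map_zero, tmul_zero, smul_zero]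
    | add x y _ _ hx hy => simp only [map_add, tmul_add, smul_add, hx, hy]
    | smul r x _ hx => simp only [map_smul, tmul_smul, smul_comm _ r, hx]

end ShiftedBD

namespace ShiftedBD

variable {ℒ : ℤ → Submodule R A} (D : ShiftedBD ħ ℒ)

/-- The multiplication of the last letter of a word with a given letter. -/
def lastR (a : A) : TensorCoalg R A →ₗ[R] TensorCoalg R A := D.last.flip a

theorem lastR_apply (w : TensorCoalg R A) (a : A) : D.lastR a w = D.last w a := rfl

/-- The map `a ⊗ b ⊗ w ↦ ν(a, b) ⊗ w`. -/
def mrg (ν : A →ₗ[R] A →ₗ[R] A) :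
    A ⊗[R] (A ⊗[R] TensorCoalg R A) →ₗ[R] A ⊗[R] TensorCoalg R A :=
  TensorProduct.lift (LinearMap.rTensorHom (TensorCoalg R A) ∘ₗ ν)

theorem mrg_tmul (ν : A →ₗ[R] A →ₗ[R] A) (a b : A) (w : TensorCoalg R A) :
    mrg ν (a ⊗ₜ (b ⊗ₜ w)) = ν a b ⊗ₜ w := rfl

/-- The differential on letters and words. -/
def difR (ν : A →ₗ[R] A →ₗ[R] A) (δ : TensorCoalg R A →ₗ[R] A ⊗[R] TensorCoalg R A) :
    A ⊗[R] TensorCoalg R A →ₗ[R] A ⊗[R] TensorCoalg R A :=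
  TensorProduct.map (signMap D.isInternal 1) D.dT + D.d.rTensor (TensorCoalg R A)
    + mrg ν ∘ₗ δ.lTensor A

theorem difR_tmul (ν : A →ₗ[R] A →ₗ[R] A) (δ : TensorCoalg R A →ₗ[R] A ⊗[R] TensorCoalg R A)
    {i : ℤ} {a : A} (ha : a ∈ ℒ i) (w : TensorCoalg R A) : D.difR ν δ (a ⊗ₜ w)
      = sgn i • a ⊗ₜ D.dT w + D.d a ⊗ₜ w + mrg ν (a ⊗ₜ δ w) := by
  rw [difR, lin_add, lin_add, map_tmul, signMap_apply _ _ ha, one_mul, sgn_tmul]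
  rfl

theorem delR_dT {ν : A →ₗ[R] A →ₗ[R] A}
    (hν : ∀ {i j a b}, a ∈ ℒ i → b ∈ ℒ j → ν a b = sgn (i * j) • D.μ b a) {i : ℤ}
    {x : TensorCoalg R A} (hx : IsWord ℒ i x) :
    D.delR (D.dT x) = D.difR ν D.delR (D.delR x) := by
  cases hx with
  | one => rw [dT_one, delR_one, map_zero (D.difR _ _), map_zero]
  | @sn i j w a hw ha =>
    rw [D.dT_sn hw.mem, map_add, map_add, D.delR_sn (D.dT_mem hw) ha, map_sgn_smul,
      D.delR_sn hw.mem (D.d_mem ha), D.delR_sn hw.mem ha, map_sgn_smul, D.difR_tmul _ _ ha]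
    have key : D.delR (D.last w a) = sgn (j * i) • mrg ν (a ⊗ₜ D.delR w) := by
      cases hw with
      | one => rw [last_one, delR_one, map_zero, tmul_zero, map_zero, smul_zero]
      | @sn i k u c hu hc =>
        rw [D.last_sn hu.mem, map_sgn_smul, D.delR_sn hu.mem (D.μ_mem hc ha), D.delR_sn hu.mem hc,
          tmul_sgn, map_sgn_smul, mrg_tmul, hν ha hc, sgn_tmul]
        simp only [smul_smul, sgn_expand, sgn_cancel, sgn_sort]
    rw [key]
    simp only [smul_add, smul_smul, sgn_expand, sgn_cancel, sgn_sort]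

theorem cou_last {i : ℤ} {w : TensorCoalg R A} (hw : IsWord ℒ i w) (a : A) :
    cou R A (D.last w a) = 0 := by
  cases hw with
  | one => rw [last_one, map_zero]
  | sn hu hc => rw [D.last_sn hu.mem, map_sgn_smul, cou_sn, smul_zero]

theorem cou_dT {i : ℤ} {w : TensorCoalg R A} (hw : IsWord ℒ i w) : cou R A (D.dT w) = 0 := by
  cases hw with
  | one => rw [dT_one, map_zero]
  | sn hu hc =>
    rw [D.dT_sn hu.mem, map_add, map_add, map_sgn_smul, cou_sn, cou_sn, smul_zero, add_zero,
      zero_add, D.cou_last hu]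

/-- The map `c ⊗ u ↦ ε(u) μ(c, a) ⊗ 1`. -/
def frs (a : A) : A ⊗[R] TensorCoalg R A →ₗ[R] A ⊗[R] TensorCoalg R A :=
  TensorProduct.map (D.μ.flip a) ((cou R A).smulRight 1)

theorem frs_tmul (a c : A) (u : TensorCoalg R A) :
    D.frs a (c ⊗ₜ u) = cou R A u • D.μ c a ⊗ₜ 1 := by
  rw [frs, map_tmul, LinearMap.smulRight_apply, tmul_smul]; rfl

theorem delL_last {i : ℤ} {w : TensorCoalg R A} (hw : IsWord ℒ i w) (a : A) :
    delL R A (D.last w a) = TensorProduct.map (signMap D.isInternal 1) (D.lastR a) (delL R A w)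
      + D.frs a (delL R A w) := by
  cases hw with
  | one => rw [last_one, delL_one, map_zero, map_zero (D.frs a), add_zero, map_zero]
  | @sn i j u c hu hc =>
    have hz := delL_mem hu
    have hu' : sgn i • cou R A u = cou R A u := by
      cases hu with
      | one => rw [sgn_zero, one_smul]
      | sn => rw [cou_sn, smul_zero]
    have h1 : sgn i • cou R A u • D.μ c a ⊗ₜ[R] (1 : TensorCoalg R A)
        = cou R A u • D.μ c a ⊗ₜ[R] 1 := by rw [← smul_assoc, hu']
    rw [D.last_sn hu.mem, map_sgn_smul, delL_sn, delL_sn, smul_add, h1, map_add, map_add, map_smul,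
      map_smul, D.frs_tmul, cou_one, one_smul, map_tmul, lastR_apply, last_one, tmul_zero,
      smul_zero, add_zero, ← add_assoc]
    congr 1
    clear h1 hu' hu
    generalize delL R A u = z at hz ⊢
    induction hz using tgr_induction with
    | @tmul k l e u he hu h =>
      rw [lTensor_tmul, lTensor_tmul, snR_apply, snR_apply, frs_tmul, cou_sn, zero_smul, add_zero,
        map_tmul, signMap_apply _ _ he, one_mul, lastR_apply, D.last_sn hu, tmul_sgn, sgn_tmul,
        smul_smul, ← h, sgn_add, sgn_mul_sgn_comm]
    | zero => simp only [map_zero, smul_zero, add_zero]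
    | add x y _ _ hx hy => simp only [map_add, smul_add, hx, hy]; abel
    | smul r x _ hx => rw [map_smul, map_smul, map_smul, map_smul, smul_comm _ r, hx, smul_add]

theorem delL_dT {i : ℤ} {x : TensorCoalg R A} (hx : IsWord ℒ i x) :
    delL R A (D.dT x) = D.difR D.μ (delL R A) (delL R A x) := by
  induction hx with
  | one => rw [dT_one, delL_one, map_zero (D.difR _ _), map_zero]
  | @sn i j w a hw ha ih =>
    have hz := delL_mem hw
    have h0 : sgn i • cou R A w = cou R A w := by
      cases hw with
      | one => rw [sgn_zero, one_smul]
      | sn => rw [cou_sn, smul_zero]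
    have h1 : sgn i • cou R A w • D.d a ⊗ₜ[R] (1 : TensorCoalg R A)
        = cou R A w • D.d a ⊗ₜ[R] 1 := by rw [← smul_assoc, h0]
    rw [D.dT_sn hw.mem, map_add, map_add, map_sgn_smul, delL_sn, delL_sn, delL_sn, D.cou_dT hw,
      zero_smul, add_zero, ih, D.delL_last hw, map_add, map_smul, D.difR_tmul _ _ ha, dT_one,
      delL_one, tmul_zero, smul_zero, tmul_zero, map_zero, add_zero, zero_add, smul_add, h1]
    clear h1 h0 ih hw
    generalize delL R A w = z at hz ⊢
    suffices (snR a).lTensor A (D.difR D.μ (delL R A) z)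
        + sgn i • (snR (D.d a)).lTensor A z
        + (TensorProduct.map (signMap D.isInternal 1) (D.lastR a) z + D.frs a z)
        = D.difR D.μ (delL R A) ((snR a).lTensor A z) by rw [← this]; abel
    induction hz using tgr_induction with
    | @tmul k l c u hc hu h =>
      rw [lTensor_tmul, lTensor_tmul, snR_apply, snR_apply, frs_tmul, map_tmul,
        signMap_apply _ _ hc, one_mul, lastR_apply, D.difR_tmul _ _ hc, D.difR_tmul _ _ hc,
        D.dT_sn hu, delL_sn, map_add, map_add, map_sgn_smul, lTensor_tmul, lTensor_tmul, snR_apply,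
        snR_apply, tmul_add, tmul_add, tmul_add, map_add, tmul_sgn, sgn_tmul, tmul_smul,
        map_smul (mrg D.μ), mrg_tmul, ← h]
      have h2 : ∀ z : A ⊗[R] TensorCoalg R A, (snR a).lTensor A (mrg D.μ (c ⊗ₜ z))
          = mrg D.μ (c ⊗ₜ (snR a).lTensor A z) := by
        intro z
        induction z using TensorProduct.induction_on with
        | zero => simp only [map_zero, tmul_zero]
        | tmul => rfl
        | add x y hx hy => simp only [map_add, tmul_add, hx, hy]
      rw [h2]
      simp only [smul_add, smul_smul, sgn_add]
      abel
    | zero => simp only [map_zero, smul_zero, add_zero]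
    | add x y _ _ hx hy => simp only [map_add, smul_add, ← hx, ← hy]; abel
    | smul r x _ hx => simp only [map_smul, smul_comm _ r, ← hx, smul_add]

end ShiftedBD

namespace ShiftedBD

variable {ℒ : ℤ → Submodule R A} (D : ShiftedBD ħ ℒ)

/-- The bracket with a word of degree `k` on letters and words. -/
def adR (k : ℤ) (s : TensorCoalg R A) : A ⊗[R] TensorCoalg R A →ₗ[R] A ⊗[R] TensorCoalg R A :=
  TensorProduct.map (signMap D.isInternal (1 + k)) (D.brT s)

theorem adR_tmul (k : ℤ) (s : TensorCoalg R A) {i : ℤ} {c : A} (hc : c ∈ ℒ i)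
    (u : TensorCoalg R A) : D.adR k s (c ⊗ₜ u) = sgn ((1 + k) * i) • c ⊗ₜ D.brT s u := by
  rw [adR, map_tmul, signMap_apply _ _ hc, sgn_tmul]

theorem adR_one_right (k : ℤ) (s : TensorCoalg R A) (c : A) : D.adR k s (c ⊗ₜ 1) = 0 := by
  rw [adR, map_tmul, brT_one_right, tmul_zero]

theorem adR_one_left (k : ℤ) (z : A ⊗[R] TensorCoalg R A) : D.adR k 1 z = 0 := by
  rw [adR, show D.brT 1 = 0 from LinearMap.ext fun x => D.brT_one_left x,
    TensorProduct.map_zero_right, lin_zero]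

/-- The bracket of letters combined with the product of words. -/
def bmul : A ⊗[R] TensorCoalg R A →ₗ[R] A ⊗[R] TensorCoalg R A →ₗ[R] A ⊗[R] TensorCoalg R A :=
  koszulMap₂ (𝒱 := ℒ) (𝒲 := Tgr ℒ) D.isInternal (Tgr_isInternal D.isInternal) D.β D.mul

theorem bmul_tmul {i j : ℤ} {b : A} {t : TensorCoalg R A} (ht : t ∈ Tgr ℒ j) (hb : b ∈ ℒ i) (a : A)
    (u : TensorCoalg R A) :
    D.bmul (a ⊗ₜ t) (b ⊗ₜ u) = sgn (i * j) • (D.β a b ⊗ₜ D.mul t u) :=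
  koszulMap₂_apply _ _ _ _ ht hb _ _

theorem delR_brT {i j : ℤ} {x y : TensorCoalg R A} (hx : IsWord ℒ i x) (hy : IsWord ℒ j y) :
    D.delR (D.brT x y) = D.adR i x (D.delR y) + sgn (i * j) • D.adR j y (D.delR x)
      + D.bmul (D.delR x) (D.delR y) := by
  cases hx with
  | one =>
    rw [brT_one_left, delR_one, map_zero, map_zero, map_zero, adR_one_left, lin_zero, smul_zero,
      add_zero, add_zero]
  | @sn n j w a hw ha =>
    cases hy with
    | one =>
      rw [brT_one_right, delR_one, map_zero, map_zero, map_zero, adR_one_left, smul_zero, add_zero,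
        add_zero]
    | @sn i l v b hv hb =>
      have hx := hw.sn ha
      have hy := hv.sn hb
      rw [D.brT_sn_sn hw.mem ha hv.mem hb, map_add, map_add, map_sgn_smul, map_sgn_smul,
        D.delR_sn (D.brT_mem hx hv) hb, D.delR_sn (D.brT_mem hw hy) ha,
        D.delR_sn (D.mul_mem hw.mem hv.mem) (D.β_mem ha hb), D.delR_sn hw.mem ha,
        D.delR_sn hv.mem hb, map_sgn_smul, map_sgn_smul, map_sgn_smul, map_sgn_smul₂,
        D.adR_tmul _ _ ha, D.adR_tmul _ _ hb, D.bmul_tmul hw.mem hb, D.brT_symm hy hw, tmul_sgn]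
      simp only [smul_smul, sgn_expand, sgn_cancel, sgn_sort]

theorem adR_snR {n j l m : ℤ} {a b : A} {w : TensorCoalg R A} (hw : w ∈ Tgr ℒ n)
    (ha : a ∈ ℒ j) (hb : b ∈ ℒ l) {z : A ⊗[R] TensorCoalg R A} (hz : z ∈ tgr ℒ (Tgr ℒ) m) :
    D.adR (n + j) (sn w a) ((snR b).lTensor A z) = (snR b).lTensor A (D.adR (n + j) (sn w a) z)
      + sgn (j * (m + l)) • (snR a).lTensor A (D.adR n w ((snR b).lTensor A z))
      + sgn (m + n * m + j * m + n) • (snR (D.β a b)).lTensor A ((D.mulR w).lTensor A z) := by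
  induction hz using tgr_induction with
  | @tmul k i c u hc hu h =>
    rw [lTensor_tmul, lTensor_tmul, snR_apply, D.adR_tmul _ _ hc, D.adR_tmul _ _ hc,
      D.adR_tmul _ _ hc, map_sgn_smul, map_sgn_smul, lTensor_tmul, lTensor_tmul, lTensor_tmul,
      snR_apply, snR_apply, snR_apply, mulR_apply, D.brT_sn_sn hw ha hu hb, D.mul_comm' hw hu,
      map_sgn_smul₂, tmul_add, tmul_add, tmul_sgn, tmul_sgn, tmul_sgn, ← h]
    simp only [smul_add, smul_smul, sgn_expand, sgn_cancel, sgn_sort]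
  | zero => simp only [map_zero, smul_zero, add_zero]
  | add x y _ _ hx hy => simp only [map_add, smul_add, hx, hy]; abel
  | smul r x _ hx => simp only [map_smul, smul_comm _ r, hx, smul_add]

theorem bmul_snR {j l m m' : ℤ} {a b : A} (ha : a ∈ ℒ j) (hb : b ∈ ℒ l)
    {z z' : A ⊗[R] TensorCoalg R A} (hz : z ∈ tgr ℒ (Tgr ℒ) m) (hz' : z' ∈ tgr ℒ (Tgr ℒ) m') :
    D.bmul ((snR a).lTensor A z) ((snR b).lTensor A z')
      = (snR b).lTensor A (D.bmul ((snR a).lTensor A z) z')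
        + sgn (j * (m' + l)) • (snR a).lTensor A (D.bmul z ((snR b).lTensor A z')) := by
  induction hz using tgr_induction with
  | @tmul k i c u hc hu h =>
    induction hz' using tgr_induction with
    | @tmul k' i' c' u' hc' hu' h' =>
      rw [lTensor_tmul, lTensor_tmul, snR_apply, snR_apply, D.bmul_tmul (sn_mem hu ha) hc',
        D.bmul_tmul (sn_mem hu ha) hc', D.bmul_tmul hu hc', map_sgn_smul, map_sgn_smul,
        lTensor_tmul, lTensor_tmul, snR_apply, snR_apply, mulT_sn_sn _ _ ha hu' hb, tmul_add,
        tmul_sgn, ← h']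
      simp only [smul_add, smul_smul, sgn_expand, sgn_sort]
    | zero => simp only [map_zero, smul_zero, add_zero]
    | add x y _ _ hx hy => simp only [map_add, smul_add, hx, hy]; abel
    | smul r x _ hx => simp only [map_smul, smul_comm _ r, hx, smul_add]
  | zero => simp only [map_zero, lin_zero, smul_zero, add_zero]
  | add x y _ _ hx hy => simp only [map_add, lin_add, smul_add, hx, hy]; abel
  | smul r x _ hx => simp only [map_smul, lin_smul, smul_comm _ r, hx, smul_add]

theorem bmul_snR_letter {j l m : ℤ} {a b : A} (ha : a ∈ ℒ j) (hb : b ∈ ℒ l)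
    {z : A ⊗[R] TensorCoalg R A} (hz : z ∈ tgr ℒ (Tgr ℒ) m) :
    D.bmul ((snR a).lTensor A z) (b ⊗ₜ 1) = sgn (j * l) • (snR a).lTensor A (D.bmul z
      (b ⊗ₜ 1)) := by
  induction hz using tgr_induction with
  | @tmul k i c u hc hu h =>
    rw [lTensor_tmul, snR_apply, D.bmul_tmul (sn_mem hu ha) hb, D.bmul_tmul hu hb, map_sgn_smul,
      lTensor_tmul, snR_apply, mulT_one_right, mulT_one_right, smul_smul]
    simp only [sgn_expand, sgn_sort]
  | zero => simp only [map_zero, lin_zero, smul_zero]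
  | add x y _ _ hx hy => simp only [map_add, lin_add, smul_add, hx, hy]
  | smul r x _ hx => simp only [map_smul, lin_smul, smul_comm _ r, hx]

theorem bmul_letter_snR (a b : A) {m : ℤ} {z : A ⊗[R] TensorCoalg R A}
    (hz : z ∈ tgr ℒ (Tgr ℒ) m) :
    D.bmul (a ⊗ₜ 1) ((snR b).lTensor A z) = (snR b).lTensor A (D.bmul (a ⊗ₜ 1) z) := by
  induction hz using tgr_induction with
  | @tmul k i c u hc hu h =>
    rw [lTensor_tmul, snR_apply, D.bmul_tmul one_mem_Tgr hc, D.bmul_tmul one_mem_Tgr hc,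
      map_sgn_smul, lTensor_tmul, snR_apply, mulT_one_left, mulT_one_left]
  | zero => simp only [map_zero]
  | add x y _ _ hx hy => simp only [map_add, hx, hy]
  | smul r x _ hx => simp only [map_smul, hx]

theorem cou_brT {i j : ℤ} {x y : TensorCoalg R A} (hx : IsWord ℒ i x) (hy : IsWord ℒ j y) :
    cou R A (D.brT x y) = 0 := by
  cases hx with
  | one => rw [brT_one_left, map_zero]
  | sn hw ha =>
    cases hy with
    | one => rw [brT_one_right, map_zero]
    | sn hv hb =>
      rw [D.brT_sn_sn hw.mem ha hv.mem hb, map_add, map_add, map_sgn_smul, map_sgn_smul, cou_sn,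
        cou_sn, cou_sn, smul_zero, smul_zero, add_zero, add_zero]

theorem cou_eq_zero_or {i : ℤ} {x : TensorCoalg R A} (hx : IsWord ℒ i x) :
    cou R A x = 0 ∨ i = 0 := by
  cases hx with
  | one => exact Or.inr rfl
  | sn => exact Or.inl (cou_sn _ _)

theorem snR_sgn (u : ℤˣ) (a : A) (z : A ⊗[R] TensorCoalg R A) :
    (snR (u • a)).lTensor A z = u • (snR a).lTensor A z := by
  induction z using TensorProduct.induction_on with
  | zero => simp only [map_zero, smul_zero]
  | tmul c u =>
    rw [lTensor_tmul, lTensor_tmul, snR_apply, snR_apply, map_sgn_smul, tmul_sgn]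
  | add x y hx hy => simp only [map_add, smul_add, hx, hy]

theorem smul_units (r : R) (u : ℤˣ) (v : V) :
    r • u • v = u • r • v := smul_comm _ _ _

set_option maxHeartbeats 1000000 in
theorem delL_brT {i j : ℤ} {x y : TensorCoalg R A} (hx : IsWord ℒ i x) (hy : IsWord ℒ j y) :
    delL R A (D.brT x y) = D.adR i x (delL R A y) + sgn (i * j) • D.adR j y (delL R A x)
      + D.bmul (delL R A x) (delL R A y) := by
  induction hx generalizing j y with
  | one =>
    rw [brT_one_left, delL_one, map_zero, map_zero, map_zero, adR_one_left, lin_zero, smul_zero,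
      add_zero, add_zero]
  | @sn n j w a hw ha ih =>
    induction hy with
    | one =>
      rw [brT_one_right, delL_one, map_zero, map_zero, map_zero, adR_one_left, smul_zero, add_zero,
        add_zero]
    | @sn i l v b hv hb ih' =>
      have hx := hw.sn ha
      have hy := hv.sn hb
      have hz := delL_mem hw
      have hz' := delL_mem hv
      have hcw := cou_eq_zero_or hw
      have hcv := cou_eq_zero_or hv
      rw [D.brT_sn_sn hw.mem ha hv.mem hb, map_add, map_add, map_sgn_smul, map_sgn_smul, delL_sn,
        delL_sn, delL_sn, D.cou_brT hx hv, D.cou_brT hw hy, D.cou_mul hw hv, ih', ih hy,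
        D.delL_mul hw hv, delL_sn, delL_sn]
      clear ih ih'
      generalize delL R A w = z at hz ⊢
      generalize delL R A v = z' at hz' ⊢
      generalize cou R A w = e at hcw ⊢
      generalize cou R A v = e' at hcv ⊢
      simp only [map_add, map_smul, lin_add, lin_smul, map_sgn_smul, D.adR_one_right,
        D.adR_snR hw.mem ha hb hz', D.adR_snR hv.mem hb ha hz, D.bmul_snR ha hb hz hz',
        D.bmul_snR_letter ha hb hz, D.bmul_letter_snR a b hz', D.bmul_tmul one_mem_Tgr hb,
        D.β_symm hb ha, snR_sgn, mulT_one_left, zero_smul, add_zero, smul_zero, mul_zero, sgn_zero,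
        one_smul]
      rcases hcw with h | h <;> rcases hcv with h' | h' <;>
      · simp only [h, h', zero_smul, mul_zero, zero_mul, zero_add, add_zero, sgn_zero, one_smul]
        simp only [smul_add, smul_smul, smul_units, one_smul, mul_comm e' e, sgn_expand,
          sgn_cancel, sgn_sort]
        abel

end ShiftedBD

section Deriv

variable {H : GCAlgebra 𝒲}

/-- A derivation may be checked on homogeneous generators of the module. -/
theorem IsDeriv.ofSpan {𝒢 : ℤ → Set V} (hs : ∀ i, 𝒱 i = Submodule.span R (𝒢 i))
    {D : V →ₗ[R] L ⊗[R] V} (mem : ∀ {i x}, x ∈ 𝒢 i → D x ∈ tgr ℒ 𝒱 i)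
    (leib : ∀ {i j x y}, x ∈ 𝒢 i → y ∈ 𝒢 j → D (G.mul x y)
      = (G.mul.flip y).lTensor L (D x) + sgn (i * j) • (G.mul.flip x).lTensor L (D y)) :
    IsDeriv ℒ G D where
  mem := by
    intro i x hx
    rw [hs] at hx
    exact (span_le (p := (tgr ℒ 𝒱 i).comap D)).2 (fun _ h => mem h) hx
  leib := by
    intro i j x y hx hy
    rw [hs] at hx hy
    have h1 : ∀ x ∈ 𝒢 i, D (G.mul x y)
        = (G.mul.flip y).lTensor L (D x) + sgn (i * j) • (G.mul.flip x).lTensor L (D y) := by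
      intro x hx
      exact eqOn_span (f := D ∘ₗ G.mul x)
        (g := (LinearMap.lTensorHom L ∘ₗ G.mul.flip).flip (D x)
          + sgn (i * j) • (G.mul.flip x).lTensor L ∘ₗ D) (fun y hy => leib hx hy) hy
    exact eqOn_span (f := D ∘ₗ G.mul.flip y)
      (g := (G.mul.flip y).lTensor L ∘ₗ D
        + sgn (i * j) • (LinearMap.lTensorHom L ∘ₗ G.mul.flip).flip (D y)) h1 hx

variable (W) in
/-- The extension of a derivation of `V` to `V ⊗ W`. -/
def extFst (δ : V →ₗ[R] L ⊗[R] V) : V ⊗[R] W →ₗ[R] L ⊗[R] (V ⊗[R] W) :=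
  (TensorProduct.assoc R L V W).toLinearMap ∘ₗ δ.rTensor W

theorem extFst_tmul (δ : V →ₗ[R] L ⊗[R] V) (v : V) (w : W) :
    extFst W δ (v ⊗ₜ w) = ((TensorProduct.mk R V W).flip w).lTensor L (δ v) := by
  change (TensorProduct.assoc R L V W) (δ v ⊗ₜ w) = _
  induction δ v using TensorProduct.induction_on with
  | zero => simp only [zero_tmul, map_zero]
  | tmul => rfl
  | add x y hx hy => simp only [add_tmul, map_add, hx, hy]

/-- The extension of a derivation of `W` to `V ⊗ W`. -/
def extSnd (hV : DirectSum.IsInternal 𝒱) (hL : DirectSum.IsInternal ℒ)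
    (δ : W →ₗ[R] L ⊗[R] W) : V ⊗[R] W →ₗ[R] L ⊗[R] (V ⊗[R] W) :=
  TensorProduct.lift (hrec (X := W →ₗ[R] L ⊗[R] (V ⊗[R] W)) hV fun i =>
    lcomp R (L ⊗[R] (V ⊗[R] W)) δ ∘ₗ
      TensorProduct.mapBilinear (RingHom.id R) L W L (V ⊗[R] W) (signMap hL i) ∘ₗ
      TensorProduct.mk R V W ∘ₗ (𝒱 i).subtype)

theorem extSnd_tmul (hV : DirectSum.IsInternal 𝒱) (hL : DirectSum.IsInternal ℒ)
    (δ : W →ₗ[R] L ⊗[R] W) {i : ℤ} {v : V} (hv : v ∈ 𝒱 i) (w : W) :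
    extSnd hV hL δ (v ⊗ₜ w)
      = TensorProduct.map (signMap hL i) (TensorProduct.mk R V W v) (δ w) := by
  rw [extSnd, TensorProduct.lift.tmul, hrec_of_mem _ _ hv]
  rfl

theorem IsDeriv.extFst {δ : V →ₗ[R] L ⊗[R] V} (h : IsDeriv ℒ G δ) :
    IsDeriv ℒ (tensorGC G H) (BD.extFst W δ) := by
  refine IsDeriv.ofSpan (fun _ => rfl) ?_ ?_
  · rintro _ _ ⟨i, j, v, w, hv, hw, rfl, rfl⟩
    rw [extFst_tmul]
    have hz := h.mem hv
    generalize δ v = z at hz ⊢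
    induction hz using tgr_induction with
    | tmul ha hu h => exact tmul_mem ha (tmul_mem hu hw rfl) (by rw [← h, add_assoc])
    | zero => rw [map_zero]; exact zero_mem _
    | add x y _ _ hx hy => rw [map_add]; exact add_mem hx hy
    | smul r x _ hx => rw [map_smul]; exact smul_mem _ r hx
  · rintro _ _ _ _ ⟨i, j, v, w, hv, hw, rfl, rfl⟩ ⟨i', j', v', w', hv', hw', rfl, rfl⟩
    rw [tensorGC_mul_apply G H hw hv', map_sgn_smul, extFst_tmul, extFst_tmul, extFst_tmul,
      h.leib hv hv', map_add, map_sgn_smul]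
    have e1 : ∀ z : L ⊗[R] V, ((TensorProduct.mk R V W).flip (H.mul w w')).lTensor L
        ((G.mul.flip v').lTensor L z) = sgn (i' * j) • ((tensorGC G H).mul.flip
          (v' ⊗ₜ w')).lTensor L
          (((TensorProduct.mk R V W).flip w).lTensor L z) := by
      intro z
      induction z using TensorProduct.induction_on with
      | zero => simp only [map_zero, smul_zero]
      | tmul a u =>
        simp only [lTensor_tmul, flip_apply, mk_apply]
        rw [tensorGC_mul_apply G H hw hv', tmul_sgn, smul_smul, mul_comm i', sgn_mul_self, one_smul]
      | add x y hx hy => simp only [map_add, smul_add, hx, hy]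
    have e2 : ∀ z : L ⊗[R] V, ((TensorProduct.mk R V W).flip (H.mul w w')).lTensor L
        ((G.mul.flip v).lTensor L z) = sgn (i * j' + j * j') •
          ((tensorGC G H).mul.flip (v ⊗ₜ w)).lTensor L
          (((TensorProduct.mk R V W).flip w').lTensor L z) := by
      intro z
      induction z using TensorProduct.induction_on with
      | zero => simp only [map_zero, smul_zero]
      | tmul a u =>
        simp only [lTensor_tmul, flip_apply, mk_apply]
        rw [tensorGC_mul_apply G H hw' hv, tmul_sgn, smul_smul, H.mul_comm hw hw', tmul_sgn,
          tmul_sgn]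
        simp only [sgn_add, sgn_cancel, sgn_sort]
      | add x y hx hy => simp only [map_add, smul_add, hx, hy]
    rw [e1, e2]
    simp only [smul_add, smul_smul, one_smul, sgn_expand, sgn_cancel, sgn_sort]

theorem IsDeriv.extSnd (hL : DirectSum.IsInternal ℒ) {δ : W →ₗ[R] L ⊗[R] W} (h : IsDeriv ℒ H δ) :
    IsDeriv ℒ (tensorGC G H) (BD.extSnd G.isInternal hL δ) := by
  refine IsDeriv.ofSpan (fun _ => rfl) ?_ ?_
  · rintro _ _ ⟨i, j, v, w, hv, hw, rfl, rfl⟩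
    rw [extSnd_tmul _ _ _ hv]
    have hz := h.mem hw
    generalize δ w = z at hz ⊢
    induction hz using tgr_induction with
    | tmul ha hu h =>
      rw [map_tmul, signMap_apply _ _ ha, sgn_tmul]
      exact sgn_smul_mem _ _ (tmul_mem ha (tmul_mem hv hu rfl) (by rw [← h]; ring))
    | zero => rw [map_zero]; exact zero_mem _
    | add x y _ _ hx hy => rw [map_add]; exact add_mem hx hy
    | smul r x _ hx => rw [map_smul]; exact smul_mem _ r hx
  · rintro _ _ _ _ ⟨i, j, v, w, hv, hw, rfl, rfl⟩ ⟨i', j', v', w', hv', hw', rfl, rfl⟩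
    rw [tensorGC_mul_apply G H hw hv', map_sgn_smul, extSnd_tmul _ _ _ hv, extSnd_tmul _ _ _ hv',
      extSnd_tmul _ _ _ (G.mul_mem hv hv'), h.leib hw hw', map_add, map_sgn_smul]
    have e1 : ∀ z ∈ tgr ℒ 𝒲 j, TensorProduct.map (signMap hL (i + i'))
        (TensorProduct.mk R V W (G.mul v v')) ((H.mul.flip w').lTensor L z)
        = sgn (i' * j) • ((tensorGC G H).mul.flip (v' ⊗ₜ w')).lTensor L
          (TensorProduct.map (signMap hL i) (TensorProduct.mk R V W v) z) := by
      intro z hz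
      induction hz using tgr_induction with
      | @tmul k l a u ha hu h =>
        rw [lTensor_tmul, map_tmul, map_tmul, signMap_apply _ _ ha, signMap_apply _ _ ha,
          lTensor_tmul]
        simp only [flip_apply, mk_apply]
        rw [tensorGC_mul_apply G H hu hv', tmul_sgn, sgn_tmul, sgn_tmul, ← h]
        simp only [smul_smul, sgn_expand, sgn_cancel, sgn_sort]
      | zero => simp only [map_zero, smul_zero]
      | add x y _ _ hx hy => simp only [map_add, smul_add, hx, hy]
      | smul r x _ hx => simp only [map_smul, hx, smul_comm _ r]
    have e2 : ∀ z ∈ tgr ℒ 𝒲 j', TensorProduct.map (signMap hL (i + i'))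
        (TensorProduct.mk R V W (G.mul v v')) ((H.mul.flip w).lTensor L z)
        = sgn (i * i' + i * j') • ((tensorGC G H).mul.flip (v ⊗ₜ w)).lTensor L
          (TensorProduct.map (signMap hL i') (TensorProduct.mk R V W v') z) := by
      intro z hz
      induction hz using tgr_induction with
      | @tmul k l a u ha hu h =>
        rw [lTensor_tmul, map_tmul, map_tmul, signMap_apply _ _ ha, signMap_apply _ _ ha,
          lTensor_tmul]
        simp only [flip_apply, mk_apply]
        rw [tensorGC_mul_apply G H hu hv, tmul_sgn, sgn_tmul, sgn_tmul, ← h, G.mul_comm hv hv',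
          sgn_tmul, tmul_sgn]
        simp only [smul_smul, sgn_expand, sgn_cancel, sgn_sort]
      | zero => simp only [map_zero, smul_zero]
      | add x y _ _ hx hy => simp only [map_add, smul_add, hx, hy]
      | smul r x _ hx => simp only [map_smul, hx, smul_comm _ r]
    rw [e1 _ (h.mem hw), e2 _ (h.mem hw')]
    simp only [smul_add, smul_smul, one_smul, sgn_expand, sgn_cancel, sgn_sort]

end Deriv

section Wings

variable (ħ) (GN) (GT) (GM)

/-- `T` as a subalgebra of `N ⊗ T ⊗ M`. -/
def embT : OpEmb ħ GT (tensorGC GN (tensorGC GT GM)) := embSnd.comp embFst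

/-- `M` as a subalgebra of `N ⊗ T ⊗ M`. -/
def embM : OpEmb ħ GM (tensorGC GN (tensorGC GT GM)) := embSnd.comp embSnd

/-- `N` as a subalgebra of `N ⊗ T ⊗ M`. -/
def embN : OpEmb ħ GN (tensorGC GN (tensorGC GT GM)) := embFst

theorem embT_j (t : T) : (embT ħ GN GT GM).j t = GN.one ⊗ₜ (t ⊗ₜ GM.one) := rfl
theorem embM_j (m : M) : (embM ħ GN GT GM).j m = GN.one ⊗ₜ (GT.one ⊗ₜ m) := rfl
theorem embN_j (n : N) : (embN ħ GN GT GM).j n = n ⊗ₜ (GT.one ⊗ₜ GM.one) := rfl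

/-- The extension of a derivation of `T` to `N ⊗ T ⊗ M`. -/
def extT (hL : DirectSum.IsInternal ℒ) (δ : T →ₗ[R] L ⊗[R] T) :
    N ⊗[R] (T ⊗[R] M) →ₗ[R] L ⊗[R] (N ⊗[R] (T ⊗[R] M)) :=
  extSnd GN.isInternal hL (extFst M δ)

variable {GN GT GM}

theorem IsDeriv.extT (hL : DirectSum.IsInternal ℒ) {δ : T →ₗ[R] L ⊗[R] T} (h : IsDeriv ℒ GT δ) :
    IsDeriv ℒ (tensorGC GN (tensorGC GT GM)) (BD.extT GN hL δ) := h.extFst.extSnd hL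

theorem extT_M (hL : DirectSum.IsInternal ℒ) {δ : T →ₗ[R] L ⊗[R] T} (h : IsDeriv ℒ GT δ) (m : M) :
    extT GN hL δ ((embM ħ GN GT GM).j m) = 0 := by
  rw [embM_j, extT, extSnd_tmul _ _ _ GN.one_mem, extFst_tmul, h.one, map_zero, map_zero]

theorem extT_N (hL : DirectSum.IsInternal ℒ) {δ : T →ₗ[R] L ⊗[R] T} (h : IsDeriv ℒ GT δ) (n : N) :
    extT GN hL δ ((embN ħ GN GT GM).j n) = 0 := by
  have : extT (M := M) GN hL δ ∘ₗ (embN ħ GN GT GM).j = 0 := by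
    refine hom_ext GN.isInternal fun i n hn => ?_
    rw [comp_apply, embN_j, extT, extSnd_tmul _ _ _ hn, extFst_tmul, h.one, map_zero, map_zero,
      lin_zero]
  exact LinearMap.congr_fun this n

theorem extT_T (hL : DirectSum.IsInternal ℒ) (δ : T →ₗ[R] L ⊗[R] T) (t : T) :
    extT GN hL δ ((embT ħ GN GT GM).j t) = (embT ħ GN GT GM).j.lTensor L (δ t) := by
  rw [embT_j, extT, extSnd_tmul _ _ _ GN.one_mem, extFst_tmul, signMap_zero]
  exact (LinearMap.lTensor_comp_apply L _ _ _).symm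

/-- The wing `M` of `N ⊗ T ⊗ M`. -/
def wingM (hL : DirectSum.IsInternal ℒ) {δ : T →ₗ[R] L ⊗[R] T} (h : IsDeriv ℒ GT δ) :
    Wing ħ GT GM (tensorGC GN (tensorGC GT GM)) ℒ where
  eT := embT ħ GN GT GM
  eY := embM ħ GN GT GM
  kills_T t := OpEmb.Kills.comp_right (embSnd_kills t)
  kills_Y m := OpEmb.Kills.comp_right (embFst_kills m)
  hL := hL
  δ := δ
  δ_mem := h.mem
  D := extT GN hL δ
  isDeriv := h.extT hL
  D_Y := extT_M ħ hL h
  D_T := extT_T ħ hL δ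

/-- The wing `N` of `N ⊗ T ⊗ M`. -/
def wingN (hL : DirectSum.IsInternal ℒ) {δ : T →ₗ[R] L ⊗[R] T} (h : IsDeriv ℒ GT δ) :
    Wing ħ GT GN (tensorGC GN (tensorGC GT GM)) ℒ where
  eT := embT ħ GN GT GM
  eY := embN ħ GN GT GM
  kills_T _ := embFst_kills _
  kills_Y n := OpEmb.Kills.comp_left (embSnd_kills n)
  hL := hL
  δ := δ
  δ_mem := h.mem
  D := extT GN hL δ
  isDeriv := h.extT hL
  D_Y := extT_N ħ hL h
  D_T := extT_T ħ hL δ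

theorem wings_opposite (hL : DirectSum.IsInternal ℒ) {δ δ' : T →ₗ[R] L ⊗[R] T}
    (h : IsDeriv ℒ GT δ) (h' : IsDeriv ℒ GT δ') :
    (wingM (GN := GN) (GM := GM) ħ hL h).Opposite (wingN ħ hL h') where
  eq_T := rfl
  kills n := OpEmb.Kills.comp_left (embSnd_kills n)
  kills' _ := embFst_kills _
  D_Y' := extT_N ħ hL h
  D'_Y := extT_M ħ hL h'

end Wings

theorem HomList.exists_ofFn {γ : List (ℤ × V)} (h : HomList 𝒱 γ) :
    ∃ (k : ℕ) (e : Fin k → ℤ) (b : Fin k → V), (∀ s, b s ∈ 𝒱 (e s)) ∧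
      γ = List.ofFn (fun s => (e s, b s)) ∧ γ.map Prod.snd = List.ofFn b := by
  refine ⟨γ.length, fun s => (γ.get s).1, fun s => (γ.get s).2, fun s => h _ (List.get_mem _ _),
    (List.ofFn_get γ).symm, ?_⟩
  conv_lhs => rw [← List.ofFn_get γ, List.map_ofFn]
  rfl

theorem evl_map_snd (P : Ops R V) {k : ℕ} (e : Fin k → ℤ) (b : Fin k → V) :
    evl P ((List.ofFn fun s => (e s, b s)).map Prod.snd) = P k b := by
  rw [List.map_ofFn, ← evl_ofFn]; rfl

section

theorem prdL_sgn_left (u : ℤˣ) (q : ℤ) (P Q : Ops R V) (γ : List (ℤ × V)) :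
    prdL ħ G q (u • P) Q γ = u • prdL ħ G q P Q γ :=
  map_sgn_smul (prdLₗ ħ G q Q γ) u P

theorem prdL_sgn_right (u : ℤˣ) (q : ℤ) (P Q : Ops R V) (γ : List (ℤ × V)) :
    prdL ħ G q P (u • Q) γ = u • prdL ħ G q P Q γ := by
  induction γ generalizing q P Q with
  | nil => simp only [prdL, evl_sgn, map_sgn_smul, smul_add, smul_comm ħ, evl_cons]
  | cons x γ ih =>
    simp only [prdL, map_sgn_smul, sgn_smul_apply, ih, smul_add, smul_comm _ u]

end

section Family

variable {B : BD0Algebra ħ 𝒱} (f : LeftBD1Module alg B)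

/-- The structure map of a module. -/
def LeftBD1Module.str : A →ₗ[R] Ops R V := LinearMap.pi f.map

/-- The family of operations `(-1)^{|a| - 1} f(a)`. -/
def LeftBD1Module.family : A →ₗ[R] Ops R V := -(f.str ∘ₗ signMap alg.isInternal 1)

theorem LeftBD1Module.family_apply {i : ℤ} {a : A} (ha : a ∈ 𝒜 (i + 1)) :
    f.family a = sgn i • f.str a := by
  rw [family, lin_neg, comp_apply, signMap_apply _ _ ha, map_sgn_smul, one_mul, sgn_add, sgn_one,
    mul_neg, mul_one, Units.neg_smul, neg_neg]

theorem LeftBD1Module.neg_family_apply {i : ℤ} {a : A} (ha : a ∈ 𝒜 (i + 1)) :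
    (-f.family) a = sgn (i + 1) • f.str a := by
  rw [lin_neg, f.family_apply ha, sgn_add, sgn_one, mul_neg, mul_one, Units.neg_smul]

theorem LeftBD1Module.str_hd {i : ℤ} {a : A} (ha : a ∈ 𝒜 (i + 1)) :
    IsHDiffOp ħ B.toGCAlgebra (1 + i) (f.str a) := by
  rw [add_comm]; exact f.isHDiffOp ha

theorem LeftBD1Module.family_fam : IsFam (fun i => 𝒜 (i + 1)) ħ B.toGCAlgebra 1 f.family := by
  intro i a ha
  rw [f.family_apply ha]
  exact (f.str_hd ha).sgn_smul _

theorem LeftBD1Module.str_d {i : ℤ} {a : A} (ha : a ∈ 𝒜 (i + 1)) {γ : List (ℤ × V)}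
    (hγ : HomList 𝒱 γ) :
    evl (f.str (alg.d a)) (γ.map Prod.snd) = brL 1 (1 + i) B.ops (f.str a) γ := by
  obtain ⟨k, e, b, hb, rfl, -⟩ := hγ.exists_ofFn
  rw [evl_map_snd, ← hBracket_eq_brL B.ops_isHDiffOp (f.str_hd ha) hb, add_comm 1 i]
  exact f.map_d ha hb

theorem LeftBD1Module.str_bracket {i j : ℤ} {a b : A} (ha : a ∈ 𝒜 (i + 1)) (hb : b ∈ 𝒜 (j + 1))
    {γ : List (ℤ × V)} (hγ : HomList 𝒱 γ) : evl (f.str (alg.bracket a b)) (γ.map Prod.snd)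
      = brL (1 + i) (1 + j) (f.str a) (f.str b) γ := by
  obtain ⟨k, e, c, hc, rfl, -⟩ := hγ.exists_ofFn
  rw [evl_map_snd, ← hBracket_eq_brL (f.str_hd ha) (f.str_hd hb) hc, add_comm 1 i, add_comm 1 j]
  exact f.map_bracket ha hb hc

theorem LeftBD1Module.str_mul {i j : ℤ} {a b : A} (ha : a ∈ 𝒜 (i + 1)) (hb : b ∈ 𝒜 (j + 1))
    {γ : List (ℤ × V)} (hγ : HomList 𝒱 γ) : evl (f.str (alg.mul a b)) (γ.map Prod.snd)
      = prdL ħ B.toGCAlgebra (1 + j) (f.str a) (f.str b) γ := by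
  obtain ⟨k, e, c, hc, rfl, -⟩ := hγ.exists_ofFn
  rw [evl_map_snd, ← hMul_eq_prdL, add_comm 1 j]
  exact f.map_mul ha hb hc

end Family

namespace ShiftedBD

variable {ℒ : ℤ → Submodule R A} (D : ShiftedBD ħ ℒ)

theorem delR_deriv : IsDeriv ℒ D.barT.toGCAlgebra D.delR :=
  IsDeriv.ofSpan (𝒢 := fun i => {x | IsWord ℒ i x}) (fun _ => rfl) (fun h => D.delR_mem h)
    fun hx hy => D.delR_mul hx hy

theorem delL_deriv : IsDeriv ℒ D.barT.toGCAlgebra (delL R A) :=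
  IsDeriv.ofSpan (𝒢 := fun i => {x | IsWord ℒ i x}) (fun _ => rfl) (fun h => delL_mem h)
    fun hx hy => D.delL_mul hx hy

theorem delL_delR' {i : ℤ} {x : TensorCoalg R A} (hx : x ∈ Tgr ℒ i) :
    Wing.swp D.isInternal (D.delR.lTensor A (delL R A x)) = (delL R A).lTensor A (D.delR x) :=
  eqOn_Tgr (F := Wing.swp D.isInternal ∘ₗ D.delR.lTensor A ∘ₗ delL R A)
    (F' := (delL R A).lTensor A ∘ₗ D.delR) (fun h => D.delL_delR h) hx

theorem delR_dT' {ν : A →ₗ[R] A →ₗ[R] A}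
    (hν : ∀ {i j a b}, a ∈ ℒ i → b ∈ ℒ j → ν a b = sgn (i * j) • D.μ b a) {i : ℤ}
    {x : TensorCoalg R A} (hx : x ∈ Tgr ℒ i) :
    D.delR (D.dT x) = D.difR ν D.delR (D.delR x) :=
  eqOn_Tgr (F := D.delR ∘ₗ D.dT) (F' := D.difR ν D.delR ∘ₗ D.delR) (fun h => D.delR_dT hν h) hx

theorem delL_dT' {i : ℤ} {x : TensorCoalg R A} (hx : x ∈ Tgr ℒ i) :
    delL R A (D.dT x) = D.difR D.μ (delL R A) (delL R A x) :=
  eqOn_Tgr (F := delL R A ∘ₗ D.dT) (F' := D.difR D.μ (delL R A) ∘ₗ delL R A)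
    (fun h => D.delL_dT h) hx

/-- `adR` as a bilinear map. -/
def adRₗ (k : ℤ) :
    TensorCoalg R A →ₗ[R] A ⊗[R] TensorCoalg R A →ₗ[R] A ⊗[R] TensorCoalg R A :=
  TensorProduct.mapBilinear (RingHom.id R) A (TensorCoalg R A) A (TensorCoalg R A)
    (signMap D.isInternal (1 + k)) ∘ₗ D.brT

theorem del_brT {δ : TensorCoalg R A →ₗ[R] A ⊗[R] TensorCoalg R A}
    (h : ∀ {i j x y}, IsWord ℒ i x → IsWord ℒ j y → δ (D.brT x y)
      = D.adR i x (δ y) + sgn (i * j) • D.adR j y (δ x) + D.bmul (δ x) (δ y))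
    {i j : ℤ} {x y : TensorCoalg R A} (hx : x ∈ Tgr ℒ i) (hy : y ∈ Tgr ℒ j) :
    δ (D.brT x y) = D.adR i x (δ y) + sgn (i * j) • D.adR j y (δ x) + D.bmul (δ x) (δ y) :=
  Tgr_induction₂ (S := A ⊗[R] TensorCoalg R A)
    (F := (llcomp R _ _ _ δ) ∘ₗ D.brT)
    (F' := (lcomp R (A ⊗[R] TensorCoalg R A) δ) ∘ₗ D.adRₗ i
      + sgn (i * j) • ((lcomp R (A ⊗[R] TensorCoalg R A) δ) ∘ₗ D.adRₗ j).flip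
      + (lcomp R (A ⊗[R] TensorCoalg R A) δ) ∘ₗ D.bmul ∘ₗ δ)
    (fun hx hy => h hx hy) hx hy

end ShiftedBD

section Compat

/-- The graded commutative algebra `N ⊗ T(A[1]) ⊗ M`. -/
abbrev barAlg (alg : BD1Algebra ħ 𝒜) (BM : BD0Algebra ħ ℳ) (BN : BD0Algebra ħ 𝒩) :=
  tensorGC BN.toGCAlgebra (tensorGC alg.shifted.barT.toGCAlgebra BM.toGCAlgebra)

variable (alg BM BN)

/-- The wing of `M`. -/
def wgM : Wing ħ alg.shifted.barT.toGCAlgebra BM.toGCAlgebra (barAlg alg BM BN)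
    (fun i => 𝒜 (i + 1)) :=
  wingM ħ alg.shifted.isInternal alg.shifted.delR_deriv

/-- The wing of `N`. -/
def wgN : Wing ħ alg.shifted.barT.toGCAlgebra BN.toGCAlgebra (barAlg alg BM BN)
    (fun i => 𝒜 (i + 1)) :=
  wingN ħ alg.shifted.isInternal alg.shifted.delL_deriv

variable {alg BM BN}

theorem opMul_mem (h : DirectSum.IsInternal 𝒜) {μ : A →ₗ[R] A →ₗ[R] A} {t : ℤ}
    (hμ : ∀ {i j a b}, a ∈ 𝒜 i → b ∈ 𝒜 j → μ a b ∈ 𝒜 (i + j + t)) {i j : ℤ} {a b : A}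
    (ha : a ∈ 𝒜 i) (hb : b ∈ 𝒜 j) : opMul h μ a b ∈ 𝒜 (i + j + t) := by
  rw [opMul_apply h μ ha hb, add_comm i j]
  exact sgn_smul_mem _ _ (hμ hb ha)

/-- The module `M` and the removal of the last letter. -/
def compatM (f : LeftBD1Module alg BM) : (wgM alg BM BN).Compat f.family where
  d := alg.shifted.d
  β := alg.shifted.β
  ν := opMul alg.shifted.isInternal alg.shifted.μ
  B := alg.shifted.bmul
  fam := f.family_fam
  φ_d := by
    intro i a γ ha hγ
    change evl (f.family (alg.d a)) _ = _
    rw [f.family_apply (i := i + 1) (alg.d_mem ha), f.family_apply ha, evl_sgn, f.str_d ha hγ,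
      brL_sgn_right, sgn_add, sgn_one, mul_neg, mul_one, Units.neg_smul]
  φ_β := by
    intro i j a b γ ha hb hγ
    change evl (f.family (shiftOp _ _ a b)) _ = _
    rw [shiftOp_apply _ _ ha, map_sgn_smul,
      f.family_apply (i := i + j + 1) (by convert alg.bracket_mem ha hb using 2; ring),
      f.family_apply ha, f.family_apply hb, evl_sgn, evl_sgn, f.str_bracket ha hb hγ, brL_sgn_right,
      brL_sgn_left]
    simp only [smul_neg, smul_smul, sgn_add, sgn_one, mul_neg, Units.neg_smul, sgn_cancel, sgn_sort]
  φ_ν := by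
    intro i j a b γ ha hb hγ
    rw [opMul_apply (𝒜 := fun i => 𝒜 (i + 1)) _ _ ha hb]
    change evl (f.family (_ • shiftOp _ _ b a)) _ = _
    rw [shiftOp_apply _ _ hb, map_sgn_smul, map_sgn_smul,
      f.family_apply (i := i + j + 1) (by convert alg.mul_mem hb ha using 2; ring),
      f.family_apply ha, f.family_apply hb, evl_sgn, evl_sgn, evl_sgn, f.str_mul hb ha hγ,
      prdL_sgn_right, prdL_sgn_left]
    simp only [smul_neg, smul_smul, sgn_add, sgn_one, mul_neg, Units.neg_smul, sgn_cancel, sgn_sort]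
  d_mem := alg.shifted.d_mem
  β_mem := alg.shifted.β_mem
  ν_mem ha hb := opMul_mem (𝒜 := fun i => 𝒜 (i + 1)) alg.shifted.isInternal (t := 1)
    (fun ha hb => by simpa only [add_assoc] using alg.shifted.μ_mem ha hb) ha hb
  B_apply ha ht hb hu := alg.shifted.bmul_tmul ht hb _ _
  δ_d ht := alg.shifted.delR_dT' (fun ha hb => opMul_apply _ _ ha hb) ht
  δ_bracket hs ht := alg.shifted.del_brT (fun h h' => alg.shifted.delR_brT h h') hs ht

/-- The module `N` and the removal of the first letter. -/
def compatN (g : RightBD1Module alg BN) : (wgN alg BM BN).Compat (-g.family) where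
  d := alg.shifted.d
  β := alg.shifted.β
  ν := alg.shifted.μ
  B := alg.shifted.bmul
  fam := by
    intro i a ha
    rw [lin_neg, ← neg_one_smul R]
    exact (g.family_fam ha).smul _
  φ_d := by
    intro i a γ ha hγ
    change evl ((-g.family) (alg.d a)) _ = _
    rw [g.neg_family_apply (i := i + 1) (alg.d_mem ha), g.neg_family_apply ha, evl_sgn]
    erw [g.str_d ha hγ]
    rw [brL_sgn_right]
    simp only [sgn_add, sgn_one, mul_neg, mul_one, Units.neg_smul]
  φ_β := by
    intro i j a b γ ha hb hγ
    change evl ((-g.family) (shiftOp _ _ a b)) _ = _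
    have e : alg.bracket a b = - alg.op.bracket a b := (neg_neg _).symm
    rw [shiftOp_apply _ _ ha, map_sgn_smul,
      g.neg_family_apply (i := i + j + 1) (by convert alg.bracket_mem ha hb using 2; ring),
      g.neg_family_apply ha, g.neg_family_apply hb, e, map_neg, smul_neg, smul_neg, evl_neg,
      evl_sgn, evl_sgn, g.str_bracket ha hb hγ, brL_sgn_right, brL_sgn_left]
    simp only [smul_neg, smul_smul, sgn_add, sgn_one, mul_neg, neg_mul, neg_neg, Units.neg_smul,
      sgn_cancel, sgn_sort]
  φ_ν := by
    intro i j a b γ ha hb hγ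
    change evl ((-g.family) (shiftOp _ _ a b)) _ = _
    have e : alg.mul a b = sgn ((i + 1) * (j + 1)) • alg.op.mul b a := by
      change _ = _ • opMul _ _ b a
      rw [opMul_apply _ _ hb ha, smul_smul, mul_comm (j + 1), sgn_mul_self, one_smul]
    rw [shiftOp_apply _ _ ha, map_sgn_smul,
      g.neg_family_apply (i := i + j + 1) (by convert alg.mul_mem ha hb using 2; ring),
      g.neg_family_apply ha, g.neg_family_apply hb, e, map_sgn_smul, evl_sgn, evl_sgn, evl_sgn,
      g.str_mul hb ha hγ, prdL_sgn_right, prdL_sgn_left]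
    simp only [smul_neg, smul_smul, sgn_one, mul_neg, neg_mul, neg_neg, Units.neg_smul, sgn_expand,
      sgn_cancel, sgn_sort]
  d_mem := alg.shifted.d_mem
  β_mem := alg.shifted.β_mem
  ν_mem := alg.shifted.μ_mem
  B_apply ha ht hb hu := alg.shifted.bmul_tmul ht hb _ _
  δ_d ht := alg.shifted.delL_dT' ht
  δ_bracket hs ht := alg.shifted.del_brT (fun h h' => alg.shifted.delL_brT h h') hs ht

end Compat

section Cast

variable {𝒱' : ℤ → Submodule R V}

/-- Transport along an equality of gradings. -/
def GCAlgebra.cast (h : 𝒱 = 𝒱') (G : GCAlgebra 𝒱) : GCAlgebra 𝒱' := h ▸ G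

theorem GCAlgebra.cast_mul (h : 𝒱 = 𝒱') (G : GCAlgebra 𝒱) : (G.cast h).mul = G.mul := by
  subst h; rfl

theorem GCAlgebra.cast_one (h : 𝒱 = 𝒱') (G : GCAlgebra 𝒱) : (G.cast h).one = G.one := by
  subst h; rfl

/-- Transport along an equality of gradings. -/
def BDHat0Structure.cast (h : 𝒱 = 𝒱') {G : GCAlgebra 𝒱} (S : BDHat0Structure ħ G) :
    BDHat0Structure ħ (G.cast h) where
  l := S.l
  isHDiffOp := by subst h; exact S.isHDiffOp
  l_zero := S.l_zero
  maurerCartan := by subst h; exact S.maurerCartan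

end Cast

theorem BD0Algebra.evl_ops_nil (B : BD0Algebra ħ 𝒱) : evl B.ops [] = 0 := rfl

section Words

variable {ℒ : ℤ → Submodule R A}

theorem wd_ofFn_succ {p : ℕ} (a : Fin (p + 1) → A) :
    wd R (List.ofFn a) = sn (wd R (List.ofFn (a ∘ Fin.castSucc))) (a (Fin.last p)) := by
  rw [List.ofFn_succ', List.concat_eq_append, wd_append_singleton]; rfl

theorem wd_nil : wd R ([] : List A) = 1 := rfl

theorem isWord_wd {p : ℕ} {e : Fin p → ℤ} {a : Fin p → A} (ha : ∀ q, a q ∈ ℒ (e q)) :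
    IsWord ℒ (∑ q, e q) (wd R (List.ofFn a)) := by
  induction p with
  | zero => rw [List.ofFn_zero, Fin.sum_univ_zero]; exact IsWord.one
  | succ p ih =>
    rw [wd_ofFn_succ, Fin.sum_univ_castSucc]
    exact (ih (fun q => ha _)).sn (ha _)

theorem IsWord.exists_wd {t : ℤ} {x : TensorCoalg R A} (h : IsWord ℒ t x) :
    ∃ (p : ℕ) (e : Fin p → ℤ) (a : Fin p → A), (∀ q, a q ∈ ℒ (e q)) ∧ ∑ q, e q = t ∧
      x = wd R (List.ofFn a) := by
  induction h with
  | one => exact ⟨0, Fin.elim0, Fin.elim0, fun q => q.elim0, rfl, by rw [List.ofFn_zero]; rfl⟩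
  | @sn i j w b hw hb ih =>
    obtain ⟨p, e, a, ha, rfl, rfl⟩ := ih
    refine ⟨p + 1, Fin.snoc (α := fun _ => ℤ) e j, Fin.snoc (α := fun _ => A) a b, fun q => ?_,
      ?_, ?_⟩
    · induction q using Fin.lastCases with
      | last => simpa using hb
      | cast q => simpa using ha q
    · rw [Fin.sum_univ_castSucc]; simp
    · rw [wd_ofFn_succ]
      congr 2
      · congr 2; funext q; simp
      · simp

end Words

section Bar

theorem tgr₃_le {t : ℤ} {S : Submodule R (N ⊗[R] (T ⊗[R] M))}
    (h : ∀ {i j l n w m}, n ∈ 𝒩 i → w ∈ 𝒯 j → m ∈ ℳ l → i + (j + l) = t → n ⊗ₜ (w ⊗ₜ m) ∈ S) :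
    tgr 𝒩 (tgr 𝒯 ℳ) t ≤ S := by
  refine Submodule.span_le.2 ?_
  rintro _ ⟨i, s, n, x, hn, hx, hs, rfl⟩
  refine (span_le (p := S.comap (TensorProduct.mk R N (T ⊗[R] M) n))).2 ?_ hx
  rintro _ ⟨j, l, w, m, hw, hm, rfl, rfl⟩
  exact h hn hw hm hs

theorem bar_eq {p : ℕ} (n : N) (a : Fin p → A) (m : M) :
    bar R n a m = n ⊗ₜ (wd R (List.ofFn a) ⊗ₜ m) := by
  rw [bar, lof_tprod]

theorem barGrading_eq :
    tgr 𝒩 (tgr (Tgr fun i => 𝒜 (i + 1)) ℳ) = barGrading 𝒩 𝒜 ℳ := by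
  funext t
  refine le_antisymm (tgr₃_le ?_) (Submodule.span_le.2 ?_)
  · intro i j l n w m hn hw hm ht
    refine (span_le (p := (barGrading 𝒩 𝒜 ℳ t).comap
      (TensorProduct.mk R N _ n ∘ₗ (TensorProduct.mk R (TensorCoalg R A) M).flip m))).2 ?_ hw
    intro x hx
    obtain ⟨p, e, a, ha, rfl, rfl⟩ := IsWord.exists_wd hx
    refine subset_span ⟨p, i, l, fun q => e q + 1, n, a, m, hn, ha, hm, ?_, ?_⟩
    · simp only [add_sub_cancel_right, ← ht, add_assoc]
    · rw [bar_eq]; rfl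
  · rintro _ ⟨p, i, j, e, n, a, m, hn, ha, hm, ht, rfl⟩
    rw [bar_eq]
    refine tmul_mem hn (tmul_mem (isWord_wd (e := fun q => e q - 1) fun q => ?_).mem hm rfl) ?_
    · rw [sub_add_cancel]; exact ha q
    · rw [← ht, add_assoc]

theorem emb_mul_emb (n : N) {j : ℤ} {w : T} (hw : w ∈ 𝒯 j) (m : M) :
    (tensorGC GN (tensorGC GT GM)).mul ((tensorGC GN (tensorGC GT GM)).mul
      (n ⊗ₜ (GT.one ⊗ₜ GM.one)) (GN.one ⊗ₜ (w ⊗ₜ GM.one))) (GN.one ⊗ₜ (GT.one ⊗ₜ m))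
      = n ⊗ₜ (w ⊗ₜ m) := by
  rw [tensorGC_mul_apply _ _ (tmul_mem GT.one_mem GM.one_mem rfl) GN.one_mem, GN.mul_one, mul_zero,
    sgn_zero, one_smul, ← tensorGC_one, (tensorGC GT GM).one_mul,
    tensorGC_mul_apply _ _ (tmul_mem hw GM.one_mem rfl) GN.one_mem, GN.mul_one, mul_zero, sgn_zero,
    one_smul, tensorGC_mul_apply _ _ GM.one_mem GT.one_mem, GT.mul_one, mul_zero, sgn_zero,
    one_smul, GM.one_mul]

variable (f : LeftBD1Module alg BM) (g : RightBD1Module alg BN)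

/-- The operations on `N ⊗ T(A[1]) ⊗ M`. -/
def barOps : Ops R (Bar R N A M) :=
  (wgM alg BM BN).eT.ι alg.shifted.barT.ops + (wgM alg BM BN).eY.ι BM.ops
    + (wgN alg BM BN).eY.ι BN.ops + (wgM alg BM BN).Φ f.family + (wgN alg BM BN).Φ (-g.family)

theorem barOps_hd : IsHDiffOp ħ (barAlg alg BM BN) 1 (barOps f g) :=
  (((((wgM alg BM BN).eT.ι_hd alg.shifted.barT.ops_isHDiffOp).add
    ((wgM alg BM BN).eY.ι_hd BM.ops_isHDiffOp)).add
    ((wgN alg BM BN).eY.ι_hd BN.ops_isHDiffOp)).add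
    (Wing.Φ_hd (compatM (BN := BN) f).fam)).add (Wing.Φ_hd (compatN (BM := BM) g).fam)

theorem evl_barOps_nil : evl (barOps f g) [] = 0 := by
  rw [barOps, evl_add, evl_add, evl_add, evl_add, (wgM alg BM BN).eT.ι_nil,
    (wgM alg BM BN).eY.ι_nil, (wgN alg BM BN).eY.ι_nil, BD0Algebra.evl_ops_nil,
    BD0Algebra.evl_ops_nil, BD0Algebra.evl_ops_nil, map_zero, map_zero, map_zero,
    show evl ((wgM alg BM BN).Φ f.family) [] = 0 from phi_nil ..,
    show evl ((wgN alg BM BN).Φ (-g.family)) [] = 0 from phi_nil ..]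
  simp only [add_zero]

theorem barOps_mc {γ : List (ℤ × Bar R N A M)}
    (hγ : HomList (tgr 𝒩 (tgr (Tgr fun i => 𝒜 (i + 1)) ℳ)) γ) :
    brL 1 1 (barOps f g) (barOps f g) γ = 0 := by
  have O := wings_opposite (GN := BN.toGCAlgebra) (GM := BM.toGCAlgebra) ħ alg.shifted.isInternal
    alg.shifted.delR_deriv alg.shifted.delL_deriv
  refine brL_eq_zero_of_generators (G := barAlg alg BM BN)
    (𝒢 := fun i => {x | (wgM alg BM BN).Gen (wgN alg BM BN) (i, x)})
    (fun i x hx => Wing.gen_mem hx) ?_ (barOps_hd f g) (barOps_hd f g) ?_ hγ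
  · intro t
    refine tgr₃_le fun {i j l n w m} hn hw hm ht => ?_
    rw [← emb_mul_emb (GN := BN.toGCAlgebra) (GT := alg.shifted.barT.toGCAlgebra)
      (GM := BM.toGCAlgebra) n hw m,
      ← (barAlg alg BM BN).one_mul (n ⊗ₜ _)]
    have := ((Prods.one (G := barAlg alg BM BN)
      (𝒢 := fun i => {x | (wgM alg BM BN).Gen (wgN alg BM BN) (i, x)})).mul
      (j := i) (Or.inr (Or.inr ⟨n, hn, rfl⟩))).mul (j := j) (Or.inl ⟨w, hw, rfl⟩) |>.mul (j := l)
      (Or.inr (Or.inl ⟨m, hm, rfl⟩))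
    refine subset_span ?_
    rw [zero_add, add_assoc, ht] at this
    exact this
  · intro γ hγ
    exact O.mc (compatM (BN := BN) f) (compatN (BM := BM) g) rfl
      (fun ht => alg.shifted.delL_delR' ht) hγ

/-- The `\widehat{BD}_0`-structure on `N ⊗ T(A[1]) ⊗ M`. -/
def barStr : BDHat0Structure ħ (barAlg alg BM BN) where
  l := barOps f g
  isHDiffOp := barOps_hd f g
  l_zero := by
    ext b
    rw [Subsingleton.elim b ![]]
    exact evl_barOps_nil f g
  maurerCartan hb := by
    rw [hBracket_eq_brL (barOps_hd f g) (barOps_hd f g) hb]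
    refine barOps_mc f g fun x hx => ?_
    rw [List.mem_ofFn] at hx
    obtain ⟨s, rfl⟩ := hx
    exact hb s

end Bar

section Shuffles

/-- The bijection `τ` extended by a last element. -/
def extLast {X Y : Type*} {n : ℕ} (e : Option X ≃ Y) (τ : X ≃ Fin n) : Y ≃ Fin (n + 1) :=
  (e.symm.trans τ.optionCongr).trans finSuccEquivLast.symm

section

variable {X Y : Type*} {n : ℕ} (e : Option X ≃ Y) (τ : X ≃ Fin n)

theorem extLast_none : extLast e τ (e none) = Fin.last n := by simp [extLast]

theorem extLast_some (x : X) : extLast e τ (e (some x)) = (τ x).castSucc := by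
  simp [extLast, finSuccEquivLast_symm_some]

theorem extLast_symm_last : (extLast e τ).symm (Fin.last n) = e none := by
  rw [Equiv.symm_apply_eq, extLast_none]

theorem extLast_symm_castSucc (s : Fin n) :
    (extLast e τ).symm s.castSucc = e (some (τ.symm s)) := by
  rw [Equiv.symm_apply_eq, extLast_some, Equiv.apply_symm_apply]

theorem comp_extLast_symm {W : Type*} (c : Y → W) :
    c ∘ (extLast e τ).symm = Fin.snoc (α := fun _ => W) ((fun x => c (e (some x))) ∘ τ.symm)
      (c (e none)) := by
  funext s
  induction s using Fin.lastCases with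
  | last => rw [Function.comp_apply, extLast_symm_last, Fin.snoc_last]
  | cast s => rw [Function.comp_apply, extLast_symm_castSucc, Fin.snoc_castSucc]; rfl

theorem sum_extLast [Fintype X] [DecidableEq X] [Fintype Y] [DecidableEq Y] {S : Type*}
    [AddCommMonoid S] (F : (Y ≃ Fin (n + 1)) → S) :
    ∑ σ with σ.symm (Fin.last n) = e none, F σ = ∑ τ, F (extLast e τ) := by
  symm
  refine Finset.sum_bij (fun τ _ => extLast e τ) ?_ ?_ ?_ fun _ _ => rfl
  · intro τ _
    simp [extLast_symm_last]
  · intro τ _ τ' _ h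
    ext x
    have := congrArg (fun σ => (σ (e (some x)) : ℕ)) h
    simpa only [extLast_some, Fin.val_castSucc] using this
  · intro σ hσ
    rw [Finset.mem_filter, Equiv.symm_apply_eq] at hσ
    have h0 : (e.trans σ).trans finSuccEquivLast none = none := by
      rw [Equiv.trans_apply, Equiv.trans_apply, ← hσ.2, finSuccEquivLast_last]
    refine ⟨Equiv.removeNone ((e.trans σ).trans finSuccEquivLast), Finset.mem_univ _, ?_⟩
    refine Equiv.ext fun y => ?_
    obtain ⟨x, rfl⟩ := e.surjective y
    cases x with
    | none => rw [extLast_none, hσ.2]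
    | some x =>
      have h : ∃ z, (e.trans σ).trans finSuccEquivLast (some x) = some z := by
        rw [← Option.ne_none_iff_exists']
        intro h
        exact Option.some_ne_none x (Equiv.injective _ (h.trans h0.symm))
      have := Equiv.removeNone_some _ h
      rw [extLast_some, ← finSuccEquivLast_symm_some, this]
      simp

end

/-- The right summand extended by a last element. -/
def optR (p q : ℕ) : Option (Fin p ⊕ Fin q) ≃ Fin p ⊕ Fin (q + 1) where
  toFun x := x.elim (Sum.inr (Fin.last q)) (Sum.map id Fin.castSucc)
  invFun := Sum.elim (fun i => some (Sum.inl i))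
    (Fin.lastCases (motive := fun _ => Option (Fin p ⊕ Fin q)) none fun j => some (Sum.inr j))
  left_inv x := by rcases x with _ | i | j <;> simp
  right_inv x := by
    rcases x with i | j
    · rfl
    · induction j using Fin.lastCases <;> simp

/-- The left summand extended by a last element. -/
def optL (p q : ℕ) : Option (Fin p ⊕ Fin q) ≃ Fin (p + 1) ⊕ Fin q where
  toFun x := x.elim (Sum.inl (Fin.last p)) (Sum.map Fin.castSucc id)
  invFun := Sum.elim
    (Fin.lastCases (motive := fun _ => Option (Fin p ⊕ Fin q)) none fun j => some (Sum.inl j))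
    (fun i => some (Sum.inr i))
  left_inv x := by rcases x with _ | i | j <;> simp
  right_inv x := by
    rcases x with i | j
    · induction i using Fin.lastCases <;> simp
    · rfl

/-- Bijections which are increasing on both summands. -/
def IsShuffle {p q n : ℕ} (σ : Fin p ⊕ Fin q ≃ Fin n) : Prop :=
  (∀ i j, i < j → σ (Sum.inl i) < σ (Sum.inl j)) ∧ ∀ i j, i < j → σ (Sum.inr i) < σ (Sum.inr j)

instance {p q n : ℕ} (σ : Fin p ⊕ Fin q ≃ Fin n) : Decidable (IsShuffle σ) := instDecidableAnd

section

variable {p q n : ℕ} (τ : Fin p ⊕ Fin q ≃ Fin n)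

theorem extR_inl (i : Fin p) : extLast (optR p q) τ (Sum.inl i) = (τ (Sum.inl i)).castSucc :=
  extLast_some (optR p q) τ (Sum.inl i)

theorem extR_inr (i : Fin q) :
    extLast (optR p q) τ (Sum.inr i.castSucc) = (τ (Sum.inr i)).castSucc :=
  extLast_some (optR p q) τ (Sum.inr i)

theorem extR_last : extLast (optR p q) τ (Sum.inr (Fin.last q)) = Fin.last n :=
  extLast_none (optR p q) τ

theorem extL_inl (i : Fin p) :
    extLast (optL p q) τ (Sum.inl i.castSucc) = (τ (Sum.inl i)).castSucc :=
  extLast_some (optL p q) τ (Sum.inl i)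

theorem extL_inr (i : Fin q) : extLast (optL p q) τ (Sum.inr i) = (τ (Sum.inr i)).castSucc :=
  extLast_some (optL p q) τ (Sum.inr i)

theorem extL_last : extLast (optL p q) τ (Sum.inl (Fin.last p)) = Fin.last n :=
  extLast_none (optL p q) τ

theorem isShuffle_extR : IsShuffle (extLast (optR p q) τ) ↔ IsShuffle τ := by
  simp [IsShuffle, Fin.forall_fin_succ', extR_inl, extR_inr, extR_last, Fin.castSucc_lt_last,
    not_lt_of_gt (Fin.castSucc_lt_last _)]

theorem isShuffle_extL : IsShuffle (extLast (optL p q) τ) ↔ IsShuffle τ := by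
  simp [IsShuffle, Fin.forall_fin_succ', extL_inl, extL_inr, extL_last, Fin.castSucc_lt_last,
    not_lt_of_gt (Fin.castSucc_lt_last _)]

variable {τ} in
theorem IsShuffle.symm_last {σ : Fin p ⊕ Fin q ≃ Fin (n + 1)} (h : IsShuffle σ) :
    (∀ i, σ.symm (Fin.last n) = Sum.inl i → ∀ j, j ≤ i)
      ∧ ∀ i, σ.symm (Fin.last n) = Sum.inr i → ∀ j, j ≤ i := by
  constructor <;>
  · intro i hi j
    rw [Equiv.symm_apply_eq] at hi
    by_contra! hij
    first
    | exact absurd (h.1 _ _ hij) (by rw [← hi]; exact not_lt.2 (Fin.le_last _))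
    | exact absurd (h.2 _ _ hij) (by rw [← hi]; exact not_lt.2 (Fin.le_last _))

variable {S : Type*} [AddCommMonoid S]

theorem sum_shuffle_inl (F : (Fin (p + 1) ⊕ Fin q ≃ Fin (n + 1)) → S) :
    ∑ σ with IsShuffle σ, (if (σ.symm (Fin.last n)).isLeft then F σ else 0)
      = ∑ τ : Fin p ⊕ Fin q ≃ Fin n with IsShuffle τ, F (extLast (optL p q) τ) := by
  rw [Finset.sum_filter, Finset.sum_filter]
  refine .trans ?_ ((sum_extLast (optL p q) fun σ => if IsShuffle σ then F σ else 0).trans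
    (Finset.sum_congr rfl fun τ _ => if_congr (isShuffle_extL τ) rfl rfl))
  rw [Finset.sum_filter]
  refine Finset.sum_congr rfl fun σ _ => ?_
  by_cases hσ : IsShuffle σ
  · simp only [hσ, if_true]
    congr 1
    refine propext ⟨fun h => ?_, fun h => by rw [h]; rfl⟩
    obtain ⟨i, hi⟩ := Sum.isLeft_iff.1 h
    rw [hi]
    exact congrArg Sum.inl (le_antisymm (Fin.le_last _) (hσ.symm_last.1 i hi _))
  · simp [hσ]

theorem sum_shuffle_inr (F : (Fin p ⊕ Fin (q + 1) ≃ Fin (n + 1)) → S) :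
    ∑ σ with IsShuffle σ, (if (σ.symm (Fin.last n)).isRight then F σ else 0)
      = ∑ τ : Fin p ⊕ Fin q ≃ Fin n with IsShuffle τ, F (extLast (optR p q) τ) := by
  rw [Finset.sum_filter, Finset.sum_filter]
  refine .trans ?_ ((sum_extLast (optR p q) fun σ => if IsShuffle σ then F σ else 0).trans
    (Finset.sum_congr rfl fun τ _ => if_congr (isShuffle_extR τ) rfl rfl))
  rw [Finset.sum_filter]
  refine Finset.sum_congr rfl fun σ _ => ?_
  by_cases hσ : IsShuffle σ
  · simp only [hσ, if_true]
    congr 1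
    refine propext ⟨fun h => ?_, fun h => by rw [h]; rfl⟩
    obtain ⟨i, hi⟩ := Sum.isRight_iff.1 h
    rw [hi]
    exact congrArg Sum.inr (le_antisymm (Fin.le_last _) (hσ.symm_last.2 i hi _))
  · simp [hσ]

theorem sum_shuffle_split (F : (Fin p ⊕ Fin q ≃ Fin (n + 1)) → S) :
    ∑ σ with IsShuffle σ, F σ
      = ∑ σ with IsShuffle σ, (if (σ.symm (Fin.last n)).isLeft then F σ else 0)
        + ∑ σ with IsShuffle σ, (if (σ.symm (Fin.last n)).isRight then F σ else 0) := by
  rw [← Finset.sum_add_distrib]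
  refine Finset.sum_congr rfl fun σ _ => ?_
  rcases σ.symm (Fin.last n) with i | i <;> simp

theorem sum_shuffle_zero_left (F : (Fin 0 ⊕ Fin (q + 1) ≃ Fin (n + 1)) → S) :
    ∑ σ with IsShuffle σ, F σ
      = ∑ τ : Fin 0 ⊕ Fin q ≃ Fin n with IsShuffle τ, F (extLast (optR 0 q) τ) := by
  rw [← sum_shuffle_inr]
  refine Finset.sum_congr rfl fun σ _ => ?_
  rcases σ.symm (Fin.last n) with i | i
  · exact i.elim0
  · rfl

theorem sum_shuffle_zero_right (F : (Fin (p + 1) ⊕ Fin 0 ≃ Fin (n + 1)) → S) :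
    ∑ σ with IsShuffle σ, F σ
      = ∑ τ : Fin p ⊕ Fin 0 ≃ Fin n with IsShuffle τ, F (extLast (optL p 0) τ) := by
  rw [← sum_shuffle_inl]
  refine Finset.sum_congr rfl fun σ _ => ?_
  rcases σ.symm (Fin.last n) with i | i
  · rfl
  · exact i.elim0

theorem sum_shuffle_succ (F : (Fin (p + 1) ⊕ Fin (q + 1) ≃ Fin (n + 1)) → S) :
    ∑ σ with IsShuffle σ, F σ
      = ∑ τ : Fin p ⊕ Fin (q + 1) ≃ Fin n with IsShuffle τ, F (extLast (optL p (q + 1)) τ)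
        + ∑ τ : Fin (p + 1) ⊕ Fin q ≃ Fin n with IsShuffle τ, F (extLast (optR (p + 1) q) τ) := by
  rw [sum_shuffle_split, sum_shuffle_inl, sum_shuffle_inr]

/-- The Koszul sign of a shuffle of letters of degrees `e` and `e'`. -/
def shSign (σ : Fin p ⊕ Fin q ≃ Fin n) (e : Fin p → ℤ) (e' : Fin q → ℤ) : ℤˣ :=
  ∏ i, ∏ j, if σ (Sum.inr j) < σ (Sum.inl i) then sgn (e i * e' j) else 1

theorem shSign_extR (e : Fin p → ℤ) (e' : Fin (q + 1) → ℤ) :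
    shSign (extLast (optR p q) τ) e e' = shSign τ e (e' ∘ Fin.castSucc) := by
  simp only [shSign, Fin.prod_univ_castSucc, extR_inl, extR_inr, extR_last,
    Fin.castSucc_lt_castSucc_iff, not_lt.2 (Fin.le_last _), if_false, mul_one, Function.comp_apply]

theorem shSign_extL (e : Fin (p + 1) → ℤ) (e' : Fin q → ℤ) :
    shSign (extLast (optL p q) τ) e e'
      = shSign τ (e ∘ Fin.castSucc) e' * sgn (e (Fin.last p) * ∑ j, e' j) := by
  simp only [shSign, Fin.prod_univ_castSucc, extL_inl, extL_inr, extL_last,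
    Fin.castSucc_lt_castSucc_iff, Fin.castSucc_lt_last, if_true, Finset.mul_sum, sgn_sum,
    Function.comp_apply]

theorem elim_optR {W : Type*} (a : Fin p → W) (b : Fin (q + 1) → W) :
    (fun x => Sum.elim a b (optR p q (some x))) = Sum.elim a (b ∘ Fin.castSucc) := by
  funext x; rcases x with i | i <;> rfl

theorem elim_optL {W : Type*} (a : Fin (p + 1) → W) (b : Fin q → W) :
    (fun x => Sum.elim a b (optL p q (some x))) = Sum.elim (a ∘ Fin.castSucc) b := by
  funext x; rcases x with i | i <;> rfl

theorem word_extR {W : Type*} (a : Fin p → W) (b : Fin (q + 1) → W) :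
    Sum.elim a b ∘ (extLast (optR p q) τ).symm
      = Fin.snoc (α := fun _ => W) (Sum.elim a (b ∘ Fin.castSucc) ∘ τ.symm) (b (Fin.last q)) := by
  rw [comp_extLast_symm, elim_optR]; rfl

theorem word_extL {W : Type*} (a : Fin (p + 1) → W) (b : Fin q → W) :
    Sum.elim a b ∘ (extLast (optL p q) τ).symm
      = Fin.snoc (α := fun _ => W) (Sum.elim (a ∘ Fin.castSucc) b ∘ τ.symm) (a (Fin.last p)) := by
  rw [comp_extLast_symm, elim_optL]; rfl

end

end Shuffles

section Formulas

variable {ℒ : ℤ → Submodule R A} (D : ShiftedBD ħ ℒ)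

theorem wd_snoc {n : ℕ} (x : Fin n → A) (y : A) :
    wd R (List.ofFn (Fin.snoc (α := fun _ => A) x y)) = sn (wd R (List.ofFn x)) y := by
  rw [wd_ofFn_succ, Fin.snoc_last]
  congr 4
  funext i; simp

theorem sum_sgn_sn {ι : Type*} (s : Finset ι) (u : ι → ℤˣ) (x : ι → TensorCoalg R A) (a : A) :
    sn (∑ i ∈ s, u i • x i) a = ∑ i ∈ s, u i • sn (x i) a := by
  rw [map_sum, LinearMap.sum_apply]
  simp only [map_sgn_smul₂]

theorem mulT_wd {p q n : ℕ} (hn : p + q = n) {e : Fin p → ℤ} {e' : Fin q → ℤ} {a : Fin p → A}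
    {b : Fin q → A} (ha : ∀ i, a i ∈ ℒ (e i)) (hb : ∀ i, b i ∈ ℒ (e' i)) :
    D.mul (wd R (List.ofFn a)) (wd R (List.ofFn b))
      = ∑ σ : Fin p ⊕ Fin q ≃ Fin n with IsShuffle σ,
        shSign σ e e' • wd R (List.ofFn (Sum.elim a b ∘ σ.symm)) := by
  induction n generalizing p q with
  | zero =>
    obtain rfl : p = 0 := by omega
    obtain rfl : q = 0 := by omega
    have : (Finset.univ.filter fun σ : Fin 0 ⊕ Fin 0 ≃ Fin 0 => IsShuffle σ)
        = {Equiv.equivOfIsEmpty _ _} := by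
      refine Finset.eq_singleton_iff_unique_mem.2 ⟨?_, fun σ _ => Subsingleton.elim _ _⟩
      exact Finset.mem_filter.2 ⟨Finset.mem_univ _, fun i => i.elim0, fun i => i.elim0⟩
    rw [this, Finset.sum_singleton, shSign]
    simp [wd_nil, mulT_one_left]
  | succ n ih =>
    rcases p with _ | p <;> rcases q with _ | q
    · omega
    · rw [sum_shuffle_zero_left]
      simp only [shSign_extR, word_extR, wd_snoc]
      rw [← sum_sgn_sn,
        ← ih (by omega) (b := b ∘ Fin.castSucc) (e' := e' ∘ Fin.castSucc) ha fun i => hb _,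
        List.ofFn_zero, wd_nil, mulT_one_left, mulT_one_left, wd_ofFn_succ]
    · rw [sum_shuffle_zero_right]
      simp only [shSign_extL, word_extL, wd_snoc, Finset.univ_eq_empty, Finset.sum_empty, mul_zero,
        sgn_zero, mul_one]
      rw [← sum_sgn_sn,
        ← ih (by omega) (a := a ∘ Fin.castSucc) (e := e ∘ Fin.castSucc) (fun i => ha _) hb,
        List.ofFn_zero, wd_nil, mulT_one_right, mulT_one_right, wd_ofFn_succ]
    · have ha' : ∀ i : Fin p, (a ∘ Fin.castSucc) i ∈ ℒ ((e ∘ Fin.castSucc) i) := fun i => ha _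
      have hb' : ∀ i : Fin q, (b ∘ Fin.castSucc) i ∈ ℒ ((e' ∘ Fin.castSucc) i) := fun i => hb _
      rw [sum_shuffle_succ]
      refine .trans ?_ (add_comm _ _)
      simp only [shSign_extL, word_extL, shSign_extR, word_extR, wd_snoc]
      rw [← sum_sgn_sn, ← ih (by omega) ha hb', wd_ofFn_succ a, wd_ofFn_succ b,
        mulT_sn_sn _ _ (ha _) (isWord_wd hb').mem (hb _), ← wd_ofFn_succ, ← wd_ofFn_succ]
      simp only [mul_comm (shSign _ _ _), ← smul_smul]
      rw [← Finset.smul_sum, ← sum_sgn_sn,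
        ← ih (by omega) (a := a ∘ Fin.castSucc) (e := e ∘ Fin.castSucc) (fun i => ha _) hb,
        Fin.sum_univ_castSucc]
      rfl

/-- The total degree of the letters before a position. -/
def preDeg {n : ℕ} (x : Fin n → ℤ) (s : Fin n) : ℤ := ∑ t with t < s, x t

theorem preDeg_castSucc {n : ℕ} (x : Fin (n + 1) → ℤ) (s : Fin n) :
    preDeg x s.castSucc = preDeg (x ∘ Fin.castSucc) s := by
  simp only [preDeg, Finset.sum_filter, Fin.sum_univ_castSucc, Fin.castSucc_lt_castSucc_iff,
    not_lt.2 (Fin.le_last _), if_false, add_zero, Function.comp_apply]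

theorem preDeg_last {n : ℕ} (x : Fin (n + 1) → ℤ) :
    preDeg x (Fin.last n) = ∑ s : Fin n, x s.castSucc := by
  simp only [preDeg, Finset.sum_filter, Fin.sum_univ_castSucc, Fin.castSucc_lt_last, if_true,
    lt_irrefl, if_false, add_zero]

theorem mergeAt_castSucc (μ : A → A → A) {n : ℕ} (c : Fin (n + 2) → A) (s : Fin n) :
    wd R (List.ofFn (mergeAt μ c s.castSucc))
      = sn (wd R (List.ofFn (mergeAt μ (c ∘ Fin.castSucc) s))) (c (Fin.last _)) := by
  have h1 : mergeAt μ c s.castSucc ∘ Fin.castSucc = mergeAt μ (c ∘ Fin.castSucc) s := by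
    funext t
    simp [mergeAt]
  have h2 : mergeAt μ c s.castSucc (Fin.last n) = c (Fin.last _) := by
    simp [mergeAt, not_lt.2 (Fin.le_last _), (Fin.castSucc_lt_last s).ne']
  rw [wd_ofFn_succ, h1, h2]

theorem mergeAt_last (μ : A → A → A) {n : ℕ} (c : Fin (n + 2) → A) :
    wd R (List.ofFn (mergeAt μ c (Fin.last n)))
      = sn (wd R (List.ofFn (c ∘ Fin.castSucc ∘ Fin.castSucc)))
        (μ (c (Fin.last n).castSucc) (c (Fin.last _))) := by
  have h1 : mergeAt μ c (Fin.last n) ∘ Fin.castSucc = c ∘ Fin.castSucc ∘ Fin.castSucc := by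
    funext t
    simp [mergeAt, Fin.castSucc_lt_last]
  have h2 : mergeAt μ c (Fin.last n) (Fin.last n) = μ (c (Fin.last n).castSucc) (c
    (Fin.last _)) := by
    simp [mergeAt]
  rw [wd_ofFn_succ, h1, h2]

theorem dT_wd {n : ℕ} {e : Fin (n + 1) → ℤ} {a : Fin (n + 1) → A} (ha : ∀ i, a i ∈ ℒ (e i)) :
    D.dT (wd R (List.ofFn a))
      = ∑ s, sgn (preDeg e s) • wd R (List.ofFn (Function.update a s (D.d (a s))))
        + ∑ s : Fin n, sgn (preDeg e s.castSucc) •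
          wd R (List.ofFn (mergeAt (fun x y => D.μ x y) a s)) := by
  induction n with
  | zero =>
    rw [wd_ofFn_succ, List.ofFn_zero, wd_nil, D.dT_sn one_mem_Tgr, D.dT_one, D.last_one, map_zero,
      sgn_zero, one_smul, lin_zero, zero_add, add_zero, Fin.sum_univ_one, Finset.univ_eq_empty,
      Finset.sum_empty, add_zero, wd_ofFn_succ, List.ofFn_zero, wd_nil, ← Fin.last_zero,
      preDeg_last]
    simp
  | succ n ih =>
    have hw := isWord_wd (R := R) (a := a ∘ Fin.castSucc) (e := e ∘ Fin.castSucc) fun i => ha _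
    have hw' := isWord_wd (R := R) (a := a ∘ Fin.castSucc ∘ Fin.castSucc)
      (e := e ∘ Fin.castSucc ∘ Fin.castSucc) fun i => ha _
    rw [Fin.sum_univ_castSucc,
      Fin.sum_univ_castSucc (fun s : Fin (n + 1) => sgn (preDeg e s.castSucc) • wd R (List.ofFn
        (mergeAt _ a s))),
      wd_ofFn_succ, D.dT_sn hw.mem,
      ih (a := a ∘ Fin.castSucc) (e := e ∘ Fin.castSucc) (fun i => ha _), preDeg_last, mergeAt_last,
      preDeg_castSucc _ (Fin.last n), preDeg_last, wd_ofFn_succ (a ∘ _), Function.comp_assoc,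
      D.last_sn hw'.mem, map_add, lin_add, sum_sgn_sn, sum_sgn_sn]
    have e1 : ∀ y, wd R (List.ofFn (Function.update a (Fin.last _) y))
        = sn (sn (wd R (List.ofFn (a ∘ Fin.castSucc ∘ Fin.castSucc)))
          ((a ∘ Fin.castSucc) (Fin.last n))) y := by
      intro y
      rw [wd_ofFn_succ, Function.update_self, ← Function.comp_assoc, ← wd_ofFn_succ]
      congr 4
      funext i
      simp [(Fin.castSucc_lt_last i).ne]
    have e2 : ∀ (s : Fin (n + 1)) y, wd R (List.ofFn (Function.update a s.castSucc y))
        = sn (wd R (List.ofFn (Function.update (a ∘ Fin.castSucc) s y))) (a (Fin.last _)) := by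
      intro s y
      rw [wd_ofFn_succ, Function.update_of_ne (Fin.castSucc_lt_last s).ne',
        Function.update_comp_eq_of_injective _ (Fin.castSucc_injective _)]
    simp only [e1, e2, mergeAt_castSucc, preDeg_castSucc, Function.comp_apply]
    abel

end Formulas

section BracketFormula

variable {ℒ : ℤ → Submodule R A} (D : ShiftedBD ħ ℒ) {p q n : ℕ}

/-- A term of the bracket of two words. -/
def brTerm (σ : Fin p ⊕ Fin q ≃ Fin (n + 1)) (e : Fin p → ℤ) (e' : Fin q → ℤ) (a : Fin p → A)
    (b : Fin q → A) (s : Fin n) : TensorCoalg R A :=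
  if (σ.symm s.castSucc).isLeft ∧ (σ.symm s.succ).isRight then
    (shSign σ e e' * sgn (preDeg (Sum.elim e e' ∘ σ.symm) s.castSucc)) •
      wd R (List.ofFn (mergeAt (fun x y => D.β x y) (Sum.elim a b ∘ σ.symm) s))
  else 0

theorem isLeft_optR (x : Fin p ⊕ Fin q) : (optR p q (some x)).isLeft = x.isLeft := by
  rcases x with x | x <;> rfl

theorem isRight_optR (x : Fin p ⊕ Fin q) : (optR p q (some x)).isRight = x.isRight := by
  rcases x with x | x <;> rfl

theorem isLeft_optL (x : Fin p ⊕ Fin q) : (optL p q (some x)).isLeft = x.isLeft := by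
  rcases x with x | x <;> rfl

theorem isRight_optL (x : Fin p ⊕ Fin q) : (optL p q (some x)).isRight = x.isRight := by
  rcases x with x | x <;> rfl

theorem snoc_comp_castSucc {W : Type*} (x : Fin n → W) (y : W) :
    Fin.snoc (α := fun _ => W) x y ∘ Fin.castSucc = x := by
  funext i; simp

theorem brTerm_extR_castSucc (τ : Fin p ⊕ Fin q ≃ Fin (n + 1)) (e : Fin p → ℤ)
    (e' : Fin (q + 1) → ℤ) (a : Fin p → A) (b : Fin (q + 1) → A) (s : Fin n) :
    brTerm D (extLast (optR p q) τ) e e' a b s.castSucc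
      = sn (brTerm D τ e (e' ∘ Fin.castSucc) a (b ∘ Fin.castSucc) s) (b (Fin.last q)) := by
  rw [brTerm, brTerm, ← Fin.castSucc_succ, extLast_symm_castSucc, extLast_symm_castSucc,
    isLeft_optR, isRight_optR, word_extR, word_extR, preDeg_castSucc, shSign_extR,
    snoc_comp_castSucc]
  split_ifs
  · rw [mergeAt_castSucc, snoc_comp_castSucc, Fin.snoc_last, map_sgn_smul₂]
  · rw [map_zero]; rfl

theorem brTerm_extL_castSucc (τ : Fin p ⊕ Fin q ≃ Fin (n + 1)) (e : Fin (p + 1) → ℤ)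
    (e' : Fin q → ℤ) (a : Fin (p + 1) → A) (b : Fin q → A) (s : Fin n) :
    brTerm D (extLast (optL p q) τ) e e' a b s.castSucc
      = sgn (e (Fin.last p) * ∑ j, e' j) •
        sn (brTerm D τ (e ∘ Fin.castSucc) e' (a ∘ Fin.castSucc) b s) (a (Fin.last p)) := by
  rw [brTerm, brTerm, ← Fin.castSucc_succ, extLast_symm_castSucc, extLast_symm_castSucc,
    isLeft_optL, isRight_optL, word_extL, word_extL, preDeg_castSucc, shSign_extL,
    snoc_comp_castSucc]
  split_ifs
  · rw [mergeAt_castSucc, snoc_comp_castSucc, Fin.snoc_last, map_sgn_smul₂, smul_smul,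
      mul_comm (shSign _ _ _), mul_assoc]
  · rw [map_zero, lin_zero, smul_zero]

theorem brTerm_extL_last (τ : Fin p ⊕ Fin q ≃ Fin (n + 1)) (e : Fin (p + 1) → ℤ)
    (e' : Fin q → ℤ) (a : Fin (p + 1) → A) (b : Fin q → A) :
    brTerm D (extLast (optL p q) τ) e e' a b (Fin.last n) = 0 := by
  rw [brTerm, Fin.succ_last, extLast_symm_last]
  exact if_neg fun h => Bool.false_ne_true h.2

theorem brTerm_extR_last (τ : Fin p ⊕ Fin q ≃ Fin (n + 1)) (e : Fin p → ℤ)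
    (e' : Fin (q + 1) → ℤ) (a : Fin p → A) (b : Fin (q + 1) → A) :
    brTerm D (extLast (optR p q) τ) e e' a b (Fin.last n)
      = if (τ.symm (Fin.last n)).isLeft then
          (shSign τ e (e' ∘ Fin.castSucc) *
            sgn (preDeg (Sum.elim e (e' ∘ Fin.castSucc) ∘ τ.symm) (Fin.last n))) •
          sn (wd R (List.ofFn ((Sum.elim a (b ∘ Fin.castSucc) ∘ τ.symm) ∘ Fin.castSucc)))
            (D.β (Sum.elim a (b ∘ Fin.castSucc) (τ.symm (Fin.last n))) (b (Fin.last q)))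
        else 0 := by
  rw [brTerm, Fin.succ_last, extLast_symm_last, extLast_symm_castSucc, isLeft_optR, word_extR,
    word_extR, preDeg_castSucc, shSign_extR, snoc_comp_castSucc, mergeAt_last, Fin.snoc_last,
    Fin.snoc_castSucc, ← Function.comp_assoc, snoc_comp_castSucc]
  exact if_congr (and_iff_left rfl) rfl rfl

theorem sum_comp_symm (τ : Fin p ⊕ Fin q ≃ Fin n) (e : Fin p → ℤ) (e' : Fin q → ℤ) :
    ∑ s, (Sum.elim e e' ∘ τ.symm) s = ∑ i, e i + ∑ j, e' j := by
  rw [← τ.sum_comp, Fintype.sum_sum_type]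
  simp

theorem brTerm_zero_left (σ : Fin 0 ⊕ Fin q ≃ Fin (n + 1)) (e : Fin 0 → ℤ) (e' : Fin q → ℤ)
    (a : Fin 0 → A) (b : Fin q → A) (s : Fin n) : brTerm D σ e e' a b s = 0 := by
  refine if_neg ?_
  rcases σ.symm s.castSucc with i | i
  · exact i.elim0
  · exact fun h => Bool.false_ne_true h.1

theorem brTerm_zero_right (σ : Fin p ⊕ Fin 0 ≃ Fin (n + 1)) (e : Fin p → ℤ) (e' : Fin 0 → ℤ)
    (a : Fin p → A) (b : Fin 0 → A) (s : Fin n) : brTerm D σ e e' a b s = 0 := by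
  refine if_neg ?_
  rcases σ.symm s.succ with i | i
  · exact fun h => Bool.false_ne_true h.2
  · exact i.elim0

theorem brT_wd (hn : p + q = n + 1) {e : Fin p → ℤ} {e' : Fin q → ℤ} {a : Fin p → A}
    {b : Fin q → A} (ha : ∀ i, a i ∈ ℒ (e i)) (hb : ∀ i, b i ∈ ℒ (e' i)) :
    D.brT (wd R (List.ofFn a)) (wd R (List.ofFn b))
      = ∑ σ : Fin p ⊕ Fin q ≃ Fin (n + 1) with IsShuffle σ, ∑ s, brTerm D σ e e' a b s := by
  induction n generalizing p q with
  | zero =>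
    simp only [Finset.univ_eq_empty, Finset.sum_empty, Finset.sum_const_zero]
    rcases p with _ | p
    · rw [List.ofFn_zero, wd_nil, D.brT_one_left]
    · obtain rfl : q = 0 := by omega
      rw [List.ofFn_zero, wd_nil, D.brT_one_right]
  | succ n ih =>
    rcases p with _ | p
    · simp only [brTerm_zero_left, Finset.sum_const_zero]
      rw [List.ofFn_zero, wd_nil, D.brT_one_left]
    rcases q with _ | q
    · simp only [brTerm_zero_right, Finset.sum_const_zero]
      rw [List.ofFn_zero, wd_nil, D.brT_one_right]
    have ha' : ∀ i : Fin p, (a ∘ Fin.castSucc) i ∈ ℒ ((e ∘ Fin.castSucc) i) := fun i => ha _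
    have hb' : ∀ i : Fin q, (b ∘ Fin.castSucc) i ∈ ℒ ((e' ∘ Fin.castSucc) i) := fun i => hb _
    have hM := mulT_wd D (n := n) (by omega) ha' hb'
    rw [sum_shuffle_succ, wd_ofFn_succ a, wd_ofFn_succ b,
      D.brT_sn_sn (isWord_wd ha').mem (ha _) (isWord_wd hb').mem (hb _), ← wd_ofFn_succ,
      ← wd_ofFn_succ, ih (by omega) ha hb', ih (by omega) ha' hb, hM]
    simp only [Fin.sum_univ_castSucc (n := n), brTerm_extL_castSucc, brTerm_extL_last,
      brTerm_extR_castSucc, brTerm_extR_last, add_zero, Finset.sum_add_distrib]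
    rw [sum_shuffle_inl]
    simp only [map_sum, LinearMap.sum_apply, Finset.smul_sum, shSign_extL, word_extL, map_sgn_smul₂,
      preDeg_last, extLast_symm_last, smul_smul, snoc_comp_castSucc, Fin.snoc_castSucc,
      sum_comp_symm, Fin.sum_univ_castSucc e']
    rw [add_comm (Finset.sum _ _) (Finset.sum _ _), add_assoc]
    refine congrArg₂ _ rfl (congrArg₂ _ rfl (Finset.sum_congr rfl fun τ _ => ?_))
    rw [mul_comm (sgn _), mul_assoc, ← sgn_add, add_comm (e (Fin.last p) * _)]
    rfl

end BracketFormula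

section Frozen

variable {p q : ℕ}

theorem sum_shuffles {S : Type*} [AddCommMonoid S] (F : Equiv.Perm (Fin (p + q)) → S) :
    ∑ σ ∈ shuffles p q, F σ = ∑ σ : Fin p ⊕ Fin q ≃ Fin (p + q) with IsShuffle σ,
      F (finSumFinEquiv.symm.trans σ) := by
  refine Finset.sum_equiv (finSumFinEquiv.symm.equivCongr (Equiv.refl _)) (fun σ => ?_)
    fun σ _ => ?_
  · rw [shuffles, Finset.mem_filter, Finset.mem_filter]
    simp [IsShuffle]
  · congr 1
    ext i
    simp

theorem append_symm {W : Type*} (a : Fin p → W) (b : Fin q → W) (s : Fin (p + q)) :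
    Fin.append a b s = Sum.elim a b (finSumFinEquiv.symm s) := by
  induction s using Fin.addCases <;> simp

theorem shuffleWord_eq {W : Type*} (σ : Fin p ⊕ Fin q ≃ Fin (p + q)) (a : Fin p → W)
    (b : Fin q → W) :
    shuffleWord (finSumFinEquiv.symm.trans σ) a b = Sum.elim a b ∘ σ.symm := by
  funext s
  simp [shuffleWord, append_symm]

theorem shuffleSign_eq (σ : Fin p ⊕ Fin q ≃ Fin (p + q)) (e : Fin p → ℤ) (e' : Fin q → ℤ) :
    shuffleSign (finSumFinEquiv.symm.trans σ) e e'
      = shSign σ (fun i => e i - 1) (fun j => e' j - 1) := by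
  simp only [shuffleSign, shSign, Finset.prod_filter, ← Finset.univ_product_univ,
    Finset.prod_product, Equiv.trans_apply, finSumFinEquiv_symm_apply_natAdd,
    finSumFinEquiv_symm_apply_castAdd]

theorem isLeft_finSumFinEquiv_symm (s : Fin (p + q)) :
    (finSumFinEquiv.symm s).isLeft ↔ (s : ℕ) < p := by
  induction s using Fin.addCases <;> simp

theorem isRight_finSumFinEquiv_symm (s : Fin (p + q)) :
    (finSumFinEquiv.symm s).isRight ↔ p ≤ (s : ℕ) := by
  induction s using Fin.addCases <;> simp

theorem mergeAt_eq_update {W : Type*} {n : ℕ} (μ ν : W → W → W) (c : Fin (n + 1) → W) (s : Fin n) :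
    mergeAt μ c s = Function.update (mergeAt ν c s) s (μ (c s.castSucc) (c s.succ)) := by
  funext t
  by_cases h : t = s
  · subst h; simp [mergeAt]
  · simp [mergeAt, h]

variable (alg)

theorem wd_ofFn {n : ℕ} (a : Fin n → A) :
    wd R (List.ofFn a) = DirectSum.lof R ℕ (fun p => ⨂[R]^p A) n (PiTensorProduct.tprod R a) :=
  (lof_tprod a).symm

theorem wd_update_smul {n : ℕ} (a : Fin n → A) (s : Fin n) (u : ℤˣ) (x : A) :
    wd R (List.ofFn (Function.update a s (u • x)))
      = u • wd R (List.ofFn (Function.update a s x)) := by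
  rw [wd_ofFn, wd_ofFn]
  exact map_sgn_smul (DirectSum.lof R ℕ (fun p => ⨂[R]^p A) n ∘ₗ
    (PiTensorProduct.tprod R).toLinearMap a s) u x

theorem wd_mergeAt_sgn {n : ℕ} (μ ν : A → A → A) (c : Fin (n + 1) → A) (s : Fin n) (u : ℤˣ)
    (h : μ (c s.castSucc) (c s.succ) = u • ν (c s.castSucc) (c s.succ)) :
    wd R (List.ofFn (mergeAt μ c s)) = u • wd R (List.ofFn (mergeAt ν c s)) := by
  rw [mergeAt_eq_update μ ν, h, wd_update_smul, ← mergeAt_eq_update ν ν]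

theorem preDeg_shift {n : ℕ} (e : Fin n → ℤ) (s : Fin n) :
    preDeg (fun i => e i - 1) s = prefixDeg e s := rfl

theorem elim_mem {p q n : ℕ} (σ : Fin p ⊕ Fin q ≃ Fin n) {e : Fin p → ℤ} {e' : Fin q → ℤ}
    {a : Fin p → A} {b : Fin q → A} (ha : ∀ s, a s ∈ 𝒜 (e s)) (hb : ∀ s, b s ∈ 𝒜 (e' s))
    (s : Fin n) : (Sum.elim a b ∘ σ.symm) s ∈ 𝒜 ((Sum.elim e e' ∘ σ.symm) s) := by
  simp only [Function.comp_apply]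
  rcases σ.symm s with i | i
  exacts [ha i, hb i]

theorem elim_shift {p q n : ℕ} (σ : Fin p ⊕ Fin q ≃ Fin n) (e : Fin p → ℤ) (e' : Fin q → ℤ) :
    Sum.elim (fun i => e i - 1) (fun i => e' i - 1) ∘ σ.symm
      = fun s => (Sum.elim e e' ∘ σ.symm) s - 1 := by
  funext s
  simp only [Function.comp_apply]
  rcases σ.symm s with i | i <;> rfl

theorem mem_shift {i : ℤ} {a : A} (ha : a ∈ 𝒜 i) : a ∈ (fun j => 𝒜 (j + 1)) (i - 1) := by
  show a ∈ 𝒜 (i - 1 + 1)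
  rwa [sub_add_cancel]

theorem isWord_shift {e : Fin p → ℤ} {a : Fin p → A} (ha : ∀ s, a s ∈ 𝒜 (e s)) :
    IsWord (fun i => 𝒜 (i + 1)) (∑ s, (e s - 1)) (wd R (List.ofFn a)) :=
  isWord_wd fun s => mem_shift (ha s)

theorem mul_words {e : Fin p → ℤ} {e' : Fin q → ℤ} {a : Fin p → A} {b : Fin q → A}
    (ha : ∀ s, a s ∈ 𝒜 (e s)) (hb : ∀ s, b s ∈ 𝒜 (e' s)) :
    alg.shifted.mul (wd R (List.ofFn a)) (wd R (List.ofFn b))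
      = ∑ σ ∈ shuffles p q, shuffleSign σ e e' • wd R (List.ofFn (shuffleWord σ a b)) := by
  rw [sum_shuffles, mulT_wd alg.shifted rfl (fun s => mem_shift (ha s)) (fun s => mem_shift (hb s))]
  simp only [shuffleSign_eq, shuffleWord_eq]

theorem brT_words {e : Fin p → ℤ} {e' : Fin (q + 1) → ℤ} {a : Fin p → A} {b : Fin (q + 1) → A}
    (ha : ∀ s, a s ∈ 𝒜 (e s)) (hb : ∀ s, b s ∈ 𝒜 (e' s)) :
    alg.shifted.brT (wd R (List.ofFn a)) (wd R (List.ofFn b))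
      = ∑ σ ∈ shuffles p (q + 1), ∑ s : Fin (p + q),
          let w : Fin (p + q + 1) → A := shuffleWord (p := p) (q := q + 1) σ a b
          let ew : Fin (p + q + 1) → ℤ := shuffleWord (p := p) (q := q + 1) σ e e'
          if (σ.symm s.castSucc : ℕ) < p ∧ p ≤ (σ.symm s.succ : ℕ) then
            (shuffleSign σ e e' * sgn (prefixDeg ew s.castSucc + (ew s.castSucc - 1))) •
              wd R (List.ofFn (mergeAt (fun x y => alg.bracket x y) w s))
          else 0 := by
  rw [sum_shuffles,
    brT_wd alg.shifted (p := p) (q := q + 1) (n := p + q) rfl (fun s => mem_shift (ha s))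
      (fun s => mem_shift (hb s))]
  refine Finset.sum_congr rfl fun σ _ => Finset.sum_congr rfl fun s _ => ?_
  simp only [shuffleSign_eq, shuffleWord_eq]
  refine if_congr (and_congr ?_ ?_) ?_ rfl
  · rw [← isLeft_finSumFinEquiv_symm (p := p) (q := q + 1)]; simp
  · rw [← isRight_finSumFinEquiv_symm (p := p) (q := q + 1)]; simp
  · rw [wd_mergeAt_sgn (fun x y => alg.shifted.β x y) (fun x y => alg.bracket x y) _ s (sgn
    ((Sum.elim e e' ∘ σ.symm) s.castSucc - 1)) (shiftOp_apply _ _ (mem_shift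
    (elim_mem σ ha hb _)) _),
      smul_smul, elim_shift, preDeg_shift, mul_assoc, ← sgn_add]

theorem dT_words {r : ℕ} {e : Fin (r + 1) → ℤ} {a : Fin (r + 1) → A} (ha : ∀ s, a s ∈ 𝒜 (e s)) :
    alg.shifted.dT (wd R (List.ofFn a))
      = ∑ s, sgn (prefixDeg e s) • wd R (List.ofFn (Function.update a s (alg.d (a s))))
        + ∑ s : Fin r, sgn (prefixDeg e s.castSucc + (e s.castSucc - 1)) •
          wd R (List.ofFn (mergeAt (fun x y => alg.mul x y) a s)) := by
  rw [dT_wd alg.shifted fun s => mem_shift (ha s)]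
  refine congrArg₂ _ rfl (Finset.sum_congr rfl fun s _ => ?_)
  rw [wd_mergeAt_sgn (fun x y => alg.shifted.μ x y) (fun x y => alg.mul x y) _ s (sgn
    (e s.castSucc - 1)) (shiftOp_apply _ _ (mem_shift (ha _)) _),
    smul_smul, ← sgn_add]
  rfl

end Frozen

end

section

variable {R : Type*} [CommRing R] {ħ : R} {A L M N T V Y Y' : Type*} [AddCommGroup A] [Module R A]
  [AddCommGroup L] [Module R L] [AddCommGroup M] [Module R M] [AddCommGroup N] [Module R N]
  [AddCommGroup T] [Module R T] [AddCommGroup V] [Module R V] [AddCommGroup Y] [Module R Y]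
  [AddCommGroup Y'] [Module R Y'] {𝒜 : ℤ → Submodule R A} {ℒ : ℤ → Submodule R L}
  {ℳ : ℤ → Submodule R M} {𝒩 : ℤ → Submodule R N} {𝒯 : ℤ → Submodule R T} {𝒱 : ℤ → Submodule R V}
  {𝒴 : ℤ → Submodule R Y} {𝒴' : ℤ → Submodule R Y'} {G : GCAlgebra 𝒱} {GN : GCAlgebra 𝒩}
  {GT : GCAlgebra 𝒯} {GM : GCAlgebra ℳ} {GY : GCAlgebra 𝒴} {GY' : GCAlgebra 𝒴'}
  {alg : BD1Algebra ħ 𝒜} {BM : BD0Algebra ħ ℳ} {BN : BD0Algebra ħ 𝒩}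

section Vanishing

theorem apply_eq_cur (P : Ops R V) {k : ℕ} (x : Fin (k + 1) → V) :
    P (k + 1) x = cur P (x 0) k (Fin.tail x) := by
  rw [cur_apply, Fin.cons_self_tail]

/-- Evaluation of a family of operations. -/
def evalₗ {k : ℕ} (x : Fin k → V) : Ops R V →ₗ[R] V where
  toFun P := P k x
  map_add' _ _ := rfl
  map_smul' _ _ := rfl

theorem apply_eq_zero_of_cur (h : DirectSum.IsInternal 𝒴) {j : Y →ₗ[R] V}
    (hj : ∀ {i y}, y ∈ 𝒴 i → j y ∈ 𝒱 i) {p : ℤ} {P : Ops R V} (hP : IsHDiffOp ħ G p P)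
    (H : ∀ y, cur P (j y) = 0) {k : ℕ} {x : Fin k → V} {s : Fin k} (hs : ∃ y, x s = j y) :
    P k x = 0 := by
  induction k generalizing p P with
  | zero => exact s.elim0
  | succ k ih =>
    rw [apply_eq_cur]
    cases s using Fin.cases with
    | zero => obtain ⟨y, hy⟩ := hs; rw [hy, H]; rfl
    | succ s =>
      have : evalₗ (Fin.tail x) ∘ₗ cur P = 0 := hom_ext G.isInternal fun l v hv => by
        refine ih (hP.cur hv) (fun y => ?_) (s := s) hs
        have : cur (cur P v) ∘ₗ j = 0 := hom_ext h fun l y hy => by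
          rw [comp_apply, hP.cur_cur hv (hj hy), H, map_zero, lin_zero, smul_zero]; rfl
        exact LinearMap.congr_fun this y
      exact LinearMap.congr_fun this (x 0)

theorem apply_eq_zero_of_cur_cur (h : DirectSum.IsInternal 𝒴) {j : Y →ₗ[R] V}
    (hj : ∀ {i y}, y ∈ 𝒴 i → j y ∈ 𝒱 i) {p : ℤ} {P : Ops R V} (hP : IsHDiffOp ħ G p P)
    (H : ∀ y y', cur (cur P (j y)) (j y') = 0) {k : ℕ} {x : Fin k → V} {s t : Fin k} (hst : s ≠ t)
    (hs : ∃ y, x s = j y) (ht : ∃ y, x t = j y) : P k x = 0 := by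
  have key : ∀ {k : ℕ} {P : Ops R V} {p : ℤ} (_ : IsHDiffOp ħ G p P)
      (_ : ∀ y y', cur (cur P (j y)) (j y') = 0) {x : Fin k → V} {t : Fin k} (_ : ∃ y, x t = j y)
      (y : Y), cur P (j y) k x = 0 := by
    intro k P p hP H x t ht y
    have : evalₗ x ∘ₗ cur P ∘ₗ j = 0 := hom_ext h fun l y hy =>
      apply_eq_zero_of_cur h hj (hP.cur (hj hy)) (H y) ht
    exact LinearMap.congr_fun this y
  induction k generalizing p P with
  | zero => exact s.elim0
  | succ k ih =>
    rw [apply_eq_cur]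
    cases s using Fin.cases with
    | zero =>
      obtain ⟨y, hy⟩ := hs
      obtain ⟨t, rfl⟩ := Fin.exists_succ_eq.2 hst.symm
      rw [hy]
      exact key hP H (x := Fin.tail x) ht y
    | succ s =>
      cases t using Fin.cases with
      | zero =>
        obtain ⟨y, hy⟩ := ht
        rw [hy]
        exact key hP H (x := Fin.tail x) (t := s) hs y
      | succ t =>
        have : evalₗ (Fin.tail x) ∘ₗ cur P = 0 := hom_ext G.isInternal fun l v hv => by
          refine ih (hP.cur hv) (fun y y' => ?_) (s := s) (t := t)
            (fun h => hst (congrArg _ h)) hs ht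
          have : (cur.compl₂ j ∘ₗ cur (cur P v) ∘ₗ j : Y →ₗ[R] Y →ₗ[R] Ops R V) = 0 :=
            hom_ext h fun l y hy => hom_ext h fun l' y' hy' => by
              show cur (cur (cur P v) (j y)) (j y') = 0
              rw [hP.cur_cur hv (hj hy), map_sgn_smul₂, (hP.cur (hj hy)).cur_cur hv (hj hy'), H,
                map_zero, lin_zero, smul_zero, smul_zero]
          exact LinearMap.congr_fun (LinearMap.congr_fun this y) y'
        exact LinearMap.congr_fun this (x 0)

theorem ι_apply (E : OpEmb ħ GY G) (P : Ops R Y) {k : ℕ} (x : Fin k → Y) :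
    E.ι P k (fun t => E.j (x t)) = E.j (P k x) := by
  rw [← evl_ofFn, ← evl_ofFn, ← E.evl_ι, List.map_ofFn]; rfl

theorem phi_apply_eq_zero (hL : DirectSum.IsInternal ℒ) {D : V →ₗ[R] L ⊗[R] V}
    (φ : L →ₗ[R] Ops R V) {k : ℕ} {x : Fin k → V} (h : ∀ s, D (x s) = 0) :
    phi ħ hL G D φ k x = 0 := by
  induction k generalizing φ with
  | zero =>
    rw [Subsingleton.elim x ![]]
    exact phi_nil ..
  | succ k ih =>
    rw [apply_eq_cur, cur_phi, h, map_zero, add_zero]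
    exact ih _ fun s => h _

end Vanishing

section Bar

theorem inT_eq {p : ℕ} (a : Fin p → A) :
    inT BN BM a = (wgM alg BM BN).eT.j (wd R (List.ofFn a)) := by
  rw [inT, bar_eq]
  exact (embT_j ..).symm

theorem inM_eq (m : M) : inM A BN m = (wgM alg BM BN).eY.j m := by
  refine (bar_eq ..).trans ?_
  rw [List.ofFn_zero, wd_nil]
  rfl

theorem inN_eq (n : N) : inN A BM n = (wgN alg BM BN).eY.j n := by
  refine (bar_eq ..).trans ?_
  rw [List.ofFn_zero, wd_nil]
  rfl

variable (alg BM BN) in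
theorem wings : (wgM alg BM BN).Opposite (wgN alg BM BN) :=
  wings_opposite (GN := BN.toGCAlgebra) (GM := BM.toGCAlgebra) ħ alg.shifted.isInternal
    alg.shifted.delR_deriv alg.shifted.delL_deriv

section

variable {k : ℕ} {x : Fin k → Bar R N A M} {s t : Fin k}

theorem OpEmb.ι_eq_zero {E : OpEmb ħ GY G} (F : OpEmb ħ GY' G) (h : ∀ y, E.Kills (F.j y)) {p : ℤ}
    {P : Ops R Y} (hP : IsHDiffOp ħ GY p P) {x : Fin k → V} (hs : ∃ y, x s = F.j y) :
    E.ι P k x = 0 :=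
  apply_eq_zero_of_cur GY'.isInternal F.j_mem (E.ι_hd hP) (fun y => h y hP) hs

theorem ιT_M (hs : ∃ y, x s = (wgM alg BM BN).eY.j y) :
    (wgM alg BM BN).eT.ι alg.shifted.barT.ops k x = 0 :=
  OpEmb.ι_eq_zero _ (wgM alg BM BN).kills_Y alg.shifted.barT.ops_isHDiffOp hs

theorem ιT_N (hs : ∃ y, x s = (wgN alg BM BN).eY.j y) :
    (wgM alg BM BN).eT.ι alg.shifted.barT.ops k x = 0 :=
  OpEmb.ι_eq_zero _ (wgN alg BM BN).kills_Y alg.shifted.barT.ops_isHDiffOp hs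

theorem ιM_T (hs : ∃ y, x s = (wgM alg BM BN).eT.j y) :
    (wgM alg BM BN).eY.ι BM.ops k x = 0 :=
  OpEmb.ι_eq_zero _ (wgM alg BM BN).kills_T BM.ops_isHDiffOp hs

theorem ιM_N (hs : ∃ y, x s = (wgN alg BM BN).eY.j y) :
    (wgM alg BM BN).eY.ι BM.ops k x = 0 :=
  OpEmb.ι_eq_zero _ (wings alg BM BN).kills BM.ops_isHDiffOp hs

theorem ιN_T (hs : ∃ y, x s = (wgM alg BM BN).eT.j y) :
    (wgN alg BM BN).eY.ι BN.ops k x = 0 :=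
  OpEmb.ι_eq_zero _ (wgN alg BM BN).kills_T BN.ops_isHDiffOp hs

theorem ιN_M (hs : ∃ y, x s = (wgM alg BM BN).eY.j y) :
    (wgN alg BM BN).eY.ι BN.ops k x = 0 :=
  OpEmb.ι_eq_zero _ (wings alg BM BN).kills' BN.ops_isHDiffOp hs

variable (f : LeftBD1Module alg BM) (g : RightBD1Module alg BN)

theorem ΦM_N (hs : ∃ n, x s = (wgN alg BM BN).eY.j n) : (wgM alg BM BN).Φ f.family k x = 0 := by
  refine apply_eq_zero_of_cur BN.isInternal (wgN alg BM BN).eY.j_mem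
    (Wing.Φ_hd (compatM (BN := BN) f).fam) (fun n => ?_) hs
  have : cur ((wgM alg BM BN).Φ f.family) ∘ₗ (wgN alg BM BN).eY.j = 0 :=
    hom_ext BN.isInternal fun _ n hn => (wings alg BM BN).cur_Φ (compatM (BN := BN) f).fam hn
  exact LinearMap.congr_fun this n

theorem ΦN_M (hs : ∃ m, x s = (wgM alg BM BN).eY.j m) :
    (wgN alg BM BN).Φ (-g.family) k x = 0 := by
  refine apply_eq_zero_of_cur BM.isInternal (wgM alg BM BN).eY.j_mem
    (Wing.Φ_hd (compatN (BM := BM) g).fam) (fun m => ?_) hs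
  have : cur ((wgN alg BM BN).Φ (-g.family)) ∘ₗ (wgM alg BM BN).eY.j = 0 :=
    hom_ext BM.isInternal fun _ m hm => (wings alg BM BN).symm.cur_Φ (compatN (BM := BM) g).fam hm
  exact LinearMap.congr_fun this m

theorem Wing.Φ_TT (W : Wing ħ GT GY G ℒ) {d : ℤ} {φ : L →ₗ[R] Ops R Y} (hφ : IsFam ℒ ħ GY d φ)
    {x : Fin k → V} (hst : s ≠ t) (hs : ∃ w, x s = W.eT.j w) (ht : ∃ w, x t = W.eT.j w) :
    W.Φ φ k x = 0 := by
  refine apply_eq_zero_of_cur_cur GT.isInternal W.eT.j_mem (Wing.Φ_hd hφ) (fun w w' => ?_) hst hs ht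
  have : (cur.compl₂ W.eT.j ∘ₗ cur (W.Φ φ) ∘ₗ W.eT.j : T →ₗ[R] T →ₗ[R] Ops R V) = 0 :=
    hom_ext GT.isInternal fun i w hw => hom_ext GT.isInternal fun i' w' hw' => by
      show cur (cur (W.Φ φ) (W.eT.j w)) (W.eT.j w') = 0
      rw [Wing.cur_Φ_T hφ hw, Wing.cur_F_T hφ (W.δ_mem hw) hw']
  exact LinearMap.congr_fun (LinearMap.congr_fun this w) w'

theorem Wing.Φ_Y (W : Wing ħ GT GY G ℒ) (φ : L →ₗ[R] Ops R Y) (y : Fin k → Y) :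
    W.Φ φ k (fun s => W.eY.j (y s)) = 0 :=
  phi_apply_eq_zero _ _ fun _ => W.D_Y _

theorem barOps_apply : barOps f g k x = (wgM alg BM BN).eT.ι alg.shifted.barT.ops k x
    + (wgM alg BM BN).eY.ι BM.ops k x + (wgN alg BM BN).eY.ι BN.ops k x
    + (wgM alg BM BN).Φ f.family k x + (wgN alg BM BN).Φ (-g.family) k x := rfl

theorem barOps_NM (hs : ∃ n, x s = inN A BM n) (ht : ∃ m, x t = inM A BN m) :
    barOps f g k x = 0 := by
  simp only [inN_eq (alg := alg) (BN := BN), inM_eq (alg := alg) (BM := BM)] at hs ht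
  rw [barOps_apply, ιT_N hs, ιM_N hs, ιN_M ht, ΦM_N f hs, ΦN_M g ht]
  simp only [add_zero]

end

variable (f : LeftBD1Module alg BM) (g : RightBD1Module alg BN)

theorem barOps_M {k : ℕ} (m : Fin (k + 1) → M) :
    barOps f g (k + 1) (fun t => inM A BN (m t)) = inM A BN (BM.ops (k + 1) m) := by
  have h0 : ∃ y, (fun t => (wgM alg BM BN).eY.j (m t)) 0 = (wgM alg BM BN).eY.j y := ⟨_, rfl⟩
  simp only [inM_eq (alg := alg) (BM := BM)]
  rw [barOps_apply, ιT_M h0, ιN_M h0, ΦN_M g h0, Wing.Φ_Y, ι_apply]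
  simp only [add_zero, zero_add]

theorem barOps_N {k : ℕ} (n : Fin (k + 1) → N) :
    barOps f g (k + 1) (fun t => inN A BM (n t)) = inN A BM (BN.ops (k + 1) n) := by
  have h0 : ∃ y, (fun t => (wgN alg BM BN).eY.j (n t)) 0 = (wgN alg BM BN).eY.j y := ⟨_, rfl⟩
  simp only [inN_eq (alg := alg) (BN := BN)]
  rw [barOps_apply, ιT_N h0, ιM_N h0, ΦM_N f h0, Wing.Φ_Y, ι_apply]
  simp only [add_zero, zero_add]

theorem barOps_T {k : ℕ} (w : Fin (k + 2) → TensorCoalg R A) :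
    barOps f g (k + 2) (fun t => (wgM alg BM BN).eT.j (w t))
      = (wgM alg BM BN).eT.j (alg.shifted.barT.ops (k + 2) w) := by
  have h (s : Fin (k + 2)) : ∃ y, (fun t => (wgM alg BM BN).eT.j (w t)) s
      = (wgM alg BM BN).eT.j y := ⟨_, rfl⟩
  have h01 : (0 : Fin (k + 2)) ≠ 1 := by simp
  rw [barOps_apply, ιM_T (h 0), ιN_T (h 0), Wing.Φ_TT _ (compatM (BN := BN) f).fam h01 (h 0) (h 1),
    (wgN alg BM BN).Φ_TT (compatN (BM := BM) g).fam h01 (h 0) (h 1), ι_apply]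
  simp only [add_zero]

theorem barOps_TT {k : ℕ} (x : Fin (k + 3) → Bar R N A M)
    (hx : ∀ t, (∃ n, x t = inN A BM n) ∨ (∃ (p : ℕ) (a : Fin p → A), x t = inT BN BM a) ∨
      (∃ m, x t = inM A BN m)) {s t : Fin (k + 3)} (hst : s ≠ t)
    (hs : ∃ (p : ℕ) (a : Fin p → A), x s = inT BN BM a)
    (ht : ∃ (p : ℕ) (a : Fin p → A), x t = inT BN BM a) : barOps f g (k + 3) x = 0 := by
  have e : ∀ t, (∃ (p : ℕ) (a : Fin p → A), x t = inT BN BM a) →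
      ∃ w, x t = (wgM alg BM BN).eT.j w := fun t ⟨p, a, h⟩ => ⟨_, h.trans (inT_eq a)⟩
  by_cases hT : ∀ t, ∃ (p : ℕ) (a : Fin p → A), x t = inT BN BM a
  · choose w hw using fun t => e t (hT t)
    rw [show x = fun t => (wgM alg BM BN).eT.j (w t) from funext hw, barOps_T f g (k := k + 1)]
    exact map_zero _
  · push Not at hT
    obtain ⟨r, hr⟩ := hT
    rw [barOps_apply, ιM_T (e s hs), ιN_T (e s hs),
      Wing.Φ_TT _ (compatM (BN := BN) f).fam hst (e s hs) (e t ht),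
      (wgN alg BM BN).Φ_TT (compatN (BM := BM) g).fam hst (e s hs) (e t ht)]
    simp only [add_zero]
    rcases hx r with ⟨n, h⟩ | ⟨p, a, h⟩ | ⟨m, h⟩
    · exact ιT_N ⟨n, h.trans (inN_eq n)⟩
    · exact absurd h (hr p a)
    · exact ιT_M ⟨m, h.trans (inM_eq m)⟩

theorem emb_T_mul_M {j : ℤ} {w : TensorCoalg R A} (hw : w ∈ Tgr (fun i => 𝒜 (i + 1)) j) (m : M) :
    (barAlg alg BM BN).mul ((wgM alg BM BN).eT.j w) ((wgM alg BM BN).eY.j m)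
      = BN.one ⊗ₜ (w ⊗ₜ m) := by
  have := emb_mul_emb (GN := BN.toGCAlgebra) (GT := alg.shifted.barT.toGCAlgebra)
    (GM := BM.toGCAlgebra) BN.one hw m
  change (barAlg alg BM BN).mul ((barAlg alg BM BN).mul (barAlg alg BM BN).one _) _ = _ at this
  rw [(barAlg alg BM BN).one_mul] at this
  exact this

theorem emb_N_mul_T {j : ℤ} {w : TensorCoalg R A} (hw : w ∈ Tgr (fun i => 𝒜 (i + 1)) j) (n : N) :
    (barAlg alg BM BN).mul ((wgN alg BM BN).eY.j n) ((wgN alg BM BN).eT.j w)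
      = n ⊗ₜ (w ⊗ₜ BM.one) := by
  have := emb_mul_emb (GN := BN.toGCAlgebra) (GT := alg.shifted.barT.toGCAlgebra)
    (GM := BM.toGCAlgebra) n hw BM.one
  change (barAlg alg BM BN).mul _ (barAlg alg BM BN).one = _ at this
  rw [(barAlg alg BM BN).mul_one] at this
  exact this

theorem delL_wd {r : ℕ} (a : Fin (r + 1) → A) :
    ShiftedBD.delL R A (wd R (List.ofFn a)) = a 0 ⊗ₜ wd R (List.ofFn (a ∘ Fin.succ)) := by
  induction r with
  | zero =>
    rw [wd_ofFn_succ, List.ofFn_zero, List.ofFn_zero, wd_nil, ShiftedBD.delL_sn, ShiftedBD.delL_one,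
      map_zero, ShiftedBD.cou_one, zero_add, one_smul]
    rfl
  | succ r ih =>
    rw [wd_ofFn_succ, ShiftedBD.delL_sn, ih, lTensor_tmul, wd_ofFn_succ (a ∘ Fin.castSucc),
      ShiftedBD.cou_sn, zero_smul, add_zero, wd_ofFn_succ (a ∘ Fin.succ)]
    rfl

theorem Wing.S_apply {BT : BD0Algebra ħ 𝒯} {BY : BD0Algebra ħ 𝒴}
    (W : Wing ħ BT.toGCAlgebra BY.toGCAlgebra G ℒ) {p j : ℤ} {P : Ops R Y}
    (hP : IsHDiffOp ħ BY.toGCAlgebra p P) {t : T} (ht : t ∈ 𝒯 j) {k : ℕ} (y : Fin k → Y) :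
    W.S P t k (fun s => W.eY.j (y s)) = sgn (p * j) • G.mul (W.eT.j t) (W.eY.j (P k y)) := by
  have : (W.S P t k).compLinearMap (fun _ => W.eY.j)
      = (sgn (p * j) • (G.mul (W.eT.j t) ∘ₗ W.eY.j)).compMultilinearMap (P k) := by
    refine multilinear_hom_ext BY.isInternal fun e b hb => ?_
    have h := Wing.evl_S (W := W) hP ht (γ := List.ofFn fun s => (e s, b s)) (fun z hz => by
      obtain ⟨s, rfl⟩ := (List.mem_ofFn ..).1 hz
      exact hb s)
    simp only [List.map_ofFn, Function.comp_def, evl_ofFn, List.sum_ofFn] at h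
    rw [MultilinearMap.compLinearMap_apply, h, G.mul_comm (W.eY.j_mem (hP.mem hb)) (W.eT.j_mem ht),
      LinearMap.compMultilinearMap_apply, sgn_smul_apply, smul_smul, add_mul, sgn_add, mul_comm j,
      mul_left_comm, sgn_mul_self, mul_one]
    rfl
  exact congrArg (fun F => F y) this

theorem barOps_TM {r k : ℕ} {e : Fin (r + 1) → ℤ} {a : Fin (r + 1) → A} (m : Fin (k + 1) → M)
    (ha : ∀ s, a s ∈ 𝒜 (e s)) :
    barOps f g (k + 2) (Matrix.vecCons (inT BN BM a) (fun t => inM A BN (m t)))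
      = sgn (wordDeg e) • bar R BN.one (a ∘ Fin.castSucc) (f.map (k + 1) (a (Fin.last r)) m) := by
  have hw := isWord_shift ha
  have hw' := isWord_shift (a := a ∘ Fin.castSucc) fun s => ha s.castSucc
  have hl := mem_shift (ha (Fin.last r))
  simp only [inT_eq (alg := alg), inM_eq (alg := alg) (BM := BM)]
  set x := Matrix.vecCons ((wgM alg BM BN).eT.j (wd R (List.ofFn a)))
    fun t => (wgM alg BM BN).eY.j (m t) with hx
  have h0 : ∃ w, x 0 = (wgM alg BM BN).eT.j w := ⟨_, rfl⟩
  have h1 : ∃ m, x 1 = (wgM alg BM BN).eY.j m := ⟨_, rfl⟩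
  rw [barOps_apply, ιT_M h1, ιM_T h0, ιN_T h0, ΦN_M g h1, apply_eq_cur, hx, Matrix.cons_val_zero,
    Wing.cur_Φ_T (W := wgM alg BM BN) (compatM (BN := BN) f).fam hw.mem,
    show (wgM alg BM BN).δ (wd R (List.ofFn a)) = alg.shifted.delR (wd R (List.ofFn a)) from rfl,
    wd_ofFn_succ, alg.shifted.delR_sn hw'.mem hl, Wing.F_sgn, Wing.F_tmul]
  change _ + sgn _ • (wgM alg BM BN).S _ _ (k + 1) (fun t => (wgM alg BM BN).eY.j (m t)) + _ = _
  rw [Wing.S_apply _ ((compatM (BN := BN) f).fam hl) hw'.mem, emb_T_mul_M hw'.mem,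
    f.family_apply hl, bar_eq]
  simp only [zero_add, add_zero]
  change _ • _ • BN.one ⊗ₜ (_ ⊗ₜ (sgn _ • f.map (k + 1) (a (Fin.last r)) m)) = _
  rw [tmul_sgn]
  erw [tmul_sgn]
  rw [smul_smul, smul_smul, wordDeg, Fin.sum_univ_castSucc]
  generalize e (Fin.last r) - 1 = i
  simp only [mul_comm, mul_left_comm, sgn_expand, sgn_cancel]

end Bar

section Bar

variable (f : LeftBD1Module alg BM) (g : RightBD1Module alg BN)

theorem tmul_sgn_bar (u : ℤˣ) (n : N) (x : TensorCoalg R A ⊗[R] M) :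
    n ⊗ₜ[R] (u • x) = u • n ⊗ₜ[R] x := tmul_sgn u n x

theorem sgn_tmul_bar (u : ℤˣ) (n : N) (x : TensorCoalg R A ⊗[R] M) :
    (u • n) ⊗ₜ[R] x = u • n ⊗ₜ[R] x := sgn_tmul u n x

theorem barOps_TN {r k : ℕ} {e : Fin (r + 1) → ℤ} {a : Fin (r + 1) → A} {i : Fin (k + 1) → ℤ}
    {n : Fin (k + 1) → N} (ha : ∀ s, a s ∈ 𝒜 (e s)) (hn : ∀ t, n t ∈ 𝒩 (i t)) :
    barOps f g (k + 2) (Matrix.vecCons (inT BN BM a) (fun t => inN A BM (n t)))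
      = sgn (e 0 + (∑ t, i t) * wordDeg (e ∘ Fin.succ)) •
          bar R (g.map (k + 1) (a 0) n) (a ∘ Fin.succ) BM.one := by
  have hw := isWord_shift ha
  have hw' := isWord_shift (a := a ∘ Fin.succ) fun s => ha s.succ
  have hl := mem_shift (ha 0)
  have hg := (compatN (BM := BM) g).fam hl
  have eT : inT BN BM a = (wgN alg BM BN).eT.j (wd R (List.ofFn a)) := inT_eq a
  simp only [eT, inN_eq (alg := alg) (BN := BN)]
  set x := Matrix.vecCons ((wgN alg BM BN).eT.j (wd R (List.ofFn a)))
    fun t => (wgN alg BM BN).eY.j (n t) with hx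
  have h0 : ∃ w, x 0 = (wgM alg BM BN).eT.j w := ⟨_, rfl⟩
  have h1 : ∃ n, x 1 = (wgN alg BM BN).eY.j n := ⟨_, rfl⟩
  rw [barOps_apply, ιT_N h1, ιM_T h0, ιN_T h0, ΦM_N f h1, apply_eq_cur, hx, Matrix.cons_val_zero,
    Wing.cur_Φ_T (W := wgN alg BM BN) (compatN (BM := BM) g).fam hw.mem,
    show (wgN alg BM BN).δ (wd R (List.ofFn a)) = ShiftedBD.delL R A (wd R (List.ofFn a)) from rfl,
    delL_wd, Wing.F_tmul]
  change _ + (wgN alg BM BN).S _ _ (k + 1) (fun t => (wgN alg BM BN).eY.j (n t)) = _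
  rw [Wing.S_apply _ hg hw'.mem,
      (barAlg alg BM BN).mul_comm ((wgN alg BM BN).eT.j_mem hw'.mem) ((wgN alg BM BN).eY.j_mem
        (hg.mem hn)),
      emb_N_mul_T hw'.mem, g.neg_family_apply hl, bar_eq]
  simp only [zero_add, add_zero]
  change _ • _ • (sgn _ • g.map (k + 1) (a 0) n) ⊗ₜ _ = _
  rw [sgn_tmul_bar, smul_smul, smul_smul]
  have e1 : wordDeg (e ∘ Fin.succ) = ∑ s : Fin r, (e s.succ - 1) := rfl
  rw [sub_add_cancel, e1, add_sub_cancel]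
  congr 1
  simp only [mul_comm, mul_left_comm, sgn_expand, sgn_cancel]

theorem bar_mul {p q : ℕ} {j i' : ℤ} {e : Fin p → ℤ} {e' : Fin q → ℤ} {n n' : N}
    {a : Fin p → A} {a' : Fin q → A} {m m' : M} (ha : ∀ s, a s ∈ 𝒜 (e s)) (hm : m ∈ ℳ j)
    (hn' : n' ∈ 𝒩 i') (ha' : ∀ s, a' s ∈ 𝒜 (e' s)) :
    (barAlg alg BM BN).mul (bar R n a m) (bar R n' a' m')
      = ∑ σ ∈ shuffles p q,
          (sgn (j * i' + j * wordDeg e' + wordDeg e * i') * shuffleSign σ e e') •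
            bar R (BN.mul n n') (shuffleWord σ a a') (BM.mul m m') := by
  have hw := (isWord_shift ha).mem
  have hw' := (isWord_shift ha').mem
  rw [bar_eq, bar_eq, tensorGC_mul_apply _ _ (tmul_mem hw hm rfl) hn',
    tensorGC_mul_apply _ _ hm hw',
    show alg.shifted.barT.mul (wd R (List.ofFn a)) (wd R (List.ofFn a')) = alg.shifted.mul (wd R
      (List.ofFn a)) (wd R (List.ofFn a')) from rfl,
    mul_words alg ha ha']
  simp only [TensorProduct.sum_tmul, TensorProduct.tmul_sum, Finset.smul_sum, tmul_sgn_bar,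
    sgn_tmul, smul_smul, bar_eq]
  refine Finset.sum_congr rfl fun σ _ => ?_
  congr 1
  rw [wordDeg, wordDeg, add_mul, sgn_add, sgn_add, sgn_add]
  simp only [mul_comm, mul_left_comm, mul_assoc]

theorem barAlg_cast_shuffle :
    IsShuffleAlgebra BN BM ((barAlg alg BM BN).cast barGrading_eq) where
  one_eq := by
    refine (GCAlgebra.cast_one _ (barAlg alg BM BN)).trans ?_
    rw [bar_eq, List.ofFn_zero, wd_nil]
    rfl
  mul_eq _ ha hm hn' ha' _ := by
    rw [GCAlgebra.cast_mul _ (barAlg alg BM BN)]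
    exact bar_mul ha hm hn' ha'

end Bar

section Ext

variable {p i j : ℤ} {P : Ops R V} {u x : V}

theorem IsHDiffOp.leib_of_cur_right (hP : IsHDiffOp ħ G p P) (hu : u ∈ 𝒱 i) (hx : x ∈ 𝒱 j)
    (h : BD.cur P x = 0) : evl P [G.mul u x] = G.mul (evl P [u]) x := by
  rw [hP.leib hu hx]
  simp only [evl_cons]
  rw [hP.cur_cur hu hx, h, map_zero, lin_zero, smul_zero, show evl (0 : Ops R V) [] = 0 from rfl,
    map_zero, lin_zero, smul_zero, smul_zero, add_zero, add_zero]

theorem IsHDiffOp.leib_of_cur_left (hP : IsHDiffOp ħ G p P) (hx : x ∈ 𝒱 j) (hu : u ∈ 𝒱 i)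
    (h : BD.cur P x = 0) : evl P [G.mul x u] = sgn (p * j) • G.mul x (evl P [u]) := by
  rw [G.mul_comm hx hu, evl_cons, map_sgn_smul, evl_sgn, ← evl_cons, hP.leib_of_cur_right hu hx h,
    evl_cons, G.mul_comm (hP.cur hu).nil_mem hx, smul_smul, add_mul, mul_comm i j, sgn_add,
    mul_left_comm, sgn_mul_self, mul_one]

theorem OpEmb.hAct_right (E : OpEmb ħ GY G) {P : Ops R Y} (hP : IsHDiffOp ħ GY p P) {y : Y}
    (hy : y ∈ 𝒴 i) (hx : x ∈ 𝒱 j) (h : E.Kills x) :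
    evl (star ħ G (E.ι P) (G.mul (E.j y) x)) [] = G.mul (E.j (hAct ħ GY P y)) x := by
  have e : evl P [y] = P 1 ![y] := evl_ofFn P ![y]
  have e' : evl P [] = P 0 ![] := rfl
  rw [star_nil, (E.ι_hd hP).leib_of_cur_right (E.j_mem hy) hx (h hP), E.ι_nil, hAct, map_add,
    map_smul, map_add, map_smul, lin_add, lin_smul, E.j_mul, G.mul_assoc, ← e, ← e',
    ← E.evl_ι P [y]]
  rfl

theorem OpEmb.hAct_left (E : OpEmb ħ GY G) {P : Ops R Y} (hP : IsHDiffOp ħ GY p P) {y : Y}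
    (hy : y ∈ 𝒴 i) (hx : x ∈ 𝒱 j) (h : E.Kills x) :
    evl (star ħ G (E.ι P) (G.mul x (E.j y))) []
      = sgn (p * j) • G.mul x (E.j (hAct ħ GY P y)) := by
  have e : evl P [y] = P 1 ![y] := evl_ofFn P ![y]
  have e' : evl P [] = P 0 ![] := rfl
  rw [star_nil, (E.ι_hd hP).leib_of_cur_left hx (E.j_mem hy) (h hP), E.ι_nil, hAct, map_add,
    map_smul, map_add, map_smul, E.j_mul, ← G.mul_assoc, G.mul_comm (E.j_mem hP.nil_mem) hx,
    ← G.mul_assoc, ← e, ← e', ← E.evl_ι P [y], map_sgn_smul₂, smul_add, smul_comm ħ]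
  rfl

end Ext

section Kills

theorem embM_kills {i j : ℤ} {n : N} {w : T} (hn : n ∈ 𝒩 i) (hw : w ∈ 𝒯 j) :
    (embM ħ GN GT GM).Kills (n ⊗ₜ (w ⊗ₜ GM.one)) := by
  intro p P hP
  change cur (opSnd _ _ (embSnd.ι P) _) _ = 0
  rw [cur_opSnd hn GN.one_mem (tmul_mem hw GM.one_mem rfl), embSnd_kills w hP, map_zero, lin_zero,
    smul_zero]

theorem embN_kills (x : T ⊗[R] M) : (embN ħ GN GT GM).Kills (GN.one ⊗ₜ x) := embFst_kills x

theorem extT_tmul (hL : DirectSum.IsInternal ℒ) {δ : T →ₗ[R] L ⊗[R] T} {i j : ℤ} {n : N}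
    (hn : n ∈ 𝒩 i) {w v : T} (m : M) {a : L} (ha : a ∈ ℒ j) (u : ℤˣ)
    (h : δ w = u • a ⊗ₜ v) :
    extT GN hL δ (n ⊗ₜ (w ⊗ₜ m)) = (sgn (i * j) * u) • a ⊗ₜ (n ⊗ₜ (v ⊗ₜ m)) := by
  rw [extT, extSnd_tmul _ _ _ hn, extFst_tmul, h, map_sgn_smul, map_sgn_smul, lTensor_tmul,
    map_tmul, signMap_apply _ _ ha, sgn_tmul, smul_smul, mul_comm u]
  rfl

end Kills

section One

variable (f : LeftBD1Module alg BM) (g : RightBD1Module alg BN) {i j l : ℤ} {n : N} {m : M}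
  {w : TensorCoalg R A}

theorem nw_mul_m (hw : w ∈ Tgr (fun i => 𝒜 (i + 1)) j) : (barAlg alg BM BN).mul
    (n ⊗ₜ (w ⊗ₜ BM.one)) ((wgM alg BM BN).eY.j m) = n ⊗ₜ (w ⊗ₜ m) := by
  have := emb_mul_emb (GN := BN.toGCAlgebra) (GT := alg.shifted.barT.toGCAlgebra)
    (GM := BM.toGCAlgebra) n hw m
  rw [← emb_N_mul_T (alg := alg) (BN := BN) hw]
  exact this

theorem n_mul_wm (y : TensorCoalg R A ⊗[R] M) : (barAlg alg BM BN).mul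
    ((wgN alg BM BN).eY.j n) (BN.one ⊗ₜ y) = n ⊗ₜ y := by
  refine (tensorGC_mul_apply BN.toGCAlgebra (tensorGC alg.shifted.barT.toGCAlgebra BM.toGCAlgebra)
    (tensorGC alg.shifted.barT.toGCAlgebra BM.toGCAlgebra).one_mem BN.one_mem n y).trans ?_
  rw [BN.mul_one, GCAlgebra.one_mul, mul_zero, sgn_zero, one_smul]

theorem evl_ops_one (B : BD0Algebra ħ ℳ) (m : M) : evl B.ops [m] = B.d m := evl_ofFn B.ops ![m]

theorem ιM_one (hn : n ∈ 𝒩 i) (hw : w ∈ Tgr (fun i => 𝒜 (i + 1)) j) (hm : m ∈ ℳ l) :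
    evl ((wgM alg BM BN).eY.ι BM.ops) [n ⊗ₜ (w ⊗ₜ m)] = sgn (i + j) • n ⊗ₜ (w ⊗ₜ BM.d m) := by
  have hk : (wgM alg BM BN).eY.Kills (n ⊗ₜ (w ⊗ₜ BM.one)) := embM_kills hn hw
  have e : evl ((wgM alg BM BN).eY.ι BM.ops) [(wgM alg BM BN).eY.j m]
      = (wgM alg BM BN).eY.j (BM.d m) :=
    ((wgM alg BM BN).eY.evl_ι _ [m]).trans (congrArg _ (evl_ops_one _ _))
  rw [← nw_mul_m (alg := alg) (BN := BN) hw,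
    ((wgM alg BM BN).eY.ι_hd BM.ops_isHDiffOp).leib_of_cur_left (tmul_mem hn
      (tmul_mem hw BM.one_mem rfl) rfl) ((wgM alg BM BN).eY.j_mem hm) (hk BM.ops_isHDiffOp),
    one_mul, add_zero, e, nw_mul_m hw]

theorem ιN_one (hn : n ∈ 𝒩 i) {y : TensorCoalg R A ⊗[R] M}
    (hy : y ∈ tgr (Tgr (fun i => 𝒜 (i + 1))) ℳ j) :
    evl ((wgN alg BM BN).eY.ι BN.ops) [n ⊗ₜ y] = BN.d n ⊗ₜ y := by
  have hk : (wgN alg BM BN).eY.Kills (BN.one ⊗ₜ y) := embN_kills y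
  have e : evl ((wgN alg BM BN).eY.ι BN.ops) [(wgN alg BM BN).eY.j n]
      = (wgN alg BM BN).eY.j (BN.d n) :=
    ((wgN alg BM BN).eY.evl_ι _ [n]).trans (congrArg _ (evl_ops_one _ _))
  rw [← n_mul_wm (alg := alg) (BM := BM),
    ((wgN alg BM BN).eY.ι_hd BN.ops_isHDiffOp).leib_of_cur_right ((wgN alg BM BN).eY.j_mem hn)
      (tmul_mem BN.one_mem hy rfl) (hk BN.ops_isHDiffOp),
    e, n_mul_wm]

theorem ιT_one (hn : n ∈ 𝒩 i) (hw : w ∈ Tgr (fun i => 𝒜 (i + 1)) j) (hm : m ∈ ℳ l) :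
    evl ((wgM alg BM BN).eT.ι alg.shifted.barT.ops) [n ⊗ₜ (w ⊗ₜ m)]
      = sgn i • n ⊗ₜ (alg.shifted.dT w ⊗ₜ m) := by
  have hP := (wgM alg BM BN).eT.ι_hd alg.shifted.barT.ops_isHDiffOp
  rw [← nw_mul_m (alg := alg) (BN := BN) hw,
    hP.leib_of_cur_right (tmul_mem hn (tmul_mem hw BM.one_mem rfl) rfl)
      ((wgM alg BM BN).eY.j_mem hm) ((wgM alg BM BN).kills_Y _ alg.shifted.barT.ops_isHDiffOp),
    ← emb_N_mul_T (alg := alg) (BN := BN) hw,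
    hP.leib_of_cur_left ((wgN alg BM BN).eY.j_mem hn) ((wgN alg BM BN).eT.j_mem hw)
      ((wgN alg BM BN).kills_Y _ alg.shifted.barT.ops_isHDiffOp),
    one_mul, map_sgn_smul₂]
  have : evl ((wgM alg BM BN).eT.ι alg.shifted.barT.ops) [(wgN alg BM BN).eT.j w]
      = (wgN alg BM BN).eT.j (alg.shifted.dT w) := by
    refine ((wgM alg BM BN).eT.evl_ι _ [w]).trans ?_
    rw [evl_ops_one]; rfl
  have hw1 : alg.shifted.dT w ∈ Tgr (fun i => 𝒜 (i + 1)) (j + 1) := alg.shifted.barT.d_mem hw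
  rw [this, emb_N_mul_T hw1, nw_mul_m hw1]

theorem evl_Φ_one (W : Wing ħ GT GY G ℒ) (φ : L →ₗ[R] Ops R Y) {z z' : V} {a : L} {u : ℤˣ}
    (h : W.D z = u • a ⊗ₜ z') :
    evl (W.Φ φ) [z] = u • evl (star ħ G (W.eY.ι (φ a)) z') [] := by
  rw [evl_cons, Wing.Φ, cur_phi, evl_add, phi_nil, zero_add, h, map_sgn_smul, evl_sgn]
  rfl

theorem hAct_sgn (G : GCAlgebra 𝒱) (u : ℤˣ) (P : Ops R V) (x : V)
    : hAct ħ G (u • P) x = u • hAct ħ G P x := by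
  rw [hAct, hAct, smul_add, smul_comm u, ← map_sgn_smul₂]
  rfl

variable {r : ℕ} {e : Fin (r + 1) → ℤ} {a : Fin (r + 1) → A}

theorem ΦM_one (hn : n ∈ 𝒩 i) (ha : ∀ s, a s ∈ 𝒜 (e s)) (hm : m ∈ ℳ l) :
    evl ((wgM alg BM BN).Φ f.family) [bar R n a m] = sgn (i + wordDeg e) •
      bar R n (a ∘ Fin.castSucc) (hAct ħ BM.toGCAlgebra (fun k => f.map k (a (Fin.last r))) m) := by
  have hw := (isWord_shift (a := a ∘ Fin.castSucc) fun s => ha s.castSucc).mem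
  have hl := mem_shift (ha (Fin.last r))
  have hD := extT_tmul (GN := BN.toGCAlgebra) alg.shifted.isInternal hn m hl _
    (alg.shifted.delR_sn hw hl)
  have hk : (wgM alg BM BN).eY.Kills (n ⊗ₜ (wd R (List.ofFn (a ∘ Fin.castSucc)) ⊗ₜ BM.one)) :=
    embM_kills hn hw
  rw [bar_eq n a m, wd_ofFn_succ, evl_Φ_one (wgM alg BM BN) f.family hD,
    ← nw_mul_m (alg := alg) (BN := BN) hw,
    OpEmb.hAct_left _ ((compatM (BN := BN) f).fam hl) hm (tmul_mem hn
      (tmul_mem hw BM.one_mem rfl) rfl) hk,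
    f.family_apply hl, hAct_sgn, map_sgn_smul, map_sgn_smul, nw_mul_m hw, smul_smul, smul_smul,
    bar_eq, wordDeg, Fin.sum_univ_castSucc]
  refine congrArg₂ _ ?_ rfl
  generalize e (Fin.last r) - 1 = t
  simp only [add_zero, mul_comm, mul_left_comm, mul_assoc, sgn_expand, sgn_cancel]

theorem ΦN_one (hn : n ∈ 𝒩 i) (ha : ∀ s, a s ∈ 𝒜 (e s)) (hm : m ∈ ℳ l) :
    evl ((wgN alg BM BN).Φ (-g.family)) [bar R n a m] = sgn (i + e 0) • bar R
      (sgn (i * e 0) • hAct ħ BN.toGCAlgebra (fun k => g.map k (a 0)) n) (a ∘ Fin.succ) m := by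
  have hw := (isWord_shift (a := a ∘ Fin.succ) fun s => ha s.succ).mem
  have hl := mem_shift (ha 0)
  have hD := extT_tmul (GN := BN.toGCAlgebra) alg.shifted.isInternal hn m hl 1
    ((delL_wd a).trans (one_smul _ _).symm)
  have hk : (wgN alg BM BN).eY.Kills (BN.one ⊗ₜ (wd R (List.ofFn (a ∘ Fin.succ)) ⊗ₜ m)) :=
    embN_kills _
  rw [bar_eq n a m, evl_Φ_one (wgN alg BM BN) (-g.family) hD, ← n_mul_wm (alg := alg) (BM := BM),
    OpEmb.hAct_right _ ((compatN (BM := BM) g).fam hl) hn (tmul_mem BN.one_mem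
      (tmul_mem hw hm rfl) rfl) hk,
    g.neg_family_apply hl, hAct_sgn, map_sgn_smul, map_sgn_smul₂, n_mul_wm, smul_smul, bar_eq,
    sgn_tmul_bar, smul_smul, sub_add_cancel]
  refine congrArg₂ _ ?_ rfl
  rw [mul_sub, mul_one, sgn_sub, sgn_add, mul_one]
  simp only [mul_comm, mul_left_comm, mul_assoc]

theorem barOps_one_nil (hn : n ∈ 𝒩 i) (hm : m ∈ ℳ l) :
    barOps f g 1 ![bar R n (![] : Fin 0 → A) m]
      = bar R (BN.d n) (![] : Fin 0 → A) m + sgn i • bar R n (![] : Fin 0 → A) (BM.d m) := by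
  rw [← evl_ofFn]
  have h1 : (1 : TensorCoalg R A) ∈ Tgr (fun i => 𝒜 (i + 1)) 0 := one_mem_Tgr
  have hD : ∀ {δ : TensorCoalg R A →ₗ[R] A ⊗[R] TensorCoalg R A}, δ 1 = 0 →
      extT BN.toGCAlgebra alg.shifted.isInternal δ (n ⊗ₜ[R] ((1 : TensorCoalg R A) ⊗ₜ[R] m)) = 0 :=
        by
    intro δ h
    rw [extT, extSnd_tmul _ _ _ hn, extFst_tmul, h, map_zero, map_zero]
  have hM : evl ((wgM alg BM BN).Φ f.family) [n ⊗ₜ[R] ((1 : TensorCoalg R A) ⊗ₜ[R] m)] = 0 := by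
    rw [evl_Φ_one (u := 1) (a := 0) (z' := 0) _ _ ((hD alg.shifted.delR_one).trans (by simp)),
      map_zero]
    exact smul_zero _
  have hN : evl ((wgN alg BM BN).Φ (-g.family)) [n ⊗ₜ[R] ((1 : TensorCoalg R A) ⊗ₜ[R] m)] = 0 := by
    rw [evl_Φ_one (u := 1) (a := 0) (z' := 0) _ _ ((hD ShiftedBD.delL_one).trans (by simp)),
      map_zero]
    exact smul_zero _
  simp only [List.ofFn_succ, List.ofFn_zero, Matrix.cons_val_zero, bar_eq, wd_nil]
  rw [barOps, evl_add, evl_add, evl_add, evl_add, ιT_one hn h1 hm, ιM_one hn h1 hm,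
    ιN_one hn (tmul_mem h1 hm rfl), hM, hN, alg.shifted.dT_one, zero_tmul, tmul_zero, smul_zero,
    add_zero]
  abel

theorem barOps_one (hn : n ∈ 𝒩 i) (ha : ∀ s, a s ∈ 𝒜 (e s)) (hm : m ∈ ℳ l) :
    barOps f g 1 ![bar R n a m] = bar R (BN.d n) a m
        + ∑ s : Fin (r + 1),
            sgn (i + prefixDeg e s) • bar R n (Function.update a s (alg.d (a s))) m
        + sgn (i + wordDeg e) • bar R n a (BM.d m)
        + sgn (i + e 0) • bar R
            (sgn (i * e 0) • hAct ħ BN.toGCAlgebra (fun k => g.map k (a 0)) n)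
            (a ∘ Fin.succ) m
        + ∑ s : Fin r, sgn (i + prefixDeg e s.castSucc + (e s.castSucc - 1)) •
            bar R n (mergeAt (fun x y => alg.mul x y) a s) m
        + sgn (i + wordDeg e) • bar R n (a ∘ Fin.castSucc)
            (hAct ħ BM.toGCAlgebra (fun k => f.map k (a (Fin.last r))) m) := by
  have hw : _ ∈ Tgr _ (wordDeg e) :=
    (isWord_shift ha).mem
  rw [← evl_ofFn]
  simp only [List.ofFn_succ, List.ofFn_zero, Matrix.cons_val_zero]
  have hM := ΦM_one (BN := BN) f hn ha hm
  have hN := ΦN_one (BM := BM) g hn ha hm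
  rw [barOps, evl_add, evl_add, evl_add, evl_add, hM, hN, bar_eq n a m, ιT_one hn hw hm,
    ιM_one hn hw hm, ιN_one hn (tmul_mem hw hm rfl), dT_words alg ha]
  simp only [add_tmul, tmul_add, TensorProduct.sum_tmul, TensorProduct.tmul_sum, sgn_tmul,
    tmul_sgn_bar, smul_add, Finset.smul_sum, smul_smul, ← sgn_add, bar_eq, add_assoc]
  abel

end One

section Bar

variable (f : LeftBD1Module alg BM) (g : RightBD1Module alg BN)

theorem barOps_bracket_T {p q : ℕ} {e : Fin p → ℤ} {e' : Fin (q + 1) → ℤ} {a : Fin p → A}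
    {b : Fin (q + 1) → A} (ha : ∀ s, a s ∈ 𝒜 (e s)) (hb : ∀ s, b s ∈ 𝒜 (e' s)) :
    barOps f g 2 ![inT BN BM a, inT BN BM b]
      = ∑ σ ∈ shuffles p (q + 1), ∑ s : Fin (p + q),
          let w : Fin (p + q + 1) → A := shuffleWord (p := p) (q := q + 1) σ a b
          let ew : Fin (p + q + 1) → ℤ := shuffleWord (p := p) (q := q + 1) σ e e'
          if (σ.symm s.castSucc : ℕ) < p ∧ p ≤ (σ.symm s.succ : ℕ) then
            (shuffleSign σ e e' * sgn (prefixDeg ew s.castSucc + (ew s.castSucc - 1))) •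
              inT BN BM (mergeAt (fun x y => alg.bracket x y) w s)
          else 0 := by
  have h : ![inT BN BM a, inT BN BM b]
      = fun t => (wgM alg BM BN).eT.j (![wd R (List.ofFn a), wd R (List.ofFn b)] t) := by
    funext t
    refine Fin.cases (inT_eq a) (fun t => ?_) t
    rw [Subsingleton.elim t 0]
    exact inT_eq b
  rw [h, barOps_T f g (k := 0)]
  refine (congrArg _ (brT_words alg ha hb)).trans ?_
  simp only [map_sum, inT_eq (alg := alg)]
  refine Finset.sum_congr rfl fun σ _ => Finset.sum_congr rfl fun s _ => ?_
  split_ifs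
  · rw [map_sgn_smul]
  · rw [map_zero]

theorem vec_two {W V : Type*} (j : W → V) (x y : W) : ![j x, j y] = fun t => j (![x, y] t) := by
  funext t
  refine Fin.cases rfl (fun t => ?_) t
  rw [Subsingleton.elim t 0]
  rfl

theorem isBarStructure : IsBarStructure f g ((barAlg alg BM BN).cast barGrading_eq)
    ((barStr f g).cast barGrading_eq) where
  shuffle := barAlg_cast_shuffle
  l_one :=
    { nil := fun hn hm => barOps_one_nil f g hn hm
      cons := fun hn ha hm => barOps_one f g hn ha hm }
  bracket_T ha hb := barOps_bracket_T f g ha hb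
  bracket_M m m' := by
    rw [vec_two]
    exact barOps_M f g (k := 1) ![m, m']
  bracket_N n n' := by
    rw [vec_two]
    exact barOps_N f g (k := 1) ![n, n']
  l_TM m ha := barOps_TM f g m ha
  l_TN ha hn := barOps_TN f g ha hn
  vanish_NM x _ s t _ hs ht := barOps_NM f g hs ht
  vanish_TT x hx s t hst hs ht := barOps_TT f g x hx hst hs ht
  vanish_N n := by
    refine (barOps_N f g n).trans ?_
    rw [inN_eq (alg := alg) (BN := BN)]
    exact map_zero _
  vanish_M m := by
    refine (barOps_M f g m).trans ?_
    rw [inM_eq (alg := alg) (BM := BM)]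
    exact map_zero _

end Bar

end

section

variable {R : Type*} [CommRing R] {ħ : R} {A M N V : Type*} [AddCommGroup A] [Module R A]
  [AddCommGroup M] [Module R M] [AddCommGroup N] [Module R N] [AddCommGroup V] [Module R V]
  {𝒜 : ℤ → Submodule R A} {ℳ : ℤ → Submodule R M} {𝒩 : ℤ → Submodule R N} {𝒱 : ℤ → Submodule R V}
  {G : GCAlgebra 𝒱} {alg : BD1Algebra ħ 𝒜} {BM : BD0Algebra ħ ℳ} {BN : BD0Algebra ħ 𝒩}

section Map

variable {R' : Type*} [CommRing R'] {σ : R →+* R'} {A' M' N' : Type*} [AddCommGroup A']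
  [Module R' A'] [AddCommGroup M'] [Module R' M'] [AddCommGroup N'] [Module R' N']

/-- The semilinear map of tensor coalgebras induced by a semilinear map. -/
def mapT (r : A →ₛₗ[σ] A') : TensorCoalg R A →ₛₗ[σ] TensorCoalg R' A' :=
  let _ : Module R (TensorCoalg R' A') := Module.compHom _ σ
  let F : TensorCoalg R A →ₗ[R] TensorCoalg R' A' :=
    DirectSum.toModule R ℕ _ fun p => PiTensorProduct.lift
      { toFun := fun a => DirectSum.lof R' ℕ (fun p => ⨂[R']^p A') p
          (PiTensorProduct.tprod R' (r ∘ a))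
        map_update_add' := fun a i x y => by
          simp only [Function.comp_update, map_add, MultilinearMap.map_update_add]
        map_update_smul' := fun a i c x => by
          simp only [Function.comp_update, LinearMap.map_smulₛₗ, MultilinearMap.map_update_smul]
          rfl }
  { toFun := F
    map_add' := F.map_add
    map_smul' := F.map_smul }

theorem mapT_lof (r : A →ₛₗ[σ] A') {p : ℕ} (a : Fin p → A) :
    mapT r (DirectSum.lof R ℕ (fun p => ⨂[R]^p A) p (PiTensorProduct.tprod R a))
      = DirectSum.lof R' ℕ (fun p => ⨂[R']^p A') p (PiTensorProduct.tprod R' (r ∘ a)) := by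
  let _ : Module R (TensorCoalg R' A') := Module.compHom _ σ
  refine (DirectSum.toModule_lof R (M := fun p => ⨂[R]^p A) (N := TensorCoalg R' A') p _).trans ?_
  exact PiTensorProduct.lift.tprod _

/-- The semilinear map of bar complexes induced by semilinear maps. -/
def barMap (rN : N →ₛₗ[σ] N') (rA : A →ₛₗ[σ] A') (rM : M →ₛₗ[σ] M') :
    Bar R N A M →ₛₗ[σ] Bar R' N' A' M' :=
  TensorProduct.map rN (TensorProduct.map (mapT rA) rM)

theorem barMap_bar (rN : N →ₛₗ[σ] N') (rA : A →ₛₗ[σ] A') (rM : M →ₛₗ[σ] M') {p : ℕ} (n : N)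
    (a : Fin p → A) (m : M) :
    barMap rN rA rM (bar R n a m) = bar R' (rN n) (rA ∘ a) (rM m) := by
  rw [barMap, bar, map_tmul, map_tmul, mapT_lof]
  rfl

@[elab_as_elim]
theorem bar_induction {C : Bar R N A M → Prop} (add : ∀ x y, C x → C y → C (x + y))
    (gen : ∀ (p : ℕ) (n : N) (a : Fin p → A) (m : M), C (bar R n a m)) (x : Bar R N A M) : C x := by
  have zero : C 0 := by
    have := gen 0 0 ![] 0
    rwa [bar, zero_tmul] at this
  induction x using TensorProduct.induction_on with
  | zero => exact zero
  | add x y hx hy => exact add x y hx hy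
  | tmul n y =>
    induction y using TensorProduct.induction_on with
    | zero => rwa [tmul_zero]
    | add x y hx hy => rw [tmul_add]; exact add _ _ hx hy
    | tmul w m =>
      induction w using DirectSum.induction_on with
      | zero => rwa [zero_tmul, tmul_zero]
      | add x y hx hy => rw [add_tmul, tmul_add]; exact add _ _ hx hy
      | of p t =>
        induction t using PiTensorProduct.induction_on with
        | add x y hx hy =>
          rw [map_add, add_tmul, tmul_add]; exact add _ _ hx hy
        | smul_tprod c a =>
          have h : n ⊗ₜ[R] (DirectSum.of (fun p => ⨂[R]^p A) p (c • PiTensorProduct.tprod R a)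
              ⊗ₜ[R] m) = bar R (c • n) a m := by
            rw [bar, ← DirectSum.lof_eq_of R, map_smul, ← smul_tmul', tmul_smul, smul_tmul']
          rw [h]
          exact gen ..

theorem barMap_surjective {rN : N →ₛₗ[σ] N'} {rA : A →ₛₗ[σ] A'} {rM : M →ₛₗ[σ] M'}
    (hN : Function.Surjective rN) (hA : Function.Surjective rA) (hM : Function.Surjective rM) :
    Function.Surjective (barMap rN rA rM) := by
  intro x
  induction x using bar_induction with
  | add x y hx hy =>
    obtain ⟨x, rfl⟩ := hx
    obtain ⟨y, rfl⟩ := hy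
    exact ⟨x + y, map_add ..⟩
  | gen p n a m =>
    obtain ⟨n, rfl⟩ := hN n
    obtain ⟨m, rfl⟩ := hM m
    choose b hb using fun s => hA (a s)
    exact ⟨bar R n b m, by rw [barMap_bar]; congr 1; exact funext hb⟩

theorem barMap_mem {rN : N →ₛₗ[σ] N'} {rA : A →ₛₗ[σ] A'} {rM : M →ₛₗ[σ] M'}
    {𝒜 : ℤ → Submodule R A} {ℳ : ℤ → Submodule R M} {𝒩 : ℤ → Submodule R N}
    {𝒜' : ℤ → Submodule R' A'} {ℳ' : ℤ → Submodule R' M'} {𝒩' : ℤ → Submodule R' N'}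
    (hN : ∀ {i x}, x ∈ 𝒩 i → rN x ∈ 𝒩' i) (hA : ∀ {i x}, x ∈ 𝒜 i → rA x ∈ 𝒜' i)
    (hM : ∀ {i x}, x ∈ ℳ i → rM x ∈ ℳ' i) {t : ℤ} {x : Bar R N A M}
    (hx : x ∈ barGrading 𝒩 𝒜 ℳ t) : barMap rN rA rM x ∈ barGrading 𝒩' 𝒜' ℳ' t := by
  induction hx using span_induction with
  | mem x hx =>
    obtain ⟨p, i, j, e, n, a, m, hn, ha, hm, ht, rfl⟩ := hx
    rw [barMap_bar]
    exact subset_span ⟨p, i, j, e, _, _, _, hN hn, fun q => hA (ha q), hM hm, ht, rfl⟩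
  | zero => rw [map_zero]; exact zero_mem _
  | add x y _ _ hx hy => rw [map_add]; exact add_mem hx hy
  | smul c x _ hx => rw [LinearMap.map_smulₛₗ]; exact smul_mem _ _ hx

/-- A multilinear map sends congruent arguments modulo `t` to congruent values. -/
theorem multilinear_congr (t : R) {p : ℕ} (f : MultilinearMap R (fun _ : Fin p => A) V)
    {a b : Fin p → A} (h : ∀ s, ∃ y, a s - b s = t • y) : ∃ y, f a - f b = t • y := by
  have key : ∀ S : Finset (Fin p), ∃ y, f a - f (S.piecewise b a) = t • y := by
    intro S
    induction S using Finset.induction_on with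
    | empty => exact ⟨0, by simp⟩
    | insert j S hj ih =>
      obtain ⟨y, hy⟩ := ih
      obtain ⟨z, hz⟩ := h j
      refine ⟨y + f (Function.update (S.piecewise b a) j z), ?_⟩
      have e : b j = (S.piecewise b a) j - t • z := by
        rw [Finset.piecewise_eq_of_notMem _ _ _ hj, ← hz, sub_sub_cancel]
      rw [Finset.piecewise_insert, e, f.map_update_sub, f.map_update_smul, Function.update_eq_self,
        smul_add, ← hy]
      abel
  simpa using key Finset.univ

theorem bar_congr (t : R) {p : ℕ} {n n' : N} {a a' : Fin p → A} {m m' : M}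
    (hn : ∃ y, n - n' = t • y) (ha : ∀ s, ∃ y, a s - a' s = t • y) (hm : ∃ y, m - m' = t • y) :
    ∃ y, bar R n a m - bar R n' a' m' = t • y := by
  obtain ⟨y, hy⟩ := hn
  obtain ⟨z, hz⟩ := hm
  obtain ⟨w, hw⟩ := multilinear_congr t
    ((DirectSum.lof R ℕ (fun p => ⨂[R]^p A) p).compMultilinearMap (PiTensorProduct.tprod R)) ha
  simp only [LinearMap.compMultilinearMap_apply] at hw
  rw [sub_eq_iff_eq_add] at hy hz hw
  refine ⟨y ⊗ₜ (DirectSum.lof R ℕ (fun p => ⨂[R]^p A) p (PiTensorProduct.tprod R a) ⊗ₜ m)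
    + n' ⊗ₜ (w ⊗ₜ m) + n' ⊗ₜ (DirectSum.lof R ℕ (fun p => ⨂[R]^p A) p
      (PiTensorProduct.tprod R a') ⊗ₜ z), ?_⟩
  simp only [bar]
  rw [hw, hy, hz]
  simp only [add_tmul, tmul_add, tmul_smul, ← smul_tmul', smul_add]
  abel

theorem barMap_section {τ : R' →+* R} {rN : N →ₛₗ[σ] N'} {rA : A →ₛₗ[σ] A'} {rM : M →ₛₗ[σ] M'}
    {sN : N' →ₛₗ[τ] N} {sA : A' →ₛₗ[τ] A} {sM : M' →ₛₗ[τ] M} (t : R)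
    (hN : ∀ x, ∃ y, x - sN (rN x) = t • y) (hA : ∀ x, ∃ y, x - sA (rA x) = t • y)
    (hM : ∀ x, ∃ y, x - sM (rM x) = t • y) (x : Bar R N A M) :
    ∃ y, x - barMap sN sA sM (barMap rN rA rM x) = t • y := by
  induction x using bar_induction with
  | add x y hx hy =>
    obtain ⟨x', hx⟩ := hx
    obtain ⟨y', hy⟩ := hy
    exact ⟨x' + y', by rw [map_add, map_add, smul_add, ← hx, ← hy]; abel⟩
  | gen p n a m =>
    rw [barMap_bar, barMap_bar]
    exact bar_congr t (hN n) (fun s => hA (a s)) (hM m)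

end Map

section Reduction

variable {k : Type*} [Field k] {V V₀ : Type*} [AddCommGroup V] [Module (PowerSeries k) V]
  [AddCommGroup V₀] [Module k V₀] {𝒱 : ℤ → Submodule (PowerSeries k) V}
  {𝒱₀ : ℤ → Submodule k V₀} {r : V →ₛₗ[PowerSeries.constantCoeff (R := k)] V₀}

theorem IsReduction.exists_section (h : IsReduction 𝒱 𝒱₀ r) :
    ∃ s : V₀ →ₛₗ[PowerSeries.C (R := k)] V,
      ∀ x, ∃ y, x - s (r x) = (PowerSeries.X : PowerSeries k) • y := by
  let _ : Module k V := Module.compHom V (PowerSeries.C (R := k))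
  let r' : V →ₗ[k] V₀ :=
    { toFun := r
      map_add' := map_add r
      map_smul' := fun c x => by
        refine (r.map_smulₛₗ (PowerSeries.C c) x).trans ?_
        rw [PowerSeries.constantCoeff_C]; rfl }
  obtain ⟨s, hs⟩ := r'.exists_rightInverse_of_surjective (LinearMap.range_eq_top.2 h.surjective)
  refine ⟨{ toFun := s, map_add' := map_add s, map_smul' := fun c x => map_smul s c x }, fun x =>
    ?_⟩
  refine (h.eq_zero_iff _).1 ?_
  rw [map_sub, sub_eq_zero]
  exact (LinearMap.congr_fun hs (r x)).symm

variable {W W₀ U U₀ : Type*} [AddCommGroup W] [Module (PowerSeries k) W]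
  [AddCommGroup W₀] [Module k W₀] {𝒲 : ℤ → Submodule (PowerSeries k) W}
  {𝒲₀ : ℤ → Submodule k W₀} {rW : W →ₛₗ[PowerSeries.constantCoeff (R := k)] W₀}
  [AddCommGroup U] [Module (PowerSeries k) U]
  [AddCommGroup U₀] [Module k U₀] {𝒰 : ℤ → Submodule (PowerSeries k) U}
  {𝒰₀ : ℤ → Submodule k U₀} {rU : U →ₛₗ[PowerSeries.constantCoeff (R := k)] U₀}

theorem IsReduction.barMap (hV : IsReduction 𝒱 𝒱₀ r) (hW : IsReduction 𝒲 𝒲₀ rW)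
    (hU : IsReduction 𝒰 𝒰₀ rU) :
    IsReduction (barGrading 𝒱 𝒲 𝒰) (barGrading 𝒱₀ 𝒲₀ 𝒰₀) (barMap r rW rU) where
  surjective := barMap_surjective hV.surjective hW.surjective hU.surjective
  eq_zero_iff x := by
    constructor
    · intro h
      obtain ⟨s, hs⟩ := hV.exists_section
      obtain ⟨sW, hsW⟩ := hW.exists_section
      obtain ⟨sU, hsU⟩ := hU.exists_section
      obtain ⟨y, hy⟩ := barMap_section _ hs hsW hsU x
      rw [h, map_zero, sub_zero] at hy
      exact ⟨y, hy⟩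
    · rintro ⟨y, rfl⟩
      rw [LinearMap.map_smulₛₗ, PowerSeries.constantCoeff_X, zero_smul]
  mem := barMap_mem hV.mem hW.mem hU.mem

end Reduction

section Evl

variable {R' : Type*} [CommRing R'] {σ : R →+* R'} {ħ' : R'} {V' : Type*} [AddCommGroup V']
  [Module R' V'] {𝒱' : ℤ → Submodule R' V'} {G' : GCAlgebra 𝒱'} {p p' : ℤ} {P : Ops R V}
  {P' : Ops R' V'} {ρ : V →ₛₗ[σ] V'}

theorem IsHDiffOp.leib_append {i j : ℤ} (hP : IsHDiffOp ħ G p P) {x y : V} (hx : x ∈ 𝒱 i)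
    (hy : y ∈ 𝒱 j) {β : List V} (hβ : ∀ b ∈ β, ∃ i, b ∈ 𝒱 i) :
    evl P (β ++ [G.mul x y]) = G.mul (evl P (β ++ [x])) y
      + sgn (i * j) • G.mul (evl P (β ++ [y])) x + ħ • evl P (β ++ [x, y]) := by
  induction β generalizing p P with
  | nil => exact hP.leib hx hy
  | cons b β ih =>
    obtain ⟨i, hb⟩ := hβ b (by simp)
    exact ih (hP.cur hb) fun c hc => hβ c (by simp [hc])

theorem IsHDiffOp.one_append (hP : IsHDiffOp ħ G p P) {β : List V}
    (hβ : ∀ b ∈ β, ∃ i, b ∈ 𝒱 i) : evl P (β ++ [G.one]) = 0 := by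
  induction β generalizing p P with
  | nil => exact hP.one
  | cons b β ih =>
    obtain ⟨i, hb⟩ := hβ b (by simp)
    exact ih (hP.cur hb) fun c hc => hβ c (by simp [hc])

theorem exists_evl_last (P : Ops R V) (β : List V) :
    ∃ F : V →ₗ[R] V, ∀ x, evl P (β ++ [x]) = F x := by
  induction β generalizing P with
  | nil => exact ⟨(evlₗ []) ∘ₗ cur P, fun _ => rfl⟩
  | cons b β ih => exact ih _

/-- `ρ` intertwines `P` and `P'` on the arguments `β`. -/
def Intertwines (ρ : V →ₛₗ[σ] V') (P : Ops R V) (P' : Ops R' V') (β : List V) : Prop :=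
  ρ (evl P β) = evl P' (β.map ρ)

theorem Intertwines.perm (hρ : ∀ {i x}, x ∈ 𝒱 i → ρ x ∈ 𝒱' i) {β γ : List V} (h : β.Perm γ)
    (hβ : ∀ b ∈ β, ∃ i, b ∈ 𝒱 i) (hP : IsHDiffOp ħ G p P) (hP' : IsHDiffOp ħ' G' p' P')
    (H : Intertwines ρ P P' γ) : Intertwines ρ P P' β := by
  induction h generalizing p p' P P' with
  | nil => exact H
  | cons x _ ih =>
    obtain ⟨i, hx⟩ := hβ x (by simp)
    exact ih (fun c hc => hβ c (by simp [hc])) (hP.cur hx) (hP'.cur (hρ hx)) H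
  | swap x y l =>
    obtain ⟨i, hx⟩ := hβ x (by simp)
    obtain ⟨j, hy⟩ := hβ y (by simp)
    simp only [Intertwines, List.map_cons, evl_cons] at H ⊢
    rw [hP.cur_cur hy hx, hP'.cur_cur (hρ hy) (hρ hx), evl_sgn, evl_sgn, ← H, Units.smul_def,
      map_zsmul, ← Units.smul_def]
  | trans h _ ih₁ ih₂ =>
    exact ih₁ hβ hP hP' (ih₂ (fun b hb => hβ b (h.mem_iff.2 hb)) hP hP' H)

theorem Intertwines.of_generators {𝒢 : ℤ → Set V} (hG : ∀ i, 𝒢 i ⊆ 𝒱 i)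
    (hs : ∀ i, 𝒱 i ≤ Submodule.span R {x | Prods G 𝒢 i x})
    (hρ : ∀ {i x}, x ∈ 𝒱 i → ρ x ∈ 𝒱' i) (hmul : ∀ x y, ρ (G.mul x y) = G'.mul (ρ x) (ρ y))
    (hone : ρ G.one = G'.one) (hħ : σ ħ = ħ')
    (hP : IsHDiffOp ħ G p P) (hP' : IsHDiffOp ħ' G' p' P')
    (h : ∀ γ : List V, (∀ x ∈ γ, ∃ i, x ∈ 𝒢 i) → Intertwines ρ P P' γ)
    {β : List V} (hβ : ∀ b ∈ β, ∃ i, b ∈ 𝒱 i) : Intertwines ρ P P' β := by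
  have hom : ∀ {γ : List V}, (∀ x ∈ γ, ∃ i, x ∈ 𝒢 i) → ∀ x ∈ γ, ∃ i, x ∈ 𝒱 i :=
    fun hγ x hx => (hγ x hx).imp fun _ h => hG _ h
  have app : ∀ {β γ : List V} {ℋ : ℤ → Set V}, (∀ x ∈ β, ∃ i, x ∈ ℋ i) →
      (∀ x ∈ γ, ∃ i, x ∈ ℋ i) → ∀ x ∈ β ++ γ, ∃ i, x ∈ ℋ i := by
    intro β γ _ h h' x hx
    rcases List.mem_append.1 hx with hx | hx
    exacts [h x hx, h' x hx]
  have hmap : ∀ {β : List V}, (∀ x ∈ β, ∃ i, x ∈ 𝒱 i) → ∀ x ∈ β.map ρ, ∃ i, x ∈ 𝒱' i := by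
    intro β hβ x hx
    obtain ⟨y, hy, rfl⟩ := List.mem_map.1 hx
    exact (hβ y hy).imp fun _ h => hρ h
  suffices H : ∀ γ : List V, (∀ x ∈ γ, ∃ i, x ∈ 𝒢 i) → Intertwines ρ P P' (β ++ γ) by
    simpa using H [] (by simp)
  induction β with
  | nil => simpa using h
  | cons x β ih =>
    have hβ' : ∀ b ∈ β, ∃ i, b ∈ 𝒱 i := fun b hb => hβ b (by simp [hb])
    have key : ∀ {i : ℤ} {x : V}, Prods G 𝒢 i x → ∀ γ : List V,
        (∀ x ∈ γ, ∃ i, x ∈ 𝒢 i) → Intertwines ρ P P' ((β ++ γ) ++ [x]) := by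
      intro i x hx
      induction hx with
      | one =>
        intro γ hγ
        have hβγ := app (ℋ := fun i => 𝒱 i) hβ' (hom hγ)
        rw [Intertwines, hP.one_append hβγ, List.map_append, List.map_singleton, hone,
          hP'.one_append (hmap hβγ), map_zero]
      | @mul i j x g hx hg ihx =>
        intro γ hγ
        have hβγ := app (ℋ := fun i => 𝒱 i) hβ' (hom hγ)
        have hgγ : ∀ y ∈ γ ++ [g], ∃ i, y ∈ 𝒢 i :=
          app hγ fun y hy => ⟨j, List.mem_singleton.1 hy ▸ hg⟩
        have e1 : Intertwines ρ P P' (β ++ γ ++ [g]) := by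
          rw [List.append_assoc]; exact ih hβ' _ hgγ
        have e3 : Intertwines ρ P P' (β ++ γ ++ [x, g]) := by
          refine Intertwines.perm hρ ?_ ?_ hP hP' (ihx _ hgγ)
          · simp only [List.append_assoc, List.cons_append, List.nil_append]
            exact ((List.Perm.swap _ _ _).append_left γ).append_left β
          · refine app (ℋ := fun i => 𝒱 i) hβγ ?_
            have hg0 : ∃ j, g ∈ 𝒱 j := ⟨j, hG j hg⟩
            have hx0 : ∃ j, x ∈ 𝒱 j := ⟨i, hx.mem hG⟩
            simp [hx0, hg0]
        have e2 := ihx γ hγ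
        simp only [Intertwines, List.map_append, List.map_cons, List.map_nil] at e1 e2 e3 ⊢
        rw [hP.leib_append (hx.mem hG) (hG _ hg) hβγ, hmul, ← List.map_append,
          hP'.leib_append (hρ (hx.mem hG)) (hρ (hG _ hg)) (hmap hβγ), List.map_append, ← e1, ← e2,
          ← e3]
        simp only [map_add, hmul, Units.smul_def, map_zsmul, LinearMap.map_smulₛₗ, hħ]
    intro γ hγ
    obtain ⟨i, hx⟩ := hβ x (by simp)
    refine Intertwines.perm hρ (γ := (β ++ γ) ++ [x]) ?_ ?_ hP hP' ?_
    · rw [List.cons_append]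
      exact (List.perm_append_singleton _ _).symm
    · exact app (ℋ := fun i => 𝒱 i) hβ (hom hγ)
    · obtain ⟨F, hF⟩ := exists_evl_last P (β ++ γ)
      obtain ⟨F', hF'⟩ := exists_evl_last P' ((β ++ γ).map ρ)
      have e : ∀ x, Intertwines ρ P P' ((β ++ γ) ++ [x]) ↔ ρ (F x) = F' (ρ x) := by
        intro x
        rw [Intertwines, hF, List.map_append, List.map_singleton, hF']
      rw [e]
      have := hs i hx
      clear hx hβ
      induction this using span_induction with
      | mem y hy => exact (e y).1 (key hy γ hγ)
      | zero => simp only [map_zero]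
      | add y z _ _ hy hz => simp only [map_add, hy, hz]
      | smul c y _ hy => simp only [map_smul, LinearMap.map_smulₛₗ, hy]

/-- Operations intertwined on homogeneous arguments are intertwined. -/
theorem Intertwines.of_homogeneous (h : DirectSum.IsInternal 𝒱)
    (H : ∀ {β : List V}, (∀ b ∈ β, ∃ i, b ∈ 𝒱 i) → Intertwines ρ P P' β) (β : List V) :
    Intertwines ρ P P' β := by
  suffices H' : ∀ γ : List V, (∀ b ∈ γ, ∃ i, b ∈ 𝒱 i) → Intertwines ρ P P' (γ ++ β) from
    H' [] (by simp)
  induction β generalizing P P' with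
  | nil => exact fun γ hγ => by rw [List.append_nil]; exact H hγ
  | cons x β ih =>
    intro γ hγ
    obtain ⟨F, hF⟩ : ∃ F : V →ₗ[R] V, ∀ x, evl P (γ ++ x :: β) = F x := by
      clear ih H hγ
      induction γ generalizing P with
      | nil => exact ⟨evlₗ β ∘ₗ cur P, fun _ => rfl⟩
      | cons b γ ih => exact ih
    obtain ⟨F', hF'⟩ : ∃ F : V' →ₗ[R'] V', ∀ x, evl P' (γ.map ρ ++ x :: β.map ρ) = F x := by
      clear ih H hγ hF
      induction γ generalizing P' with
      | nil => exact ⟨evlₗ (β.map ρ) ∘ₗ cur P', fun _ => rfl⟩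
      | cons b γ ih => exact ih
    have e : ∀ x, Intertwines ρ P P' (γ ++ x :: β) ↔ ρ (F x) = F' (ρ x) := by
      intro x
      rw [Intertwines, hF, List.map_append, List.map_cons, hF']
    rw [e]
    induction mem_span_iUnion h x using span_induction with
    | mem y hy =>
      rw [← e, List.append_cons]
      refine ih H _ fun b hb => ?_
      rcases List.mem_append.1 hb with hb | hb
      exacts [hγ b hb, List.mem_singleton.1 hb ▸ hy]
    | zero => simp only [map_zero]
    | add y z _ _ hy hz => simp only [map_add, hy, hz]
    | smul c y _ hy => simp only [map_smul, LinearMap.map_smulₛₗ, hy]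

end Evl

section Morphism

variable {R' : Type*} [CommRing R'] {σ : R →+* R'} {ħ' : R'} {A' M' N' : Type*} [AddCommGroup A']
  [Module R' A'] [AddCommGroup M'] [Module R' M'] [AddCommGroup N'] [Module R' N']
  {𝒜' : ℤ → Submodule R' A'} {ℳ' : ℤ → Submodule R' M'} {𝒩' : ℤ → Submodule R' N'}
  {alg' : BD1Algebra ħ' 𝒜'} {BM' : BD0Algebra ħ' ℳ'} {BN' : BD0Algebra ħ' 𝒩'}

/-- A semilinear morphism of `BD₁`-algebras. -/
structure BD1Hom (alg : BD1Algebra ħ 𝒜) (alg' : BD1Algebra ħ' 𝒜') (r : A →ₛₗ[σ] A') : Prop where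
  mem : ∀ {i x}, x ∈ 𝒜 i → r x ∈ 𝒜' i
  map_d : ∀ a, r (alg.d a) = alg'.d (r a)
  map_mul : ∀ a b, r (alg.mul a b) = alg'.mul (r a) (r b)
  map_bracket : ∀ a b, r (alg.bracket a b) = alg'.bracket (r a) (r b)

/-- A semilinear morphism of `BD₀`-algebras. -/
structure BD0Hom (BM : BD0Algebra ħ ℳ) (BM' : BD0Algebra ħ' ℳ') (r : M →ₛₗ[σ] M') : Prop where
  mem : ∀ {i x}, x ∈ ℳ i → r x ∈ ℳ' i
  map_one : r BM.one = BM'.one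
  map_d : ∀ a, r (BM.d a) = BM'.d (r a)
  map_mul : ∀ a b, r (BM.mul a b) = BM'.mul (r a) (r b)
  map_bracket : ∀ a b, r (BM.bracket a b) = BM'.bracket (r a) (r b)

variable {rA : A →ₛₗ[σ] A'} {rM : M →ₛₗ[σ] M'} {rN : N →ₛₗ[σ] N'}

theorem semilinear_sgn_smul (r : M →ₛₗ[σ] M') (u : ℤˣ) (m : M) : r (u • m) = u • r m := by
  rw [Units.smul_def, map_zsmul, ← Units.smul_def]

theorem BD0Hom.map_ops (h : BD0Hom BM BM' rM) {k : ℕ} (m : Fin k → M) :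
    rM (BM.ops k m) = BM'.ops k (rM ∘ m) := by
  match k, m with
  | 0, _ => exact map_zero rM
  | 1, m => exact h.map_d (m 0)
  | 2, m => exact h.map_bracket (m 0) (m 1)
  | _ + 3, _ => exact map_zero rM

theorem BD0Hom.map_hAct (h : BD0Hom BM BM' rM) (hħ : σ ħ = ħ') {P : Ops R M} {P' : Ops R' M'}
    (hP : ∀ (s : ℕ) (m : Fin s → M), rM (P s m) = P' s (rM ∘ m)) (m : M) :
    rM (hAct ħ BM.toGCAlgebra P m) = hAct ħ' BM'.toGCAlgebra P' (rM m) := by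
  rw [hAct, hAct, map_add, h.map_mul, LinearMap.map_smulₛₗ, hħ, hP, hP,
    show rM ∘ ![m] = ![rM m] from funext fun s => by rw [Subsingleton.elim s 0]; rfl,
    Subsingleton.elim (rM ∘ ![]) ![]]

theorem comp_mergeAt {W W' : Type*} {r : W → W'} {μ : W → W → W} {μ' : W' → W' → W'}
    (h : ∀ x y, r (μ x y) = μ' (r x) (r y)) {p : ℕ} (c : Fin (p + 1) → W) (s : Fin p) :
    r ∘ mergeAt μ c s = mergeAt μ' (r ∘ c) s := by
  funext t
  simp only [mergeAt, Function.comp_apply]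
  split_ifs <;> simp only [h]

theorem comp_shuffleWord {W W' : Type*} (r : W → W') {p q : ℕ} (τ : Equiv.Perm (Fin (p + q)))
    (a : Fin p → W) (b : Fin q → W) :
    r ∘ shuffleWord τ a b = shuffleWord τ (r ∘ a) (r ∘ b) := by
  funext s
  simp only [shuffleWord, Function.comp_apply]
  refine Fin.addCases (fun i => ?_) (fun i => ?_) (τ.symm s)
  · rw [Fin.append_left, Fin.append_left]; rfl
  · rw [Fin.append_right, Fin.append_right]; rfl

theorem BD1Hom.mem_comp (hA : BD1Hom alg alg' rA) {p : ℕ} {e : Fin p → ℤ} {a : Fin p → A}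
    (ha : ∀ s, a s ∈ 𝒜 (e s)) (s : Fin p) : (rA ∘ a) s ∈ 𝒜' (e s) := hA.mem (ha s)

theorem barMap_inM (hN : BD0Hom BN BN' rN) (m : M) :
    barMap rN rA rM (inM A BN m) = inM A' BN' (rM m) := by
  rw [inM, barMap_bar, hN.map_one, Subsingleton.elim (rA ∘ ![]) ![]]; rfl

theorem barMap_inN (hM : BD0Hom BM BM' rM) (n : N) :
    barMap rN rA rM (inN A BM n) = inN A' BM' (rN n) := by
  rw [inN, barMap_bar, hM.map_one, Subsingleton.elim (rA ∘ ![]) ![]]; rfl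

theorem barMap_inT (hN : BD0Hom BN BN' rN) (hM : BD0Hom BM BM' rM) {p : ℕ} (a : Fin p → A) :
    barMap rN rA rM (inT BN BM a) = inT BN' BM' (rA ∘ a) := by
  rw [inT, barMap_bar, hN.map_one, hM.map_one]; rfl

theorem bar_hom_induction (h : DirectSum.IsInternal (barGrading 𝒩 𝒜 ℳ))
    {C : Bar R N A M → Prop} (zero : C 0) (add : ∀ x y, C x → C y → C (x + y))
    (smul : ∀ (c : R) x, C x → C (c • x))
    (gen : ∀ {p : ℕ} {i j : ℤ} {e : Fin p → ℤ} {n : N} {a : Fin p → A} {m : M}, n ∈ 𝒩 i →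
      (∀ s, a s ∈ 𝒜 (e s)) → m ∈ ℳ j → C (bar R n a m)) (x : Bar R N A M) : C x := by
  induction mem_span_iUnion h x using span_induction with
  | mem y hy =>
    obtain ⟨i, hy⟩ := hy
    induction hy using span_induction with
    | mem y hy =>
      obtain ⟨p, i, j, e, n, a, m, hn, ha, hm, ht, rfl⟩ := hy
      exact gen hn ha hm
    | zero => exact zero
    | add y z _ _ hy hz => exact add y z hy hz
    | smul c y _ hy => exact smul c y hy
  | zero => exact zero
  | add y z _ _ hy hz => exact add y z hy hz
  | smul c y _ hy => exact smul c y hy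

theorem barMap_mul (hA : BD1Hom alg alg' rA) (hM : BD0Hom BM BM' rM) (hN : BD0Hom BN BN' rN)
    (x y : Bar R N A M) : barMap rN rA rM ((barAlg alg BM BN).mul x y)
      = (barAlg alg' BM' BN').mul (barMap rN rA rM x) (barMap rN rA rM y) := by
  have h := ((barAlg alg BM BN).cast barGrading_eq).isInternal
  induction x using bar_hom_induction h with
  | zero => simp only [map_zero, lin_zero]
  | add x x' hx hx' => simp only [map_add, lin_add, hx, hx']
  | smul c x hx => simp only [map_smul, lin_smul, LinearMap.map_smulₛₗ, hx]
  | gen hn ha hm =>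
    induction y using bar_hom_induction h with
    | zero => simp only [map_zero]
    | add x x' hx hx' => simp only [map_add, hx, hx']
    | smul c x hx => simp only [map_smul, LinearMap.map_smulₛₗ, hx]
    | gen hn' ha' hm' =>
      rw [bar_mul ha hm hn' ha', barMap_bar, barMap_bar,
        bar_mul (hA.mem_comp ha) (hM.mem hm) (hN.mem hn') (hA.mem_comp ha'), map_sum]
      refine Finset.sum_congr rfl fun τ _ => ?_
      rw [semilinear_sgn_smul, barMap_bar, hN.map_mul, hM.map_mul, comp_shuffleWord]

theorem inN_mul_inT_mul_inM (n : N) {p : ℕ} {e : Fin p → ℤ} {a : Fin p → A}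
    (ha : ∀ s, a s ∈ 𝒜 (e s)) (m : M) :
    (barAlg alg BM BN).mul ((barAlg alg BM BN).mul (inN A BM n) (inT BN BM a)) (inM A BN m)
      = bar R n a m := by
  simp only [inN, inT, inM, bar_eq, List.ofFn_zero, wd_nil]
  exact emb_mul_emb (GN := BN.toGCAlgebra) (GT := alg.shifted.barT.toGCAlgebra)
    (GM := BM.toGCAlgebra) n (isWord_shift ha).mem m

variable (𝒜 BM BN) in
/-- The homogeneous elements of `N`, `M` and the homogeneous non-empty words. -/
def barGen (i : ℤ) : Set (Bar R N A M) :=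
  {x | (∃ n ∈ 𝒩 i, x = inN A BM n) ∨ (∃ (r : ℕ) (e : Fin (r + 1) → ℤ) (a : Fin (r + 1) → A),
    (∀ s, a s ∈ 𝒜 (e s)) ∧ wordDeg e = i ∧ x = inT BN BM a) ∨ ∃ m ∈ ℳ i, x = inM A BN m}

theorem barGen_subset (i : ℤ) : barGen 𝒜 BM BN i ⊆ barGrading 𝒩 𝒜 ℳ i := by
  rintro x (⟨n, hn, rfl⟩ | ⟨r, e, a, ha, rfl, rfl⟩ | ⟨m, hm, rfl⟩)
  · exact subset_span ⟨0, i, 0, ![], n, ![], BM.one, hn, fun q => q.elim0, BM.one_mem,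
      by simp, rfl⟩
  · exact subset_span ⟨r + 1, 0, 0, e, BN.one, a, BM.one, BN.one_mem, ha, BM.one_mem,
      by simp, rfl⟩
  · exact subset_span ⟨0, 0, i, ![], BN.one, ![], m, BN.one_mem, fun q => q.elim0, hm,
      by simp, rfl⟩

theorem barGen_prods (i : ℤ) : barGrading 𝒩 𝒜 ℳ i ≤ Submodule.span R
    {x | Prods ((barAlg alg BM BN).cast barGrading_eq) (barGen 𝒜 BM BN) i x} := by
  refine Submodule.span_le.2 ?_
  rintro _ ⟨p, i, j, e, n, a, m, hn, ha, hm, rfl, rfl⟩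
  refine subset_span ?_
  have h1 := (Prods.one (G := (barAlg alg BM BN).cast barGrading_eq) (𝒢 := barGen 𝒜 BM BN)).mul
    (Or.inl ⟨n, hn, rfl⟩)
  rw [GCAlgebra.one_mul, zero_add] at h1
  rw [← inN_mul_inT_mul_inM (alg := alg) (BM := BM) (BN := BN) n ha m,
    ← GCAlgebra.cast_mul barGrading_eq]
  refine Prods.mul ?_ (Or.inr (Or.inr ⟨m, hm, rfl⟩))
  match p, e, a, ha with
  | 0, e, a, ha =>
    have h0 : inT BN BM a = ((barAlg alg BM BN).cast barGrading_eq).one := by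
      rw [barAlg_cast_shuffle.one_eq, Subsingleton.elim a ![]]; rfl
    rwa [h0, GCAlgebra.mul_one, Finset.univ_eq_empty, Finset.sum_empty, add_zero]
  | p + 1, e, a, ha => exact h1.mul (Or.inr (Or.inl ⟨p, e, a, ha, rfl, rfl⟩))

theorem exists_perm_barGen {γ : List (Bar R N A M)} (hγ : ∀ x ∈ γ, ∃ i, x ∈ barGen 𝒜 BM BN i) :
    ∃ (ts : List (Σ r, Fin (r + 1) → ℤ × A)) (ns : List (ℤ × N)) (ms : List M),
      (∀ t ∈ ts, ∀ s, (t.2 s).2 ∈ 𝒜 (t.2 s).1) ∧ (∀ n ∈ ns, n.2 ∈ 𝒩 n.1) ∧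
      γ.Perm (ts.map (fun t => inT BN BM fun s => (t.2 s).2)
        ++ (ns.map (fun n => inN A BM n.2) ++ ms.map (inM A BN))) := by
  induction γ with
  | nil => exact ⟨[], [], [], by simp, by simp, by simp⟩
  | cons x γ ih =>
    obtain ⟨ts, ns, ms, ht, hn, hp⟩ := ih fun y hy => hγ y (by simp [hy])
    obtain ⟨i, ⟨n, hn', rfl⟩ | ⟨r, e, a, ha, rfl, rfl⟩ | ⟨m, hm, rfl⟩⟩ := hγ x (by simp)
    · refine ⟨ts, (i, n) :: ns, ms, ht, ?_, (hp.cons _).trans List.perm_middle.symm⟩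
      simpa using ⟨hn', fun a b h => hn _ h⟩
    · refine ⟨⟨r, fun s => (e s, a s)⟩ :: ts, ns, ms, ?_, hn, hp.cons _⟩
      intro t h
      rcases List.mem_cons.1 h with rfl | h
      exacts [ha, ht t h]
    · refine ⟨ts, ns, m :: ms, ht, hn, (hp.cons _).trans ?_⟩
      rw [← List.append_assoc, ← List.append_assoc]
      exact List.perm_middle.symm

end Morphism

section Morphism

variable {R' : Type*} [CommRing R'] {σ : R →+* R'} {ħ' : R'} {A' M' N' : Type*} [AddCommGroup A']
  [Module R' A'] [AddCommGroup M'] [Module R' M'] [AddCommGroup N'] [Module R' N']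
  {𝒜' : ℤ → Submodule R' A'} {ℳ' : ℤ → Submodule R' M'} {𝒩' : ℤ → Submodule R' N'}
  {alg' : BD1Algebra ħ' 𝒜'} {BM' : BD0Algebra ħ' ℳ'} {BN' : BD0Algebra ħ' 𝒩'}
  {f : LeftBD1Module alg BM} {g : RightBD1Module alg BN} {f' : LeftBD1Module alg' BM'}
  {g' : RightBD1Module alg' BN'} {rA : A →ₛₗ[σ] A'} {rM : M →ₛₗ[σ] M'} {rN : N →ₛₗ[σ] N'}

theorem exists_ofFn {W : Type*} (l : List W) : ∃ (k : ℕ) (w : Fin k → W), l = List.ofFn w :=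
  ⟨_, _, (List.ofFn_get l).symm⟩

theorem evl_barOps_NM (n : N) (m : M) (l : List (Bar R N A M)) :
    evl (barOps f g) (inN A BM n :: inM A BN m :: l) = 0 := by
  obtain ⟨k, x, rfl⟩ := exists_ofFn l
  have h : inN A BM n :: inM A BN m :: List.ofFn x
      = List.ofFn (Fin.cons (inN A BM n) (Fin.cons (inM A BN m) x : Fin (k + 1) → _) :
        Fin (k + 2) → _) := by
    simp only [List.ofFn_cons]
  rw [h, evl_ofFn]
  exact barOps_NM f g (s := 0) (t := 1) ⟨n, rfl⟩ ⟨m, rfl⟩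

theorem evl_barOps_TT {p q : ℕ} (a : Fin p → A) (b : Fin q → A) {z : Bar R N A M}
    {l : List (Bar R N A M)} (h : ∀ y ∈ z :: l, (∃ n, y = inN A BM n) ∨
      (∃ (p : ℕ) (a : Fin p → A), y = inT BN BM a) ∨ (∃ m, y = inM A BN m)) :
    evl (barOps f g) (inT BN BM a :: inT BN BM b :: z :: l) = 0 := by
  obtain ⟨k, x, rfl⟩ := exists_ofFn l
  have e : inT BN BM a :: inT BN BM b :: z :: List.ofFn x
      = List.ofFn (Fin.cons (inT BN BM a) (Fin.cons (inT BN BM b) (Fin.cons z x : Fin (k + 1) → _) :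
        Fin (k + 2) → _) : Fin (k + 3) → _) := by
    simp only [List.ofFn_cons]
  rw [e, evl_ofFn]
  refine barOps_TT f g _ (fun t => ?_) (s := 0) (t := 1) (by simp) ⟨p, a, rfl⟩
    ⟨q, b, rfl⟩
  refine Fin.cases (Or.inr (Or.inl ⟨p, a, rfl⟩)) (fun t => ?_) t
  refine Fin.cases (Or.inr (Or.inl ⟨q, b, rfl⟩)) (fun t => ?_) t
  refine Fin.cases (h _ List.mem_cons_self) (fun t => ?_) t
  exact h _ (List.mem_cons_of_mem _ (List.mem_ofFn.2 ⟨t, rfl⟩))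

variable (f g f' g' rA rM rN) in
/-- A semilinear morphism of the data entering the two-sided bar complex. -/
structure BarHom : Prop where
  hħ : σ ħ = ħ'
  hA : BD1Hom alg alg' rA
  hM : BD0Hom BM BM' rM
  hN : BD0Hom BN BN' rN
  hf : ∀ (s : ℕ) (a : A) (m : Fin s → M), rM (f.map s a m) = f'.map s (rA a) (rM ∘ m)
  hg : ∀ (s : ℕ) (a : A) (n : Fin s → N), rN (g.map s a n) = g'.map s (rA a) (rN ∘ n)

namespace BarHom

variable (h : BarHom f g f' g' rA rM rN)

include h

theorem one_cons {r : ℕ} {i l : ℤ} {e : Fin (r + 1) → ℤ} {n : N} {a : Fin (r + 1) → A} {m : M}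
    (hn : n ∈ 𝒩 i) (ha : ∀ s, a s ∈ 𝒜 (e s)) (hm : m ∈ ℳ l) :
    barMap rN rA rM (barOps f g 1 ![bar R n a m])
      = barOps f' g' 1 ![barMap rN rA rM (bar R n a m)] := by
  rw [barOps_one f g hn ha hm, barMap_bar,
    barOps_one f' g' (h.hN.mem hn) (h.hA.mem_comp ha) (h.hM.mem hm)]
  simp only [map_add, map_sum, semilinear_sgn_smul, barMap_bar, Function.comp_update, h.hN.map_d,
    h.hM.map_d, h.hA.map_d,
    comp_mergeAt (μ := fun x y => alg.mul x y) (μ' := fun x y => alg'.mul x y) h.hA.map_mul,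
    h.hN.map_hAct h.hħ (h.hg · (a 0)), h.hM.map_hAct h.hħ (h.hf · (a (Fin.last r)))]
  rfl

theorem bracket_TT {p q : ℕ} {e : Fin p → ℤ} {e' : Fin (q + 1) → ℤ} {a : Fin p → A}
    {b : Fin (q + 1) → A} (ha : ∀ s, a s ∈ 𝒜 (e s)) (hb : ∀ s, b s ∈ 𝒜 (e' s)) :
    barMap rN rA rM (barOps f g 2 ![inT BN BM a, inT BN BM b])
      = barOps f' g' 2 ![inT BN' BM' (rA ∘ a), inT BN' BM' (rA ∘ b)] := by
  rw [barOps_bracket_T f g ha hb, barOps_bracket_T f' g' (h.hA.mem_comp ha) (h.hA.mem_comp hb)]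
  simp only [map_sum]
  refine Finset.sum_congr rfl fun τ _ => Finset.sum_congr rfl fun s _ => ?_
  split_ifs
  · rw [semilinear_sgn_smul, barMap_inT h.hN h.hM,
      comp_mergeAt (μ := fun x y => alg.bracket x y) (μ' := fun x y => alg'.bracket x y)
        h.hA.map_bracket]
    erw [comp_shuffleWord]
  · exact map_zero _

theorem intertwines_M {k : ℕ} (m : Fin k → M) :
    Intertwines (barMap rN rA rM) (barOps f g) (barOps f' g')
      ((List.ofFn m).map (inM A BN)) := by
  rw [Intertwines, List.map_ofFn, evl_ofFn, List.map_ofFn, evl_ofFn]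
  cases k with
  | zero =>
    rw [Subsingleton.elim (_ ∘ m) ![], Subsingleton.elim (_ ∘ ![]) ![], ← evl_nil, ← evl_nil,
      evl_barOps_nil, evl_barOps_nil, map_zero]
  | succ k =>
    refine (congrArg _ (barOps_M f g m)).trans ?_
    rw [barMap_inM h.hN, h.hM.map_ops]
    refine (barOps_M f' g' _).symm.trans (congrArg _ (funext fun s => ?_))
    exact (barMap_inM h.hN _).symm

theorem intertwines_N {k : ℕ} (n : Fin k → N) :
    Intertwines (barMap rN rA rM) (barOps f g) (barOps f' g')
      ((List.ofFn n).map (inN A BM)) := by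
  rw [Intertwines, List.map_ofFn, evl_ofFn, List.map_ofFn, evl_ofFn]
  cases k with
  | zero =>
    rw [Subsingleton.elim (_ ∘ n) ![], Subsingleton.elim (_ ∘ ![]) ![], ← evl_nil, ← evl_nil,
      evl_barOps_nil, evl_barOps_nil, map_zero]
  | succ k =>
    refine (congrArg _ (barOps_N f g n)).trans ?_
    rw [barMap_inN h.hM, h.hN.map_ops]
    refine (barOps_N f' g' _).symm.trans (congrArg _ (funext fun s => ?_))
    exact (barMap_inN h.hM _).symm

theorem intertwines_TM {r k : ℕ} {e : Fin (r + 1) → ℤ} {a : Fin (r + 1) → A}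
    (ha : ∀ s, a s ∈ 𝒜 (e s)) (m : Fin k → M) :
    Intertwines (barMap rN rA rM) (barOps f g) (barOps f' g')
      (inT BN BM a :: (List.ofFn m).map (inM A BN)) := by
  cases k with
  | zero => exact h.one_cons BN.one_mem ha BM.one_mem
  | succ k =>
    rw [Intertwines, List.map_ofFn, ← List.ofFn_cons, evl_ofFn, List.map_ofFn, evl_ofFn]
    refine (congrArg _ (barOps_TM f g m ha)).trans ?_
    rw [semilinear_sgn_smul, barMap_bar, h.hN.map_one, h.hf]
    refine (barOps_TM f' g' (rM ∘ m) (h.hA.mem_comp ha)).symm.trans (congrArg _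
      (funext fun s => ?_))
    refine Fin.cases (barMap_inT h.hN h.hM a).symm (fun s => ?_) s
    exact (barMap_inM h.hN _).symm

theorem intertwines_TN {r k : ℕ} {e : Fin (r + 1) → ℤ} {a : Fin (r + 1) → A}
    (ha : ∀ s, a s ∈ 𝒜 (e s)) {i : Fin k → ℤ} {n : Fin k → N} (hn : ∀ t, n t ∈ 𝒩 (i t)) :
    Intertwines (barMap rN rA rM) (barOps f g) (barOps f' g')
      (inT BN BM a :: (List.ofFn n).map (inN A BM)) := by
  cases k with
  | zero => exact h.one_cons BN.one_mem ha BM.one_mem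
  | succ k =>
    rw [Intertwines, List.map_ofFn, ← List.ofFn_cons, evl_ofFn, List.map_ofFn, evl_ofFn]
    refine (congrArg _ (barOps_TN f g ha hn)).trans ?_
    rw [semilinear_sgn_smul, barMap_bar, h.hM.map_one, h.hg]
    refine (barOps_TN f' g' (n := rN ∘ n) (h.hA.mem_comp ha) fun t => h.hN.mem (hn t)).symm.trans
      (congrArg _ (funext fun s => ?_))
    refine Fin.cases (barMap_inT h.hN h.hM a).symm (fun s => ?_) s
    exact (barMap_inN h.hM _).symm

theorem intertwines_TT {p q : ℕ} {e : Fin p → ℤ} {e' : Fin (q + 1) → ℤ} {a : Fin p → A}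
    {b : Fin (q + 1) → A} (ha : ∀ s, a s ∈ 𝒜 (e s)) (hb : ∀ s, b s ∈ 𝒜 (e' s))
    {l : List (Bar R N A M)} (hl : ∀ y ∈ l, (∃ n, y = inN A BM n) ∨
      (∃ (p : ℕ) (a : Fin p → A), y = inT BN BM a) ∨ (∃ m, y = inM A BN m)) :
    Intertwines (barMap rN rA rM) (barOps f g) (barOps f' g')
      (inT BN BM a :: inT BN BM b :: l) := by
  cases l with
  | nil =>
    have := h.bracket_TT ha hb
    rw [← evl_ofFn, ← evl_ofFn] at this
    simp only [List.ofFn_succ, List.ofFn_zero, Matrix.cons_val_zero, Matrix.cons_val_succ] at this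
    rw [Intertwines, this]
    simp only [List.map_cons, List.map_nil, barMap_inT h.hN h.hM]
  | cons z l =>
    rw [Intertwines, evl_barOps_TT a b hl, map_zero, List.map_cons, List.map_cons, List.map_cons,
      barMap_inT h.hN h.hM, barMap_inT h.hN h.hM, evl_barOps_TT]
    intro y hy
    rw [← List.map_cons] at hy
    obtain ⟨x, hx, rfl⟩ := List.mem_map.1 hy
    obtain ⟨n, rfl⟩ | ⟨p, a, rfl⟩ | ⟨m, rfl⟩ := hl x hx
    · exact Or.inl ⟨_, barMap_inN h.hM n⟩
    · exact Or.inr (Or.inl ⟨_, _, barMap_inT h.hN h.hM a⟩)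
    · exact Or.inr (Or.inr ⟨_, barMap_inM h.hN m⟩)

theorem barMap_one : barMap rN rA rM (inN A BM BN.one) = inN A' BM' BN'.one := by
  rw [barMap_inN h.hM, h.hN.map_one]

theorem mem_grading {i : ℤ} {x : Bar R N A M} (hx : x ∈ barGrading 𝒩 𝒜 ℳ i) :
    barMap rN rA rM x ∈ barGrading 𝒩' 𝒜' ℳ' i := barMap_mem h.hN.mem h.hA.mem h.hM.mem hx

theorem intertwines_NM (n : N) (m : M) {τ ν μ : List (Bar R N A M)}
    (hom : ∀ x ∈ τ ++ (inN A BM n :: ν ++ inM A BN m :: μ), ∃ i, x ∈ barGrading 𝒩 𝒜 ℳ i) :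
    Intertwines (barMap rN rA rM) (barOps f g) (barOps f' g')
      (τ ++ (inN A BM n :: ν ++ inM A BN m :: μ)) := by
  refine Intertwines.perm h.mem_grading
    (γ := inN A BM n :: inM A BN m :: (τ ++ (ν ++ μ))) ?_ hom
    ((barStr f g).cast barGrading_eq).isHDiffOp ((barStr f' g').cast barGrading_eq).isHDiffOp ?_
  · refine List.perm_middle.trans (List.Perm.cons _ ?_)
    change (τ ++ (ν ++ inM A BN m :: μ)).Perm (inM A BN m :: (τ ++ (ν ++ μ)))
    rw [← List.append_assoc, ← List.append_assoc]
    exact List.perm_middle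
  · rw [Intertwines]
    refine (congrArg _ (evl_barOps_NM n m _)).trans ?_
    rw [map_zero, List.map_cons, List.map_cons, barMap_inN h.hM, barMap_inM h.hN, evl_barOps_NM]

theorem intertwines_gens {γ : List (Bar R N A M)} (hγ : ∀ x ∈ γ, ∃ i, x ∈ barGen 𝒜 BM BN i) :
    Intertwines (barMap rN rA rM) (barOps f g) (barOps f' g') γ := by
  have hP := ((barStr f g).cast barGrading_eq).isHDiffOp
  have hP' := ((barStr f' g').cast barGrading_eq).isHDiffOp
  have hom : ∀ x ∈ γ, ∃ i, x ∈ barGrading 𝒩 𝒜 ℳ i := fun x hx =>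
    (hγ x hx).imp fun _ h => barGen_subset _ h
  obtain ⟨ts, ns, ms, ht, hn, hp⟩ := exists_perm_barGen hγ
  refine Intertwines.perm h.mem_grading hp hom hP hP' ?_
  rcases ts with _ | ⟨t, _ | ⟨t', ts⟩⟩
  rotate_right
  · refine h.intertwines_TT (ht t (by simp)) (ht t' (by simp)) fun y hy => ?_
    rcases List.mem_append.1 hy with hy | hy
    · obtain ⟨t, _, rfl⟩ := List.mem_map.1 hy
      exact Or.inr (Or.inl ⟨_, _, rfl⟩)
    · rcases List.mem_append.1 hy with hy | hy
      all_goals obtain ⟨m, _, rfl⟩ := List.mem_map.1 hy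
      exacts [Or.inl ⟨_, rfl⟩, Or.inr (Or.inr ⟨_, rfl⟩)]
  all_goals
    rcases ns with _ | ⟨n, ns⟩
    · obtain ⟨k, m, rfl⟩ := exists_ofFn ms
      first
        | exact h.intertwines_M m
        | exact h.intertwines_TM (ht t (by simp)) m
    · rcases ms with _ | ⟨m, ms⟩
      · have hn' : ∀ s : Fin (ns.length + 1), ((n :: ns).get s).2 ∈ 𝒩 ((n :: ns).get s).1 :=
          fun s => hn _ (List.get_mem _ _)
        have e : (n :: ns).map (fun n => inN A BM n.2)
            = (List.ofFn fun s => ((n :: ns).get s).2).map (inN A BM) := by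
          conv_lhs => rw [← List.ofFn_get (n :: ns)]
          rw [List.map_ofFn, List.map_ofFn]; rfl
        simp only [List.map_nil (f := inM A BN), List.append_nil]
        rw [e]
        first
          | exact h.intertwines_N _
          | exact h.intertwines_TN (ht t (by simp)) hn'
      · exact h.intertwines_NM n.2 m fun x hx => hom x (hp.mem_iff.2 hx)

/-- The structure of the two-sided bar complex is natural. -/
theorem map_barOps {s : ℕ} (x : Fin s → Bar R N A M) :
    barMap rN rA rM (barOps f g s x) = barOps f' g' s (barMap rN rA rM ∘ x) := by
  have hG := ((barAlg alg BM BN).cast barGrading_eq).isInternal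
  have hone : barMap rN rA rM ((barAlg alg BM BN).cast barGrading_eq).one
      = ((barAlg alg' BM' BN').cast barGrading_eq).one := by
    rw [barAlg_cast_shuffle.one_eq, barAlg_cast_shuffle.one_eq]
    exact h.barMap_one
  have := Intertwines.of_homogeneous hG (fun hβ => Intertwines.of_generators
    (G := (barAlg alg BM BN).cast barGrading_eq) (G' := (barAlg alg' BM' BN').cast barGrading_eq)
    barGen_subset barGen_prods h.mem_grading
    (fun x y => by rw [GCAlgebra.cast_mul, GCAlgebra.cast_mul]; exact barMap_mul h.hA h.hM h.hN x y)
    hone h.hħ ((barStr f g).cast barGrading_eq).isHDiffOp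
    ((barStr f' g').cast barGrading_eq).isHDiffOp (fun _ => h.intertwines_gens) hβ) (List.ofFn x)
  rw [Intertwines, List.map_ofFn] at this
  rw [← evl_ofFn, ← evl_ofFn]
  exact this

end BarHom

end Morphism

end

end BD

end

theorem mainTheorem9 {k : Type*} [Field k] [CharZero k]
    {A M N : Type*} [AddCommGroup A] [Module (PowerSeries k) A]
    [AddCommGroup M] [Module (PowerSeries k) M] [AddCommGroup N] [Module (PowerSeries k) N]
    {𝒜 : ℤ → Submodule (PowerSeries k) A} {ℳ : ℤ → Submodule (PowerSeries k) M}
    {𝒩 : ℤ → Submodule (PowerSeries k) N}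
    (alg : BD.BD1Algebra (PowerSeries.X : PowerSeries k) 𝒜)
    (BM : BD.BD0Algebra (PowerSeries.X : PowerSeries k) ℳ)
    (BN : BD.BD0Algebra (PowerSeries.X : PowerSeries k) 𝒩)
    (f : BD.LeftBD1Module alg BM) (g : BD.RightBD1Module alg BN) :
    ∃ (G : BD.GCAlgebra (BD.barGrading 𝒩 𝒜 ℳ))
      (S : BD.BDHat0Structure (PowerSeries.X : PowerSeries k) G),
      BD.IsBarStructure f g G S ∧
      ∀ (A₀ M₀ N₀ : Type _) [AddCommGroup A₀] [Module k A₀] [AddCommGroup M₀] [Module k M₀]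
        [AddCommGroup N₀] [Module k N₀]
        (𝒜₀ : ℤ → Submodule k A₀) (ℳ₀ : ℤ → Submodule k M₀) (𝒩₀ : ℤ → Submodule k N₀)
        (alg₀ : BD.BD1Algebra (0 : k) 𝒜₀) (BM₀ : BD.BD0Algebra (0 : k) ℳ₀)
        (BN₀ : BD.BD0Algebra (0 : k) 𝒩₀)
        (f₀ : BD.LeftBD1Module alg₀ BM₀) (g₀ : BD.RightBD1Module alg₀ BN₀)
        (rA : A →ₛₗ[PowerSeries.constantCoeff (R := k)] A₀)
        (rM : M →ₛₗ[PowerSeries.constantCoeff (R := k)] M₀)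
        (rN : N →ₛₗ[PowerSeries.constantCoeff (R := k)] N₀),
        BD.IsBD1Reduction alg alg₀ rA → BD.IsBD0Reduction BM BM₀ rM →
        BD.IsBD0Reduction BN BN₀ rN →
        (∀ (s : ℕ) (a : A) (m : Fin s → M), rM (f.map s a m) = f₀.map s (rA a) (rM ∘ m)) →
        (∀ (s : ℕ) (a : A) (n : Fin s → N), rN (g.map s a n) = g₀.map s (rA a) (rN ∘ n)) →
        ∃ (G₀ : BD.GCAlgebra (BD.barGrading 𝒩₀ 𝒜₀ ℳ₀))
          (S₀ : BD.BDHat0Structure (0 : k) G₀)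
          (ρ : BD.Bar (PowerSeries k) N A M →ₛₗ[PowerSeries.constantCoeff (R := k)]
            BD.Bar k N₀ A₀ M₀),
          BD.IsBarStructure f₀ g₀ G₀ S₀ ∧
          BD.IsReduction (BD.barGrading 𝒩 𝒜 ℳ) (BD.barGrading 𝒩₀ 𝒜₀ ℳ₀) ρ ∧
          (∀ (p : ℕ) (n : N) (a : Fin p → A) (m : M),
            ρ (BD.bar (PowerSeries k) n a m) = BD.bar k (rN n) (rA ∘ a) (rM m)) ∧
          (∀ x y, ρ (G.mul x y) = G₀.mul (ρ x) (ρ y)) ∧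
          (∀ (s : ℕ) (x : Fin s → BD.Bar (PowerSeries k) N A M),
            ρ (S.l s x) = S₀.l s (ρ ∘ x)) := by
  refine ⟨_, _, BD.isBarStructure f g, ?_⟩
  intro A₀ M₀ N₀ _ _ _ _ _ _ 𝒜₀ ℳ₀ 𝒩₀ alg₀ BM₀ BN₀ f₀ g₀ rA rM rN hA hM hN hf hg
  have h : BD.BarHom f g f₀ g₀ rA rM rN :=
    { hħ := PowerSeries.constantCoeff_X
      hA := ⟨hA.mem, hA.map_d, hA.map_mul, hA.map_bracket⟩
      hM := ⟨hM.mem, hM.map_one, hM.map_d, hM.map_mul, hM.map_bracket⟩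
      hN := ⟨hN.mem, hN.map_one, hN.map_d, hN.map_mul, hN.map_bracket⟩
      hf := hf
      hg := hg }
  refine ⟨_, _, BD.barMap rN rA rM, BD.isBarStructure f₀ g₀,
    hN.toIsReduction.barMap hA.toIsReduction hM.toIsReduction,
    fun p n a m => BD.barMap_bar rN rA rM n a m, fun x y => ?_, fun s x => h.map_barOps x⟩
  rw [BD.GCAlgebra.cast_mul, BD.GCAlgebra.cast_mul]
  exact BD.barMap_mul h.hA h.hM h.hN x y
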